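/- Notation. For a set $\Omega\subset\mathbb R^d$ let $Z_\Omega=\{\xi\in\mathbb R^d:\ \int_\Omega e^{-2\pi i\xi\cdot x}\,dx=0\}$, and for $\eta\in\mathbb R^d$ and a ball $B$ let $$X_{\Omega,\eta,B}=Z_\Omega\cap B\cap(Z_\Omega-\eta)\cap(B-\eta).$$ The entropy $\mathcal E(X)$ is the largest number of points of $X$ with pairwise distances at least $1$. A curvature point of $\Omega$ is a point $x_0\in\partial\Omega$ near which $\partial\Omega$ is a $C^\infty$ hypersurface whose Gaussian curvature at $x_0$ is nonzero. For a neighbourhood $U$ of $x_0$ let $\mathcal C_U$ be the cone of nonzero outward normal vectors of $\Omega$ at the points of $\partial\Omega\cap U$. For $\epsilon>0$, say that $\Omega$ satisfies $(\mathrm{E}_\epsilon)$ at $x_0$ if for every neighbourhood $U$ of $x_0$ there are $R_0>0$ and, for every $R\ge R_0$, a closed ball $B_R\subset\mathcal C_U$ of radius $R$ such that for all $0<c_1\le c_2$ there is a constant $C$ with $$\mathcal E(X_{\Omega,\eta,B_R})\le C\,R^{d-\epsilon}\qquad\text{for all } R\ge R_0 \text{ and all } \eta \text{ with } c_1\le|\eta|\le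 c_2 .$$ Proposition 0.3. (i) Let $d\ge2$ and let $\Omega\subset\mathbb R^d$ be a symmetric convex body (compact, convex, with nonempty interior, and symmetric with respect to some point) whose boundary is $C^\infty$. Then $\Omega$ has a curvature point, and $\Omega$ satisfies $(\mathrm{E}_\epsilon)$ with $\epsilon=1$ at each of its curvature points. (ii) Let $\Omega\subset\mathbb R^2$ be a symmetric convex body whose boundary is piecewise smooth, that is, a simple closed curve made of finitely many arcs, each $C^\infty$ up to its end points and with nonvanishing velocity. Then $\Omega$ satisfies $(\mathrm{E}_\epsilon)$ with $\epsilon=\tfrac14$ at each of its curvature points. -/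

import Mathlib

open scoped ContDiff FourierTransform ENNReal Topology RealInnerProductSpace

noncomputable section

namespace ConvexFourier

variable {d : ℕ}

/-- `Ω` is symmetric with respect to some point `c`. -/
def IsSymmetric (Ω : Set (EuclideanSpace ℝ (Fin d))) : Prop :=
  ∃ c : EuclideanSpace ℝ (Fin d), ∀ y ∈ Ω, (2 : ℝ) • c - y ∈ Ω

/-- `ρ` is a smooth defining function of `Ω` near `x`: it is `C^∞` in a neighbourhood of `x`, its
gradient at `x` does not vanish, and `Ω = {ρ ≤ 0}` near `x`. -/
structure IsLocalDefiningFunction (Ω : Set (EuclideanSpace ℝ (Fin d)))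
    (ρ : EuclideanSpace ℝ (Fin d) → ℝ) (x : EuclideanSpace ℝ (Fin d)) : Prop where
  smooth : ∀ᶠ y in 𝓝 x, ContDiffAt ℝ ∞ ρ y
  gradient_ne_zero : gradient ρ x ≠ 0
  mem_iff : ∀ᶠ y in 𝓝 x, (y ∈ Ω ↔ ρ y ≤ 0)

/-- The boundary of `Ω` is smooth: near each of its points, `Ω` has a smooth defining function. -/
def HasSmoothBoundary (Ω : Set (EuclideanSpace ℝ (Fin d))) : Prop :=
  ∀ x ∈ frontier Ω, ∃ ρ, IsLocalDefiningFunction Ω ρ x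

/-- The unit normal field `∇ρ / |∇ρ|` of the level sets of `ρ`. -/
def unitNormal (ρ : EuclideanSpace ℝ (Fin d) → ℝ) (y : EuclideanSpace ℝ (Fin d)) :
    EuclideanSpace ℝ (Fin d) :=
  ‖gradient ρ y‖⁻¹ • gradient ρ y

/-- The tangent space at `x` of the level set of `ρ` through `x`. -/
def tangentSpace (ρ : EuclideanSpace ℝ (Fin d) → ℝ) (x : EuclideanSpace ℝ (Fin d)) :
    Submodule ℝ (EuclideanSpace ℝ (Fin d)) :=
  (Submodule.span ℝ {gradient ρ x})ᗮ

/-- The shape operator (Weingarten map) at `x` of the level set of `ρ` through `x`: the derivative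
of the unit normal field, as an endomorphism of the tangent space. -/
def shapeOperator (ρ : EuclideanSpace ℝ (Fin d) → ℝ) (x : EuclideanSpace ℝ (Fin d)) :
    tangentSpace ρ x →ₗ[ℝ] tangentSpace ρ x :=
  (tangentSpace ρ x).orthogonalProjectionOnto.toLinearMap ∘ₗ
    (fderiv ℝ (unitNormal ρ) x).toLinearMap ∘ₗ (tangentSpace ρ x).subtype

/-- The Gaussian curvature at `x` of the level set of `ρ` through `x`. -/
def gaussianCurvature (ρ : EuclideanSpace ℝ (Fin d) → ℝ) (x : EuclideanSpace ℝ (Fin d)) : ℝ :=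
  LinearMap.det (shapeOperator ρ x)

/-- `x` is a boundary point of `Ω` near which the boundary is smooth and at which its Gaussian
curvature does not vanish. -/
def IsCurvaturePoint (Ω : Set (EuclideanSpace ℝ (Fin d))) (x : EuclideanSpace ℝ (Fin d)) : Prop :=
  x ∈ frontier Ω ∧ ∃ ρ, IsLocalDefiningFunction Ω ρ x ∧ gaussianCurvature ρ x ≠ 0

/-- The boundary of the planar set `Ω` is piecewise smooth: it is a simple closed curve made of
finitely many arcs, each of them `C^∞` up to its end points and with nonvanishing velocity. -/
def HasPiecewiseSmoothBoundary (Ω : Set (EuclideanSpace ℝ (Fin 2))) : Prop :=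
  ∃ (n : ℕ) (t : Fin (n + 1) → ℝ) (γ : ℝ → EuclideanSpace ℝ (Fin 2)),
    StrictMono t ∧
    γ (t 0) = γ (t (Fin.last n)) ∧
    Set.InjOn γ (Set.Ico (t 0) (t (Fin.last n))) ∧
    γ '' Set.Icc (t 0) (t (Fin.last n)) = frontier Ω ∧
    ∀ i : Fin n,
      ContDiffOn ℝ ∞ γ (Set.Icc (t i.castSucc) (t i.succ)) ∧
      ∀ s ∈ Set.Icc (t i.castSucc) (t i.succ),
        derivWithin γ (Set.Icc (t i.castSucc) (t i.succ)) s ≠ 0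

/-- The zero set `Z_Ω` of the Fourier transform of the indicator function of `Ω`. -/
def zeroSet (Ω : Set (EuclideanSpace ℝ (Fin d))) : Set (EuclideanSpace ℝ (Fin d)) :=
  {ξ | 𝓕 (Ω.indicator (fun _ => (1 : ℂ))) ξ = 0}

/-- `X_{Ω,η,B} = Z_Ω ∩ B ∩ (Z_Ω - η) ∩ (B - η)`. -/
def shiftedZeroSet (Ω : Set (EuclideanSpace ℝ (Fin d))) (η : EuclideanSpace ℝ (Fin d))
    (B : Set (EuclideanSpace ℝ (Fin d))) : Set (EuclideanSpace ℝ (Fin d)) :=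
  {ξ | ξ ∈ zeroSet Ω ∧ ξ ∈ B ∧ ξ + η ∈ zeroSet Ω ∧ ξ + η ∈ B}

/-- The entropy of `X`: the largest number of points of `X` with pairwise distances at least `1`
(`⊤` if there is no bound on their number). -/
def entropy (X : Set (EuclideanSpace ℝ (Fin d))) : ℕ∞ :=
  ⨆ (S : Set (EuclideanSpace ℝ (Fin d))) (_ : S ⊆ X)
    (_ : S.Pairwise fun x y => 1 ≤ dist x y), S.encard

/-- The cone of all nonzero outward normal vectors of the convex set `Ω` at its boundary points
in `U`. -/
def normalsCone (Ω U : Set (EuclideanSpace ℝ (Fin d))) : Set (EuclideanSpace ℝ (Fin d)) :=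
  {ξ | ξ ≠ 0 ∧ ∃ x ∈ frontier Ω ∩ U, ∀ y ∈ Ω, ⟪ξ, y - x⟫ ≤ 0}

/-- However small a neighbourhood `U` of `x₀` is chosen, for every sufficiently large `R` the cone
of normals at the boundary points in `U` contains a ball `B` of radius `R` such that, for all `η`
of size comparable to `1`, the entropy of `X_{Ω,η,B}` is `O(R^(d-ε))`. The balls do not depend on
the constants `c₁, c₂` that make `|η| ∼ 1` precise, and the implied constant `C` does not depend
on `R` and `η`. -/
def HasLowEntropyBalls (Ω : Set (EuclideanSpace ℝ (Fin d))) (x₀ : EuclideanSpace ℝ (Fin d))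
    (ε : ℝ) : Prop :=
  ∀ U ∈ 𝓝 x₀, ∃ R₀ : ℝ, 0 < R₀ ∧ ∃ z : ℝ → EuclideanSpace ℝ (Fin d),
    (∀ R, R₀ ≤ R → Metric.closedBall (z R) R ⊆ normalsCone Ω U) ∧
    ∀ c₁ c₂ : ℝ, 0 < c₁ → c₁ ≤ c₂ → ∃ C : ℝ, 0 < C ∧
      ∀ R, R₀ ≤ R → ∀ η : EuclideanSpace ℝ (Fin d), c₁ ≤ ‖η‖ → ‖η‖ ≤ c₂ →
        (entropy (shiftedZeroSet Ω η (Metric.closedBall (z R) R)) : ℝ≥0∞) ≤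
          ENNReal.ofReal (C * R ^ ((d : ℝ) - ε))

end ConvexFourier

end

noncomputable section

open scoped ContDiff FourierTransform ENNReal Topology RealInnerProductSpace
open MeasureTheory Set Filter

set_option linter.unusedSectionVars false

namespace ConvexFourier

/-! ### Smooth dependence of integrals on a parameter; Hadamard's lemma. -/

section ParametricIntegral

/-! Pairs of zeros are turned into an arithmetic condition on the support function, and the points
satisfying it are counted by volume.

Let `s ξ` be the support point of `Ω` in direction `ξ`, h(ξ) = ⟪ξ, s ξ⟫ the support function, c the
centre of symmetry, and T f the Fourier transform of f restricted to `Ω`. Write 1 = φ + φ(2c - ·) +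
f with a cutoff φ at the curvature point x₀. After multiplication by exp(2πi⟪ξ, c⟫) the transforms
of the first two pieces are complex conjugates, so at a zero ξ the number exp(2πi⟪ξ, c⟫) T φ(ξ) is
purely imaginary up to an error ‖T f(ξ)‖ / 2 (`abs_re_le_of_cutTransform_eq_zero`). If ξ + η is a
zero as well, comparing the two arguments shows that F(ξ) = 2 (h(ξ + η) - h(ξ) - ⟪η, c⟫) lies within
O(|ξ|^(-p)) of an integer; this is `HasPhaseBound`.

The comparison needs a lower bound for G(ξ) = exp(2πi h(ξ)) T φ(ξ), and that its argument moves by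
only O(|ξ|^(-2)) between ξ and ξ + η. Both come from one integration by parts rather than from an
asymptotic expansion: by strong convexity at x₀, a real amplitude that vanishes at the stationary
point can be traded for i/τ times another real amplitude, τ being the frequency
(`IsStronglyConvexPatch.exists_gain`). Consequently the integral of the cutoff satisfies a first
order equation in complex τ. Rotating τ from i l to l barely changes the modulus, and at i l the
integral is a positive Laplace integral; a crude polynomial lower bound for the latter closes a
bootstrap (`exists_norm_le`, `exists_comparison`). Since the amplitudes are real, the 1/l term of
the logarithmic derivative of G does not affect the argument (`exists_abs_re_div_le`,
`exists_phase_bound`).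

The exponent p measures T f against T φ, and is at most 2 because of the drift of the argument. For
a smooth boundary the remainder f is nonstationary everywhere and decays to any order, so p = 2. In
the plane only convexity is used away from x₀: concavity of the end points of slices gives O(l^(-2))
for the remainder (`norm_cutTransform_planar_le`), and a cap of area about l^(-3/2) bounds the
Laplace integral from below, so p = 1/2.

For the count, the gradient of F is 2 (s(ξ + η) - s(ξ)), which the strong monotonicity of the Gauss
map controls (`IsGaussCone`). Moving ξ by t along `push` lowers F by at least a multiple of t²/R².
Once t ≥ l with l of order R^(1 - p/2), this exceeds the width R^(-p) of the window. Hence the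
pushes by 0, l, 2l, ... up to R of a separated set belonging to one integer stay separated, and the
volume of a ball of radius 2R gives #S · R/l = O(R^d) (`IsGaussCone.card_mul_le`). As F is bounded,
boundedly many integers occur, and the total is O(R^(d - p/2)): the exponents 1 and 1/4 are p/2. -/

theorem hasFDerivAt_intervalIntegral_of_contDiff {P F : Type} [NormedAddCommGroup P]
    [NormedSpace ℝ P] [ProperSpace P] [NormedAddCommGroup F] [NormedSpace ℝ F]
    [CompleteSpace F] {f : P × ℝ → F} (hf : ContDiff ℝ 1 f) (p₀ : P) :
    HasFDerivAt (fun p => ∫ s in (0 : ℝ)..1, f (p, s))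
      (∫ s in (0 : ℝ)..1, (fderiv ℝ f (p₀, s)).comp (ContinuousLinearMap.inl ℝ P ℝ)) p₀ := by
  have hcont : Continuous fun q : P × ℝ =>
      (fderiv ℝ f q).comp (ContinuousLinearMap.inl ℝ P ℝ) :=
    (hf.continuous_fderiv one_ne_zero).clm_comp continuous_const
  obtain ⟨C, hC⟩ := ((isCompact_closedBall p₀ 1).prod
    (isCompact_Icc (a := (0 : ℝ)) (b := 1))).exists_bound_of_continuousOn hcont.continuousOn
  refine (intervalIntegral.hasFDerivAt_integral_of_dominated_of_fderiv_le
    (F' := fun p s => (fderiv ℝ f (p, s)).comp (ContinuousLinearMap.inl ℝ P ℝ))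
    (bound := fun _ => C) (Metric.ball_mem_nhds p₀ one_pos) ?_ ?_ ?_ ?_ ?_ ?_)
  · refine Eventually.of_forall fun p => ?_
    exact (hf.continuous.comp (by fun_prop : Continuous fun s : ℝ => (p, s))).aestronglyMeasurable
  · exact (hf.continuous.comp (by fun_prop :
      Continuous fun s : ℝ => (p₀, s))).intervalIntegrable _ _
  · exact (hcont.comp (by fun_prop : Continuous fun s : ℝ => (p₀, s))).aestronglyMeasurable
  · refine Eventually.of_forall fun s hs p hp => hC (p, s) ⟨Metric.ball_subset_closedBall hp, ?_⟩
    rw [uIoc_of_le zero_le_one] at hs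
    exact Ioc_subset_Icc_self hs
  · exact intervalIntegrable_const
  · refine Eventually.of_forall fun s _ p _ => ?_
    have h1 : HasFDerivAt (fun p : P => (p, s)) (ContinuousLinearMap.inl ℝ P ℝ) p :=
      hasFDerivAt_prodMk_left p s
    exact ((hf.differentiable one_ne_zero).differentiableAt.hasFDerivAt).comp p h1

/-- Induction on the order: the derivative of such an integral is again one, with values in `P →L[ℝ]
F`. This is why the target space varies in the induction. -/
theorem contDiff_intervalIntegral_param {P F : Type} [NormedAddCommGroup P]
    [NormedSpace ℝ P] [ProperSpace P] [NormedAddCommGroup F] [NormedSpace ℝ F]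
    [CompleteSpace F] {f : P × ℝ → F} (hf : ContDiff ℝ ∞ f) :
    ContDiff ℝ ∞ (fun p => ∫ s in (0 : ℝ)..1, f (p, s)) := by
  rw [contDiff_infty]
  intro n
  induction n generalizing F with
  | zero =>
    rw [Nat.cast_zero, contDiff_zero]
    exact intervalIntegral.continuous_parametric_intervalIntegral_of_continuous'
      (f := fun p s => f (p, s)) (by simpa [Function.uncurry_def] using hf.continuous) 0 1
  | succ n ih =>
    have hd := fun p => hasFDerivAt_intervalIntegral_of_contDiff (hf.of_le (by simp)) p
    rw [Nat.cast_add, Nat.cast_one, contDiff_succ_iff_fderiv]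
    refine ⟨fun p => (hd p).differentiableAt, by simp, ?_⟩
    rw [show (fderiv ℝ fun p => ∫ s in (0 : ℝ)..1, f (p, s)) = fun p => ∫ s in (0 : ℝ)..1,
      (fderiv ℝ f (p, s)).comp (ContinuousLinearMap.inl ℝ P ℝ) from funext fun p => (hd p).fderiv]
    exact ih (f := fun q => (fderiv ℝ f q).comp (ContinuousLinearMap.inl ℝ P ℝ))
      ((hf.fderiv_right (by simp)).clm_comp contDiff_const)

/-- Hadamard's lemma with a parameter. -/
theorem exists_contDiff_sub_eq_apply {E F : Type} [NormedAddCommGroup E]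
    [NormedSpace ℝ E] [FiniteDimensional ℝ E] [NormedAddCommGroup F] [NormedSpace ℝ F]
    [CompleteSpace F] {G : E × E → F} (hG : ContDiff ℝ ∞ G) :
    ∃ H : E × E → E →L[ℝ] F, ContDiff ℝ ∞ H ∧
      (∀ y x, G (y, x) - G (y, y) = H (y, x) (x - y)) ∧
      ∀ y, H (y, y) = fderiv ℝ (fun x => G (y, x)) y := by
  have : ProperSpace E := FiniteDimensional.proper_real E
  let f : (E × E) × ℝ → E →L[ℝ] F := fun q =>
    (fderiv ℝ G (q.1.1, q.1.1 + q.2 • (q.1.2 - q.1.1))).comp (ContinuousLinearMap.inr ℝ E E)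
  have hf : ContDiff ℝ ∞ f := by
    refine ContDiff.clm_comp ?_ contDiff_const
    exact (hG.fderiv_right (m := ∞) (by simp)).comp (by fun_prop)
  have hpart : ∀ y x, HasFDerivAt (fun x => G (y, x))
      ((fderiv ℝ G (y, x)).comp (ContinuousLinearMap.inr ℝ E E)) x := fun y x =>
    ((hG.differentiable (by simp)).differentiableAt.hasFDerivAt).comp x
      (hasFDerivAt_prodMk_right y x)
  refine ⟨fun p => ∫ s in (0 : ℝ)..1, f (p, s), contDiff_intervalIntegral_param hf, ?_, ?_⟩
  · intro y x
    have hc : Continuous fun s : ℝ => f ((y, x), s) := hf.continuous.comp (by fun_prop)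
    rw [ContinuousLinearMap.intervalIntegral_apply (hc.intervalIntegrable _ _)]
    have := intervalIntegral.integral_eq_sub_of_hasDerivAt (a := 0) (b := 1)
      (f := fun s : ℝ => G (y, y + s • (x - y))) (f' := fun s => f ((y, x), s) (x - y)) ?_ ?_
    · rw [this]; simp
    · intro s _
      have h2 : HasDerivAt (fun s : ℝ => y + s • (x - y)) (x - y) s := by
        simpa using ((hasDerivAt_id s).smul_const (x - y)).const_add y
      exact (hpart y _).comp_hasDerivAt s h2
    · exact (hc.clm_apply continuous_const).intervalIntegrable _ _
  · intro y
    simp [f, (hpart y y).fderiv]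

end ParametricIntegral

/-! ### Smooth cutoff functions. -/

section Cutoff

theorem exists_contDiff_cutoff {V : Type*} [NormedAddCommGroup V] [NormedSpace ℝ V]
    [FiniteDimensional ℝ V] {K U : Set V} (hK : IsCompact K) (hU : IsOpen U) (hKU : K ⊆ U) :
    ∃ θ : V → ℝ, ContDiff ℝ ∞ θ ∧ HasCompactSupport θ ∧ tsupport θ ⊆ U ∧
      (∀ x ∈ K, θ x = 1) ∧ ∀ x, 0 ≤ θ x ∧ θ x ≤ 1 := by
  have : ProperSpace V := FiniteDimensional.proper_real V
  obtain ⟨L, hL, hKL, hLU⟩ := exists_compact_between hK hU hKU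
  obtain ⟨θ, h1, h2, h3, h4⟩ := exists_contMDiff_support_eq_eq_one_iff (n := (⊤ : ℕ∞))
    (modelWithCornersSelf ℝ V) isOpen_interior hK.isClosed hKL
  have hts : tsupport θ ⊆ L := by
    rw [tsupport, h3]
    exact closure_minimal interior_subset hL.isClosed
  exact ⟨θ, h1.contDiff, HasCompactSupport.of_support_subset_isCompact hL
    ((subset_tsupport θ).trans hts), hts.trans hLU, fun x hx => (h4 x).1 hx,
    fun x => h2 (mem_range_self x)⟩

end Cutoff

/-! ### The divergence theorem for fields tangent to the boundary. -/

section Divergence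

variable {E : Type*} [NormedAddCommGroup E] [InnerProductSpace ℝ E] [FiniteDimensional ℝ E]

/-- The divergence of a vector field. -/
def divergence (X : E → E) (x : E) : ℝ :=
  ∑ i, ⟪stdOrthonormalBasis ℝ E i, fderiv ℝ X x (stdOrthonormalBasis ℝ E i)⟫

theorem continuous_divergence {X : E → E} (hX : ContDiff ℝ 1 X) :
    Continuous (divergence X) :=
  continuous_finsetSum _ fun _ _ => continuous_const.inner
    ((hX.continuous_fderiv one_ne_zero).clm_apply continuous_const)

theorem divergence_eq_zero_of_notMem_tsupport {X : E → E} {x : E} (hx : x ∉ tsupport X) :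
    divergence X x = 0 := by
  simp [divergence, fderiv_of_notMem_tsupport ℝ hx]

variable [MeasurableSpace E] [BorelSpace E]

theorem integral_fderiv_apply_eq_zero {f : E → ℂ} (hf : ContDiff ℝ 1 f)
    (hs : HasCompactSupport f) (v : E) : ∫ x, fderiv ℝ f x v = 0 := by
  have hc : Continuous fun x => fderiv ℝ f x v :=
    (hf.continuous_fderiv one_ne_zero).clm_apply continuous_const
  have hs' : HasCompactSupport fun x => fderiv ℝ f x v := hs.fderiv_apply ℝ v
  have := integral_mul_fderiv_eq_neg_fderiv_mul_of_integrable (μ := volume)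
    (f := fun _ : E => (1 : ℂ)) (g := f) (v := v) (by simp)
    (by simpa using hc.integrable_of_hasCompactSupport hs')
    (by simpa using hf.continuous.integrable_of_hasCompactSupport hs)
    (fun x _ => differentiableAt_const _)
    (fun x _ => (hf.differentiable one_ne_zero).differentiableAt)
  simpa using this

theorem integral_fderiv_add_mul_divergence_eq_zero {u : E → ℂ} {X : E → E}
    (hu : ContDiff ℝ 1 u) (hX : ContDiff ℝ 1 X) (hs : HasCompactSupport X) :
    ∫ x, (fderiv ℝ u x (X x) + u x * divergence X x) = 0 := by
  let b := stdOrthonormalBasis ℝ E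
  let f : Fin (Module.finrank ℝ E) → E → ℂ := fun i x => u x * (⟪b i, X x⟫ : ℝ)
  have hfc : ∀ i, ContDiff ℝ 1 (f i) := fun i => by
    refine hu.mul (Complex.ofRealCLM.contDiff.comp ?_)
    exact contDiff_const.inner ℝ hX
  have hfs : ∀ i, HasCompactSupport (f i) := fun i => by
    refine hs.mono fun x hx => ?_
    contrapose! hx
    simp only [Function.mem_support, not_not] at hx
    simp [f, hx]
  have key : ∀ x, fderiv ℝ u x (X x) + u x * divergence X x = ∑ i, fderiv ℝ (f i) x (b i) := by
    intro x
    have hXd := (hX.differentiable one_ne_zero).differentiableAt (x := x)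
    have hud := (hu.differentiable one_ne_zero).differentiableAt (x := x)
    have h1 : ∀ i, fderiv ℝ (f i) x (b i)
        = u x * (⟪b i, fderiv ℝ X x (b i)⟫ : ℝ) + (⟪b i, X x⟫ : ℝ) * fderiv ℝ u x (b i) := by
      intro i
      have h2 : HasFDerivAt (fun x => (⟪b i, X x⟫ : ℝ))
          ((innerSL ℝ (b i)).comp (fderiv ℝ X x)) x :=
        (innerSL ℝ (b i)).hasFDerivAt.comp x hXd.hasFDerivAt
      have h3 := Complex.ofRealCLM.hasFDerivAt.comp x h2
      have h4 := hud.hasFDerivAt.mul h3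
      have h5 : fderiv ℝ (f i) x = _ := h4.fderiv
      rw [h5]
      simp
    simp_rw [h1, Finset.sum_add_distrib]
    rw [add_comm, ← Finset.mul_sum]
    congr 1
    · simp [divergence, b]
    · conv_lhs => rw [← b.sum_repr' (X x)]
      simp [map_sum]
  simp_rw [key]
  rw [integral_finsetSum]
  · exact Finset.sum_eq_zero fun i _ => integral_fderiv_apply_eq_zero (hfc i) (hfs i) _
  · intro i _
    exact (((hfc i).continuous_fderiv one_ne_zero).clm_apply
      continuous_const).integrable_of_hasCompactSupport ((hfs i).fderiv_apply ℝ _)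

/-- For `t ≤ 0` and `t ≥ 1` the function has an extreme value, so its derivative vanishes; in
between it is bounded by compactness. -/
theorem exists_bound_deriv_smoothTransition :
    ∃ B : ℝ, 0 ≤ B ∧ (∀ t, |deriv Real.smoothTransition t| ≤ B) ∧
      (∀ t, t ≤ 0 → deriv Real.smoothTransition t = 0) ∧
      ∀ t, 1 ≤ t → deriv Real.smoothTransition t = 0 := by
  have h0 : ∀ t, t ≤ 0 → deriv Real.smoothTransition t = 0 := fun t ht =>
    IsLocalMin.deriv_eq_zero (Eventually.of_forall fun s => by
      rw [Real.smoothTransition.zero_of_nonpos ht]; exact Real.smoothTransition.nonneg s)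
  have h1 : ∀ t, 1 ≤ t → deriv Real.smoothTransition t = 0 := fun t ht =>
    IsLocalMax.deriv_eq_zero (Eventually.of_forall fun s => by
      rw [Real.smoothTransition.one_of_one_le ht]; exact Real.smoothTransition.le_one s)
  have hcont : Continuous (deriv Real.smoothTransition) :=
    (Real.smoothTransition.contDiff (n := 1)).continuous_deriv le_rfl
  obtain ⟨B, hB⟩ := (isCompact_Icc (a := (0 : ℝ)) (b := 1)).exists_bound_of_continuousOn
    hcont.continuousOn
  have hB0 : 0 ≤ B := (norm_nonneg _).trans (hB 0 (by simp))
  refine ⟨B, hB0, fun t => ?_, h0, h1⟩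
  rcases le_total t 0 with ht | ht
  · rwa [h0 t ht, abs_zero]
  rcases le_total 1 t with ht' | ht'
  · rwa [h1 t ht', abs_zero]
  exact hB t ⟨ht, ht'⟩

/-- The divergence theorem for a vector field that is tangent to the boundary of a domain. -/
theorem setIntegral_fderiv_add_mul_divergence_eq_zero {Ω : Set E} (hΩ : MeasurableSet Ω)
    {ρ c : E → ℝ} {C : ℝ} {u : E → ℂ} {X : E → E} (hρ : ContDiff ℝ 1 ρ) (hu : ContDiff ℝ 1 u)
    (hX : ContDiff ℝ 1 X) (hs : HasCompactSupport X)
    (hmem : ∀ x ∈ tsupport X, (x ∈ Ω ↔ ρ x ≤ 0))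
    (hc : ∀ x, fderiv ℝ ρ x (X x) = c x * ρ x) (hC : ∀ x, |c x| ≤ C) :
    ∫ x in Ω, (fderiv ℝ u x (X x) + u x * divergence X x) = 0 := by
  obtain ⟨B, hB0, hB, hst0, hst1⟩ := exists_bound_deriv_smoothTransition
  have hC0 : 0 ≤ C := (abs_nonneg _).trans (hC 0)
  let w : E → ℂ := fun x => fderiv ℝ u x (X x) + u x * divergence X x
  have hw : Continuous w := ((hu.continuous_fderiv one_ne_zero).clm_apply hX.continuous).add
    (hu.continuous.mul (Complex.continuous_ofReal.comp (continuous_divergence hX)))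
  have hXz : ∀ x, x ∉ tsupport X → X x = 0 := fun x hx => image_eq_zero_of_notMem_tsupport hx
  have hwz : ∀ x, x ∉ tsupport X → w x = 0 := fun x hx => by
    simp [w, hXz x hx, divergence_eq_zero_of_notMem_tsupport hx]
  have hws : HasCompactSupport w := HasCompactSupport.intro hs hwz
  -- `χ n ∘ ρ` is 1 on `{ρ ≤ 0}` and 0 where `ρ ≥ 1 / n`, so it smooths out the indicator of `Ω`.
  -- Inserting it into the identity on the whole space costs the extra term `s n`, which has to
  -- vanish in the limit. No surface measure is needed.
  let χ : ℕ → ℝ → ℝ := fun n r => Real.smoothTransition (1 - n * r)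
  let χ' : ℕ → ℝ → ℝ := fun n r => -(n * deriv Real.smoothTransition (1 - n * r))
  have hχd : ∀ n r, HasDerivAt (χ n) (χ' n r) r := by
    intro n r
    have h1 : HasDerivAt (fun r : ℝ => 1 - n * r) (-n) r := by
      simpa using ((hasDerivAt_id r).const_mul (n : ℝ)).const_sub 1
    have h2 := ((Real.smoothTransition.contDiff (n := 1)).differentiable
      one_ne_zero).differentiableAt (x := 1 - n * r) |>.hasDerivAt
    refine (h2.comp r h1).congr_deriv ?_
    simp only [χ']; ring
  have hχs : ∀ n, ContDiff ℝ 1 (χ n) := fun n =>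
    Real.smoothTransition.contDiff.comp (by fun_prop)
  have hχ'c : ∀ n, Continuous (χ' n) := fun n => by
    have : χ' n = deriv (χ n) := funext fun r => (hχd n r).deriv.symm
    rw [this]; exact (hχs n).continuous_deriv le_rfl
  let s : ℕ → E → ℂ := fun n x => u x * ((χ' n (ρ x) * fderiv ℝ ρ x (X x) : ℝ) : ℂ)
  have hsc : ∀ n, Continuous (s n) := fun n =>
    hu.continuous.mul (Complex.continuous_ofReal.comp (((hχ'c n).comp hρ.continuous).mul
      ((hρ.continuous_fderiv one_ne_zero).clm_apply hX.continuous)))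
  have hzero : ∀ n, ∫ x, ((χ n (ρ x) : ℂ) * w x + s n x) = 0 := by
    intro n
    have hv : ContDiff ℝ 1 fun x => (χ n (ρ x) : ℂ) * u x :=
      (Complex.ofRealCLM.contDiff.comp ((hχs n).comp hρ)).mul hu
    rw [← integral_fderiv_add_mul_divergence_eq_zero hv hX hs]
    refine integral_congr_ae (Eventually.of_forall fun x => ?_)
    have h1 : HasFDerivAt (fun x => (χ n (ρ x) : ℂ))
        (Complex.ofRealCLM.comp (χ' n (ρ x) • fderiv ℝ ρ x)) x :=
      Complex.ofRealCLM.hasFDerivAt.comp x ((hχd n (ρ x)).comp_hasFDerivAt x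
        (hρ.differentiable one_ne_zero).differentiableAt.hasFDerivAt)
    have h2 := h1.mul (hu.differentiable one_ne_zero).differentiableAt.hasFDerivAt
    have h3 : fderiv ℝ (fun x => (χ n (ρ x) : ℂ) * u x) x = _ := h2.fderiv
    simp only [w, s, h3]
    simp
    ring
  let g : E → ℝ := (tsupport X).indicator fun x => ‖w x‖ + ‖u x‖ * (B * C)
  have hg : Integrable g := by
    refine (integrable_indicator_iff hs.isCompact.measurableSet).2 ?_
    exact (hw.norm.add (hu.continuous.norm.mul continuous_const)).continuousOn.integrableOn_compact
      hs.isCompact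
  -- Tangency enters here: the derivative of `ρ` along `X` contains a factor `ρ`, which compensates
  -- the factor `n` of `χ' n`, since the latter is supported where `0 ≤ n * ρ ≤ 1`.
  have hcρ : ∀ n x, |χ' n (ρ x) * fderiv ℝ ρ x (X x)| ≤ B * C := by
    intro n x
    rw [hc x]
    have h1 : |n * ρ x * deriv Real.smoothTransition (1 - n * ρ x)| ≤ B := by
      rcases le_total (n * ρ x) 0 with h | h
      · rw [hst1 _ (by linarith), mul_zero, abs_zero]; exact hB0
      rcases le_total 1 (n * ρ x) with h' | h'
      · rw [hst0 _ (by linarith), mul_zero, abs_zero]; exact hB0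
      rw [abs_mul, abs_of_nonneg h]
      calc _ ≤ 1 * B := by gcongr; exact hB _
        _ = B := one_mul B
    calc _ = |n * ρ x * deriv Real.smoothTransition (1 - n * ρ x)| * |c x| := by
          rw [← abs_mul, ← abs_neg]; congr 1; simp only [χ']; ring
      _ ≤ B * C := by gcongr; exact hC x
  have hlim : Tendsto (fun n => ∫ x, ((χ n (ρ x) : ℂ) * w x + s n x)) atTop
      (𝓝 (∫ x, Ω.indicator w x)) := by
    refine tendsto_integral_of_dominated_convergence g ?_ hg ?_ ?_
    · intro n
      exact (((Complex.continuous_ofReal.comp ((hχs n).continuous.comp hρ.continuous)).mul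
        hw).add (hsc n)).aestronglyMeasurable
    · intro n
      refine Eventually.of_forall fun x => ?_
      by_cases hx : x ∈ tsupport X
      · simp only [g, indicator_of_mem hx]
        refine (norm_add_le _ _).trans (add_le_add ?_ ?_)
        · rw [norm_mul]
          refine mul_le_of_le_one_left (norm_nonneg _) ?_
          rw [Complex.norm_real, Real.norm_eq_abs, abs_of_nonneg (Real.smoothTransition.nonneg _)]
          exact Real.smoothTransition.le_one _
        · rw [norm_mul]
          refine mul_le_mul_of_nonneg_left ?_ (norm_nonneg _)
          rw [Complex.norm_real]
          exact hcρ n x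
      · simp [g, hx, hwz x hx, s, hXz x hx]
    · refine Eventually.of_forall fun x => ?_
      by_cases hx : x ∈ tsupport X
      · rcases le_or_gt (ρ x) 0 with h | h
        · rw [indicator_of_mem ((hmem x hx).2 h)]
          have h1 : ∀ n : ℕ, 1 ≤ 1 - n * ρ x := fun n => by
            have := mul_nonneg (Nat.cast_nonneg (α := ℝ) n) (neg_nonneg.2 h)
            linarith
          refine tendsto_const_nhds.congr fun n => ?_
          simp [χ, s, χ', Real.smoothTransition.one_of_one_le (h1 n), hst1 _ (h1 n)]
        · rw [indicator_of_notMem fun h' => absurd ((hmem x hx).1 h') (not_le.2 h)]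
          obtain ⟨N, hN⟩ := exists_nat_gt (1 / ρ x)
          refine tendsto_const_nhds.congr' ?_
          filter_upwards [eventually_ge_atTop N] with n hn
          have h1 : 1 - n * ρ x ≤ 0 := by
            have h2 : 1 / ρ x < n := hN.trans_le (by exact_mod_cast hn)
            rw [div_lt_iff₀ h] at h2
            linarith
          simp [χ, s, χ', Real.smoothTransition.zero_of_nonpos h1, hst0 _ h1]
      · have h0 : w x = 0 := hwz x hx
        have : Ω.indicator w x = 0 := by by_cases h : x ∈ Ω <;> simp [h, h0]
        rw [this]
        refine tendsto_const_nhds.congr fun n => ?_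
        simp [h0, s, hXz x hx]
  simp_rw [hzero] at hlim
  rw [integral_indicator hΩ] at hlim
  exact (tendsto_nhds_unique hlim tendsto_const_nhds)

end Divergence

/-! ### Smoothness of gradients. -/

section Gradient

variable {E : Type*} [NormedAddCommGroup E] [InnerProductSpace ℝ E] [CompleteSpace E]

theorem inner_gradient_eq_fderiv (ρ : E → ℝ) (x v : E) :
    ⟪gradient ρ x, v⟫ = fderiv ℝ ρ x v := by
  simp [gradient]

theorem ContDiffAt.gradient_of_smooth {ρ : E → ℝ} {x : E} (h : ContDiffAt ℝ ∞ ρ x) :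
    ContDiffAt ℝ ∞ (gradient ρ) x := by
  let L : (E →L[ℝ] ℝ) →L[ℝ] E :=
    { toFun := (InnerProductSpace.toDual ℝ E).symm
      map_add' := by simp
      map_smul' := by simp
      cont := (InnerProductSpace.toDual ℝ E).symm.continuous }
  exact L.contDiff.contDiffAt.comp x (h.fderiv_right (m := ∞) (by simp))

theorem contDiff_gradient {ρ : E → ℝ} (h : ContDiff ℝ ∞ ρ) : ContDiff ℝ ∞ (gradient ρ) :=
  contDiff_iff_contDiffAt.2 fun _ => ContDiffAt.gradient_of_smooth h.contDiffAt

end Gradient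

/-! ### Supports of functions of two variables with one variable fixed. -/

section Slice

theorem hasCompactSupport_slice {V F : Type*} [TopologicalSpace V] [R1Space V] [Zero F]
    {X : V × V → F} (hs : HasCompactSupport X)
    (y : V) : HasCompactSupport fun x => X (y, x) := by
  refine HasCompactSupport.of_support_subset_isCompact (hs.isCompact.image continuous_snd) ?_
  intro x hx
  exact ⟨(y, x), subset_tsupport _ hx, rfl⟩

theorem tsupport_slice_subset {V F : Type*} [TopologicalSpace V] [Zero F] (X : V × V → F) (y : V) :
    tsupport (fun x => X (y, x)) ⊆ {x | (y, x) ∈ tsupport X} := by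
  refine closure_minimal (fun x hx => subset_tsupport _ hx) ?_
  exact (isClosed_tsupport X).preimage (by fun_prop)

end Slice

/-! ### Amplitudes, oscillatory integrals and integration by parts. -/

section Amplitude

variable {E : Type} [NormedAddCommGroup E] [InnerProductSpace ℝ E]

/-- The function `a (y, x)` is smooth and compactly supported in `A × B`. -/
structure IsAmplitude (A B : Set E) (a : E × E → ℝ) : Prop where
  contDiff : ContDiff ℝ ∞ a
  hasCompactSupport : HasCompactSupport a
  tsupport_subset : tsupport a ⊆ A ×ˢ B

theorem IsAmplitude.eq_zero {A B : Set E} {a : E × E → ℝ} (ha : IsAmplitude A B a) {y x : E}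
    (h : y ∉ A ∨ x ∉ B) : a (y, x) = 0 := by
  refine image_eq_zero_of_notMem_tsupport fun h' => ?_
  have := mem_prod.1 (ha.tsupport_subset h')
  tauto

theorem IsAmplitude.mul_right {A B : Set E} {a : E × E → ℝ} (ha : IsAmplitude A B a)
    {f : E × E → ℝ} (hf : ContDiff ℝ ∞ f) : IsAmplitude A B (fun p => a p * f p) :=
  ⟨ha.contDiff.mul hf, ha.hasCompactSupport.mul_right,
    (tsupport_mul_subset_left).trans ha.tsupport_subset⟩

theorem IsAmplitude.sub {A B : Set E} {a b : E × E → ℝ} (ha : IsAmplitude A B a)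
    (hb : IsAmplitude A B b) : IsAmplitude A B (fun p => a p - b p) :=
  ⟨ha.contDiff.sub hb.contDiff, by simpa using! ha.hasCompactSupport.sub hb.hasCompactSupport,
    (tsupport_sub a b).trans (union_subset ha.tsupport_subset hb.tsupport_subset)⟩

/-- Restriction of an amplitude to the diagonal, extended by a cutoff in the second variable. -/
theorem IsAmplitude.diag_mul {A B : Set E} {a : E × E → ℝ} (ha : IsAmplitude A B a)
    {φ : E → ℝ} (hφ : ContDiff ℝ ∞ φ) (hφc : HasCompactSupport φ) (hφB : tsupport φ ⊆ B) :
    IsAmplitude A B (fun p => a (p.1, p.1) * φ p.2) := by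
  have hsub : (Function.support fun p : E × E => a (p.1, p.1) * φ p.2) ⊆
      (Prod.fst '' tsupport a) ×ˢ tsupport φ := by
    intro p hp
    have h1 : a (p.1, p.1) ≠ 0 := left_ne_zero_of_mul hp
    have h2 : φ p.2 ≠ 0 := right_ne_zero_of_mul hp
    exact ⟨⟨_, subset_tsupport _ h1, rfl⟩, subset_tsupport _ h2⟩
  have hc : IsCompact ((Prod.fst '' tsupport a) ×ˢ tsupport φ) :=
    (ha.hasCompactSupport.isCompact.image continuous_fst).prod hφc.isCompact
  refine ⟨?_, HasCompactSupport.of_support_subset_isCompact hc hsub, ?_⟩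
  · exact (ha.contDiff.comp (contDiff_fst.prodMk contDiff_fst)).mul (hφ.comp contDiff_snd)
  · refine (closure_minimal hsub hc.isClosed).trans (prod_mono ?_ hφB)
    rintro _ ⟨p, hp, rfl⟩
    exact (ha.tsupport_subset hp).1

theorem contDiff_smul_of_tsupport {V F : Type*} [NormedAddCommGroup V] [NormedSpace ℝ V]
    [NormedAddCommGroup F] [NormedSpace ℝ F] {a : V → ℝ} {f : V → F} (ha : ContDiff ℝ ∞ a)
    (hf : ∀ p ∈ tsupport a, ContDiffAt ℝ ∞ f p) : ContDiff ℝ ∞ (fun p => a p • f p) := by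
  refine contDiff_iff_contDiffAt.2 fun p => ?_
  by_cases hp : p ∈ tsupport a
  · exact ha.contDiffAt.smul (hf p hp)
  · refine contDiffAt_const (c := (0 : F)) |>.congr_of_eventuallyEq ?_
    filter_upwards [(isClosed_tsupport a).isOpen_compl.mem_nhds hp] with q hq
    simp [image_eq_zero_of_notMem_tsupport hq]

variable [FiniteDimensional ℝ E]

theorem IsAmplitude.divergence {A B : Set E} {X : E × E → E} (hX : ContDiff ℝ ∞ X)
    (hs : HasCompactSupport X) (hAB : tsupport X ⊆ A ×ˢ B) (k : ℝ) :
    IsAmplitude A B (fun p => k * ConvexFourier.divergence (fun x => X (p.1, x)) p.2) := by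
  have hd : ∀ p : E × E, fderiv ℝ (fun x => X (p.1, x)) p.2 =
      (fderiv ℝ X p).comp (ContinuousLinearMap.inr ℝ E E) := fun p =>
    (((hX.differentiable (by simp)).differentiableAt (x := (p.1, p.2))).hasFDerivAt.comp p.2
      (hasFDerivAt_prodMk_right p.1 p.2)).fderiv
  have hz : ∀ p, p ∉ tsupport X →
      k * ConvexFourier.divergence (fun x => X (p.1, x)) p.2 = 0 := fun p hp => by
    simp [ConvexFourier.divergence, hd, fderiv_of_notMem_tsupport ℝ hp]
  refine ⟨?_, HasCompactSupport.intro hs hz, ?_⟩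
  · simp only [ConvexFourier.divergence, hd]
    refine contDiff_const.mul (ContDiff.sum fun i _ => contDiff_const.inner ℝ ?_)
    exact ((hX.fderiv_right (m := ∞) (by simp)).clm_comp contDiff_const).clm_apply contDiff_const
  · refine (closure_minimal (fun p hp => ?_) (isClosed_tsupport X)).trans hAB
    by_contra h
    exact hp (hz p h)

variable [MeasurableSpace E] [BorelSpace E]

/-- The oscillatory integral over `Ω` with phase `ψ_y(x) = ⟪ν y, y - x⟫` and amplitude
`a (y, ·)`. -/
def oscIntegral (Ω : Set E) (ν : E → E) (a : E × E → ℝ) (y : E) (τ : ℂ) : ℂ :=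
  ∫ x in Ω, (a (y, x) : ℂ) * Complex.exp (2 * Real.pi * Complex.I * τ * (⟪ν y, y - x⟫ : ℝ))

/-- Integration by parts along a vector field that is tangent to the boundary. -/
theorem oscIntegral_eq_of_tangent {Ω : Set E} (hΩ : MeasurableSet Ω) {ν : E → E}
    {a : E × E → ℝ} {X : E × E → E} (hX : ContDiff ℝ ∞ X) (hs : HasCompactSupport X) {y : E}
    (hXa : ∀ x, ⟪ν y, X (y, x)⟫ = -a (y, x)) {ρ c : E → ℝ} {C : ℝ} (hρ : ContDiff ℝ ∞ ρ)
    (hmem : ∀ x, (y, x) ∈ tsupport X → (x ∈ Ω ↔ ρ x ≤ 0))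
    (hc : ∀ x, fderiv ℝ ρ x (X (y, x)) = c x * ρ x) (hC : ∀ x, |c x| ≤ C) (τ : ℂ) :
    τ * oscIntegral Ω ν a y τ = Complex.I * oscIntegral Ω ν
      (fun p => (2 * Real.pi)⁻¹ * divergence (fun x => X (p.1, x)) p.2) y τ := by
  have hXy : ContDiff ℝ 1 fun x => X (y, x) :=
    (hX.of_le (by simp)).comp (contDiff_const.prodMk contDiff_id)
  let u : E → ℂ := fun x =>
    Complex.exp (2 * Real.pi * Complex.I * τ * (⟪ν y, y - x⟫ : ℝ))
  have hin : ContDiff ℝ 1 fun x => (⟪ν y, y - x⟫ : ℝ) :=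
    contDiff_const.inner ℝ (contDiff_const.sub contDiff_id)
  have hu : ContDiff ℝ 1 u :=
    (contDiff_const.mul (Complex.ofRealCLM.contDiff.comp hin)).cexp
  have hud : ∀ x v, fderiv ℝ u x v =
      u x * (2 * Real.pi * Complex.I * τ * (-(⟪ν y, v⟫ : ℝ) : ℝ)) := by
    intro x v
    have h1 : HasFDerivAt (fun x => (⟪ν y, y - x⟫ : ℝ)) (-(innerSL ℝ (ν y))) x := by
      have := (innerSL ℝ (ν y)).hasFDerivAt.comp x ((hasFDerivAt_id x).const_sub y)
      refine this.congr_fderiv ?_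
      ext v; simp
    have h2 := ((Complex.ofRealCLM.hasFDerivAt.comp x h1).const_mul
      (2 * Real.pi * Complex.I * τ)).cexp
    have h3 : fderiv ℝ u x = _ := h2.fderiv
    rw [h3]
    simp [u]
  have key := setIntegral_fderiv_add_mul_divergence_eq_zero hΩ (hρ.of_le (by simp)) hu hXy
    (hasCompactSupport_slice hs y) (fun x hx => hmem x (tsupport_slice_subset X y hx)) hc hC
  have hDc : Continuous (divergence fun x => X (y, x)) := continuous_divergence hXy
  have hDs : HasCompactSupport (divergence fun x => X (y, x)) :=
    HasCompactSupport.intro (hasCompactSupport_slice hs y) fun x hx =>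
      divergence_eq_zero_of_notMem_tsupport hx
  have hac : Continuous fun x => a (y, x) := by
    have : (fun x => a (y, x)) = fun x => -⟪ν y, X (y, x)⟫ := funext fun x => by rw [hXa]; ring
    rw [this]
    exact (continuous_const.inner hXy.continuous).neg
  have has : HasCompactSupport fun x => a (y, x) :=
    HasCompactSupport.intro (hasCompactSupport_slice hs y) fun x hx => by
      have h : X (y, x) = 0 := image_eq_zero_of_notMem_tsupport (f := fun x => X (y, x)) hx
      have h' := hXa x
      rw [h, inner_zero_right] at h'
      linarith
  have hi1 : Integrable fun x => (a (y, x) : ℂ) * u x :=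
    ((Complex.continuous_ofReal.comp hac).mul hu.continuous).integrable_of_hasCompactSupport
      ((has.comp_left Complex.ofReal_zero).mul_right)
  have hi2 : Integrable fun x => ((divergence (fun x => X (y, x)) x : ℝ) : ℂ) * u x :=
    ((Complex.continuous_ofReal.comp hDc).mul hu.continuous).integrable_of_hasCompactSupport
      ((hDs.comp_left Complex.ofReal_zero).mul_right)
  have h1 : (∫ x in Ω, (fderiv ℝ u x (X (y, x)) + u x * divergence (fun x => X (y, x)) x)) =
      2 * Real.pi * Complex.I * τ * (∫ x in Ω, (a (y, x) : ℂ) * u x) +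
      ∫ x in Ω, ((divergence (fun x => X (y, x)) x : ℝ) : ℂ) * u x := by
    rw [← integral_const_mul, ← integral_add (hi1.integrableOn.const_mul _) hi2.integrableOn]
    refine integral_congr_ae (Eventually.of_forall fun x => ?_)
    simp only [hud, hXa]
    push_cast
    ring
  rw [h1] at key
  have h2 : oscIntegral Ω ν (fun p => (2 * Real.pi)⁻¹ * divergence (fun x => X (p.1, x)) p.2) y τ
      = (2 * Real.pi : ℂ)⁻¹ * ∫ x in Ω, ((divergence (fun x => X (y, x)) x : ℝ) : ℂ) * u x := by
    rw [oscIntegral, ← integral_const_mul]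
    refine integral_congr_ae (Eventually.of_forall fun x => ?_)
    simp only [u]
    push_cast
    ring
  have hpi : (Real.pi : ℂ) ≠ 0 := by exact_mod_cast Real.pi_ne_zero
  rw [h2, eq_neg_of_add_eq_zero_right key]
  simp only [oscIntegral, u]
  field_simp
  rw [Complex.I_sq]
  ring

end Amplitude

/-! ### Gain of one power of the frequency away from stationary points. -/

section Nonstationary

variable {E : Type} [NormedAddCommGroup E] [InnerProductSpace ℝ E] [FiniteDimensional ℝ E]
  [MeasurableSpace E] [BorelSpace E]

/-- Dividing `V` by the nonvanishing `⟪ν y, V⟫` gives a field `X` with `⟪ν y, X⟫ = -a` that is still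
tangent to all level sets of `ρ`. The new amplitude is of the same class, so the gain can be
iterated. -/
theorem exists_amplitude_of_nonstationary {Ω : Set E} (hΩ : MeasurableSet Ω) {ν : E → E}
    (hν : ContDiff ℝ ∞ ν) {ρ : E → ℝ} (hρ : ContDiff ℝ ∞ ρ) {V : E × E → E}
    (hV : ContDiff ℝ ∞ V) {A B : Set E} (hmem : ∀ x ∈ B, (x ∈ Ω ↔ ρ x ≤ 0))
    (hVρ : ∀ y x, fderiv ℝ ρ x (V (y, x)) = 0)
    (hVν : ∀ y ∈ A, ∀ x ∈ B, ⟪ν y, V (y, x)⟫ ≠ 0) {a : E × E → ℝ} (ha : IsAmplitude A B a) :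
    ∃ a', IsAmplitude A B a' ∧ ∀ y τ,
      τ * oscIntegral Ω ν a y τ = Complex.I * oscIntegral Ω ν a' y τ := by
  let X : E × E → E := fun p => a p • (-(⟪ν p.1, V p⟫)⁻¹ • V p)
  have hX : ContDiff ℝ ∞ X := by
    refine contDiff_smul_of_tsupport ha.contDiff fun p hp => ?_
    have hp' := ha.tsupport_subset hp
    refine ContDiffAt.smul (ContDiffAt.neg (ContDiffAt.inv ?_ (hVν _ hp'.1 _ hp'.2)))
      hV.contDiffAt
    exact ((hν.comp contDiff_fst).inner ℝ hV).contDiffAt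
  have hsupp : Function.support X ⊆ tsupport a := fun p hp => by
    refine subset_tsupport _ fun h => hp ?_
    simp [X, h]
  have hs : HasCompactSupport X :=
    HasCompactSupport.of_support_subset_isCompact ha.hasCompactSupport hsupp
  have hts : tsupport X ⊆ tsupport a := closure_minimal hsupp (isClosed_tsupport a)
  refine ⟨_, IsAmplitude.divergence hX hs (hts.trans ha.tsupport_subset) (2 * Real.pi)⁻¹,
    fun y τ => ?_⟩
  refine oscIntegral_eq_of_tangent hΩ hX hs (c := 0) (C := 0) ?_ hρ
    (fun x hx => hmem x ((hts.trans ha.tsupport_subset) hx).2) ?_ (by simp) τ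
  · intro x
    by_cases h : a (y, x) = 0
    · simp [X, h]
    · have hp := ha.tsupport_subset (subset_tsupport _ h)
      have := hVν _ hp.1 _ hp.2
      simp only [X, inner_smul_right]
      simp only at this
      field_simp
  · intro x
    simp [X, hVρ]

end Nonstationary

/-! ### Gain of one power of the frequency for amplitudes vanishing at the stationary point. -/

section Stationary

variable {E : Type} [NormedAddCommGroup E] [InnerProductSpace ℝ E] [FiniteDimensional ℝ E]

/-- Near `x₀`, the set `Ω` is the sublevel set of the smooth, strongly convex function `ρ` with
nonvanishing gradient. -/
structure IsStronglyConvexPatch (Ω : Set E) (ρ : E → ℝ) (x₀ : E) (r c : ℝ) : Prop where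
  contDiff : ContDiff ℝ ∞ ρ
  r_pos : 0 < r
  c_pos : 0 < c
  eq_zero : ρ x₀ = 0
  mem_iff : ∀ x ∈ Metric.ball x₀ r, (x ∈ Ω ↔ ρ x ≤ 0)
  gradient_ne_zero : ∀ x ∈ Metric.ball x₀ r, gradient ρ x ≠ 0
  hessian : ∀ x ∈ Metric.ball x₀ r, ∀ v, c * ‖v‖ ^ 2 ≤ ⟪fderiv ℝ (gradient ρ) x v, v⟫

/-- A vector valued function whose components generate the ideal of stationarity: it vanishes on
the diagonal, and its components are the derivatives of the phase along tangential fields. -/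
def stationaryMap (ρ : E → ℝ) (p : E × E) : E :=
  ⟪gradient ρ p.2, gradient ρ p.2⟫ • gradient ρ p.1 -
    ⟪gradient ρ p.1, gradient ρ p.2⟫ • gradient ρ p.2 + (ρ p.2 - ρ p.1) • gradient ρ p.2

theorem contDiff_stationaryMap {ρ : E → ℝ} (hρ : ContDiff ℝ ∞ ρ) :
    ContDiff ℝ ∞ (stationaryMap ρ) := by
  have h1 := (contDiff_gradient hρ).comp (contDiff_fst (E := E) (F := E) (𝕜 := ℝ))
  have h2 := (contDiff_gradient hρ).comp (contDiff_snd (E := E) (F := E) (𝕜 := ℝ))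
  exact (((h2.inner ℝ h2).smul h1).sub ((h1.inner ℝ h2).smul h2)).add
    (((hρ.comp contDiff_snd).sub (hρ.comp contDiff_fst)).smul h2)

theorem stationaryMap_self (ρ : E → ℝ) (y : E) : stationaryMap ρ (y, y) = 0 := by
  simp [stationaryMap]

theorem fderiv_stationaryMap_apply {ρ : E → ℝ} (hρ : ContDiff ℝ ∞ ρ) (y v : E) :
    fderiv ℝ (fun x => stationaryMap ρ (y, x)) y v =
      ⟪gradient ρ y, fderiv ℝ (gradient ρ) y v⟫ • gradient ρ y
        - ⟪gradient ρ y, gradient ρ y⟫ • fderiv ℝ (gradient ρ) y v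
        + ⟪gradient ρ y, v⟫ • gradient ρ y := by
  have hν : HasFDerivAt (gradient ρ) (fderiv ℝ (gradient ρ) y) y :=
    ((contDiff_gradient hρ).differentiable (by simp)).differentiableAt.hasFDerivAt
  have hr : HasFDerivAt ρ (fderiv ℝ ρ y) y :=
    (hρ.differentiable (by simp)).differentiableAt.hasFDerivAt
  have h1 := (hν.inner ℝ hν).smul (hasFDerivAt_const (gradient ρ y) y)
  have h2 := ((hasFDerivAt_const (gradient ρ y) y).inner ℝ hν).smul hν
  have h3 := (hr.sub_const (ρ y)).smul hν
  have h4 : fderiv ℝ (fun x => stationaryMap ρ (y, x)) y = _ := ((h1.sub h2).add h3).fderiv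
  rw [h4]
  simp [fderivInnerCLM_apply]
  module

/-- For a kernel vector `v`, pairing with `∇ρ x₀` cancels the first two terms, and the third, coming
from `ρ p.2 - ρ p.1`, shows that `v` is tangential. Pairing with `v` then leaves only the Hessian,
which is positive definite. -/
theorem IsStronglyConvexPatch.injective_fderiv_stationaryMap {Ω : Set E} {ρ : E → ℝ} {x₀ : E}
    {r c : ℝ} (h : IsStronglyConvexPatch Ω ρ x₀ r c) :
    Function.Injective (fderiv ℝ (fun x => stationaryMap ρ (x₀, x)) x₀) := by
  refine (injective_iff_map_eq_zero _).2 fun v hv => ?_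
  rw [fderiv_stationaryMap_apply h.contDiff] at hv
  have hx₀ := Metric.mem_ball_self h.r_pos (x := x₀)
  set w := gradient ρ x₀ with hw
  set Hv := fderiv ℝ (gradient ρ) x₀ v with hHv
  have hw0 : 0 < ⟪w, w⟫ := real_inner_self_pos.2 (h.gradient_ne_zero x₀ hx₀)
  have h1 : ⟪w, v⟫ = 0 := by
    have := congrArg (fun z => ⟪w, z⟫) hv
    simp only [inner_add_right, inner_sub_right, inner_smul_right, inner_zero_right] at this
    have h2 : ⟪w, v⟫ * ⟪w, w⟫ = 0 := by linarith
    exact (mul_eq_zero.1 h2).resolve_right hw0.ne'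
  have h2 : ⟪Hv, v⟫ = 0 := by
    have := congrArg (fun z => ⟪z, v⟫) hv
    simp only [inner_add_left, inner_sub_left, real_inner_smul_left, inner_zero_left, h1] at this
    have h2 : ⟪w, w⟫ * ⟪Hv, v⟫ = 0 := by linarith
    exact (mul_eq_zero.1 h2).resolve_left hw0.ne'
  have h3 := h.hessian x₀ hx₀ v
  rw [← hHv, h2] at h3
  have h4 : ‖v‖ ^ 2 ≤ 0 := by
    by_contra h5
    push Not at h5
    have := mul_pos h.c_pos h5
    linarith
  simpa using h4

variable [MeasurableSpace E] [BorelSpace E]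

/-- Hadamard's lemma gives `a = H (x - y)` and `stationaryMap = M (x - y)` with `M` invertible near
`(x₀, x₀)`. So `a` is a combination of the components of `stationaryMap`, that is, the derivative of
the phase along a field tangent to the boundary, and one integration by parts applies. -/
theorem IsStronglyConvexPatch.exists_gain {Ω : Set E} (hΩ : MeasurableSet Ω) {ρ : E → ℝ} {x₀ : E}
    {r c : ℝ} (h : IsStronglyConvexPatch Ω ρ x₀ r c) :
    ∃ ε, 0 < ε ∧ ε ≤ r ∧ ∀ A B : Set E, IsOpen A → IsOpen B → A ⊆ Metric.ball x₀ ε →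
      B ⊆ Metric.ball x₀ ε → ∀ a, IsAmplitude A B a → (∀ y, a (y, y) = 0) →
      ∃ a', IsAmplitude A B a' ∧ ∀ y, ρ y = 0 → ∀ τ,
        τ * oscIntegral Ω (gradient ρ) a y τ =
          Complex.I * oscIntegral Ω (gradient ρ) a' y τ := by
  have hρ := h.contDiff
  have hν := contDiff_gradient hρ
  obtain ⟨M, hM, hMg, hMd⟩ := exists_contDiff_sub_eq_apply (contDiff_stationaryMap hρ)
  have hMg' : ∀ y x, stationaryMap ρ (y, x) = M (y, x) (x - y) := fun y x => by
    rw [← hMg, stationaryMap_self, sub_zero]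
  have hunit : IsUnit (M (x₀, x₀)) := by
    rw [hMd]
    have hinj := h.injective_fderiv_stationaryMap
    refine ContinuousLinearMap.isUnit_iff_bijective.2 ⟨hinj, ?_⟩
    exact (LinearMap.injective_iff_surjective (f :=
      (fderiv ℝ (fun x => stationaryMap ρ (x₀, x)) x₀).toLinearMap)).1 hinj
  have hnhds : {p : E × E | IsUnit (M p)} ∈ 𝓝 (x₀, x₀) :=
    hM.continuous.continuousAt.preimage_mem_nhds (Units.isOpen.mem_nhds hunit)
  obtain ⟨ε₀, hε₀, hball⟩ := Metric.mem_nhds_iff.1 hnhds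
  refine ⟨min ε₀ r, lt_min hε₀ h.r_pos, min_le_right _ _, ?_⟩
  intro A B hA hB hAε hBε a ha hdiag
  have hMunit : ∀ p ∈ A ×ˢ B, IsUnit (M p) := fun p hp => hball <| by
    rw [← ball_prod_same]
    exact ⟨Metric.ball_subset_ball (min_le_left _ _) (hAε hp.1),
      Metric.ball_subset_ball (min_le_left _ _) (hBε hp.2)⟩
  have hBr : B ⊆ Metric.ball x₀ r := hBε.trans (Metric.ball_subset_ball (min_le_right _ _))
  have hAr : A ⊆ Metric.ball x₀ r := hAε.trans (Metric.ball_subset_ball (min_le_right _ _))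
  obtain ⟨H, hH, hHa, -⟩ := exists_contDiff_sub_eq_apply ha.contDiff
  -- The inverse of `M` is available on `A ×ˢ B` only; `θ` cuts the field off there without
  -- affecting `a`.
  obtain ⟨θ, hθ, hθc, hθs, hθ1, -⟩ := exists_contDiff_cutoff ha.hasCompactSupport.isCompact
    (hA.prod hB) ha.tsupport_subset
  let b := stdOrthonormalBasis ℝ E
  -- The vector representing the functional `H ∘ M⁻¹`.
  let β : E × E → E := fun p => ∑ i, (H p (Ring.inverse (M p) (b i))) • b i
  have hβ : ∀ p ∈ A ×ˢ B, ContDiffAt ℝ ∞ β p := by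
    intro p hp
    have h1 : ContDiffAt ℝ ∞ (fun p => Ring.inverse (M p)) p := by
      obtain ⟨U, hU⟩ := hMunit p hp
      exact ContDiffAt.comp p (g := Ring.inverse) (f := M)
        (by rw [← hU]; exact contDiffAt_ringInverse ℝ U) hM.contDiffAt
    refine ContDiffAt.sum fun i _ => ContDiffAt.smul ?_ contDiffAt_const
    exact hH.contDiffAt.clm_apply (h1.clm_apply contDiffAt_const)
  have hβg : ∀ y x, (y, x) ∈ A ×ˢ B → ⟪β (y, x), stationaryMap ρ (y, x)⟫ = a (y, x) := by
    intro y x hp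
    have h1 : ⟪β (y, x), stationaryMap ρ (y, x)⟫ =
        H (y, x) (Ring.inverse (M (y, x)) (stationaryMap ρ (y, x))) := by
      conv_rhs => rw [← b.sum_repr' (stationaryMap ρ (y, x))]
      simp only [β, sum_inner, real_inner_smul_left, map_sum, map_smul, smul_eq_mul]
      exact Finset.sum_congr rfl fun i _ => mul_comm _ _
    have h2 : Ring.inverse (M (y, x)) (M (y, x) (x - y)) = x - y := by
      have := congrArg (fun T : E →L[ℝ] E => T (x - y))
        (Ring.inverse_mul_cancel _ (hMunit _ hp))
      simpa using this
    rw [h1, hMg', h2, ← hHa, hdiag, sub_zero]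
  let α : E × E → E := fun p => θ p • β p
  have hα : ContDiff ℝ ∞ α := contDiff_smul_of_tsupport hθ fun p hp => hβ p (hθs hp)
  have hν1 : ContDiff ℝ ∞ fun p : E × E => gradient ρ p.1 := hν.comp contDiff_fst
  have hν2 : ContDiff ℝ ∞ fun p : E × E => gradient ρ p.2 := hν.comp contDiff_snd
  -- The first two terms are tangent to every level set of `ρ`. The third pairs with `∇ρ p.1` to the
  -- last term of `stationaryMap`; it is not tangent, but it has the factor `ρ p.2 - ρ p.1`, which
  -- for `ρ y = 0` vanishes on the boundary. This is where `ρ y = 0` is needed.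
  let Z : E × E → E := fun p =>
    ⟪β p, gradient ρ p.2⟫ • gradient ρ p.2 - ⟪gradient ρ p.2, gradient ρ p.2⟫ • β p -
    ((ρ p.2 - ρ p.1) * ⟪β p, gradient ρ p.2⟫ * (⟪gradient ρ p.1, gradient ρ p.1⟫)⁻¹) •
      gradient ρ p.1
  have hpos : ∀ y ∈ A, 0 < ⟪gradient ρ y, gradient ρ y⟫ := fun y hy =>
    real_inner_self_pos.2 (h.gradient_ne_zero y (hAr hy))
  have hZ : ∀ p ∈ A ×ˢ B, ContDiffAt ℝ ∞ Z p := fun p hp => by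
    have h1 := (hβ p hp).inner ℝ hν2.contDiffAt
    refine ((h1.smul hν2.contDiffAt).sub ((hν2.inner ℝ hν2).contDiffAt.smul (hβ p hp))).sub
      (ContDiffAt.smul (ContDiffAt.mul (ContDiffAt.mul ?_ h1) ?_) hν1.contDiffAt)
    · exact ((hρ.comp contDiff_snd).sub (hρ.comp contDiff_fst)).contDiffAt
    · exact (hν1.inner ℝ hν1).contDiffAt.inv (hpos _ hp.1).ne'
  let X : E × E → E := fun p => θ p • Z p
  have hX : ContDiff ℝ ∞ X := contDiff_smul_of_tsupport hθ fun p hp => hZ p (hθs hp)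
  have hXsupp : Function.support X ⊆ tsupport θ := fun p hp => by
    refine subset_tsupport _ fun h => hp ?_
    simp [X, h]
  have hXc : HasCompactSupport X := HasCompactSupport.of_support_subset_isCompact hθc hXsupp
  have hXs : tsupport X ⊆ A ×ˢ B :=
    (closure_minimal hXsupp (isClosed_tsupport θ)).trans hθs
  refine ⟨_, IsAmplitude.divergence hX hXc hXs (2 * Real.pi)⁻¹, fun y hy τ => ?_⟩
  have hαν : Continuous fun x => ⟪α (y, x), gradient ρ x⟫ * ⟪gradient ρ x, gradient ρ y⟫ *
      (⟪gradient ρ y, gradient ρ y⟫)⁻¹ := by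
    have h1 : Continuous fun x => α (y, x) := hα.continuous.comp (by fun_prop)
    exact ((h1.inner hν.continuous).mul (hν.continuous.inner continuous_const)).mul
      continuous_const
  have hανs : HasCompactSupport fun x => ⟪α (y, x), gradient ρ x⟫ *
      ⟪gradient ρ x, gradient ρ y⟫ * (⟪gradient ρ y, gradient ρ y⟫)⁻¹ := by
    refine HasCompactSupport.intro (hasCompactSupport_slice hθc y) fun x hx => ?_
    have h1 : θ (y, x) = 0 := image_eq_zero_of_notMem_tsupport (f := fun x => θ (y, x)) hx
    simp [α, h1]
  obtain ⟨C, hC⟩ := hανs.exists_bound_of_continuous hαν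
  refine oscIntegral_eq_of_tangent hΩ hX hXc (C := C)
    (c := fun x => -(⟪α (y, x), gradient ρ x⟫ * ⟪gradient ρ x, gradient ρ y⟫ *
      (⟪gradient ρ y, gradient ρ y⟫)⁻¹)) ?_ hρ
    (fun x hx => h.mem_iff x (hBr (hXs hx).2)) ?_ (fun x => by rw [abs_neg]; exact hC x) τ
  · intro x
    by_cases hp : (y, x) ∈ tsupport θ
    · have hp' := hθs hp
      have h1 : θ (y, x) * a (y, x) = a (y, x) := by
        by_cases h2 : (y, x) ∈ tsupport a
        · rw [hθ1 _ h2, one_mul]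
        · rw [image_eq_zero_of_notMem_tsupport h2, mul_zero]
      have h3 := hpos y hp'.1
      rw [← h1, ← hβg y x hp']
      simp only [X, Z, stationaryMap, inner_smul_right, inner_sub_right, inner_add_right]
      rw [real_inner_comm (gradient ρ y) (β (y, x))]
      field_simp
      ring
    · have h0 : θ (y, x) = 0 := image_eq_zero_of_notMem_tsupport hp
      have h1 : a (y, x) = 0 := by
        by_contra h2
        have := hθ1 _ (subset_tsupport _ h2)
        rw [h0] at this
        exact zero_ne_one this
      simp [X, h0, h1]
  · intro x
    rw [← inner_gradient_eq_fderiv]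
    simp only [X, Z, α, inner_smul_right, inner_sub_right, real_inner_smul_left, hy]
    rw [real_inner_comm (gradient ρ x) (β (y, x))]
    ring

end Stationary

/-! ### Comparison of oscillatory integrals with a Laplace integral. -/

section Bootstrap

variable {E : Type} [NormedAddCommGroup E] [InnerProductSpace ℝ E] [FiniteDimensional ℝ E]
  [MeasurableSpace E] [BorelSpace E]

theorem continuous_oscIntegrand {ν : E → E} {a : E × E → ℝ} {y : E}
    (ha : Continuous fun x => a (y, x)) : Continuous fun q : ℂ × E => (a (y, q.2) : ℂ) *
      Complex.exp (2 * Real.pi * Complex.I * q.1 * (⟪ν y, y - q.2⟫ : ℝ)) := by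
  have h1 : Continuous fun q : ℂ × E => (⟪ν y, y - q.2⟫ : ℝ) :=
    continuous_const.inner (continuous_const.sub continuous_snd)
  exact (Complex.continuous_ofReal.comp (ha.comp continuous_snd)).mul
    ((continuous_const.mul continuous_fst).mul (Complex.continuous_ofReal.comp h1)).cexp

theorem integrableOn_oscIntegrand {Ω : Set E} (hΩ : IsCompact Ω) {ν : E → E} {a : E × E → ℝ}
    {y : E} (ha : Continuous fun x => a (y, x)) (τ : ℂ) : IntegrableOn (fun x => (a (y, x) : ℂ) *
      Complex.exp (2 * Real.pi * Complex.I * τ * (⟪ν y, y - x⟫ : ℝ))) Ω :=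
  ((continuous_oscIntegrand ha).comp
    (by fun_prop : Continuous fun x : E => (τ, x))).continuousOn.integrableOn_compact hΩ

theorem oscIntegral_sub {Ω : Set E} (hΩ : IsCompact Ω) {ν : E → E} {a b : E × E → ℝ} {y : E}
    (ha : Continuous fun x => a (y, x)) (hb : Continuous fun x => b (y, x)) (τ : ℂ) :
    oscIntegral Ω ν (fun p => a p - b p) y τ = oscIntegral Ω ν a y τ - oscIntegral Ω ν b y τ := by
  simp only [oscIntegral]
  rw [← integral_sub (integrableOn_oscIntegrand hΩ ha τ) (integrableOn_oscIntegrand hΩ hb τ)]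
  refine integral_congr_ae (Eventually.of_forall fun x => ?_)
  simp only [Complex.ofReal_sub]
  ring

theorem oscIntegral_const_mul (Ω : Set E) (ν : E → E) (k : E → ℝ) (a : E × E → ℝ) (y : E) (τ : ℂ) :
    oscIntegral Ω ν (fun p => k p.1 * a p) y τ = k y * oscIntegral Ω ν a y τ := by
  simp only [oscIntegral]
  rw [← integral_const_mul]
  refine integral_congr_ae (Eventually.of_forall fun x => ?_)
  simp only [Complex.ofReal_mul]
  ring

theorem hasDerivAt_oscIntegral {Ω : Set E} (hΩ : IsCompact Ω) {ν : E → E} {a : E × E → ℝ}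
    {y : E} (ha : Continuous fun x => a (y, x)) (τ : ℂ) :
    HasDerivAt (oscIntegral Ω ν a y) (2 * Real.pi * Complex.I *
      oscIntegral Ω ν (fun p => a p * ⟪ν p.1, p.1 - p.2⟫) y τ) τ := by
  have hψ : Continuous fun x => ⟪ν y, y - x⟫ := continuous_const.inner (by fun_prop)
  have haψ : Continuous fun x => (fun p : E × E => a p * ⟪ν p.1, p.1 - p.2⟫) (y, x) := ha.mul hψ
  have hc := continuous_oscIntegrand (ν := ν) (a := fun p => a p * ⟪ν p.1, p.1 - p.2⟫) haψ
  let F' : ℂ → E → ℂ := fun σ x => 2 * Real.pi * Complex.I * ((a (y, x) * ⟪ν y, y - x⟫ : ℝ) *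
      Complex.exp (2 * Real.pi * Complex.I * σ * (⟪ν y, y - x⟫ : ℝ)))
  have hF' : Continuous fun q : ℂ × E => F' q.1 q.2 := continuous_const.mul hc
  obtain ⟨C, hC⟩ := ((isCompact_closedBall τ 1).prod hΩ).exists_bound_of_continuousOn
    hF'.continuousOn
  have : IsFiniteMeasure (volume.restrict Ω) := ⟨by simpa using hΩ.measure_lt_top⟩
  have key := hasDerivAt_integral_of_dominated_loc_of_deriv_le (μ := volume.restrict Ω)
    (F := fun σ x => (a (y, x) : ℂ) *
      Complex.exp (2 * Real.pi * Complex.I * σ * (⟪ν y, y - x⟫ : ℝ)))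
    (F' := F') (x₀ := τ) (bound := fun _ => C) (Metric.ball_mem_nhds τ one_pos) ?_ ?_ ?_ ?_ ?_ ?_
  · refine key.2.congr_deriv ?_
    simp only [F', oscIntegral]
    rw [integral_const_mul]
  · exact Eventually.of_forall fun σ => (integrableOn_oscIntegrand hΩ ha σ).aestronglyMeasurable
  · exact integrableOn_oscIntegrand hΩ ha τ
  · exact (hF'.comp (by fun_prop : Continuous fun x : E => (τ, x))).aestronglyMeasurable
  · filter_upwards [ae_restrict_mem hΩ.measurableSet] with x hx σ hσ
    exact hC (σ, x) ⟨Metric.ball_subset_closedBall hσ, hx⟩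
  · exact integrable_const C
  · refine Eventually.of_forall fun x σ _ => ?_
    have h1 : HasDerivAt (fun σ : ℂ => 2 * Real.pi * Complex.I * σ * (⟪ν y, y - x⟫ : ℝ))
        (2 * Real.pi * Complex.I * (⟪ν y, y - x⟫ : ℝ)) σ := by
      simpa using (((hasDerivAt_id σ).const_mul (2 * Real.pi * Complex.I)).mul_const
        ((⟪ν y, y - x⟫ : ℝ) : ℂ))
    refine (h1.cexp.const_mul (a (y, x) : ℂ)).congr_deriv ?_
    simp only [F']
    push_cast
    ring

theorem norm_oscIntegral_le {Ω : Set E} (hΩ : IsCompact Ω) {ν : E → E} {a : E × E → ℝ} {y : E}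
    (hψ : ∀ x ∈ Ω, 0 ≤ ⟪ν y, y - x⟫) {C : ℝ} (hC : ∀ x, |a (y, x)| ≤ C) {τ : ℂ} (hτ : 0 ≤ τ.im) :
    ‖oscIntegral Ω ν a y τ‖ ≤ C * volume.real Ω := by
  refine norm_setIntegral_le_of_norm_le_const hΩ.measure_lt_top fun x hx => ?_
  rw [norm_mul, Complex.norm_real, Complex.norm_exp]
  have h1 : (2 * Real.pi * Complex.I * τ * (⟪ν y, y - x⟫ : ℝ)).re =
      -(2 * Real.pi * τ.im * ⟪ν y, y - x⟫) := by
    simp [Complex.mul_re, Complex.mul_im]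
  have h2 : Real.exp (2 * Real.pi * Complex.I * τ * (⟪ν y, y - x⟫ : ℝ)).re ≤ 1 := by
    rw [h1, Real.exp_le_one_iff]
    have := hψ x hx
    have := Real.pi_pos
    rw [neg_nonpos]
    positivity
  calc _ ≤ C * 1 := mul_le_mul (hC x) h2 (Real.exp_nonneg _) ((abs_nonneg _).trans (hC x))
    _ = C := mul_one C

/-- The Laplace transform type integral, which measures the size of `oscIntegral`. -/
def laplaceIntegral (Ω : Set E) (ν : E → E) (φ : E → ℝ) (y : E) (l : ℝ) : ℝ :=
  ∫ x in Ω, φ x * Real.exp (-(2 * Real.pi * l * ⟪ν y, y - x⟫))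

theorem laplaceIntegral_nonneg {Ω : Set E} {ν : E → E} {φ : E → ℝ} (hφ : ∀ x, 0 ≤ φ x) (y : E)
    (l : ℝ) : 0 ≤ laplaceIntegral Ω ν φ y l :=
  integral_nonneg fun x => mul_nonneg (hφ x) (Real.exp_nonneg _)

theorem oscIntegral_I_mul (Ω : Set E) (ν : E → E) (φ : E → ℝ) (y : E) (l : ℝ) :
    oscIntegral Ω ν (fun p => φ p.2) y (l * Complex.I) = laplaceIntegral Ω ν φ y l := by
  rw [oscIntegral, laplaceIntegral, ← integral_complex_ofReal]
  refine integral_congr_ae (Eventually.of_forall fun x => ?_)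
  simp only
  push_cast
  congr 2
  linear_combination (2 * Real.pi * l * (⟪ν y, y - x⟫ : ℝ) : ℂ) * Complex.I_sq

/-- The standing assumptions under which the oscillatory integrals with a stationary point on the
diagonal are estimated. -/
structure HasStationaryGain (Ω : Set E) (ν : E → E) (φ : E → ℝ) (A B Y₀ Y : Set E) : Prop where
  isCompact : IsCompact Ω
  contDiff_normal : ContDiff ℝ ∞ ν
  isOpen_left : IsOpen A
  contDiff_cutoff : ContDiff ℝ ∞ φ
  hasCompactSupport_cutoff : HasCompactSupport φ
  tsupport_cutoff : tsupport φ ⊆ B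
  cutoff_eq_one : ∀ x ∈ A, φ x = 1
  cutoff_nonneg : ∀ x, 0 ≤ φ x
  isCompact_param : IsCompact Y₀
  param_subset : Y₀ ⊆ A
  subset_param : Y ⊆ Y₀
  phase_nonneg : ∀ y ∈ Y, ∀ x ∈ Ω, 0 ≤ ⟪ν y, y - x⟫
  gain : ∀ a, IsAmplitude A B a → (∀ y, a (y, y) = 0) → ∃ a', IsAmplitude A B a' ∧
    ∀ y ∈ Y, ∀ τ, τ * oscIntegral Ω ν a y τ = Complex.I * oscIntegral Ω ν a' y τ

namespace HasStationaryGain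

variable {Ω : Set E} {ν : E → E} {φ : E → ℝ} {A B Y₀ Y : Set E}

theorem continuous_slice {a : E × E → ℝ} (ha : IsAmplitude A B a) (y : E) :
    Continuous fun x => a (y, x) := ha.contDiff.continuous.comp (by fun_prop)

/-- `a (y, x) - a (y, y) * φ x` vanishes on the diagonal, because `φ = 1` on `A` and `a` vanishes
for `y` outside `A`; so the gain applies to it. -/
theorem exists_decomposition (h : HasStationaryGain Ω ν φ A B Y₀ Y) {a : E × E → ℝ}
    (ha : IsAmplitude A B a) : ∃ a', IsAmplitude A B a' ∧ ∀ y ∈ Y, ∀ τ, τ ≠ 0 →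
      oscIntegral Ω ν a y τ = a (y, y) * oscIntegral Ω ν (fun p => φ p.2) y τ +
        Complex.I / τ * oscIntegral Ω ν a' y τ := by
  have hb := ha.diag_mul h.contDiff_cutoff h.hasCompactSupport_cutoff h.tsupport_cutoff
  obtain ⟨a', ha', H⟩ := h.gain _ (ha.sub hb) fun y => by
    by_cases hy : y ∈ A
    · simp [h.cutoff_eq_one y hy]
    · simp [ha.eq_zero (x := y) (Or.inl hy)]
  refine ⟨a', ha', fun y hy τ hτ => ?_⟩
  have h1 := H y hy τ
  rw [oscIntegral_sub h.isCompact (continuous_slice ha y) (continuous_slice hb y),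
    oscIntegral_const_mul Ω ν (fun y => a (y, y)) (fun p => φ p.2)] at h1
  field_simp
  linear_combination h1

/-- Differentiation in `τ` multiplies the amplitude by the phase, which vanishes on the diagonal.
One gain followed by the decomposition yields a first order linear equation with an error of
relative order `1 / τ`. That `κ` is real is essential later. -/
theorem exists_hasDerivAt (h : HasStationaryGain Ω ν φ A B Y₀ Y) :
    ∃ (κ : E → ℝ) (a : E × E → ℝ), IsAmplitude A B a ∧ ∀ y ∈ Y, ∀ τ, τ ≠ 0 →
      HasDerivAt (oscIntegral Ω ν (fun p => φ p.2) y)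
        (-(2 * Real.pi / τ) * (κ y * oscIntegral Ω ν (fun p => φ p.2) y τ +
          Complex.I / τ * oscIntegral Ω ν a y τ)) τ := by
  -- `φ p.2` alone is not compactly supported in `y`; the factor `χ p.1`, equal to 1 on the
  -- parameters, makes it an amplitude.
  obtain ⟨χ, hχ, hχc, hχA, hχ1, -⟩ := exists_contDiff_cutoff h.isCompact_param h.isOpen_left
    h.param_subset
  have hb : IsAmplitude A B (fun p => χ p.1 * φ p.2) := by
    have hsub : (Function.support fun p : E × E => χ p.1 * φ p.2) ⊆ tsupport χ ×ˢ tsupport φ :=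
      fun p hp => ⟨subset_tsupport _ (left_ne_zero_of_mul hp),
        subset_tsupport _ (right_ne_zero_of_mul hp)⟩
    have hc := hχc.isCompact.prod h.hasCompactSupport_cutoff.isCompact
    exact ⟨(hχ.comp contDiff_fst).mul (h.contDiff_cutoff.comp contDiff_snd),
      HasCompactSupport.of_support_subset_isCompact hc hsub,
      (closure_minimal hsub hc.isClosed).trans (prod_mono hχA h.tsupport_cutoff)⟩
  have hψ : ContDiff ℝ ∞ fun p : E × E => ⟪ν p.1, p.1 - p.2⟫ :=
    (h.contDiff_normal.comp contDiff_fst).inner ℝ (contDiff_fst.sub contDiff_snd)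
  obtain ⟨a₁, ha₁, H₁⟩ := h.gain _ (hb.mul_right hψ) fun y => by simp
  obtain ⟨a₂, ha₂, H₂⟩ := h.exists_decomposition ha₁
  refine ⟨fun y => a₁ (y, y), a₂, ha₂, fun y hy τ hτ => ?_⟩
  have hφc : Continuous fun x => (fun p : E × E => φ p.2) (y, x) := h.contDiff_cutoff.continuous
  refine (hasDerivAt_oscIntegral h.isCompact hφc τ).congr_deriv ?_
  have h1 := H₁ y hy τ
  have h2 : oscIntegral Ω ν (fun p => χ p.1 * φ p.2 * ⟪ν p.1, p.1 - p.2⟫) y τ =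
      oscIntegral Ω ν (fun p => φ p.2 * ⟪ν p.1, p.1 - p.2⟫) y τ := by
    have := oscIntegral_const_mul Ω ν χ (fun p => φ p.2 * ⟪ν p.1, p.1 - p.2⟫) y τ
    rw [hχ1 y (h.subset_param hy), Complex.ofReal_one, one_mul] at this
    rw [← this]
    simp only [mul_assoc]
  rw [h2] at h1
  rw [← H₂ y hy τ hτ]
  field_simp
  linear_combination (Complex.I) * h1 + oscIntegral Ω ν a₁ y τ * Complex.I_sq

theorem bounded_amplitude {a : E × E → ℝ} (ha : IsAmplitude A B a) :
    ∃ C, 0 ≤ C ∧ ∀ p, |a p| ≤ C := by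
  obtain ⟨C, hC⟩ := ha.hasCompactSupport.exists_bound_of_continuous ha.contDiff.continuous
  exact ⟨max C 0, le_max_right _ _, fun p => (hC p).trans (le_max_left _ _)⟩

/-- On the arc of radius `l` the main term of the differential equation only rotates the integral,
so its modulus changes by `O(S / l)` from the end point `l * I`, where the integral is the Laplace
integral. -/
theorem exists_arc_bound (h : HasStationaryGain Ω ν φ A B Y₀ Y) :
    ∃ a, IsAmplitude A B a ∧ ∀ y ∈ Y, ∀ l S : ℝ, 1 ≤ l →
      (∀ t ∈ Icc 0 (Real.pi / 2), ‖oscIntegral Ω ν a y (l * Complex.exp (t * Complex.I))‖ ≤ S) →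
      ∀ t ∈ Icc 0 (Real.pi / 2),
        |‖oscIntegral Ω ν (fun p => φ p.2) y (l * Complex.exp (t * Complex.I))‖ -
          laplaceIntegral Ω ν φ y l| ≤ 16 * S / l := by
  obtain ⟨κ, a, ha, hd⟩ := h.exists_hasDerivAt
  refine ⟨a, ha, fun y hy l S hl hS t ht => ?_⟩
  set J := oscIntegral Ω ν (fun p => φ p.2) y with hJ
  have hS0 : 0 ≤ S := (norm_nonneg _).trans (hS t ht)
  have hl0 : (l : ℂ) ≠ 0 := by exact_mod_cast (by linarith : l ≠ 0)
  -- The unimodular integrating factor: `dτ / τ = i ds` on the arc, and `κ y` is real.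
  let D : ℝ → ℂ := fun s => Complex.exp (2 * Real.pi * Complex.I * κ y * s) *
    J (l * Complex.exp (s * Complex.I))
  have hD : ∀ s : ℝ, HasDerivAt D (Complex.exp (2 * Real.pi * Complex.I * κ y * s) *
      (2 * Real.pi / (l * Complex.exp (s * Complex.I)) *
        oscIntegral Ω ν a y (l * Complex.exp (s * Complex.I)))) s := by
    intro s
    have hτ : (l : ℂ) * Complex.exp (s * Complex.I) ≠ 0 := mul_ne_zero hl0 (Complex.exp_ne_zero _)
    have h1 : HasDerivAt (fun s : ℝ => (l : ℂ) * Complex.exp (s * Complex.I))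
        (l * (Complex.exp (s * Complex.I) * Complex.I)) s := by
      have := ((hasDerivAt_id s).ofReal_comp.mul_const Complex.I).cexp.const_mul (l : ℂ)
      simpa using this
    have h2 := HasDerivAt.comp s (hd y hy _ hτ) h1
    have h3 : HasDerivAt (fun s : ℝ => Complex.exp (2 * Real.pi * Complex.I * κ y * s))
        (Complex.exp (2 * Real.pi * Complex.I * κ y * s) * (2 * Real.pi * Complex.I * κ y)) s := by
      have := ((hasDerivAt_id s).ofReal_comp.const_mul (2 * Real.pi * Complex.I * κ y)).cexp
      simpa using this
    refine (h3.mul h2).congr_deriv ?_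
    simp only [Function.comp_apply, ← hJ]
    have he := Complex.exp_ne_zero (s * Complex.I)
    generalize oscIntegral Ω ν a y (l * Complex.exp (s * Complex.I)) = w
    generalize J (l * Complex.exp (s * Complex.I)) = j
    generalize Complex.exp (s * Complex.I) = e at he
    field_simp
    linear_combination (-w) * Complex.I_sq
  have hnorm : ∀ s : ℝ, ‖Complex.exp (2 * Real.pi * Complex.I * κ y * s)‖ = 1 := fun s => by
    have : (2 * Real.pi * Complex.I * κ y * s : ℂ) =
        ((2 * Real.pi * κ y * s : ℝ) : ℂ) * Complex.I := by
      push_cast; ring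
    rw [this, Complex.norm_exp_ofReal_mul_I]
  have hDn : ∀ s : ℝ, ‖D s‖ = ‖J (l * Complex.exp (s * Complex.I))‖ := fun s => by
    simp only [D, norm_mul, hnorm, one_mul]
  have hmv := (convex_Icc (0 : ℝ) (Real.pi / 2)).norm_image_sub_le_of_norm_hasDerivWithin_le
    (f := D) (C := 2 * Real.pi * S / l) (fun s _ => (hD s).hasDerivWithinAt) ?_
    (right_mem_Icc.2 (by positivity)) ht
  · have h1 : Complex.exp (((Real.pi / 2 : ℝ) : ℂ) * Complex.I) = Complex.I := by
      push_cast
      exact Complex.exp_pi_div_two_mul_I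
    have h2 : ‖D (Real.pi / 2)‖ = laplaceIntegral Ω ν φ y l := by
      rw [hDn, h1, hJ, oscIntegral_I_mul, Complex.norm_real, Real.norm_eq_abs,
        abs_of_nonneg (laplaceIntegral_nonneg h.cutoff_nonneg y l)]
    have h3 : ‖t - Real.pi / 2‖ ≤ Real.pi / 2 := by
      rw [Real.norm_eq_abs, abs_le]; constructor <;> linarith [ht.1, ht.2]
    have hπ := Real.pi_lt_four
    have hπ0 := Real.pi_pos
    calc _ = |‖D t‖ - ‖D (Real.pi / 2)‖| := by rw [hDn t, h2]
      _ ≤ ‖D t - D (Real.pi / 2)‖ := abs_norm_sub_norm_le _ _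
      _ ≤ 2 * Real.pi * S / l * (Real.pi / 2) := hmv.trans (by gcongr)
      _ = Real.pi * Real.pi * S / l := by ring
      _ ≤ 16 * S / l := by gcongr; nlinarith
  · intro s hs
    rw [norm_mul, hnorm, one_mul, norm_mul, norm_div, norm_mul (l : ℂ),
      Complex.norm_exp_ofReal_mul_I, mul_one, Complex.norm_real, Real.norm_eq_abs,
      abs_of_pos (by linarith : 0 < l)]
    have : ‖(2 * Real.pi : ℂ)‖ = 2 * Real.pi := by
      rw [norm_mul, Complex.norm_real, Real.norm_eq_abs, abs_of_pos Real.pi_pos]; simp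
    rw [this, mul_div_right_comm (2 * Real.pi) S l]
    gcongr
    exact hS s hs

/-- For `k = 0` the phase and `Im τ` are nonnegative, so the exponential is bounded. In the
induction step, both error terms, that of the decomposition of `a` and that of the arc bound for the
cutoff, carry a factor `1 / l` in front of integrals already estimated with exponent `k`. -/
theorem exists_norm_le (h : HasStationaryGain Ω ν φ A B Y₀ Y) (k : ℕ) :
    ∀ a, IsAmplitude A B a → ∃ C, 0 ≤ C ∧ ∀ y ∈ Y, ∀ l : ℝ, 1 ≤ l → ∀ t ∈ Icc 0 (Real.pi / 2),
      ‖oscIntegral Ω ν a y (l * Complex.exp (t * Complex.I))‖ ≤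
        C * (laplaceIntegral Ω ν φ y l + (l ^ k)⁻¹) := by
  induction k with
  | zero =>
    intro a ha
    obtain ⟨C, hC0, hC⟩ := bounded_amplitude ha
    refine ⟨C * volume.real Ω, by positivity, fun y hy l hl t ht => ?_⟩
    have h1 : 0 ≤ ((l : ℂ) * Complex.exp (t * Complex.I)).im := by
      rw [Complex.im_ofReal_mul, Complex.exp_ofReal_mul_I_im]
      exact mul_nonneg (by linarith) (Real.sin_nonneg_of_nonneg_of_le_pi ht.1
        (by linarith [ht.2, Real.pi_pos]))
    refine (norm_oscIntegral_le h.isCompact (h.phase_nonneg y hy) (fun x => hC _) h1).trans ?_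
    refine le_mul_of_one_le_right (by positivity) ?_
    have := laplaceIntegral_nonneg (Ω := Ω) (ν := ν) h.cutoff_nonneg y l
    simp; linarith
  | succ k ih =>
    intro a ha
    obtain ⟨C, hC0, hC⟩ := bounded_amplitude ha
    obtain ⟨a₁, ha₁, H₁⟩ := h.exists_arc_bound
    obtain ⟨C₁, hC₁, hC₁'⟩ := ih a₁ ha₁
    obtain ⟨a₂, ha₂, H₂⟩ := h.exists_decomposition ha
    obtain ⟨C₂, hC₂, hC₂'⟩ := ih a₂ ha₂
    refine ⟨C * (1 + 16 * C₁) + C₂, by positivity, fun y hy l hl t ht => ?_⟩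
    have hl0 : 0 < l := by linarith
    have hN := laplaceIntegral_nonneg (Ω := Ω) (ν := ν) h.cutoff_nonneg y l
    set N := laplaceIntegral Ω ν φ y l
    set τ := (l : ℂ) * Complex.exp (t * Complex.I) with hτ
    have hτn : ‖τ‖ = l := by
      rw [hτ, norm_mul, Complex.norm_exp_ofReal_mul_I, mul_one, Complex.norm_real,
        Real.norm_eq_abs, abs_of_pos hl0]
    have hτ0 : τ ≠ 0 := by rw [← norm_pos_iff, hτn]; exact hl0
    have hdiv : (N + (l ^ k)⁻¹) / l ≤ N + (l ^ (k + 1))⁻¹ := by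
      rw [add_div]
      refine add_le_add (div_le_self hN hl) (le_of_eq ?_)
      rw [pow_succ, mul_inv]; rfl
    have hJ : ‖oscIntegral Ω ν (fun p => φ p.2) y τ‖ ≤ (1 + 16 * C₁) * (N + (l ^ (k + 1))⁻¹) := by
      have h1 := H₁ y hy l _ hl (fun s hs => hC₁' y hy l hl s hs) t ht
      have h2 := (abs_le.1 h1).2
      have h3 : 16 * (C₁ * (N + (l ^ k)⁻¹)) / l ≤ 16 * C₁ * (N + (l ^ (k + 1))⁻¹) := by
        calc _ = 16 * C₁ * ((N + (l ^ k)⁻¹) / l) := by ring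
          _ ≤ _ := by gcongr
      have h4 : 0 ≤ (l ^ (k + 1))⁻¹ := by positivity
      linarith
    rw [H₂ y hy τ hτ0]
    calc _ ≤ ‖(a (y, y) : ℂ) * oscIntegral Ω ν (fun p => φ p.2) y τ‖ +
          ‖Complex.I / τ * oscIntegral Ω ν a₂ y τ‖ := norm_add_le _ _
      _ ≤ C * ((1 + 16 * C₁) * (N + (l ^ (k + 1))⁻¹)) + C₂ * (N + (l ^ (k + 1))⁻¹) := by
          refine add_le_add ?_ ?_
          · rw [norm_mul, Complex.norm_real]
            exact mul_le_mul (hC _) hJ (norm_nonneg _) hC0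
          · rw [norm_mul, norm_div, Complex.norm_I, hτn, one_div_mul_eq_div]
            calc _ ≤ C₂ * (N + (l ^ k)⁻¹) / l := by gcongr; exact hC₂' y hy l hl t ht
              _ = C₂ * ((N + (l ^ k)⁻¹) / l) := by ring
              _ ≤ _ := by gcongr
      _ = _ := by ring

/-- If the Laplace transform decays at most polynomially, then the oscillatory integral of the
cutoff function is comparable with it, and dominates those of all amplitudes. -/
theorem exists_comparison (h : HasStationaryGain Ω ν φ A B Y₀ Y) {c : ℝ} {k : ℕ} (hc : 0 < c)
    (hk : ∀ y ∈ Y, ∀ l : ℝ, 1 ≤ l → c * (l ^ k)⁻¹ ≤ laplaceIntegral Ω ν φ y l) :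
    ∃ l₀, 1 ≤ l₀ ∧ (∀ y ∈ Y, ∀ l : ℝ, l₀ ≤ l →
      laplaceIntegral Ω ν φ y l / 2 ≤ ‖oscIntegral Ω ν (fun p => φ p.2) y l‖) ∧
      ∀ a, IsAmplitude A B a → ∃ C, 0 ≤ C ∧ ∀ y ∈ Y, ∀ l : ℝ, l₀ ≤ l →
        ‖oscIntegral Ω ν a y l‖ ≤ C * ‖oscIntegral Ω ν (fun p => φ p.2) y l‖ := by
  have hbound : ∀ a, IsAmplitude A B a → ∃ C, 0 ≤ C ∧ ∀ y ∈ Y, ∀ l : ℝ, 1 ≤ l →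
      ∀ t ∈ Icc 0 (Real.pi / 2), ‖oscIntegral Ω ν a y (l * Complex.exp (t * Complex.I))‖ ≤
        C * laplaceIntegral Ω ν φ y l := by
    intro a ha
    obtain ⟨C, hC0, hC⟩ := h.exists_norm_le k a ha
    refine ⟨C * (1 + c⁻¹), by positivity, fun y hy l hl t ht => (hC y hy l hl t ht).trans ?_⟩
    have h1 : (l ^ k)⁻¹ ≤ c⁻¹ * laplaceIntegral Ω ν φ y l := by
      rw [inv_mul_eq_div, le_div_iff₀' hc]
      exact hk y hy l hl
    rw [mul_assoc]
    gcongr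
    linarith
  obtain ⟨a₁, ha₁, H₁⟩ := h.exists_arc_bound
  obtain ⟨C₁, hC₁, hC₁'⟩ := hbound a₁ ha₁
  have h0 : (0 : ℝ) ∈ Icc 0 (Real.pi / 2) := ⟨le_rfl, by positivity⟩
  -- Beyond this threshold the error `16 * C₁ / l` of the arc bound is at most half of the Laplace
  -- integral.
  have hlow : ∀ y ∈ Y, ∀ l : ℝ, 1 + 32 * C₁ ≤ l →
      laplaceIntegral Ω ν φ y l / 2 ≤ ‖oscIntegral Ω ν (fun p => φ p.2) y l‖ := by
    intro y hy l hl
    have hl1 : 1 ≤ l := by linarith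
    have h1 := (abs_le.1 (H₁ y hy l _ hl1 (fun s hs => hC₁' y hy l hl1 s hs) 0 h0)).1
    have hN := laplaceIntegral_nonneg (Ω := Ω) (ν := ν) h.cutoff_nonneg y l
    have h2 : 16 * (C₁ * laplaceIntegral Ω ν φ y l) / l ≤ laplaceIntegral Ω ν φ y l / 2 := by
      rw [div_le_iff₀ (by linarith)]
      nlinarith
    simp only [Complex.ofReal_zero, zero_mul, Complex.exp_zero, mul_one] at h1
    linarith
  refine ⟨1 + 32 * C₁, by linarith, hlow, fun a ha => ?_⟩
  obtain ⟨C, hC0, hC⟩ := hbound a ha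
  refine ⟨2 * C, by positivity, fun y hy l hl => ?_⟩
  have h1 := hC y hy l (by linarith) 0 h0
  simp only [Complex.ofReal_zero, zero_mul, Complex.exp_zero, mul_one] at h1
  have h2 := hlow y hy l hl
  calc _ ≤ C * laplaceIntegral Ω ν φ y l := h1
    _ = 2 * C * (laplaceIntegral Ω ν φ y l / 2) := by ring
    _ ≤ _ := by gcongr

/-- An amplitude vanishing on the diagonal contributes, relative to the cutoff function, a purely
imaginary number up to a quadratically decaying error. -/
theorem exists_abs_re_div_le (h : HasStationaryGain Ω ν φ A B Y₀ Y) {l₀ : ℝ} (hl₀ : 1 ≤ l₀)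
    (hJ : ∀ y ∈ Y, ∀ l : ℝ, l₀ ≤ l → oscIntegral Ω ν (fun p => φ p.2) y l ≠ 0)
    (hcomp : ∀ a, IsAmplitude A B a → ∃ C, 0 ≤ C ∧ ∀ y ∈ Y, ∀ l : ℝ, l₀ ≤ l →
        ‖oscIntegral Ω ν a y l‖ ≤ C * ‖oscIntegral Ω ν (fun p => φ p.2) y l‖)
    {a : E × E → ℝ} (ha : IsAmplitude A B a) (hdiag : ∀ y, a (y, y) = 0) :
    ∃ C, 0 ≤ C ∧ ∀ y ∈ Y, ∀ l : ℝ, l₀ ≤ l →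
      |(oscIntegral Ω ν a y l / oscIntegral Ω ν (fun p => φ p.2) y l).re| ≤ C / l ^ 2 := by
  obtain ⟨a₁, ha₁, H₁⟩ := h.gain a ha hdiag
  obtain ⟨a₂, ha₂, H₂⟩ := h.exists_decomposition ha₁
  obtain ⟨C, hC0, hC⟩ := hcomp a₂ ha₂
  refine ⟨C, hC0, fun y hy l hl => ?_⟩
  have hl0 : 0 < l := by linarith
  have hlc : (l : ℂ) ≠ 0 := by exact_mod_cast hl0.ne'
  have h0 := hJ y hy l hl
  have h1 := H₁ y hy l
  have h2 := H₂ y hy l hlc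
  have h3 := hC y hy l hl
  set J := oscIntegral Ω ν (fun p => φ p.2) y l
  -- The coefficient `a₁ (y, y)` is real, so the term of order `1 / l` is purely imaginary and drops
  -- out of the real part.
  have h4 : oscIntegral Ω ν a y l / J = ((a₁ (y, y) / l : ℝ) : ℂ) * Complex.I -
      ((l ^ 2)⁻¹ : ℝ) * (oscIntegral Ω ν a₂ y l / J) := by
    rw [h2] at h1
    push_cast
    field_simp
    field_simp at h1
    linear_combination h1 + oscIntegral Ω ν a₂ y l * Complex.I_sq
  rw [h4, Complex.sub_re, Complex.re_ofReal_mul, Complex.I_re, mul_zero, zero_sub, abs_neg,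
    Complex.re_ofReal_mul, abs_mul, abs_of_pos (by positivity : 0 < (l ^ 2)⁻¹), div_eq_inv_mul C]
  refine mul_le_mul_of_nonneg_left ((Complex.abs_re_le_norm _).trans ?_) (by positivity)
  rw [norm_div, div_le_iff₀ (norm_pos_iff.2 h0)]
  exact h3

end HasStationaryGain

end Bootstrap

/-! ### Defining functions: second order behaviour and strong convexity. -/

section Hessian

variable {E : Type} [NormedAddCommGroup E] [InnerProductSpace ℝ E] [FiniteDimensional ℝ E]

theorem exists_contDiff_eventuallyEq {ρ : E → ℝ} {x : E}
    (h : ∀ᶠ y in 𝓝 x, ContDiffAt ℝ ∞ ρ y) : ∃ ρ' : E → ℝ, ContDiff ℝ ∞ ρ' ∧ ρ' =ᶠ[𝓝 x] ρ := by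
  obtain ⟨U, hU, hUo, hxU⟩ := eventually_nhds_iff.1 h
  obtain ⟨K, hK, hxK, hKU⟩ := exists_compact_subset hUo hxU
  obtain ⟨θ, hθ, -, hθU, hθ1, -⟩ := exists_contDiff_cutoff hK hUo hKU
  refine ⟨fun y => θ y • ρ y, contDiff_smul_of_tsupport hθ fun p hp => hU p (hθU hp), ?_⟩
  filter_upwards [isOpen_interior.mem_nhds hxK] with y hy
  simp [hθ1 y (interior_subset hy)]

theorem inner_fderiv_gradient {ρ : E → ℝ} {x : E} (h : ContDiffAt ℝ ∞ ρ x) (v w : E) :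
    ⟪fderiv ℝ (gradient ρ) x v, w⟫ = fderiv ℝ (fderiv ℝ ρ) x v w := by
  have h1 : HasFDerivAt (gradient ρ) (fderiv ℝ (gradient ρ) x) x :=
    ((ContDiffAt.gradient_of_smooth h).differentiableAt (by simp)).hasFDerivAt
  have h2 : HasFDerivAt (fderiv ℝ ρ) (fderiv ℝ (fderiv ℝ ρ) x) x :=
    ((h.fderiv_right (m := ∞) (by simp)).differentiableAt (by simp)).hasFDerivAt
  have h3 := h1.inner ℝ (hasFDerivAt_const w x)
  have h4 := h2.clm_apply (hasFDerivAt_const w x)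
  have h5 : (fun t => ⟪gradient ρ t, w⟫) = fun t => fderiv ℝ ρ t w :=
    funext fun t => inner_gradient_eq_fderiv ρ t w
  rw [h5] at h3
  have h6 := congrArg (fun L : E →L[ℝ] ℝ => L v) (h3.unique h4)
  simpa [fderivInnerCLM_apply] using h6

theorem inner_fderiv_gradient_comm {ρ : E → ℝ} {x : E} (h : ContDiffAt ℝ ∞ ρ x) (v w : E) :
    ⟪fderiv ℝ (gradient ρ) x v, w⟫ = ⟪fderiv ℝ (gradient ρ) x w, v⟫ := by
  rw [inner_fderiv_gradient h, inner_fderiv_gradient h]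
  exact (h.isSymmSndFDerivAt (by simpa using! (by exact_mod_cast le_top :
    ((2 : ℕ∞) : WithTop ℕ∞) ≤ ((⊤ : ℕ∞) : WithTop ℕ∞)))).eq v w

/-- Second order behaviour of a function along a parabola tangent to its level set. -/
theorem eventually_nonpos_of_hessian_lt {ρ : E → ℝ} (hρ : ContDiff ℝ ∞ ρ) {x v : E} {β : ℝ}
    (h0 : ρ x = 0) (hv : ⟪gradient ρ x, v⟫ = 0)
    (hβ : ⟪fderiv ℝ (gradient ρ) x v, v⟫ < 2 * β * ‖gradient ρ x‖ ^ 2) :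
    ∀ᶠ t in 𝓝 (0 : ℝ), ρ (x + t • v - (β * t ^ 2) • gradient ρ x) ≤ 0 := by
  set w := gradient ρ x with hw
  let γ : ℝ → E := fun t => x + t • v - (β * t ^ 2) • w
  have hγ : ∀ t, HasDerivAt γ (v - (2 * β * t) • w) t := by
    intro t
    have h1 : HasDerivAt (fun t : ℝ => x + t • v) v t := by
      simpa using ((hasDerivAt_id t).smul_const v).const_add x
    have h2 : HasDerivAt (fun t : ℝ => β * t ^ 2) (2 * β * t) t := by
      refine ((hasDerivAt_pow 2 t).const_mul β).congr_deriv ?_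
      push_cast; ring
    exact h1.sub (h2.smul_const w)
  have hf : ∀ t, HasDerivAt (fun t => ρ (γ t)) ⟪gradient ρ (γ t), v - (2 * β * t) • w⟫ t := by
    intro t
    rw [inner_gradient_eq_fderiv]
    exact ((hρ.differentiable (by simp)).differentiableAt.hasFDerivAt).comp_hasDerivAt t (hγ t)
  have hγ0 : γ 0 = x := by simp [γ]
  have hd : deriv (fun t => ρ (γ t)) = fun t => ⟪gradient ρ (γ t), v - (2 * β * t) • w⟫ :=
    funext fun t => (hf t).deriv
  have hd2 : HasDerivAt (fun t => ⟪gradient ρ (γ t), v - (2 * β * t) • w⟫)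
      (⟪fderiv ℝ (gradient ρ) x v, v⟫ - 2 * β * ‖w‖ ^ 2) 0 := by
    have h1 : HasDerivAt (fun t => gradient ρ (γ t)) (fderiv ℝ (gradient ρ) x v) 0 := by
      have h2 : HasFDerivAt (gradient ρ) (fderiv ℝ (gradient ρ) x) (γ 0) := by
        rw [hγ0]
        exact ((contDiff_gradient hρ).differentiable (by simp)).differentiableAt.hasFDerivAt
      have := h2.comp_hasDerivAt 0 (hγ 0)
      simpa using! this
    have h3 : HasDerivAt (fun t : ℝ => v - (2 * β * t) • w) (-((2 * β) • w)) 0 := by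
      have := (((hasDerivAt_id (0 : ℝ)).const_mul (2 * β)).smul_const w).const_sub v
      simpa using this
    refine (h1.inner ℝ h3).congr_deriv ?_
    simp [hγ0, ← hw, inner_smul_right]
    ring
  have hmax := isLocalMax_of_deriv_deriv_neg (f := fun t => ρ (γ t)) (x₀ := 0)
    (by rw [hd, hd2.deriv]; linarith) (by simp [hd, hγ0, ← hw, hv]) (hf 0).continuousAt
  filter_upwards [hmax] with t ht
  rw [hγ0, h0] at ht
  exact ht

/-- On the unit sphere the set where the form is nonpositive is compact and misses the orthogonal
complement of `w`, so `⟪w, v⟫ ^ 2` is bounded below on it and a large `K` makes the sum positive.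
Compactness and homogeneity give `c`. -/
theorem exists_pos_add_sq_inner (T : E →L[ℝ] E) (w : E)
    (hT : ∀ v, ⟪w, v⟫ = 0 → v ≠ 0 → 0 < ⟪T v, v⟫) :
    ∃ K c : ℝ, 0 ≤ K ∧ 0 < c ∧ ∀ v, c * ‖v‖ ^ 2 ≤ ⟪T v, v⟫ + 2 * K * ⟪w, v⟫ ^ 2 := by
  have hf : Continuous fun v : E => ⟪T v, v⟫ := T.continuous.inner continuous_id
  have hg : Continuous fun v : E => ⟪w, v⟫ ^ 2 := (continuous_const.inner continuous_id).pow 2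
  have hS := isCompact_sphere (0 : E) 1
  obtain ⟨K, hK0, hK⟩ : ∃ K : ℝ, 0 ≤ K ∧ ∀ v ∈ Metric.sphere (0 : E) 1,
      0 < ⟪T v, v⟫ + 2 * K * ⟪w, v⟫ ^ 2 := by
    obtain ⟨M, hM⟩ := hS.exists_bound_of_continuousOn hf.continuousOn
    let N := Metric.sphere (0 : E) 1 ∩ {v | ⟪T v, v⟫ ≤ 0}
    have hN : IsCompact N := hS.inter_right (isClosed_le hf continuous_const)
    rcases N.eq_empty_or_nonempty with hNe | hNe
    · refine ⟨0, le_rfl, fun v hv => ?_⟩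
      by_contra h
      have : v ∈ N := ⟨hv, by simpa using h⟩
      simp [hNe] at this
    · obtain ⟨u, hu, hmin⟩ := hN.exists_isMinOn hNe hg.continuousOn
      have hu0 : u ≠ 0 := by
        rintro rfl
        simpa using hu.1
      have hwu : ⟪w, u⟫ ≠ 0 := fun h => absurd (hT u h hu0) (not_lt.2 hu.2)
      have hpos : 0 < ⟪w, u⟫ ^ 2 := (sq_nonneg _).lt_of_ne' (pow_ne_zero 2 hwu)
      refine ⟨(|M| + 1) / (2 * ⟪w, u⟫ ^ 2), by positivity, fun v hv => ?_⟩
      rcases lt_or_ge 0 ⟪T v, v⟫ with h | h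
      · positivity
      · have h1 : ⟪w, u⟫ ^ 2 ≤ ⟪w, v⟫ ^ 2 := hmin ⟨hv, h⟩
        have h2 : |M| + 1 ≤ 2 * ((|M| + 1) / (2 * ⟪w, u⟫ ^ 2)) * ⟪w, v⟫ ^ 2 := by
          calc |M| + 1 = 2 * ((|M| + 1) / (2 * ⟪w, u⟫ ^ 2)) * ⟪w, u⟫ ^ 2 := by field_simp
            _ ≤ _ := by gcongr
        have h3 := (abs_le.1 (hM v hv)).1
        have h4 := le_abs_self M
        linarith
  obtain ⟨c, hc0, hc⟩ : ∃ c : ℝ, 0 < c ∧ ∀ v ∈ Metric.sphere (0 : E) 1,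
      c ≤ ⟪T v, v⟫ + 2 * K * ⟪w, v⟫ ^ 2 := by
    rcases (Metric.sphere (0 : E) 1).eq_empty_or_nonempty with hNe | hNe
    · exact ⟨1, one_pos, by simp [hNe]⟩
    · obtain ⟨u, hu, hmin⟩ := hS.exists_isMinOn hNe
        (hf.add (continuous_const.mul hg)).continuousOn (f := fun v => ⟪T v, v⟫ + 2 * K * ⟪w, v⟫ ^ 2)
      exact ⟨_, hK u hu, fun v hv => hmin hv⟩
  refine ⟨K, c, hK0, hc0, fun v => ?_⟩
  rcases eq_or_ne v 0 with rfl | hv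
  · simp
  have hn : 0 < ‖v‖ := norm_pos_iff.2 hv
  have h1 := hc (‖v‖⁻¹ • v) (by simp [norm_smul, hn.ne'])
  simp only [map_smul, real_inner_smul_left, inner_smul_right] at h1
  have h2 : c * ‖v‖ ^ 2 ≤ (‖v‖⁻¹ * (‖v‖⁻¹ * ⟪T v, v⟫) + 2 * K * (‖v‖⁻¹ * ⟪w, v⟫) ^ 2) * ‖v‖ ^ 2 := by
    gcongr
  refine h2.trans (le_of_eq ?_)
  field_simp

/-- Replacing `ρ` by `ρ + K * ρ ^ 2 = ρ * (1 + K * ρ)` keeps the sublevel set near `x`, while the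
Hessian at `x` gains `2 * K * ⟪∇ρ x, v⟫ ^ 2`. Positivity on tangent vectors thus becomes positivity
in all directions, and it persists nearby by continuity. -/
theorem exists_patch_of_pos {Ω : Set E} {ρ : E → ℝ} (hρ : ContDiff ℝ ∞ ρ) {x : E} (h0 : ρ x = 0)
    (hgrad : gradient ρ x ≠ 0) (hmem : ∀ᶠ y in 𝓝 x, (y ∈ Ω ↔ ρ y ≤ 0))
    (hpos : ∀ v, ⟪gradient ρ x, v⟫ = 0 → v ≠ 0 → 0 < ⟪fderiv ℝ (gradient ρ) x v, v⟫) :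
    ∃ ρ' r c, IsStronglyConvexPatch Ω ρ' x r c := by
  obtain ⟨K, c, hK, hc, H⟩ := exists_pos_add_sq_inner _ _ hpos
  let ρ' : E → ℝ := fun y => ρ y + K * ρ y ^ 2
  have hρ' : ContDiff ℝ ∞ ρ' := hρ.add (contDiff_const.mul (hρ.pow 2))
  have hg : gradient ρ' = fun y => (1 + 2 * K * ρ y) • gradient ρ y := by
    funext y
    refine ext_inner_right ℝ fun v => ?_
    have h1 : HasFDerivAt ρ (fderiv ℝ ρ y) y :=
      (hρ.differentiable (by simp)).differentiableAt.hasFDerivAt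
    have h2 : fderiv ℝ ρ' y = _ := (h1.add ((h1.pow 2).const_mul K)).fderiv
    rw [inner_gradient_eq_fderiv, real_inner_smul_left, inner_gradient_eq_fderiv, h2]
    simp
    ring
  have hH : ∀ v, fderiv ℝ (gradient ρ') x v =
      fderiv ℝ (gradient ρ) x v + (2 * K * ⟪gradient ρ x, v⟫) • gradient ρ x := by
    intro v
    have h1 : HasFDerivAt ρ (fderiv ℝ ρ x) x :=
      (hρ.differentiable (by simp)).differentiableAt.hasFDerivAt
    have h2 : HasFDerivAt (gradient ρ) (fderiv ℝ (gradient ρ) x) x :=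
      ((contDiff_gradient hρ).differentiable (by simp)).differentiableAt.hasFDerivAt
    have h3 := ((h1.const_mul (2 * K)).const_add 1).smul h2
    rw [hg, show fderiv ℝ (fun y => (1 + 2 * K * ρ y) • gradient ρ y) x = _ from h3.fderiv]
    simp [h0]
  have hcont : Continuous fun y => fderiv ℝ (gradient ρ') y :=
    (contDiff_gradient hρ').continuous_fderiv (by simp)
  have e1 : ∀ᶠ y in 𝓝 x, ∀ v, c / 2 * ‖v‖ ^ 2 ≤ ⟪fderiv ℝ (gradient ρ') y v, v⟫ := by
    have h1 := hcont.tendsto x (Metric.ball_mem_nhds _ (half_pos hc))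
    filter_upwards [h1] with y hy v
    have h2 : ‖fderiv ℝ (gradient ρ') y - fderiv ℝ (gradient ρ') x‖ < c / 2 := by
      simpa [dist_eq_norm] using hy
    have h3 : |⟪(fderiv ℝ (gradient ρ') y - fderiv ℝ (gradient ρ') x) v, v⟫| ≤ c / 2 * ‖v‖ ^ 2 := by
      refine (abs_real_inner_le_norm _ _).trans ?_
      calc _ ≤ (c / 2 * ‖v‖) * ‖v‖ := by
            gcongr
            exact (ContinuousLinearMap.le_opNorm _ _).trans (by gcongr)
        _ = _ := by ring
    have h4 := (abs_le.1 h3).1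
    have h5 := H v
    rw [sub_apply, inner_sub_left, hH, inner_add_left, real_inner_smul_left] at h4
    nlinarith
  have e2 : ∀ᶠ y in 𝓝 x, gradient ρ' y ≠ 0 := by
    refine (contDiff_gradient hρ').continuous.continuousAt.eventually_ne ?_
    rw [hg]
    simpa [h0] using hgrad
  have e3 : ∀ᶠ y in 𝓝 x, (y ∈ Ω ↔ ρ' y ≤ 0) := by
    have h1 : ∀ᶠ y in 𝓝 x, 0 < 1 + K * ρ y := by
      have : Continuous fun y => 1 + K * ρ y :=
        continuous_const.add (continuous_const.mul hρ.continuous)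
      exact this.continuousAt.eventually (lt_mem_nhds (by simp [h0]))
    filter_upwards [hmem, h1] with y hy h1
    rw [hy, show ρ' y = ρ y * (1 + K * ρ y) by simp only [ρ']; ring]
    constructor
    · intro h; exact mul_nonpos_of_nonpos_of_nonneg h h1.le
    · intro h; by_contra h2
      exact absurd (mul_pos (not_le.1 h2) h1) (not_lt.2 h)
  obtain ⟨r, hr, hball⟩ := Metric.eventually_nhds_iff_ball.1 (e1.and (e2.and e3))
  exact ⟨ρ', r, c / 2, hρ', hr, half_pos hc, by simp [ρ', h0], fun y hy => (hball y hy).2.2,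
    fun y hy => (hball y hy).2.1, fun y hy => (hball y hy).1⟩

/-- A boundary point in a region where the set is given by an inequality. -/
theorem eq_zero_of_mem_frontier {Ω : Set E} (hΩ : IsClosed Ω) {ρ : E → ℝ} {x : E}
    (hρ : ContinuousAt ρ x) (hmem : ∀ᶠ y in 𝓝 x, (y ∈ Ω ↔ ρ y ≤ 0)) (hx : x ∈ frontier Ω) :
    ρ x = 0 := by
  have hxΩ : x ∈ Ω := hΩ.frontier_subset hx
  refine le_antisymm (hmem.self_of_nhds.1 hxΩ) ?_
  by_contra h
  push Not at h
  have h1 : ∀ᶠ y in 𝓝 x, y ∈ Ω := by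
    filter_upwards [hmem, hρ.eventually (gt_mem_nhds h)] with y hy hy'
    exact hy.2 hy'.le
  exact hx.2 (mem_interior_iff_mem_nhds.2 h1)

/-- The gradient of a defining function of a convex set is an outward normal vector. -/
theorem inner_gradient_nonpos {Ω : Set E} (hΩ : Convex ℝ Ω) {ρ : E → ℝ} {x : E}
    (hρ : DifferentiableAt ℝ ρ x) (hmem : ∀ᶠ y in 𝓝 x, (y ∈ Ω ↔ ρ y ≤ 0)) (h0 : ρ x = 0)
    {y : E} (hy : y ∈ Ω) : ⟪gradient ρ x, y - x⟫ ≤ 0 := by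
  have hxΩ : x ∈ Ω := hmem.self_of_nhds.2 h0.le
  have h1 : HasDerivAt (fun t : ℝ => x + t • (y - x)) (y - x) 0 := by
    simpa using ((hasDerivAt_id (0 : ℝ)).smul_const (y - x)).const_add x
  have h2 : HasDerivAt (fun t : ℝ => ρ (x + t • (y - x))) ⟪gradient ρ x, y - x⟫ 0 := by
    rw [inner_gradient_eq_fderiv]
    refine HasFDerivAt.comp_hasDerivAt (x := (0 : ℝ)) (f := fun t : ℝ => x + t • (y - x)) ?_ h1
    simpa using hρ.hasFDerivAt
  by_contra h
  push Not at h
  have h3 : ∀ᶠ t in 𝓝[>] (0 : ℝ), 0 < ρ (x + t • (y - x)) := by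
    have h4 := (hasDerivAt_iff_tendsto_slope.1 h2).eventually (lt_mem_nhds h)
    have h5 : ∀ᶠ t in 𝓝[>] (0 : ℝ), 0 < slope (fun t : ℝ => ρ (x + t • (y - x))) 0 t :=
      h4.filter_mono (nhdsWithin_mono _ fun t ht => ne_of_gt ht)
    filter_upwards [h5, self_mem_nhdsWithin] with t ht ht0
    have ht0' : (0 : ℝ) < t := ht0
    rw [slope_def_field, sub_zero] at ht
    simp only [zero_smul, add_zero, h0, sub_zero] at ht
    exact (div_pos_iff_of_pos_right ht0').1 ht
  have h6 : ∀ᶠ t in 𝓝[>] (0 : ℝ), ρ (x + t • (y - x)) ≤ 0 := by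
    have h7 : Tendsto (fun t : ℝ => x + t • (y - x)) (𝓝[>] 0) (𝓝 x) := by
      have := h1.continuousAt.tendsto.mono_left (nhdsWithin_le_nhds (s := Ioi 0))
      simpa using this
    filter_upwards [h7.eventually hmem, Ioo_mem_nhdsGT (zero_lt_one' ℝ)] with t ht ht1
    exact ht.1 (hΩ.add_smul_sub_mem hxΩ hy ⟨ht1.1.le, ht1.2.le⟩)
  obtain ⟨t, ht1, ht2⟩ := (h3.and h6).exists
  linarith

end Hessian

/-! ### Normal vectors and the sign of the Hessian for convex sets. -/

section Normal

variable {E : Type} [NormedAddCommGroup E] [InnerProductSpace ℝ E] [FiniteDimensional ℝ E]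

/-- At a smooth boundary point, every normal vector is a multiple of the gradient. -/
theorem exists_eq_smul_gradient {Ω : Set E} {ρ : E → ℝ} {x : E}
    (hρ : DifferentiableAt ℝ ρ x) (hmem : ∀ᶠ y in 𝓝 x, (y ∈ Ω ↔ ρ y ≤ 0)) (h0 : ρ x = 0)
    (hgrad : gradient ρ x ≠ 0) {ξ : E} (hξ : ∀ y ∈ Ω, ⟪ξ, y - x⟫ ≤ 0) :
    ∃ s : ℝ, 0 ≤ s ∧ ξ = s • gradient ρ x := by
  set w := gradient ρ x with hw
  have hneg : ∀ v, ⟪w, v⟫ < 0 → ⟪ξ, v⟫ ≤ 0 := by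
    intro v hv
    have h1 : HasDerivAt (fun t : ℝ => x + t • v) v 0 := by
      simpa using ((hasDerivAt_id (0 : ℝ)).smul_const v).const_add x
    have h2 : HasDerivAt (fun t : ℝ => ρ (x + t • v)) ⟪w, v⟫ 0 := by
      rw [hw, inner_gradient_eq_fderiv]
      refine HasFDerivAt.comp_hasDerivAt (x := (0 : ℝ)) (f := fun t : ℝ => x + t • v) ?_ h1
      simpa using hρ.hasFDerivAt
    have h3 : ∀ᶠ t in 𝓝[>] (0 : ℝ), ρ (x + t • v) < 0 := by
      have h4 := (hasDerivAt_iff_tendsto_slope.1 h2).eventually (gt_mem_nhds hv)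
      have h5 : ∀ᶠ t in 𝓝[>] (0 : ℝ), slope (fun t : ℝ => ρ (x + t • v)) 0 t < 0 :=
        h4.filter_mono (nhdsWithin_mono _ fun t ht => ne_of_gt ht)
      filter_upwards [h5, self_mem_nhdsWithin] with t ht ht0
      have ht0' : (0 : ℝ) < t := ht0
      rw [slope_def_field, sub_zero] at ht
      simp only [zero_smul, add_zero, h0, sub_zero] at ht
      rwa [div_lt_iff₀ ht0', zero_mul] at ht
    have h7 : Tendsto (fun t : ℝ => x + t • v) (𝓝[>] 0) (𝓝 x) := by
      have := h1.continuousAt.tendsto.mono_left (nhdsWithin_le_nhds (s := Ioi 0))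
      simpa using this
    obtain ⟨t, ht1, ht2, ht3⟩ :=
      (h3.and ((h7.eventually hmem).and self_mem_nhdsWithin)).exists
    have ht0' : (0 : ℝ) < t := ht3
    have h8 := hξ _ (ht2.2 ht1.le)
    rw [add_sub_cancel_left, inner_smul_right] at h8
    exact nonpos_of_mul_nonpos_right h8 ht0'
  have hww : 0 < ⟪w, w⟫ := real_inner_self_pos.2 hgrad
  have hperp : ∀ v, ⟪w, v⟫ = 0 → ⟪ξ, v⟫ ≤ 0 := by
    intro v hv
    have h1 : ∀ ε : ℝ, 0 < ε → ⟪ξ, v⟫ ≤ ε * ⟪ξ, w⟫ := by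
      intro ε hε
      have := hneg (v - ε • w) (by
        rw [inner_sub_right, hv, inner_smul_right]; nlinarith)
      rw [inner_sub_right, inner_smul_right] at this
      linarith
    have h2 : Tendsto (fun ε : ℝ => ε * ⟪ξ, w⟫) (𝓝[>] 0) (𝓝 0) := by
      have : Tendsto (fun ε : ℝ => ε * ⟪ξ, w⟫) (𝓝 0) (𝓝 (0 * ⟪ξ, w⟫)) :=
        tendsto_id.mul_const _
      rw [zero_mul] at this
      exact this.mono_left nhdsWithin_le_nhds
    exact ge_of_tendsto h2 (by filter_upwards [self_mem_nhdsWithin] with ε hε using h1 ε hε)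
  have hs : 0 ≤ ⟪ξ, w⟫ := by
    have := hneg (-w) (by rw [inner_neg_right]; linarith)
    rw [inner_neg_right] at this
    linarith
  refine ⟨⟪ξ, w⟫ / ⟪w, w⟫, by positivity, ?_⟩
  set u := ξ - (⟪ξ, w⟫ / ⟪w, w⟫) • w with hu
  have huw : ⟪w, u⟫ = 0 := by
    rw [hu, inner_sub_right, inner_smul_right, real_inner_comm ξ w]
    field_simp
    ring
  have h1 := hperp u huw
  have h2 : ⟪ξ, u⟫ = ⟪u, u⟫ := by
    have : ξ = u + (⟪ξ, w⟫ / ⟪w, w⟫) • w := by rw [hu]; abel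
    conv_lhs => rw [this]
    rw [inner_add_left, real_inner_smul_left, huw, mul_zero, add_zero]
  have h3 : u = 0 := inner_self_eq_zero (𝕜 := ℝ).1
    (le_antisymm (by rw [← h2]; exact h1) real_inner_self_nonneg)
  exact sub_eq_zero.1 h3

/-- If the Hessian were negative along a tangent vector, a parabola bending outwards from the
tangent hyperplane would stay in `Ω`, against the supporting property of the gradient. -/
theorem hessian_nonneg_of_convex {Ω : Set E} (hΩ : Convex ℝ Ω) {ρ : E → ℝ}
    (hρ : ContDiff ℝ ∞ ρ) {x : E} (hmem : ∀ᶠ y in 𝓝 x, (y ∈ Ω ↔ ρ y ≤ 0)) (h0 : ρ x = 0)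
    (hgrad : gradient ρ x ≠ 0) {v : E} (hv : ⟪gradient ρ x, v⟫ = 0) :
    0 ≤ ⟪fderiv ℝ (gradient ρ) x v, v⟫ := by
  by_contra h
  push Not at h
  set w := gradient ρ x with hw
  have hn : 0 < ‖w‖ ^ 2 := by positivity
  set q := ⟪fderiv ℝ (gradient ρ) x v, v⟫ with hq
  have h1 := eventually_nonpos_of_hessian_lt hρ (β := q / (4 * ‖w‖ ^ 2)) h0 hv (by
    rw [← hw, ← hq]; field_simp; linarith)
  have h2 : Tendsto (fun t : ℝ => x + t • v - (q / (4 * ‖w‖ ^ 2) * t ^ 2) • w) (𝓝 0) (𝓝 x) := by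
    have : Continuous fun t : ℝ => x + t • v - (q / (4 * ‖w‖ ^ 2) * t ^ 2) • w := by fun_prop
    simpa using this.tendsto 0
  have h3 : ∀ᶠ t in 𝓝[>] (0 : ℝ), 0 < t ∧ x + t • v - (q / (4 * ‖w‖ ^ 2) * t ^ 2) • w ∈ Ω := by
    filter_upwards [nhdsWithin_le_nhds h1, nhdsWithin_le_nhds (h2.eventually hmem),
      self_mem_nhdsWithin] with t h4 h5 h6
    exact ⟨h6, h5.2 h4⟩
  obtain ⟨t, ht, htΩ⟩ := h3.exists
  have h4 := inner_gradient_nonpos hΩ (hρ.differentiable (by simp)).differentiableAt hmem h0 htΩ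
  rw [← hw, add_sub_assoc, add_sub_cancel_left, inner_sub_right, inner_smul_right,
    inner_smul_right, hv, real_inner_self_eq_norm_sq] at h4
  have h5 : q / (4 * ‖w‖ ^ 2) * t ^ 2 * ‖w‖ ^ 2 = q * t ^ 2 / 4 := by field_simp
  have h6 : q * t ^ 2 < 0 := mul_neg_of_neg_of_pos h (by positivity)
  linarith

/-- A nonnegative symmetric form that vanishes at `v` has `v` in its kernel, which nondegeneracy
excludes. -/
theorem hessian_pos_of_convex {Ω : Set E} (hΩ : Convex ℝ Ω) {ρ : E → ℝ}
    (hρ : ContDiff ℝ ∞ ρ) {x : E} (hmem : ∀ᶠ y in 𝓝 x, (y ∈ Ω ↔ ρ y ≤ 0)) (h0 : ρ x = 0)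
    (hgrad : gradient ρ x ≠ 0)
    (hinj : ∀ v, ⟪gradient ρ x, v⟫ = 0 →
      (∀ w, ⟪gradient ρ x, w⟫ = 0 → ⟪fderiv ℝ (gradient ρ) x v, w⟫ = 0) → v = 0)
    {v : E} (hv : ⟪gradient ρ x, v⟫ = 0) (hv0 : v ≠ 0) :
    0 < ⟪fderiv ℝ (gradient ρ) x v, v⟫ := by
  have hnn := fun u hu => hessian_nonneg_of_convex hΩ hρ hmem h0 hgrad (v := u) hu
  refine lt_of_le_of_ne (hnn v hv) fun hz => hv0 (hinj v hv fun w hw => ?_)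
  set H := fderiv ℝ (gradient ρ) x
  have hquad : ∀ t : ℝ, 0 ≤ 2 * t * ⟪H v, w⟫ + t ^ 2 * ⟪H w, w⟫ := by
    intro t
    have h1 := hnn (v + t • w) (by rw [inner_add_right, inner_smul_right, hv, hw]; simp)
    have h2 : ⟪H w, v⟫ = ⟪H v, w⟫ := inner_fderiv_gradient_comm hρ.contDiffAt w v
    simp only [map_add, map_smul, inner_add_left, inner_add_right, real_inner_smul_left,
      inner_smul_right, h2, ← hz] at h1
    linarith
  by_contra hne
  have hw0 : 0 ≤ ⟪H w, w⟫ := hnn w hw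
  -- Nearly the minimiser of the quadratic; the added 1 covers the case `⟪H w, w⟫ = 0`.
  have h1 := hquad (-⟪H v, w⟫ / (⟪H w, w⟫ + 1))
  have h2 : 2 * (-⟪H v, w⟫ / (⟪H w, w⟫ + 1)) * ⟪H v, w⟫ +
      (-⟪H v, w⟫ / (⟪H w, w⟫ + 1)) ^ 2 * ⟪H w, w⟫ =
      -(⟪H v, w⟫ ^ 2 * (⟪H w, w⟫ + 2) / (⟪H w, w⟫ + 1) ^ 2) := by
    field_simp
    ring
  rw [h2] at h1
  have h3 : 0 < ⟪H v, w⟫ ^ 2 * (⟪H w, w⟫ + 2) / (⟪H w, w⟫ + 1) ^ 2 := by positivity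
  linarith

end Normal

/-! ### Curvature points: strongly convex patches and existence. -/

section Curvature

variable {d : ℕ}

/-- Against tangent vectors, the derivative of the factor `‖∇ρ‖⁻¹` contributes nothing. Hence the
shape operator is a nonzero multiple of the compressed Hessian, and its determinant is nonzero
exactly when its kernel is trivial. -/
theorem gaussianCurvature_ne_zero_iff {ρ : EuclideanSpace ℝ (Fin d) → ℝ}
    {x : EuclideanSpace ℝ (Fin d)} (hρ : ContDiffAt ℝ ∞ ρ x) (hgrad : gradient ρ x ≠ 0) :
    gaussianCurvature ρ x ≠ 0 ↔ ∀ v, ⟪gradient ρ x, v⟫ = 0 →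
      (∀ w, ⟪gradient ρ x, w⟫ = 0 → ⟪fderiv ℝ (gradient ρ) x v, w⟫ = 0) → v = 0 := by
  have hmemT : ∀ v, v ∈ tangentSpace ρ x ↔ ⟪gradient ρ x, v⟫ = 0 := fun v =>
    Submodule.mem_orthogonal_singleton_iff_inner_right
  have hν : DifferentiableAt ℝ (gradient ρ) x :=
    (ContDiffAt.gradient_of_smooth hρ).differentiableAt (by simp)
  have hf : DifferentiableAt ℝ (fun y => ‖gradient ρ y‖⁻¹) x :=
    (hν.norm ℝ hgrad).inv (norm_ne_zero_iff.2 hgrad)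
  have hn : ∀ v w, ⟪gradient ρ x, w⟫ = 0 → ⟪fderiv ℝ (unitNormal ρ) x v, w⟫ =
      ‖gradient ρ x‖⁻¹ * ⟪fderiv ℝ (gradient ρ) x v, w⟫ := by
    intro v w hw
    have h1 : fderiv ℝ (unitNormal ρ) x = _ := (hf.hasFDerivAt.smul hν.hasFDerivAt).fderiv
    rw [h1]
    simp [inner_add_left, real_inner_smul_left, hw]
  have hker : ∀ v : tangentSpace ρ x, shapeOperator ρ x v = 0 ↔
      ∀ w, ⟪gradient ρ x, w⟫ = 0 → ⟪fderiv ℝ (gradient ρ) x v, w⟫ = 0 := by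
    intro v
    have h1 : shapeOperator ρ x v =
      (tangentSpace ρ x).orthogonalProjectionOnto (fderiv ℝ (unitNormal ρ) x v) := rfl
    rw [h1, Submodule.orthogonalProjectionOnto_eq_zero_iff, Submodule.mem_orthogonal]
    refine forall_congr' fun w => ?_
    rw [hmemT]
    refine imp_congr_right fun hw => ?_
    rw [real_inner_comm, hn _ _ hw, mul_eq_zero, or_iff_right]
    exact inv_ne_zero (norm_ne_zero_iff.2 hgrad)
  rw [gaussianCurvature, ← isUnit_iff_ne_zero, ← LinearMap.isUnit_iff_isUnit_det,
    LinearMap.isUnit_iff_ker_eq_bot, LinearMap.ker_eq_bot']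
  constructor
  · intro h v hv hw
    have := h ⟨v, (hmemT v).2 hv⟩ ((hker _).2 hw)
    simpa using this
  · intro h v hv
    exact Subtype.ext (h v ((hmemT _).1 v.2) ((hker v).1 hv))

theorem IsCurvaturePoint.exists_patch {Ω : Set (EuclideanSpace ℝ (Fin d))} (hΩ : Convex ℝ Ω)
    (hcl : IsClosed Ω) {x₀ : EuclideanSpace ℝ (Fin d)} (h : IsCurvaturePoint Ω x₀) :
    ∃ ρ r c, IsStronglyConvexPatch Ω ρ x₀ r c := by
  obtain ⟨hx₀, ρ₀, hρ₀, hcurv⟩ := h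
  obtain ⟨ρ, hρ, heq⟩ := exists_contDiff_eventuallyEq hρ₀.smooth
  have hgeq : gradient ρ =ᶠ[𝓝 x₀] gradient ρ₀ := by
    filter_upwards [heq.eventuallyEq_nhds] with y hy
    simp only [gradient, hy.fderiv_eq]
  have hmem : ∀ᶠ y in 𝓝 x₀, (y ∈ Ω ↔ ρ y ≤ 0) := by
    filter_upwards [heq, hρ₀.mem_iff] with y h1 h2
    rw [h2, h1]
  have hgrad : gradient ρ x₀ ≠ 0 := by
    rw [hgeq.eq_of_nhds]; exact hρ₀.gradient_ne_zero
  have h0 : ρ x₀ = 0 := eq_zero_of_mem_frontier hcl hρ.continuous.continuousAt hmem hx₀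
  have hinj := (gaussianCurvature_ne_zero_iff hρ₀.smooth.self_of_nhds hρ₀.gradient_ne_zero).1 hcurv
  rw [← hgeq.eq_of_nhds, ← hgeq.fderiv_eq] at hinj
  exact exists_patch_of_pos hρ h0 hgrad hmem fun v hv hv0 =>
    hessian_pos_of_convex hΩ hρ hmem h0 hgrad hinj hv hv0

/-- The point of `Ω` farthest from the origin works: there `Ω` is touched from outside by a sphere,
so its boundary bends at least as much as the sphere. A null direction of the Hessian would give a
parabola inside `Ω` that leaves the ball. -/
theorem exists_isCurvaturePoint {Ω : Set (EuclideanSpace ℝ (Fin d))} (hd : 2 ≤ d)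
    (hcpt : IsCompact Ω) (hint : (interior Ω).Nonempty) (hsm : HasSmoothBoundary Ω) :
    ∃ x₀, IsCurvaturePoint Ω x₀ := by
  have : Nonempty (Fin d) := ⟨⟨0, by omega⟩⟩
  obtain ⟨x, hx, hmax⟩ := hcpt.exists_isMaxOn (hint.mono interior_subset)
    continuous_norm.continuousOn
  have hmax' : ∀ y ∈ Ω, ‖y‖ ≤ ‖x‖ := fun y hy => hmax hy
  have hx0 : x ≠ 0 := by
    rintro rfl
    obtain ⟨z, hz⟩ := hint
    have h1 : Ω ⊆ {0} := fun y hy => by simpa using hmax' y hy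
    have h2 := interior_mono h1 hz
    rw [interior_singleton] at h2
    exact h2
  have hxn : 0 < ‖x‖ := norm_pos_iff.2 hx0
  have hxf : x ∈ frontier Ω := by
    refine ⟨subset_closure hx, fun hxi => ?_⟩
    have h1 : Tendsto (fun t : ℝ => (1 + t) • x) (𝓝[>] 0) (𝓝 x) := by
      have : Continuous fun t : ℝ => (1 + t) • x := by fun_prop
      simpa using (this.tendsto 0).mono_left nhdsWithin_le_nhds
    obtain ⟨t, ht1, ht2⟩ := ((h1.eventually (mem_interior_iff_mem_nhds.1 hxi)).and
      self_mem_nhdsWithin).exists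
    have ht : (0 : ℝ) < t := ht2
    have h3 := hmax' _ ht1
    rw [norm_smul, Real.norm_eq_abs, abs_of_pos (by linarith)] at h3
    nlinarith
  obtain ⟨ρ₀, hρ₀⟩ := hsm x hxf
  refine ⟨x, hxf, ρ₀, hρ₀, ?_⟩
  rw [gaussianCurvature_ne_zero_iff hρ₀.smooth.self_of_nhds hρ₀.gradient_ne_zero]
  obtain ⟨ρ, hρ, heq⟩ := exists_contDiff_eventuallyEq hρ₀.smooth
  have hgeq : gradient ρ =ᶠ[𝓝 x] gradient ρ₀ := by
    filter_upwards [heq.eventuallyEq_nhds] with y hy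
    simp only [gradient, hy.fderiv_eq]
  have hmem : ∀ᶠ y in 𝓝 x, (y ∈ Ω ↔ ρ y ≤ 0) := by
    filter_upwards [heq, hρ₀.mem_iff] with y h1 h2
    rw [h2, h1]
  have hgrad : gradient ρ x ≠ 0 := by
    rw [hgeq.eq_of_nhds]; exact hρ₀.gradient_ne_zero
  have h0 : ρ x = 0 :=
    eq_zero_of_mem_frontier hcpt.isClosed hρ.continuous.continuousAt hmem hxf
  rw [← hgeq.eq_of_nhds, ← hgeq.fderiv_eq]
  intro v hv hvw
  by_contra hv0
  set w := gradient ρ x with hw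
  obtain ⟨s, hs, hxs⟩ := exists_eq_smul_gradient
    (hρ.differentiable (by simp)).differentiableAt hmem h0 hgrad (ξ := x) fun y hy => by
      rw [inner_sub_right, real_inner_self_eq_norm_sq]
      have h1 := real_inner_le_norm x y
      nlinarith [hmax' y hy]
  rw [← hw] at hxs
  have hs0 : 0 < s := lt_of_le_of_ne hs fun h => hx0 (by rw [hxs, ← h, zero_smul])
  have hwn : 0 < ‖w‖ ^ 2 := by positivity
  have hvn : 0 < ‖v‖ ^ 2 := by positivity
  -- With `x = s • w`, the inward motion by `β * t ^ 2` lowers the squared norm to second order by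
  -- `t ^ 2 * ‖v‖ ^ 2 / 2`, only half of what the tangential motion adds.
  set β := ‖v‖ ^ 2 / (4 * s * ‖w‖ ^ 2) with hβ
  have hβ0 : 0 < β := by positivity
  have h1 := eventually_nonpos_of_hessian_lt hρ (β := β) h0 hv (by
    rw [hvw v hv]; positivity)
  rw [← hw] at h1
  have h2 : Tendsto (fun t : ℝ => x + t • v - (β * t ^ 2) • w) (𝓝 0) (𝓝 x) := by
    have : Continuous fun t : ℝ => x + t • v - (β * t ^ 2) • w := by fun_prop
    simpa using this.tendsto 0
  have h3 : ∀ᶠ t in 𝓝[>] (0 : ℝ), 0 < t ∧ x + t • v - (β * t ^ 2) • w ∈ Ω := by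
    filter_upwards [nhdsWithin_le_nhds h1, nhdsWithin_le_nhds (h2.eventually hmem),
      self_mem_nhdsWithin] with t h4 h5 h6
    exact ⟨h6, h5.2 h4⟩
  obtain ⟨t, ht, htΩ⟩ := h3.exists
  have h4 : ‖x + t • v - (β * t ^ 2) • w‖ ^ 2 ≤ ‖x‖ ^ 2 := by
    gcongr
    exact hmax' _ htΩ
  have h5 : ‖x + t • v - (β * t ^ 2) • w‖ ^ 2 =
      (s - β * t ^ 2) ^ 2 * ‖w‖ ^ 2 + t ^ 2 * ‖v‖ ^ 2 := by
    have : x + t • v - (β * t ^ 2) • w = (s - β * t ^ 2) • w + t • v := by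
      conv_lhs => rw [hxs]
      module
    rw [this, norm_add_sq_real, norm_smul, norm_smul, real_inner_smul_left, inner_smul_right, hv]
    simp [mul_pow]
  have h6 : ‖x‖ ^ 2 = s ^ 2 * ‖w‖ ^ 2 := by
    conv_lhs => rw [hxs]
    rw [norm_smul, mul_pow, Real.norm_eq_abs, sq_abs]
  have h7 : 2 * s * β * ‖w‖ ^ 2 = ‖v‖ ^ 2 / 2 := by rw [hβ]; field_simp; norm_num
  rw [h5, h6] at h4
  have h8 : 0 ≤ (β * t ^ 2) ^ 2 * ‖w‖ ^ 2 := by positivity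
  have h9 : 0 < t ^ 2 * ‖v‖ ^ 2 := by positivity
  have h10 : (s - β * t ^ 2) ^ 2 * ‖w‖ ^ 2 =
      s ^ 2 * ‖w‖ ^ 2 - t ^ 2 * (2 * s * β * ‖w‖ ^ 2) + (β * t ^ 2) ^ 2 * ‖w‖ ^ 2 := by ring
  rw [h7] at h10
  nlinarith

end Curvature

/-! ### Quadratic separation of the set from its tangent hyperplanes. -/

section Separation

variable {E : Type} [NormedAddCommGroup E] [InnerProductSpace ℝ E] [FiniteDimensional ℝ E]

theorem IsStronglyConvexPatch.add_inner_add_le {Ω : Set E} {ρ : E → ℝ} {x₀ : E} {r c : ℝ}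
    (h : IsStronglyConvexPatch Ω ρ x₀ r c) {x y : E} (hx : x ∈ Metric.ball x₀ r)
    (hy : y ∈ Metric.ball x₀ r) :
    ρ y + ⟪gradient ρ y, x - y⟫ + c / 2 * ‖x - y‖ ^ 2 ≤ ρ x := by
  set v := x - y with hv
  have hseg : ∀ t ∈ Icc (0 : ℝ) 1, y + t • v ∈ Metric.ball x₀ r := fun t ht =>
    (convex_ball x₀ r).add_smul_sub_mem hy hx ht
  have hγ : ∀ t : ℝ, HasDerivAt (fun t : ℝ => y + t • v) v t := fun t => by
    simpa using ((hasDerivAt_id t).smul_const v).const_add y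
  have hk : ∀ t : ℝ, HasDerivAt (fun t : ℝ => ⟪gradient ρ (y + t • v), v⟫ - c * ‖v‖ ^ 2 * t)
      (⟪fderiv ℝ (gradient ρ) (y + t • v) v, v⟫ - c * ‖v‖ ^ 2) t := by
    intro t
    have h1 : HasFDerivAt (gradient ρ) (fderiv ℝ (gradient ρ) (y + t • v)) (y + t • v) :=
      ((contDiff_gradient h.contDiff).differentiable (by simp)).differentiableAt.hasFDerivAt
    have h2 := (h1.comp_hasDerivAt t (hγ t)).inner ℝ (hasDerivAt_const t v)
    have h3 := h2.sub ((hasDerivAt_id t).const_mul (c * ‖v‖ ^ 2))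
    simpa using! h3
  have hg : ∀ t : ℝ, HasDerivAt (fun t : ℝ => ρ (y + t • v) - t * ⟪gradient ρ y, v⟫ -
      c / 2 * ‖v‖ ^ 2 * t ^ 2)
      (⟪gradient ρ (y + t • v), v⟫ - c * ‖v‖ ^ 2 * t - ⟪gradient ρ y, v⟫) t := by
    intro t
    have h1 : HasFDerivAt ρ (fderiv ℝ ρ (y + t • v)) (y + t • v) :=
      (h.contDiff.differentiable (by simp)).differentiableAt.hasFDerivAt
    have h2 := (((h1.comp_hasDerivAt t (hγ t)).sub
      ((hasDerivAt_id t).mul_const ⟪gradient ρ y, v⟫)).sub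
      ((hasDerivAt_pow 2 t).const_mul (c / 2 * ‖v‖ ^ 2)))
    refine h2.congr_deriv ?_
    rw [inner_gradient_eq_fderiv ρ (y + t • v)]
    push_cast
    ring
  have hkm : MonotoneOn (fun t : ℝ => ⟪gradient ρ (y + t • v), v⟫ - c * ‖v‖ ^ 2 * t)
      (Icc (0 : ℝ) 1) := by
    refine monotoneOn_of_deriv_nonneg (convex_Icc 0 1)
      (fun t _ => (hk t).continuousAt.continuousWithinAt)
      (fun t _ => (hk t).differentiableAt.differentiableWithinAt) fun t ht => ?_
    rw [(hk t).deriv]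
    rw [interior_Icc] at ht
    have := h.hessian _ (hseg t (Ioo_subset_Icc_self ht)) v
    linarith
  have hgm : MonotoneOn (fun t : ℝ => ρ (y + t • v) - t * ⟪gradient ρ y, v⟫ -
      c / 2 * ‖v‖ ^ 2 * t ^ 2) (Icc (0 : ℝ) 1) := by
    refine monotoneOn_of_deriv_nonneg (convex_Icc 0 1)
      (fun t _ => (hg t).continuousAt.continuousWithinAt)
      (fun t _ => (hg t).differentiableAt.differentiableWithinAt) fun t ht => ?_
    rw [(hg t).deriv]
    rw [interior_Icc] at ht
    have := hkm (left_mem_Icc.2 zero_le_one) (Ioo_subset_Icc_self ht) ht.1.le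
    simp only [zero_smul, add_zero, mul_zero, sub_zero] at this
    linarith
  have h1 := hgm (left_mem_Icc.2 zero_le_one) (right_mem_Icc.2 zero_le_one) zero_le_one
  have h2 : y + v = x := by rw [hv]; abel
  simp only [zero_smul, add_zero, one_smul, h2] at h1
  nlinarith

/-- Close to `y` this is strong convexity of `ρ`. A distant `x` is moved along the segment towards
`y` until it is close; the local bound then gives linear growth along that segment, and boundedness
of `Ω` turns it into a quadratic bound. -/
theorem IsStronglyConvexPatch.exists_separation {Ω : Set E} (hΩ : Convex ℝ Ω)
    (hcpt : IsCompact Ω) {ρ : E → ℝ} {x₀ : E} {r c : ℝ}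
    (h : IsStronglyConvexPatch Ω ρ x₀ r c) :
    ∃ c₁ : ℝ, 0 < c₁ ∧ ∀ y ∈ Metric.ball x₀ (r / 2), ρ y = 0 → ∀ x ∈ Ω,
      c₁ * ‖x - y‖ ^ 2 ≤ ⟪gradient ρ y, y - x⟫ := by
  have hr := h.r_pos
  have hc := h.c_pos
  obtain ⟨D, hD0, hD⟩ : ∃ D : ℝ, 0 < D ∧ ∀ x ∈ Ω, ∀ y ∈ Ω, ‖x - y‖ ≤ D := by
    obtain ⟨D, hD⟩ := hcpt.isBounded.exists_norm_le
    refine ⟨|D| + |D| + 1, by positivity, fun x hx y hy => (norm_sub_le x y).trans ?_⟩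
    linarith [(hD x hx).trans (le_abs_self D), (hD y hy).trans (le_abs_self D)]
  have hloc : ∀ y ∈ Metric.ball x₀ (r / 2), ρ y = 0 → ∀ x ∈ Ω, ‖x - y‖ < r / 2 →
      c / 2 * ‖x - y‖ ^ 2 ≤ ⟪gradient ρ y, y - x⟫ := by
    intro y hy hy0 x hx hxy
    have hyb : y ∈ Metric.ball x₀ r := Metric.ball_subset_ball (by linarith) hy
    have hxb : x ∈ Metric.ball x₀ r := by
      rw [Metric.mem_ball] at hy ⊢
      have := dist_triangle x y x₀
      rw [dist_eq_norm x y] at this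
      linarith
    have h1 := h.add_inner_add_le hxb hyb
    have h2 := (h.mem_iff x hxb).1 hx
    have h3 : ⟪gradient ρ y, y - x⟫ = -⟪gradient ρ y, x - y⟫ := by
      rw [← inner_neg_right, neg_sub]
    linarith
  refine ⟨min (c / 2) (c / 2 * (r / 4) / D), by positivity, fun y hy hy0 x hx => ?_⟩
  rcases lt_or_ge ‖x - y‖ (r / 2) with hxy | hxy
  · refine le_trans ?_ (hloc y hy hy0 x hx hxy)
    gcongr
    exact min_le_left _ _
  have hyb : y ∈ Metric.ball x₀ r := Metric.ball_subset_ball (by linarith) hy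
  have hyΩ : y ∈ Ω := (h.mem_iff y hyb).2 hy0.le
  have hn : 0 < ‖x - y‖ := by linarith
  -- Puts `y + t • (x - y)` at distance `r / 4` from `y`, inside the range of the local bound.
  set t := r / 4 / ‖x - y‖ with ht
  have ht0 : 0 < t := by positivity
  have ht1 : t ≤ 1 := by rw [ht, div_le_one hn]; linarith
  have hx' : y + t • (x - y) ∈ Ω := hΩ.add_smul_sub_mem hyΩ hx ⟨ht0.le, ht1⟩
  have htn : t * ‖x - y‖ = r / 4 := by rw [ht]; field_simp
  have h1 := hloc y hy hy0 _ hx' (by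
    rw [add_sub_cancel_left, norm_smul, Real.norm_eq_abs, abs_of_pos ht0, htn]; linarith)
  rw [add_sub_cancel_left, norm_smul, Real.norm_eq_abs, abs_of_pos ht0, htn] at h1
  have h2 : y - (y + t • (x - y)) = t • (y - x) := by
    rw [sub_add_cancel_left, ← smul_neg, neg_sub]
  rw [h2, inner_smul_right] at h1
  have h3 : c / 2 * (r / 4) * ‖x - y‖ ≤ ⟪gradient ρ y, y - x⟫ := by
    have h4 : t * (c / 2 * (r / 4) * ‖x - y‖) ≤ t * ⟪gradient ρ y, y - x⟫ := by
      calc _ = c / 2 * (r / 4) * (t * ‖x - y‖) := by ring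
        _ = c / 2 * (r / 4) ^ 2 := by rw [htn]; ring
        _ ≤ _ := h1
    exact le_of_mul_le_mul_left h4 ht0
  refine le_trans ?_ h3
  calc _ ≤ c / 2 * (r / 4) / D * ‖x - y‖ ^ 2 := by gcongr; exact min_le_right _ _
    _ = c / 2 * (r / 4) * ‖x - y‖ * (‖x - y‖ / D) := by ring
    _ ≤ c / 2 * (r / 4) * ‖x - y‖ * 1 := by
        gcongr
        rw [div_le_one hD0]
        exact hD x hx y hyΩ
    _ = _ := mul_one _

end Separation

/-! ### Support points and cones of directions. -/

section SupportPoints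

variable {E : Type} [NormedAddCommGroup E] [InnerProductSpace ℝ E] [FiniteDimensional ℝ E]

/-- `s` selects, for every direction, a point of `Ω` that is extreme in this direction. -/
def IsSupportSelection (Ω : Set E) (s : E → E) : Prop :=
  ∀ ξ, s ξ ∈ Ω ∧ ∀ z ∈ Ω, ⟪ξ, z⟫ ≤ ⟪ξ, s ξ⟫

theorem exists_isSupportSelection {Ω : Set E} (hcpt : IsCompact Ω) (hne : Ω.Nonempty) :
    ∃ s, IsSupportSelection Ω s := by
  have : ∀ ξ : E, ∃ y ∈ Ω, ∀ z ∈ Ω, ⟪ξ, z⟫ ≤ ⟪ξ, y⟫ := fun ξ => by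
    obtain ⟨y, hy, hmax⟩ := hcpt.exists_isMaxOn hne
      (innerSL ℝ ξ).continuous.continuousOn
    exact ⟨y, hy, fun z hz => by simpa using hmax hz⟩
  choose s hs using this
  exact ⟨s, hs⟩

theorem IsSupportSelection.mem_frontier {Ω : Set E} {s : E → E} (hs : IsSupportSelection Ω s)
    {ξ : E} (hξ : ξ ≠ 0) : s ξ ∈ frontier Ω := by
  refine ⟨subset_closure (hs ξ).1, fun hi => ?_⟩
  have h1 : Tendsto (fun t : ℝ => s ξ + t • ξ) (𝓝[>] 0) (𝓝 (s ξ)) := by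
    have : Continuous fun t : ℝ => s ξ + t • ξ := by fun_prop
    simpa using (this.tendsto 0).mono_left nhdsWithin_le_nhds
  obtain ⟨t, ht1, ht2⟩ := ((h1.eventually (mem_interior_iff_mem_nhds.1 hi)).and
    self_mem_nhdsWithin).exists
  have ht : (0 : ℝ) < t := ht2
  have h3 := (hs ξ).2 _ ht1
  rw [inner_add_right, inner_smul_right] at h3
  have := mul_pos ht (real_inner_self_pos.2 hξ)
  linarith

/-- Envelope argument: the maximality of `s ξ` and of `s ζ` places the linearisation error between 0
and `⟪ζ - ξ, s ζ - s ξ⟫`. Continuity of `s` suffices; its derivative is not needed. -/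
theorem IsSupportSelection.hasFDerivAt {Ω : Set E} {s : E → E} (hs : IsSupportSelection Ω s)
    {ξ : E} (hc : ContinuousAt s ξ) : HasFDerivAt (fun ξ => ⟪ξ, s ξ⟫) (innerSL ℝ (s ξ)) ξ := by
  rw [hasFDerivAt_iff_isLittleO, Asymptotics.isLittleO_iff]
  intro ε hε
  filter_upwards [hc (Metric.ball_mem_nhds _ hε)] with ζ hζ
  have hζ' : ‖s ζ - s ξ‖ < ε := by simpa [dist_eq_norm] using hζ
  have h1 := (hs ζ).2 _ (hs ξ).1
  have h2 := (hs ξ).2 _ (hs ζ).1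
  have h3 : ⟪ζ, s ζ⟫ - ⟪ξ, s ξ⟫ - ⟪s ξ, ζ - ξ⟫ = ⟪ζ, s ζ⟫ - ⟪ζ, s ξ⟫ := by
    rw [inner_sub_right, real_inner_comm ζ (s ξ), real_inner_comm ξ (s ξ)]; ring
  have h4 : ⟪ζ - ξ, s ζ - s ξ⟫ = ⟪ζ, s ζ⟫ - ⟪ζ, s ξ⟫ + (⟪ξ, s ξ⟫ - ⟪ξ, s ζ⟫) := by
    simp only [inner_sub_left, inner_sub_right]; ring
  simp only [innerSL_apply_apply]
  rw [h3, Real.norm_eq_abs, abs_of_nonneg (by linarith)]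
  calc _ ≤ ⟪ζ - ξ, s ζ - s ξ⟫ := by linarith
    _ ≤ ‖ζ - ξ‖ * ‖s ζ - s ξ‖ := real_inner_le_norm _ _
    _ ≤ ‖ζ - ξ‖ * ε := by gcongr
    _ = ε * ‖ζ - ξ‖ := mul_comm _ _

/-- The cone of vectors whose direction is close to that of `w`. -/
def directionCone (w : E) (δ : ℝ) : Set E := {ξ | ∃ t : ℝ, 0 < t ∧ ‖ξ - t • w‖ ≤ δ * t}

theorem directionCone_mono (w : E) {δ δ' : ℝ} (h : δ ≤ δ') :
    directionCone w δ ⊆ directionCone w δ' := by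
  rintro ξ ⟨t, ht, hξ⟩
  exact ⟨t, ht, hξ.trans (by gcongr)⟩

theorem convex_directionCone (w : E) (δ : ℝ) : Convex ℝ (directionCone w δ) := by
  rw [convex_iff_forall_pos]
  rintro x ⟨t, ht, hx⟩ y ⟨u, hu, hy⟩ a b ha hb -
  refine ⟨a * t + b * u, by positivity, ?_⟩
  have : a • x + b • y - (a * t + b * u) • w = a • (x - t • w) + b • (y - u • w) := by module
  rw [this]
  refine (norm_add_le _ _).trans ?_
  rw [norm_smul, norm_smul, Real.norm_eq_abs, Real.norm_eq_abs, abs_of_pos ha, abs_of_pos hb]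
  calc _ ≤ a * (δ * t) + b * (δ * u) := by gcongr
    _ = _ := by ring

/-- For a unit vector `w`, the component of a vector of the cone in direction `w`. -/
theorem directionCone_bounds {w : E} (hw : ‖w‖ = 1) {δ : ℝ} (hδ : δ ≤ 1 / 2) {ξ : E}
    (h : ξ ∈ directionCone w δ) : 0 < ⟪ξ, w⟫ ∧ ‖ξ‖ ≤ 3 * ⟪ξ, w⟫ ∧ ⟪ξ, w⟫ ≤ ‖ξ‖ := by
  obtain ⟨t, ht, hξ⟩ := h
  have h1 : |⟪ξ - t • w, w⟫| ≤ t / 2 := by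
    refine (abs_real_inner_le_norm _ _).trans ?_
    rw [hw, mul_one]
    nlinarith
  rw [inner_sub_left, real_inner_smul_left, real_inner_self_eq_norm_sq, hw] at h1
  have h2 := abs_le.1 h1
  have h3 : ‖ξ‖ ≤ t / 2 + t := by
    calc ‖ξ‖ = ‖(ξ - t • w) + t • w‖ := by rw [sub_add_cancel]
      _ ≤ ‖ξ - t • w‖ + ‖t • w‖ := norm_add_le _ _
      _ ≤ t / 2 + t := by
          rw [norm_smul, hw, mul_one, Real.norm_eq_abs, abs_of_pos ht]
          nlinarith
  refine ⟨by linarith, by linarith, ?_⟩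
  have := real_inner_le_norm ξ w
  rwa [hw, mul_one] at this

end SupportPoints

/-! ### The inverse Gauss map on a cone of directions. -/

section GaussCone

variable {E : Type} [NormedAddCommGroup E] [InnerProductSpace ℝ E] [FiniteDimensional ℝ E]

/-- On the cone of directions close to `w`, the support points `s ξ` are parametrized by the
directions in a bi-Lipschitz and strongly monotone way, and `ξ` is a multiple of `ν (s ξ)`. -/
structure IsGaussCone (Ω : Set E) (ν s : E → E) (w : E) (δ c C : ℝ) : Prop where
  norm_eq : ‖w‖ = 1
  δ_pos : 0 < δ
  δ_le : δ ≤ 1 / 2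
  c_pos : 0 < c
  C_pos : 0 < C
  selection : IsSupportSelection Ω s
  multiplier : ∀ ξ ∈ directionCone w δ, ∃ l : ℝ, 0 < l ∧ ξ = l • ν (s ξ) ∧
    ⟪ξ, w⟫ ≤ C * l ∧ l ≤ C * ⟪ξ, w⟫
  monotone : ∀ ξ ∈ directionCone w δ, ∀ ζ ∈ directionCone w δ,
    c * ‖⟪ζ, w⟫⁻¹ • ζ - ⟪ξ, w⟫⁻¹ • ξ‖ ^ 2 ≤ ⟪⟪ζ, w⟫⁻¹ • ζ - ⟪ξ, w⟫⁻¹ • ξ, s ζ - s ξ⟫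
  lipschitz : ∀ ξ ∈ directionCone w δ, ∀ ζ ∈ directionCone w δ,
    ‖s ζ - s ξ‖ ≤ C * ‖⟪ζ, w⟫⁻¹ • ζ - ⟪ξ, w⟫⁻¹ • ξ‖
  continuousAt : ∀ ξ ∈ directionCone w δ, ContinuousAt s ξ

theorem directionCone_mem_nhds {w : E} {δ δ' : ℝ} (h : δ < δ') {ξ : E}
    (hξ : ξ ∈ directionCone w δ) : directionCone w δ' ∈ 𝓝 ξ := by
  obtain ⟨t, ht, hξt⟩ := hξ
  have h1 : 0 < (δ' - δ) * t := mul_pos (by linarith) ht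
  filter_upwards [Metric.ball_mem_nhds ξ h1] with ζ hζ
  rw [Metric.mem_ball, dist_eq_norm] at hζ
  refine ⟨t, ht, ?_⟩
  calc ‖ζ - t • w‖ = ‖(ζ - ξ) + (ξ - t • w)‖ := by rw [sub_add_sub_cancel]
    _ ≤ ‖ζ - ξ‖ + ‖ξ - t • w‖ := norm_add_le _ _
    _ ≤ (δ' - δ) * t + δ * t := add_le_add hζ.le hξt
    _ = δ' * t := by ring

/-- Since `s ξ` beats `x₀` in direction `ξ`, the quadratic separation at `x₀` must be paid for by
the deviation of `ξ` from the normal at `x₀`, which is linear in `‖s ξ - x₀‖`. -/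
theorem IsStronglyConvexPatch.norm_support_sub_le {Ω : Set E} {ρ : E → ℝ} {x₀ : E} {r c c₁ : ℝ}
    (h : IsStronglyConvexPatch Ω ρ x₀ r c) (hc₁ : 0 < c₁)
    (hsep : ∀ x ∈ Ω, c₁ * ‖x - x₀‖ ^ 2 ≤ ⟪gradient ρ x₀, x₀ - x⟫)
    {s : E → E} (hs : IsSupportSelection Ω s) {δ : ℝ} {ξ : E}
    (hξ : ξ ∈ directionCone (‖gradient ρ x₀‖⁻¹ • gradient ρ x₀) δ) :
    ‖s ξ - x₀‖ ≤ δ * ‖gradient ρ x₀‖ / c₁ := by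
  obtain ⟨t, ht, hξt⟩ := hξ
  set v := gradient ρ x₀ with hv
  have hx₀ : x₀ ∈ Ω := (h.mem_iff x₀ (Metric.mem_ball_self h.r_pos)).2 h.eq_zero.le
  have hn : 0 < ‖v‖ := norm_pos_iff.2 (h.gradient_ne_zero x₀ (Metric.mem_ball_self h.r_pos))
  rcases eq_or_ne (s ξ) x₀ with he | he
  · rw [he, sub_self, norm_zero]
    have : 0 ≤ δ * t := (norm_nonneg _).trans hξt
    have : 0 ≤ δ := nonneg_of_mul_nonneg_left this ht
    positivity
  have hd : 0 < ‖s ξ - x₀‖ := norm_pos_iff.2 (sub_ne_zero.2 he)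
  have h1 := hsep _ (hs ξ).1
  have h2 : ⟪ξ, x₀ - s ξ⟫ ≤ 0 := by
    rw [inner_sub_right]; linarith [(hs ξ).2 _ hx₀]
  have h3 : ⟪t • ‖v‖⁻¹ • v, x₀ - s ξ⟫ ≤ δ * t * ‖s ξ - x₀‖ := by
    have h4 : ⟪t • ‖v‖⁻¹ • v, x₀ - s ξ⟫ = ⟪ξ, x₀ - s ξ⟫ + ⟪ξ - t • ‖v‖⁻¹ • v, s ξ - x₀⟫ := by
      rw [← neg_sub (s ξ) x₀]; simp only [inner_neg_right, inner_sub_left]; ring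
    rw [h4]
    have h5 := real_inner_le_norm (ξ - t • ‖v‖⁻¹ • v) (s ξ - x₀)
    have h6 : ‖ξ - t • ‖v‖⁻¹ • v‖ * ‖s ξ - x₀‖ ≤ δ * t * ‖s ξ - x₀‖ := by gcongr
    linarith
  rw [real_inner_smul_left, real_inner_smul_left] at h3
  have h7 : c₁ * ‖s ξ - x₀‖ ^ 2 ≤ ‖v‖ * δ * ‖s ξ - x₀‖ := by
    have h8 : t * (‖v‖⁻¹ * ⟪v, x₀ - s ξ⟫) ≤ t * (δ * ‖s ξ - x₀‖) := by linarith
    have h9 := le_of_mul_le_mul_left h8 ht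
    rw [inv_mul_le_iff₀ hn] at h9
    linarith
  rw [le_div_iff₀ hc₁]
  have h10 : ‖s ξ - x₀‖ * (‖s ξ - x₀‖ * c₁) ≤ ‖s ξ - x₀‖ * (δ * ‖v‖) := by nlinarith
  exact le_of_mul_le_mul_left h10 hd

/-- Adding the separation inequalities at `s ξ` and `s ζ` gives monotonicity measured by `‖s ζ - s
ξ‖ ^ 2`; by Cauchy-Schwarz this is the Lipschitz bound. The gradient being locally Lipschitz,
normalised directions are in turn Lipschitz in the support points, so monotonicity may be measured
by directions. -/
theorem IsStronglyConvexPatch.exists_isGaussCone {Ω : Set E} (hΩ : Convex ℝ Ω)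
    (hcpt : IsCompact Ω) {ρ : E → ℝ} {x₀ : E} {r c : ℝ} (h : IsStronglyConvexPatch Ω ρ x₀ r c)
    {V : Set E} (hV : V ∈ 𝓝 x₀) {s : E → E} (hs : IsSupportSelection Ω s) :
    ∃ δ c' C, IsGaussCone Ω (gradient ρ) s (‖gradient ρ x₀‖⁻¹ • gradient ρ x₀) δ c' C ∧
      ∀ ξ ∈ directionCone (‖gradient ρ x₀‖⁻¹ • gradient ρ x₀) δ, s ξ ∈ V ∧ ρ (s ξ) = 0 ∧
        s ξ ∈ frontier Ω := by
  obtain ⟨c₁, hc₁, hsep⟩ := h.exists_separation hΩ hcpt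
  have hr := h.r_pos
  have hν := contDiff_gradient h.contDiff
  have hx₀b : x₀ ∈ Metric.ball x₀ (r / 2) := Metric.mem_ball_self (by linarith)
  set v := gradient ρ x₀ with hv
  have hn : 0 < ‖v‖ := norm_pos_iff.2 (h.gradient_ne_zero x₀ (Metric.mem_ball_self hr))
  set w := ‖v‖⁻¹ • v with hw
  have hw1 : ‖w‖ = 1 := by rw [hw, norm_smul, norm_inv, norm_norm, inv_mul_cancel₀ hn.ne']
  have hvw : ⟪v, w⟫ = ‖v‖ := by
    rw [hw, inner_smul_right, real_inner_self_eq_norm_sq]; field_simp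
  -- a small ball on which the gradient is controlled
  have e1 : ∀ᶠ y in 𝓝 x₀, ‖v‖ / 2 < ⟪gradient ρ y, w⟫ := by
    have : Continuous fun y => ⟪gradient ρ y, w⟫ := hν.continuous.inner continuous_const
    exact this.continuousAt.eventually (lt_mem_nhds (by show ‖v‖ / 2 < ⟪v, w⟫; rw [hvw]; linarith))
  have e2 : ∀ᶠ y in 𝓝 x₀, ‖gradient ρ y‖ < 2 * ‖v‖ :=
    hν.continuous.norm.continuousAt.eventually (gt_mem_nhds (by show ‖v‖ < 2 * ‖v‖; linarith))
  obtain ⟨Λ, U, hU, hLip⟩ := (hν.of_le (by simp) : ContDiff ℝ 1 (gradient ρ)).contDiffAt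
    (x := x₀) |>.exists_lipschitzOnWith
  obtain ⟨r₁, hr₁, hball⟩ := Metric.mem_nhds_iff.1 (Filter.inter_mem (Filter.inter_mem hV hU)
    (Filter.inter_mem (Metric.ball_mem_nhds x₀ (by linarith : 0 < r / 2)) (e1.and e2)))
  set δ₁ := min (1 / 2) (r₁ / 2 * c₁ / ‖v‖) with hδ₁
  have hδ₁0 : 0 < δ₁ := by positivity
  have hsmall : ∀ ξ ∈ directionCone w δ₁, s ξ ∈ Metric.ball x₀ r₁ := by
    intro ξ hξ
    have h1 := h.norm_support_sub_le hc₁ (hsep x₀ hx₀b h.eq_zero) hs hξ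
    rw [Metric.mem_ball, dist_eq_norm]
    have h2 : δ₁ * ‖v‖ / c₁ ≤ r₁ / 2 := by
      rw [div_le_iff₀ hc₁]
      calc _ ≤ r₁ / 2 * c₁ / ‖v‖ * ‖v‖ := by gcongr; exact min_le_right _ _
        _ = _ := by field_simp
    linarith
  have hne : ∀ ξ ∈ directionCone w δ₁, 0 < ⟪ξ, w⟫ := fun ξ hξ =>
    (directionCone_bounds hw1 (min_le_left _ _) hξ).1
  have hfr : ∀ ξ ∈ directionCone w δ₁, s ξ ∈ frontier Ω := fun ξ hξ =>
    hs.mem_frontier fun h0 => by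
      have := hne ξ hξ
      rw [h0, inner_zero_left] at this
      exact lt_irrefl _ this
  have hmemr : ∀ ξ ∈ directionCone w δ₁, ∀ᶠ y in 𝓝 (s ξ), (y ∈ Ω ↔ ρ y ≤ 0) := fun ξ hξ => by
    have h1 := (hball (hsmall ξ hξ)).2.1
    filter_upwards [Metric.isOpen_ball.mem_nhds (Metric.ball_subset_ball
      (by linarith : r / 2 ≤ r) h1)] with y hy
    exact h.mem_iff y hy
  have hzero : ∀ ξ ∈ directionCone w δ₁, ρ (s ξ) = 0 := fun ξ hξ =>
    eq_zero_of_mem_frontier hcpt.isClosed h.contDiff.continuous.continuousAt (hmemr ξ hξ) (hfr ξ hξ)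
  have hmult : ∀ ξ ∈ directionCone w δ₁, ∃ l : ℝ, 0 < l ∧ ξ = l • gradient ρ (s ξ) ∧
      l * (‖v‖ / 2) ≤ ⟪ξ, w⟫ ∧ ⟪ξ, w⟫ ≤ l * (2 * ‖v‖) := by
    intro ξ hξ
    have hb := hball (hsmall ξ hξ)
    obtain ⟨l, hl, hξl⟩ := exists_eq_smul_gradient
      (h.contDiff.differentiable (by simp)).differentiableAt (hmemr ξ hξ) (hzero ξ hξ)
      (h.gradient_ne_zero _ (Metric.ball_subset_ball (by linarith) hb.2.1)) (ξ := ξ)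
      fun y hy => by rw [inner_sub_right]; linarith [(hs ξ).2 y hy]
    have h1 : ⟪ξ, w⟫ = l * ⟪gradient ρ (s ξ), w⟫ := by
      conv_lhs => rw [hξl]
      rw [real_inner_smul_left]
    have hl0 : 0 < l := lt_of_le_of_ne hl fun h0 => by
      have := hne ξ hξ
      rw [h1, ← h0, zero_mul] at this
      exact lt_irrefl _ this
    refine ⟨l, hl0, hξl, ?_, ?_⟩
    · rw [h1]; gcongr; exact hb.2.2.1.le
    · rw [h1]
      gcongr
      have h2 := real_inner_le_norm (gradient ρ (s ξ)) w
      rw [hw1, mul_one] at h2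
      exact h2.trans hb.2.2.2.le
  -- separation in terms of normalized directions
  have hnorm_dir : ∀ ξ ∈ directionCone w δ₁, ∀ z ∈ Ω,
      c₁ / (2 * ‖v‖) * ‖z - s ξ‖ ^ 2 ≤ ⟪⟪ξ, w⟫⁻¹ • ξ, s ξ - z⟫ := by
    intro ξ hξ z hz
    obtain ⟨l, hl0, hξl, -, h2⟩ := hmult ξ hξ
    have hb := hball (hsmall ξ hξ)
    have h3 := hsep (s ξ) hb.2.1 (hzero ξ hξ) z hz
    have h4 := hne ξ hξ
    have h5 : ⟪⟪ξ, w⟫⁻¹ • ξ, s ξ - z⟫ = l / ⟪ξ, w⟫ * ⟪gradient ρ (s ξ), s ξ - z⟫ := by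
      have : ⟪ξ, s ξ - z⟫ = l * ⟪gradient ρ (s ξ), s ξ - z⟫ := by
        conv_lhs => rw [hξl]
        rw [real_inner_smul_left, ← hξl]
      rw [real_inner_smul_left, this]
      ring
    rw [h5]
    have h6 : 1 / (2 * ‖v‖) ≤ l / ⟪ξ, w⟫ := by
      rw [div_le_div_iff₀ (by positivity) h4]
      linarith
    calc _ = 1 / (2 * ‖v‖) * (c₁ * ‖z - s ξ‖ ^ 2) := by ring
      _ ≤ _ := by gcongr
  have hsum : ∀ ξ ∈ directionCone w δ₁, ∀ ζ ∈ directionCone w δ₁,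
      c₁ / ‖v‖ * ‖s ζ - s ξ‖ ^ 2 ≤ ⟪⟪ζ, w⟫⁻¹ • ζ - ⟪ξ, w⟫⁻¹ • ξ, s ζ - s ξ⟫ := by
    intro ξ hξ ζ hζ
    have h1 := hnorm_dir ξ hξ _ (hs ζ).1
    have h2 := hnorm_dir ζ hζ _ (hs ξ).1
    rw [norm_sub_rev] at h2
    rw [← neg_sub (s ζ) (s ξ), inner_neg_right] at h1
    rw [inner_sub_left]
    have h3 : c₁ / ‖v‖ = c₁ / (2 * ‖v‖) + c₁ / (2 * ‖v‖) := by field_simp; ring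
    rw [h3, add_mul]
    linarith
  have hlip : ∀ ξ ∈ directionCone w δ₁, ∀ ζ ∈ directionCone w δ₁,
      ‖s ζ - s ξ‖ ≤ ‖v‖ / c₁ * ‖⟪ζ, w⟫⁻¹ • ζ - ⟪ξ, w⟫⁻¹ • ξ‖ := by
    intro ξ hξ ζ hζ
    rcases eq_or_ne (s ζ) (s ξ) with he | he
    · rw [he, sub_self, norm_zero]; positivity
    have hd : 0 < ‖s ζ - s ξ‖ := norm_pos_iff.2 (sub_ne_zero.2 he)
    have h1 := (hsum ξ hξ ζ hζ).trans (real_inner_le_norm _ _)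
    rw [pow_two, ← mul_assoc] at h1
    have h2 := le_of_mul_le_mul_right h1 hd
    rw [div_mul_eq_mul_div, le_div_iff₀ hc₁]
    rw [div_mul_eq_mul_div, div_le_iff₀ hn] at h2
    linarith
  have hbilip : ∀ ξ ∈ directionCone w δ₁, ∀ ζ ∈ directionCone w δ₁,
      ‖⟪ζ, w⟫⁻¹ • ζ - ⟪ξ, w⟫⁻¹ • ξ‖ ≤ (16 * Λ / ‖v‖) * ‖s ζ - s ξ‖ := by
    intro ξ hξ ζ hζ
    have hbξ := hball (hsmall ξ hξ)
    have hbζ := hball (hsmall ζ hζ)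
    obtain ⟨l, hl0, hξl, -, -⟩ := hmult ξ hξ
    obtain ⟨k, hk0, hζk, -, -⟩ := hmult ζ hζ
    set a := gradient ρ (s ξ)
    set b := gradient ρ (s ζ)
    have ha : ‖v‖ / 2 < ⟪a, w⟫ := hbξ.2.2.1
    have hb : ‖v‖ / 2 < ⟪b, w⟫ := hbζ.2.2.1
    have ha' : ‖a‖ < 2 * ‖v‖ := hbξ.2.2.2
    have hab : ‖b - a‖ ≤ Λ * ‖s ζ - s ξ‖ := by
      have := hLip.dist_le_mul _ hbζ.1.2 _ hbξ.1.2
      rwa [dist_eq_norm, dist_eq_norm] at this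
    have hq : ∀ (l : ℝ) (u ξ : E), 0 < l → ξ = l • u → ⟪ξ, w⟫⁻¹ • ξ = ⟪u, w⟫⁻¹ • u := by
      rintro l u ξ hl rfl
      rw [real_inner_smul_left, smul_smul]
      congr 1
      rw [mul_inv, mul_comm l⁻¹, mul_assoc, inv_mul_cancel₀ hl.ne', mul_one]
    rw [hq l a ξ hl0 hξl, hq k b ζ hk0 hζk]
    have hb0 : 0 < ⟪b, w⟫ := by linarith
    have ha0 : 0 < ⟪a, w⟫ := by linarith
    have h1 : ⟪b, w⟫⁻¹ • b - ⟪a, w⟫⁻¹ • a =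
        ⟪b, w⟫⁻¹ • ((b - a) - (⟪b - a, w⟫ * ⟪a, w⟫⁻¹) • a) := by
      rw [inner_sub_left, smul_sub, smul_sub, smul_smul]
      have : ⟪b, w⟫⁻¹ * ((⟪b, w⟫ - ⟪a, w⟫) * ⟪a, w⟫⁻¹) = ⟪a, w⟫⁻¹ - ⟪b, w⟫⁻¹ := by
        field_simp
      rw [this, sub_smul]
      abel
    rw [h1, norm_smul, norm_inv, Real.norm_eq_abs, abs_of_pos hb0]
    have h2 : ‖(b - a) - (⟪b - a, w⟫ * ⟪a, w⟫⁻¹) • a‖ ≤ 5 * ‖b - a‖ := by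
      refine (norm_sub_le _ _).trans ?_
      rw [norm_smul, norm_mul, norm_inv, Real.norm_eq_abs ⟪a, w⟫, abs_of_pos ha0]
      have h3 : ‖⟪b - a, w⟫‖ ≤ ‖b - a‖ := by
        have := norm_inner_le_norm (𝕜 := ℝ) (b - a) w
        rwa [hw1, mul_one] at this
      have h4 : ⟪a, w⟫⁻¹ * ‖a‖ ≤ 4 := by
        rw [inv_mul_le_iff₀ ha0]; linarith
      calc _ = ‖b - a‖ + ‖⟪b - a, w⟫‖ * (⟪a, w⟫⁻¹ * ‖a‖) := by ring
        _ ≤ ‖b - a‖ + ‖b - a‖ * 4 := by gcongr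
        _ = _ := by ring
    have h5 : ⟪b, w⟫⁻¹ ≤ 2 / ‖v‖ := by
      rw [inv_le_comm₀ hb0 (by positivity), inv_div]; exact hb.le
    calc _ ≤ 2 / ‖v‖ * (5 * (Λ * ‖s ζ - s ξ‖)) := by gcongr; exact h2.trans (by gcongr)
      _ = 10 * (Λ / ‖v‖ * ‖s ζ - s ξ‖) := by ring
      _ ≤ 16 * (Λ / ‖v‖ * ‖s ζ - s ξ‖) := by gcongr; norm_num
      _ = _ := by ring
  -- The summand 1 keeps `κ` positive when `Λ = 0`.
  set κ := 16 * (Λ : ℝ) / ‖v‖ + 1 with hκ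
  have hκ0 : 0 < κ := by positivity
  -- Half the aperture leaves a full neighbourhood of each direction inside the larger cone, as
  -- continuity of `s` requires.
  have hsub := directionCone_mono w (half_le_self hδ₁0.le)
  refine ⟨δ₁ / 2, c₁ / ‖v‖ / κ ^ 2, ‖v‖ / c₁ + 2 * ‖v‖ + 2 / ‖v‖, ⟨hw1, by positivity,
    by linarith [min_le_left (1 / 2) (r₁ / 2 * c₁ / ‖v‖)], by positivity, by positivity, hs,
    ?_, ?_, ?_, ?_⟩, fun ξ hξ => ⟨(hball (hsmall ξ (hsub hξ))).1.1, hzero ξ (hsub hξ),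
    hfr ξ (hsub hξ)⟩⟩
  · intro ξ hξ
    obtain ⟨l, hl0, hξl, h1, h2⟩ := hmult ξ (hsub hξ)
    refine ⟨l, hl0, hξl, ?_, ?_⟩
    · refine h2.trans ?_
      rw [mul_comm]
      gcongr
      have : 0 ≤ ‖v‖ / c₁ := by positivity
      have : 0 ≤ 2 / ‖v‖ := by positivity
      linarith
    · have h3 : l ≤ 2 / ‖v‖ * ⟪ξ, w⟫ := by
        rw [div_mul_eq_mul_div, le_div_iff₀ hn]; linarith
      refine h3.trans ?_
      have := hne ξ (hsub hξ)
      gcongr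
      have : 0 ≤ ‖v‖ / c₁ := by positivity
      linarith
  · intro ξ hξ ζ hζ
    refine le_trans ?_ (hsum ξ (hsub hξ) ζ (hsub hζ))
    have h1 := hbilip ξ (hsub hξ) ζ (hsub hζ)
    have h2 : ‖⟪ζ, w⟫⁻¹ • ζ - ⟪ξ, w⟫⁻¹ • ξ‖ ≤ κ * ‖s ζ - s ξ‖ := by
      refine h1.trans ?_
      gcongr
      linarith
    calc _ ≤ c₁ / ‖v‖ / κ ^ 2 * (κ * ‖s ζ - s ξ‖) ^ 2 := by gcongr
      _ = _ := by field_simp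
  · intro ξ hξ ζ hζ
    refine (hlip ξ (hsub hξ) ζ (hsub hζ)).trans ?_
    gcongr
    have : 0 ≤ 2 / ‖v‖ := by positivity
    linarith
  · intro ξ hξ
    rw [ContinuousAt, tendsto_iff_norm_sub_tendsto_zero]
    have hpos := hne ξ (hsub hξ)
    have h1 : ContinuousAt (fun ζ : E => ⟪ζ, w⟫⁻¹ • ζ) ξ := by
      refine ContinuousAt.smul (ContinuousAt.inv₀ ?_ hpos.ne') continuousAt_id
      exact (continuous_id.inner continuous_const).continuousAt
    have h2 : Tendsto (fun ζ => ‖v‖ / c₁ * ‖⟪ζ, w⟫⁻¹ • ζ - ⟪ξ, w⟫⁻¹ • ξ‖) (𝓝 ξ) (𝓝 0) := by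
      have := (tendsto_iff_norm_sub_tendsto_zero.1 h1.tendsto).const_mul (‖v‖ / c₁)
      rwa [mul_zero] at this
    refine squeeze_zero' (Eventually.of_forall fun _ => norm_nonneg _) ?_ h2
    filter_upwards [directionCone_mem_nhds (half_lt_self hδ₁0) hξ] with ζ hζ
    exact hlip ξ (hsub hξ) ζ hζ

end GaussCone

/-! ### Arguments of complex numbers and distance to integers. -/

section Phase

/-- `G * exp (-∫ g)` is constant, so the quotient of the end values is the exponential of the
integral of `g`, whose imaginary part is at most `C`. -/
theorem exists_polar_quotient {G g : ℝ → ℂ} {C : ℝ}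
    (hG : ∀ s ∈ Icc (0 : ℝ) 1, HasDerivAt G (g s * G s) s) (hg : ContinuousOn g (Icc 0 1))
    (hC : ∀ s ∈ Icc (0 : ℝ) 1, |(g s).im| ≤ C) :
    ∃ r β : ℝ, 0 < r ∧ |β| ≤ C ∧ G 1 = r * Complex.exp (β * Complex.I) * G 0 := by
  -- Extending `g` by its end values makes the integrand continuous on the whole line, so that its
  -- primitive is differentiable at the end points as well.
  let p : ℝ → ℂ := fun s => g (projIcc 0 1 zero_le_one s)
  have hp : Continuous p := hg.comp_continuous
    (continuous_subtype_val.comp continuous_projIcc) fun s => (projIcc 0 1 zero_le_one s).2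
  have hpg : ∀ s ∈ Icc (0 : ℝ) 1, p s = g s := fun s hs => by
    simp [p, projIcc_of_mem zero_le_one hs]
  have hpC : ∀ s, |(p s).im| ≤ C := fun s => hC _ (projIcc 0 1 zero_le_one s).2
  let L : ℝ → ℂ := fun s => ∫ t in (0 : ℝ)..s, p t
  have hL : ∀ s, HasDerivAt L (p s) s := fun s =>
    intervalIntegral.integral_hasDerivAt_right (hp.intervalIntegrable _ _)
      (hp.stronglyMeasurableAtFilter _ _) hp.continuousAt
  have hF : ∀ s ∈ Icc (0 : ℝ) 1, HasDerivAt (fun s => G s * Complex.exp (-L s)) 0 s := by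
    intro s hs
    refine ((hG s hs).mul (hL s).neg.cexp).congr_deriv ?_
    rw [hpg s hs]
    ring
  have hconst := constant_of_has_deriv_right_zero
    (fun s hs => (hF s hs).continuousAt.continuousWithinAt)
    (fun s hs => (hF s (Ico_subset_Icc_self hs)).hasDerivWithinAt) 1 (right_mem_Icc.2 zero_le_one)
  have hL0 : L 0 = 0 := intervalIntegral.integral_same
  simp only [hL0, neg_zero, Complex.exp_zero, mul_one] at hconst
  refine ⟨Real.exp (L 1).re, (L 1).im, Real.exp_pos _, ?_, ?_⟩
  · have h1 : (L 1).im = ∫ t in (0 : ℝ)..1, (p t).im :=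
      (Complex.imCLM.intervalIntegral_comp_comm (hp.intervalIntegrable 0 1)).symm
    rw [h1]
    have := intervalIntegral.norm_integral_le_of_norm_le_const (a := (0 : ℝ)) (b := 1)
      (f := fun t => (p t).im) (C := C) fun t _ => hpC t
    simpa using this
  · rw [← hconst, Complex.ofReal_exp, ← Complex.exp_add, Complex.re_add_im, mul_left_comm,
      ← Complex.exp_add]
    simp

/-- Jordan's inequality for the sine after reduction modulo 1. -/
theorem two_mul_abs_sub_round_le (x : ℝ) : 2 * |x - round x| ≤ |Real.sin (Real.pi * x)| := by
  have h1 : |Real.sin (Real.pi * x)| = |Real.sin (Real.pi * (x - round x))| := by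
    rw [mul_sub, mul_comm Real.pi (round x : ℝ), Real.sin_sub_int_mul_pi, abs_mul]
    rcases Int.even_or_odd (round x) with h | h <;> simp [h.neg_one_zpow]
  rw [h1]
  have h2 := abs_sub_round x
  have h3 : |Real.pi * (x - round x)| ≤ Real.pi / 2 := by
    rw [abs_mul, abs_of_pos Real.pi_pos]
    nlinarith [Real.pi_pos]
  have h4 := Real.mul_abs_le_abs_sin h3
  rw [abs_mul, abs_of_pos Real.pi_pos] at h4
  refine le_trans (le_of_eq ?_) h4
  have := Real.pi_pos.ne'
  field_simp

/-- Two numbers close to the imaginary axis have small cross product, and the cross product contains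
the sine of the angle between them. So that angle, `β - π * F`, is close to a multiple of `π`. -/
theorem exists_int_of_almost_imaginary {z₀ z₁ : ℂ} {r β F ε : ℝ} (hr : 0 < r) (hz : z₀ ≠ 0)
    (h : z₁ = r * Complex.exp ((β - Real.pi * F : ℝ) * Complex.I) * z₀)
    (h₀ : |z₀.re| ≤ ε * ‖z₀‖) (h₁ : |z₁.re| ≤ ε * ‖z₁‖) :
    ∃ m : ℤ, |F - m| ≤ ε + |β| := by
  set γ := β - Real.pi * F with hγ
  have hn₀ : 0 < ‖z₀‖ := norm_pos_iff.2 hz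
  have hn₁ : ‖z₁‖ = r * ‖z₀‖ := by
    rw [h, norm_mul, norm_mul, Complex.norm_exp_ofReal_mul_I, Complex.norm_real, mul_one,
      Real.norm_of_nonneg hr.le]
  have hsin : r * Real.sin γ * ‖z₀‖ ^ 2 = z₀.re * z₁.im - z₀.im * z₁.re := by
    rw [h, Complex.exp_mul_I, ← Complex.ofReal_cos, ← Complex.ofReal_sin, Complex.sq_norm,
      Complex.normSq_apply]
    simp
    rw [Complex.sin_ofReal_re]
    ring
  have hle : r * |Real.sin γ| * ‖z₀‖ ^ 2 ≤ 2 * ε * (r * ‖z₀‖ ^ 2) := by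
    have : r * |Real.sin γ| * ‖z₀‖ ^ 2 = |r * Real.sin γ * ‖z₀‖ ^ 2| := by
      rw [abs_mul, abs_mul, abs_of_pos hr, abs_of_nonneg (sq_nonneg ‖z₀‖)]
    rw [this, hsin]
    calc |z₀.re * z₁.im - z₀.im * z₁.re| ≤ |z₀.re * z₁.im| + |z₀.im * z₁.re| := abs_sub _ _
      _ = |z₀.re| * |z₁.im| + |z₀.im| * |z₁.re| := by rw [abs_mul, abs_mul]
      _ ≤ (ε * ‖z₀‖) * ‖z₁‖ + ‖z₀‖ * (ε * ‖z₁‖) := by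
        have a1 := Complex.abs_im_le_norm z₁
        have a2 := Complex.abs_im_le_norm z₀
        have a3 := (abs_nonneg _).trans h₀
        have a4 := abs_nonneg z₁.re
        gcongr
      _ = 2 * ε * (r * ‖z₀‖ ^ 2) := by rw [hn₁]; ring
  have hs : |Real.sin γ| ≤ 2 * ε := by
    have : 0 < r * ‖z₀‖ ^ 2 := by positivity
    refine le_of_mul_le_mul_right ?_ this
    linarith
  have h2 := two_mul_abs_sub_round_le (γ / Real.pi)
  rw [mul_div_cancel₀ _ Real.pi_pos.ne'] at h2
  refine ⟨-round (γ / Real.pi), ?_⟩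
  have h3 : F - ((-round (γ / Real.pi) : ℤ) : ℝ) = β / Real.pi -
      (γ / Real.pi - round (γ / Real.pi)) := by
    have := Real.pi_pos.ne'
    rw [hγ]
    push_cast
    field_simp
    ring
  rw [h3]
  have h4 : |β / Real.pi| ≤ |β| := by
    rw [abs_div, abs_of_pos Real.pi_pos]
    exact div_le_self (abs_nonneg _) (by linarith [Real.pi_gt_three])
  calc _ ≤ |β / Real.pi| + |γ / Real.pi - round (γ / Real.pi)| := abs_sub _ _
    _ ≤ |β| + ε := add_le_add h4 (by linarith)
    _ = _ := add_comm _ _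

end Phase

/-! ### Localised Fourier transforms and the drift of their argument. -/

section Transform

variable {E : Type} [NormedAddCommGroup E] [InnerProductSpace ℝ E] [FiniteDimensional ℝ E]
  [MeasurableSpace E] [BorelSpace E]

/-- The Fourier transform of the restriction of `f` to `Ω`. -/
def cutTransform (Ω : Set E) (f : E → ℝ) (ξ : E) : ℂ :=
  ∫ x in Ω, (f x : ℂ) * Complex.exp (-(2 * Real.pi * Complex.I * (⟪ξ, x⟫ : ℝ)))

theorem fourier_indicator_eq_cutTransform {Ω : Set E} (hΩ : MeasurableSet Ω) (ξ : E) :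
    𝓕 (Ω.indicator fun _ => (1 : ℂ)) ξ = cutTransform Ω (fun _ => 1) ξ := by
  rw [Real.fourier_eq', cutTransform, ← integral_indicator hΩ]
  refine integral_congr_ae (Eventually.of_forall fun x => ?_)
  by_cases hx : x ∈ Ω
  · simp only [indicator_of_mem hx, smul_eq_mul, mul_one, Complex.ofReal_one, one_mul]
    rw [real_inner_comm]
    congr 1
    push_cast
    ring
  · simp [indicator_of_notMem hx]

theorem continuous_cutIntegrand {f : E → ℝ} (hf : Continuous f) : Continuous fun q : E × E =>
    (f q.2 : ℂ) * Complex.exp (-(2 * Real.pi * Complex.I * (⟪q.1, q.2⟫ : ℝ))) := by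
  have h1 : Continuous fun q : E × E => ((⟪q.1, q.2⟫ : ℝ) : ℂ) :=
    Complex.continuous_ofReal.comp (continuous_fst.inner continuous_snd)
  exact (Complex.continuous_ofReal.comp (hf.comp continuous_snd)).mul
    (continuous_const.mul h1).neg.cexp

theorem integrableOn_cutIntegrand {Ω : Set E} (hΩ : IsCompact Ω) {f : E → ℝ} (hf : Continuous f)
    (ξ : E) : IntegrableOn (fun x => (f x : ℂ) *
      Complex.exp (-(2 * Real.pi * Complex.I * (⟪ξ, x⟫ : ℝ)))) Ω :=
  ((continuous_cutIntegrand hf).comp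
    (by fun_prop : Continuous fun x : E => (ξ, x))).continuousOn.integrableOn_compact hΩ

theorem continuous_cutTransform {Ω : Set E} (hΩ : IsCompact Ω) {f : E → ℝ} (hf : Continuous f) :
    Continuous (cutTransform Ω f) := by
  have : IsFiniteMeasure (volume.restrict Ω) := ⟨by simpa using hΩ.measure_lt_top⟩
  obtain ⟨C, hC⟩ := hΩ.exists_bound_of_continuousOn hf.continuousOn
  refine continuous_of_dominated (bound := fun _ => C) (fun ξ => ?_) (fun ξ => ?_) ?_ ?_
  · exact ((continuous_cutIntegrand hf).comp
      (by fun_prop : Continuous fun x : E => (ξ, x))).aestronglyMeasurable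
  · filter_upwards [ae_restrict_mem hΩ.measurableSet] with x hx
    have : ‖Complex.exp (-(2 * Real.pi * Complex.I * (⟪ξ, x⟫ : ℝ)))‖ = 1 := by
      rw [Complex.norm_exp]; simp
    rw [norm_mul, this, mul_one, Complex.norm_real]
    exact hC x hx
  · exact integrable_const _
  · refine Eventually.of_forall fun x => ?_
    exact (continuous_cutIntegrand hf).comp (by fun_prop : Continuous fun ξ : E => (ξ, x))

theorem cutTransform_add {Ω : Set E} (hΩ : IsCompact Ω) {f g : E → ℝ} (hf : Continuous f)
    (hg : Continuous g) (ξ : E) :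
    cutTransform Ω (fun x => f x + g x) ξ = cutTransform Ω f ξ + cutTransform Ω g ξ := by
  simp only [cutTransform]
  rw [← integral_add (integrableOn_cutIntegrand hΩ hf ξ) (integrableOn_cutIntegrand hΩ hg ξ)]
  refine integral_congr_ae (Eventually.of_forall fun x => ?_)
  push_cast
  ring

/-- The substitution `x ↦ 2 • c - x` preserves `Ω` and the measure and conjugates the exponential up
to the phase of the centre; `f` is real. -/
theorem cutTransform_reflect {Ω : Set E} {c : E} (hsym : ∀ y ∈ Ω, (2 : ℝ) • c - y ∈ Ω)
    (f : E → ℝ) (ξ : E) : cutTransform Ω (fun x => f ((2 : ℝ) • c - x)) ξ =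
      Complex.exp (-(2 * Real.pi * Complex.I * (2 * ⟪ξ, c⟫ : ℝ))) *
        (starRingEnd ℂ) (cutTransform Ω f ξ) := by
  have hpre : (fun x : E => (2 : ℝ) • c - x) ⁻¹' Ω = Ω := by
    ext x
    refine ⟨fun h => by simpa using hsym _ h, fun h => hsym x h⟩
  have hmp := (Measure.measurePreserving_sub_left (volume : Measure E) ((2 : ℝ) • c))
  have h1 := hmp.setIntegral_preimage_emb (MeasurableEquiv.subLeft ((2 : ℝ) • c)).measurableEmbedding
    (fun x => (f ((2 : ℝ) • c - x) : ℂ) * Complex.exp (-(2 * Real.pi * Complex.I * (⟪ξ, x⟫ : ℝ)))) Ω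
  rw [hpre] at h1
  rw [cutTransform, ← h1, cutTransform, ← integral_conj, ← integral_const_mul]
  refine integral_congr_ae (Eventually.of_forall fun x => ?_)
  simp only [sub_sub_cancel, map_mul, Complex.conj_ofReal, ← Complex.exp_conj]
  rw [mul_left_comm, ← Complex.exp_add]
  congr 2
  simp [inner_sub_right, inner_smul_right, Complex.conj_ofNat]
  ring

theorem cutTransform_smul_eq (Ω : Set E) (ν : E → E) (f : E → ℝ) {k : E → ℝ} {y : E}
    (hk : k y = 1) (l : ℝ) :
    oscIntegral Ω ν (fun p => k p.1 * f p.2) y l =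
      Complex.exp (2 * Real.pi * Complex.I * (⟪l • ν y, y⟫ : ℝ)) * cutTransform Ω f (l • ν y) := by
  rw [oscIntegral, cutTransform, ← integral_const_mul]
  refine integral_congr_ae (Eventually.of_forall fun x => ?_)
  simp only [hk, one_mul]
  rw [mul_left_comm, ← Complex.exp_add]
  congr 2
  simp [inner_sub_right, real_inner_smul_left]
  ring

theorem norm_exp_two_pi_I_mul (t : ℝ) :
    ‖Complex.exp (2 * Real.pi * Complex.I * (t : ℝ))‖ = 1 := by
  rw [Complex.norm_exp]; simp

theorem norm_cutTransform_smul_eq (Ω : Set E) (ν : E → E) (f : E → ℝ) {k : E → ℝ} {y : E}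
    (hk : k y = 1) (l : ℝ) :
    ‖cutTransform Ω f (l • ν y)‖ = ‖oscIntegral Ω ν (fun p => k p.1 * f p.2) y l‖ := by
  rw [cutTransform_smul_eq Ω ν f hk, norm_mul, norm_exp_two_pi_I_mul, one_mul]

theorem hasDerivAt_cutTransform {Ω : Set E} (hΩ : IsCompact Ω) {f : E → ℝ} (hf : Continuous f)
    (ξ η : E) (s : ℝ) : HasDerivAt (fun s : ℝ => cutTransform Ω f (ξ + s • η))
      (-(2 * Real.pi * Complex.I) * cutTransform Ω (fun x => f x * ⟪η, x⟫) (ξ + s • η)) s := by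
  have hfη : Continuous fun x => f x * ⟪η, x⟫ := hf.mul (continuous_const.inner continuous_id)
  have : IsFiniteMeasure (volume.restrict Ω) := ⟨by simpa using hΩ.measure_lt_top⟩
  obtain ⟨C, hC⟩ := hΩ.exists_bound_of_continuousOn hfη.continuousOn
  have key := hasDerivAt_integral_of_dominated_loc_of_deriv_le (μ := volume.restrict Ω)
    (F := fun (s : ℝ) x => (f x : ℂ) *
      Complex.exp (-(2 * Real.pi * Complex.I * (⟪ξ + s • η, x⟫ : ℝ))))
    (F' := fun (s : ℝ) x => -(2 * Real.pi * Complex.I) * (((f x * ⟪η, x⟫ : ℝ) : ℂ) *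
      Complex.exp (-(2 * Real.pi * Complex.I * (⟪ξ + s • η, x⟫ : ℝ)))))
    (x₀ := s) (s := univ) (bound := fun _ => 2 * Real.pi * C) univ_mem
    (Eventually.of_forall fun t => (integrableOn_cutIntegrand hΩ hf _).aestronglyMeasurable)
    (integrableOn_cutIntegrand hΩ hf _)
    ((integrableOn_cutIntegrand hΩ hfη _).aestronglyMeasurable.const_mul _) ?_
    (integrable_const _) ?_
  · have h2 := key.2
    rw [integral_const_mul] at h2
    exact h2
  · filter_upwards [ae_restrict_mem hΩ.measurableSet] with x hx t _
    have h1 : ‖Complex.exp (-(2 * Real.pi * Complex.I * (⟪ξ + t • η, x⟫ : ℝ)))‖ = 1 := by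
      rw [Complex.norm_exp]; simp
    rw [norm_mul, norm_mul, h1, mul_one, Complex.norm_real, norm_neg]
    have h2 : ‖(2 * Real.pi * Complex.I : ℂ)‖ = 2 * Real.pi := by
      simp [abs_of_pos Real.pi_pos]
    rw [h2]
    have := hC x hx
    have := Real.pi_pos
    gcongr
  · refine Eventually.of_forall fun x t _ => ?_
    have h1 : HasDerivAt (fun s : ℝ => (⟪ξ + s • η, x⟫ : ℝ)) ⟪η, x⟫ t := by
      have : HasDerivAt (fun s : ℝ => ⟪ξ, x⟫ + s * ⟪η, x⟫) (1 * ⟪η, x⟫) t :=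
        ((hasDerivAt_id t).mul_const _).const_add _
      simpa [inner_add_left, real_inner_smul_left] using this
    have h2 := ((h1.ofReal_comp.const_mul (2 * Real.pi * Complex.I : ℂ)).neg.cexp).const_mul
      (f x : ℂ)
    refine h2.congr_deriv ?_
    simp only [Pi.neg_apply]
    push_cast
    ring

/-- Multiplied by the phase of the support function, the transform of `φ` is the oscillatory
integral based at the support point. As the gradient of the support function is `s`, its derivative
along `η` is `2πi` times the integral with amplitude `φ x * ⟪η, y - x⟫`, which vanishes on the
diagonal. The imaginary part of the logarithmic derivative is therefore the real part of a quotient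
that is `O(L ^ (-2))`. -/
theorem HasStationaryGain.exists_phase_bound {Ω : Set E} {ν : E → E} {φ : E → ℝ} {A B Y₀ Y : Set E}
    (h : HasStationaryGain Ω ν φ A B Y₀ Y) {l₀ : ℝ} (hl₀ : 1 ≤ l₀)
    (hJ : ∀ y ∈ Y, ∀ l : ℝ, l₀ ≤ l → oscIntegral Ω ν (fun p => φ p.2) y l ≠ 0)
    (hcomp : ∀ a, IsAmplitude A B a → ∃ C, 0 ≤ C ∧ ∀ y ∈ Y, ∀ l : ℝ, l₀ ≤ l →
        ‖oscIntegral Ω ν a y l‖ ≤ C * ‖oscIntegral Ω ν (fun p => φ p.2) y l‖) :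
    ∃ C, 0 ≤ C ∧ ∀ s : E → E, IsSupportSelection Ω s → ∀ (ξ η : E) (L : ℝ), 0 < L →
      (∀ t ∈ Icc (0 : ℝ) 1, ContinuousAt s (ξ + t • η) ∧ s (ξ + t • η) ∈ Y ∧
        ∃ l, l₀ ≤ l ∧ L ≤ l ∧ ξ + t • η = l • ν (s (ξ + t • η))) →
      ∃ r β : ℝ, 0 < r ∧ |β| ≤ C * ‖η‖ / L ^ 2 ∧
        Complex.exp (2 * Real.pi * Complex.I * (⟪ξ + η, s (ξ + η)⟫ : ℝ)) *
          cutTransform Ω φ (ξ + η) = r * Complex.exp (β * Complex.I) *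
        (Complex.exp (2 * Real.pi * Complex.I * (⟪ξ, s ξ⟫ : ℝ)) * cutTransform Ω φ ξ) := by
  obtain ⟨χ, hχ, hχc, hχs, hχ1, -⟩ := exists_contDiff_cutoff h.isCompact_param h.isOpen_left
    h.param_subset
  let b := stdOrthonormalBasis ℝ E
  -- The amplitude `⟪η, y - x⟫` depends on `η`; expanding it in an orthonormal basis leaves finitely
  -- many amplitudes, so the constants are uniform in `η`.
  let a : Fin (Module.finrank ℝ E) → E × E → ℝ := fun i p =>
    χ p.1 * φ p.2 * ⟪b i, p.1 - p.2⟫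
  have ha : ∀ i, IsAmplitude A B (a i) := by
    intro i
    have hprod : HasCompactSupport fun p : E × E => χ p.1 * φ p.2 := by
      refine HasCompactSupport.intro (hχc.isCompact.prod h.hasCompactSupport_cutoff.isCompact)
        fun p hp => ?_
      by_cases h1 : p.1 ∈ tsupport χ
      · rw [image_eq_zero_of_notMem_tsupport (f := φ) fun h2 => hp ⟨h1, h2⟩, mul_zero]
      · rw [image_eq_zero_of_notMem_tsupport h1, zero_mul]
    refine ⟨?_, hprod.mul_right, ?_⟩
    · exact ((hχ.comp contDiff_fst).mul (h.contDiff_cutoff.comp contDiff_snd)).mul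
        (contDiff_const.inner ℝ (contDiff_fst.sub contDiff_snd))
    · have : tsupport (a i) ⊆ tsupport χ ×ˢ tsupport φ := by
        refine closure_minimal (fun p hp => ?_)
          ((isClosed_tsupport χ).prod (isClosed_tsupport φ))
        have hp' : χ p.1 * φ p.2 * ⟪b i, p.1 - p.2⟫ ≠ 0 := hp
        exact ⟨subset_tsupport _ (left_ne_zero_of_mul (left_ne_zero_of_mul hp')),
          subset_tsupport _ (right_ne_zero_of_mul (left_ne_zero_of_mul hp'))⟩
      exact this.trans (prod_mono hχs h.tsupport_cutoff)
  have hre := fun i => h.exists_abs_re_div_le hl₀ hJ hcomp (ha i) fun y => by simp [a]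
  choose D hD0 hD using hre
  refine ⟨2 * Real.pi * ∑ i, D i, mul_nonneg (by positivity)
    (Finset.sum_nonneg fun i _ => hD0 i), ?_⟩
  intro s hs ξ η L hL hseg
  let T := cutTransform Ω φ
  let G : ℝ → ℂ := fun t => Complex.exp (2 * Real.pi * Complex.I *
    (⟪ξ + t • η, s (ξ + t • η)⟫ : ℝ)) * T (ξ + t • η)
  have hφ := h.contDiff_cutoff.continuous
  have hφη : Continuous fun x => φ x * ⟪η, x⟫ := hφ.mul (continuous_const.inner continuous_id)
  let K : ℝ → ℂ := fun t => (⟪η, s (ξ + t • η)⟫ : ℝ) * G t -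
    Complex.exp (2 * Real.pi * Complex.I * (⟪ξ + t • η, s (ξ + t • η)⟫ : ℝ)) *
      cutTransform Ω (fun x => φ x * ⟪η, x⟫) (ξ + t • η)
  have hpath : ∀ t : ℝ, HasDerivAt (fun t : ℝ => ξ + t • η) η t := fun t => by
    simpa using ((hasDerivAt_id t).smul_const η).const_add ξ
  have hGd : ∀ t ∈ Icc (0 : ℝ) 1, HasDerivAt G (2 * Real.pi * Complex.I * K t) t := by
    intro t ht
    have h1 : HasDerivAt (fun t : ℝ => (⟪ξ + t • η, s (ξ + t • η)⟫ : ℝ))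
        ⟪η, s (ξ + t • η)⟫ t := by
      have := (hs.hasFDerivAt (hseg t ht).1).comp_hasDerivAt t (hpath t)
      simpa [real_inner_comm] using! this
    refine (((h1.ofReal_comp.const_mul (2 * Real.pi * Complex.I : ℂ)).cexp).mul
      (hasDerivAt_cutTransform h.isCompact hφ ξ η t)).congr_deriv ?_
    simp only [K, G, T]
    ring
  have hGosc : ∀ t ∈ Icc (0 : ℝ) 1, ∀ l : ℝ, ξ + t • η = l • ν (s (ξ + t • η)) →
      G t = oscIntegral Ω ν (fun p => φ p.2) (s (ξ + t • η)) l ∧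
      K t = ∑ i, (⟪b i, η⟫ : ℝ) * oscIntegral Ω ν (a i) (s (ξ + t • η)) l := by
    intro t ht l hl
    set y := s (ξ + t • η) with hy
    have hχy : χ y = 1 := hχ1 y (h.subset_param (hseg t ht).2.1)
    have e1 : G t = oscIntegral Ω ν (fun p => φ p.2) y l := by
      have := cutTransform_smul_eq Ω ν φ (k := fun _ => 1) (y := y) rfl l
      simp only [one_mul] at this
      simp only [G, T, ← hy]
      rw [this, ← hl]
    refine ⟨e1, ?_⟩
    have e2 := cutTransform_smul_eq Ω ν (fun x => φ x * ⟪η, x⟫) (k := fun _ => 1) (y := y) rfl l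
    simp only [K, ← hy]
    rw [e1, hl, ← e2, ← oscIntegral_const_mul Ω ν (fun y => ⟪η, y⟫) (fun p => φ p.2),
      ← oscIntegral_sub h.isCompact
        (a := fun p => ⟪η, p.1⟫ * φ p.2) (b := fun p => 1 * (φ p.2 * ⟪η, p.2⟫))
        (by simpa using! continuous_const.mul hφ) (by simpa using! hφη)]
    have e3 : ∀ i, ((⟪b i, η⟫ : ℝ) : ℂ) * oscIntegral Ω ν (a i) y l =
        ∫ x in Ω, ((⟪b i, η⟫ * a i (y, x) : ℝ) : ℂ) *
          Complex.exp (2 * Real.pi * Complex.I * l * (⟪ν y, y - x⟫ : ℝ)) := fun i => by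
      rw [oscIntegral, ← integral_const_mul]
      refine integral_congr_ae (Eventually.of_forall fun x => ?_)
      push_cast
      ring
    simp only [e3]
    rw [← integral_finsetSum, oscIntegral]
    · refine integral_congr_ae (Eventually.of_forall fun x => ?_)
      simp only
      rw [← Finset.sum_mul, ← Complex.ofReal_sum]
      congr 2
      have e4 := b.sum_inner_mul_inner η (y - x)
      simp only [a, hχy]
      rw [inner_sub_right] at e4
      calc ⟪η, y⟫ * φ x - 1 * (φ x * ⟪η, x⟫) = φ x * (⟪η, y⟫ - ⟪η, x⟫) := by ring
        _ = ∑ i, ⟪b i, η⟫ * (1 * φ x * ⟪b i, y - x⟫) := by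
          rw [← e4, Finset.mul_sum]
          refine Finset.sum_congr rfl fun i _ => ?_
          rw [real_inner_comm (b i) η]
          ring
    · intro i _
      have hc : Continuous fun x => ⟪b i, η⟫ * a i (y, x) :=
        continuous_const.mul (continuous_slice (ha i) y)
      exact integrableOn_oscIntegrand (ν := ν) (a := fun p => ⟪b i, η⟫ * a i p) (y := y)
        h.isCompact hc l
  have hG0 : ∀ t ∈ Icc (0 : ℝ) 1, G t ≠ 0 := by
    intro t ht
    obtain ⟨-, hY, l, hl, -, he⟩ := hseg t ht
    rw [(hGosc t ht l he).1]
    exact hJ _ hY l hl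
  have hpc : Continuous fun t : ℝ => ξ + t • η := by fun_prop
  have hGc : ContinuousOn G (Icc 0 1) := fun t ht =>
    (hGd t ht).continuousAt.continuousWithinAt
  have hsc : ContinuousOn (fun t : ℝ => s (ξ + t • η)) (Icc 0 1) := fun t ht =>
    (ContinuousAt.comp (f := fun t : ℝ => ξ + t • η) (hseg t ht).1
      hpc.continuousAt).continuousWithinAt
  have hKc : ContinuousOn K (Icc 0 1) := by
    have h1 : ContinuousOn (fun t : ℝ => ((⟪η, s (ξ + t • η)⟫ : ℝ) : ℂ)) (Icc 0 1) :=
      Complex.continuous_ofReal.comp_continuousOn (continuousOn_const.inner hsc)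
    have h2 : ContinuousOn (fun t : ℝ => ((⟪ξ + t • η, s (ξ + t • η)⟫ : ℝ) : ℂ)) (Icc 0 1) :=
      Complex.continuous_ofReal.comp_continuousOn (hpc.continuousOn.inner hsc)
    exact (h1.mul hGc).sub ((continuousOn_const.mul h2).cexp.mul
      ((continuous_cutTransform h.isCompact hφη).comp hpc).continuousOn)
  obtain ⟨r, β, hr, hβ, hE⟩ := exists_polar_quotient (G := G)
    (g := fun t => 2 * Real.pi * Complex.I * (K t / G t))
    (C := 2 * Real.pi * (∑ i, D i) * ‖η‖ / L ^ 2)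
    (fun t ht => (hGd t ht).congr_deriv (by
      have := hG0 t ht
      field_simp)) (continuousOn_const.mul (hKc.div hGc hG0)) (by
    intro t ht
    obtain ⟨-, hY, l, hl, hLl, he⟩ := hseg t ht
    have h1 : (2 * Real.pi * Complex.I * (K t / G t)).im = 2 * Real.pi * (K t / G t).re := by
      simp [Complex.mul_im]
    rw [h1, abs_mul, abs_of_pos (by positivity : 0 < 2 * Real.pi), (hGosc t ht l he).1,
      (hGosc t ht l he).2, Finset.sum_div, Complex.re_sum, mul_assoc (2 * Real.pi),
      mul_div_assoc (2 * Real.pi)]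
    have h2 : |∑ i, ((⟪b i, η⟫ : ℝ) * oscIntegral Ω ν (a i) (s (ξ + t • η)) l /
        oscIntegral Ω ν (fun p => φ p.2) (s (ξ + t • η)) l : ℂ).re| ≤
        ∑ i, ‖η‖ * (D i / L ^ 2) := by
      refine (Finset.abs_sum_le_sum_abs _ _).trans (Finset.sum_le_sum fun i _ => ?_)
      rw [mul_div_assoc, Complex.re_ofReal_mul, abs_mul]
      have h3 := hD i _ hY l hl
      have h4 : |⟪b i, η⟫| ≤ ‖η‖ := by
        have := abs_real_inner_le_norm (b i) η
        simpa using this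
      have h5 : D i / l ^ 2 ≤ D i / L ^ 2 := by
        have := hD0 i
        gcongr
      exact mul_le_mul h4 (h3.trans h5) (abs_nonneg _) (norm_nonneg _)
    refine mul_le_mul_of_nonneg_left (h2.trans (le_of_eq ?_)) (by positivity)
    rw [Finset.sum_mul, Finset.sum_div]
    exact Finset.sum_congr rfl fun i _ => by ring)
  refine ⟨r, β, hr, hβ, ?_⟩
  simpa [G, T] using hE

end Transform

/-! ### From pairs of zeros to the integrality condition. -/

section Assembly

variable {E : Type} [NormedAddCommGroup E] [InnerProductSpace ℝ E] [FiniteDimensional ℝ E]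
  [MeasurableSpace E] [BorelSpace E]

/-- If `ξ` and `ξ + η` are zeros of the Fourier transform of `Ω`, then twice the increment of the
support function with respect to the centre `c` is within `O(|ξ| ^ (-p))` of an integer. -/
def HasPhaseBound (Ω : Set E) (s : E → E) (w : E) (δ : ℝ) (c : E) (p : ℝ) : Prop :=
  ∀ c₂ : ℝ, ∃ C T : ℝ, 0 ≤ C ∧ ∀ ξ η : E, ‖η‖ ≤ c₂ → T ≤ ⟪ξ, w⟫ → ξ ∈ directionCone w δ →
    ξ + η ∈ directionCone w δ → cutTransform Ω (fun _ => 1) ξ = 0 →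
    cutTransform Ω (fun _ => 1) (ξ + η) = 0 →
    ∃ m : ℤ, |2 * (⟪ξ + η, s (ξ + η)⟫ - ⟪ξ, s ξ⟫ - ⟪η, c⟫) - m| ≤ C * ⟪ξ, w⟫ ^ (-p)

/-- Recentred at `c`, the pieces at the two antipodal points are complex conjugates, so they sum to
twice a real part, and at a zero this must cancel the remainder. -/
theorem abs_re_le_of_cutTransform_eq_zero {Ω : Set E} (hΩ : IsCompact Ω) {c : E}
    (hsym : ∀ y ∈ Ω, (2 : ℝ) • c - y ∈ Ω) {φ : E → ℝ} (hφ : Continuous φ) {ξ : E}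
    (h : cutTransform Ω (fun _ => 1) ξ = 0) :
    2 * |(Complex.exp (2 * Real.pi * Complex.I * (⟪ξ, c⟫ : ℝ)) * cutTransform Ω φ ξ).re| ≤
      ‖cutTransform Ω (fun x => 1 - φ x - φ ((2 : ℝ) • c - x)) ξ‖ := by
  set f : E → ℝ := fun x => 1 - φ x - φ ((2 : ℝ) • c - x)
  have hr : Continuous fun x : E => φ ((2 : ℝ) • c - x) := hφ.comp (by fun_prop)
  have hf : Continuous f := (continuous_const.sub hφ).sub hr
  have hrf : Continuous fun x : E => φ ((2 : ℝ) • c - x) + f x := hr.add hf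
  set u := Complex.exp (2 * Real.pi * Complex.I * (⟪ξ, c⟫ : ℝ)) with hu
  have hu1 : ‖u‖ = 1 := norm_exp_two_pi_I_mul _
  have h1 : cutTransform Ω φ ξ + (Complex.exp (-(2 * Real.pi * Complex.I * (2 * ⟪ξ, c⟫ : ℝ))) *
      (starRingEnd ℂ) (cutTransform Ω φ ξ) + cutTransform Ω f ξ) = 0 := by
    rw [← cutTransform_reflect hsym, ← cutTransform_add hΩ hr hf,
      ← cutTransform_add hΩ hφ hrf, ← h]
    congr 1
    funext x
    simp only [f]
    ring
  have h2 : u * Complex.exp (-(2 * Real.pi * Complex.I * (2 * ⟪ξ, c⟫ : ℝ))) =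
      (starRingEnd ℂ) u := by
    rw [hu, ← Complex.exp_conj, ← Complex.exp_add]
    congr 1
    simp [Complex.conj_ofNat]
    ring
  have h3 : u * cutTransform Ω φ ξ + (starRingEnd ℂ) (u * cutTransform Ω φ ξ) =
      -(u * cutTransform Ω f ξ) := by
    rw [map_mul, ← h2]
    linear_combination u * h1
  rw [Complex.add_conj] at h3
  have h4 := congrArg norm h3
  rw [norm_neg, norm_mul, hu1, one_mul, Complex.norm_real, Real.norm_eq_abs, abs_mul,
    abs_two] at h4
  exact h4.le

/-- At both zeros the recentred transform of `φ` is imaginary up to relative error `O(t ^ (-p))`.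
Recentring subtracts the phase of the support function, so the quotient of the two values has
argument `β` minus `π` times the phase increment, where `β = O(t ^ (-2))` is absorbed because `p ≤
2`. -/
theorem HasStationaryGain.hasPhaseBound {Ω : Set E} {ν : E → E} {φ : E → ℝ} {A B Y₀ Y : Set E}
    (h : HasStationaryGain Ω ν φ A B Y₀ Y) {l₀ : ℝ} (hl₀ : 1 ≤ l₀)
    (hJ : ∀ y ∈ Y, ∀ l : ℝ, l₀ ≤ l → oscIntegral Ω ν (fun p => φ p.2) y l ≠ 0)
    (hcomp : ∀ a, IsAmplitude A B a → ∃ C, 0 ≤ C ∧ ∀ y ∈ Y, ∀ l : ℝ, l₀ ≤ l →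
        ‖oscIntegral Ω ν a y l‖ ≤ C * ‖oscIntegral Ω ν (fun p => φ p.2) y l‖)
    {c : E} (hsym : ∀ y ∈ Ω, (2 : ℝ) • c - y ∈ Ω) {s : E → E} {w : E} {δ c₁ C₁ : ℝ}
    (hg : IsGaussCone Ω ν s w δ c₁ C₁) (hsY : ∀ ξ ∈ directionCone w δ, s ξ ∈ Y) {p D T : ℝ}
    (hp0 : 0 ≤ p) (hp2 : p ≤ 2) (hD : 0 ≤ D)
    (hrem : ∀ ξ ∈ directionCone w δ, T ≤ ⟪ξ, w⟫ →
      ‖cutTransform Ω (fun x => 1 - φ x - φ ((2 : ℝ) • c - x)) ξ‖ ≤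
        D * ⟪ξ, w⟫ ^ (-p) * ‖cutTransform Ω φ ξ‖) :
    HasPhaseBound Ω s w δ c p := by
  intro c₂
  obtain ⟨C, hC, hph⟩ := h.exists_phase_bound hl₀ hJ hcomp
  have hC₁ := hg.C_pos
  have hc₂0 : 0 ≤ |c₂| := abs_nonneg _
  -- Beyond this threshold the segment from `ξ` to `ξ + η` has `w`-component at least `t / 2 ≥ T`,
  -- and all multipliers on it are at least `t / (2 * C₁) ≥ l₀`.
  refine ⟨D * 2 ^ p + C * |c₂| * (2 * C₁) ^ 2, 2 * |T| + 2 * |c₂| + 2 * C₁ * l₀ + 1,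
    by positivity, ?_⟩
  intro ξ η hη hT hξ hξη hz hz'
  replace hη : ‖η‖ ≤ |c₂| := hη.trans (le_abs_self _)
  set t := ⟪ξ, w⟫ with ht
  have hT0 := abs_nonneg T
  have hCl : 0 < C₁ * l₀ := by positivity
  have ht1 : 1 ≤ t := by linarith
  have hseg : ∀ r ∈ Icc (0 : ℝ) 1, ξ + r • η ∈ directionCone w δ ∧ t / 2 ≤ ⟪ξ + r • η, w⟫ := by
    intro r hr
    constructor
    · have := convex_directionCone w δ hξ hξη (sub_nonneg.2 hr.2) hr.1 (by ring)
      convert this using 1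
      module
    · rw [inner_add_left, real_inner_smul_left]
      have h1 : |⟪η, w⟫| ≤ |c₂| := by
        have := abs_real_inner_le_norm η w
        rw [hg.norm_eq, mul_one] at this
        exact this.trans hη
      have h2 : |r * ⟪η, w⟫| ≤ |c₂| := by
        rw [abs_mul, abs_of_nonneg hr.1]
        exact (mul_le_of_le_one_left (abs_nonneg _) hr.2).trans h1
      have h3 := (abs_le.1 h2).1
      linarith
  have hL : 0 < t / (2 * C₁) := by positivity
  obtain ⟨r, β, hr, hβ, hE⟩ := hph s hg.selection ξ η (t / (2 * C₁)) hL (by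
    intro r hr
    obtain ⟨h1, h2⟩ := hseg r hr
    obtain ⟨l, hl, he, hle, -⟩ := hg.multiplier _ h1
    have h3 : t / (2 * C₁) ≤ l := by
      rw [div_le_iff₀ (by positivity)]
      linarith
    refine ⟨hg.continuousAt _ h1, hsY _ h1, l, le_trans ?_ h3, h3, he⟩
    rw [le_div_iff₀ (by positivity)]
    linarith)
  have hφ := h.contDiff_cutoff.continuous
  have hTξ : cutTransform Ω φ ξ ≠ 0 := by
    obtain ⟨l, hl, he, hle, -⟩ := hg.multiplier _ hξ
    have h3 : l₀ ≤ l := by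
      have : C₁ * l₀ ≤ C₁ * l := by linarith
      exact le_of_mul_le_mul_left this hC₁
    have h4 := hJ _ (hsY _ hξ) l h3
    have h5 := norm_cutTransform_smul_eq Ω ν φ (k := fun _ => 1) (y := s ξ) rfl l
    rw [← he] at h5
    simp only [one_mul] at h5
    rw [← norm_ne_zero_iff, h5]
    exact norm_ne_zero_iff.2 h4
  have hζ : ∀ ζ ∈ directionCone w δ, t / 2 ≤ ⟪ζ, w⟫ → cutTransform Ω (fun _ => 1) ζ = 0 →
      |(Complex.exp (2 * Real.pi * Complex.I * (⟪ζ, c⟫ : ℝ)) * cutTransform Ω φ ζ).re| ≤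
      (D * 2 ^ p * t ^ (-p)) *
        ‖Complex.exp (2 * Real.pi * Complex.I * (⟪ζ, c⟫ : ℝ)) * cutTransform Ω φ ζ‖ := by
    intro ζ h1 h2 h3
    have h4 := abs_re_le_of_cutTransform_eq_zero h.isCompact hsym hφ h3
    have h5 := hrem ζ h1 (by linarith [le_abs_self T])
    rw [norm_mul, norm_exp_two_pi_I_mul, one_mul]
    have h6 : ⟪ζ, w⟫ ^ (-p) ≤ 2 ^ p * t ^ (-p) := by
      calc ⟪ζ, w⟫ ^ (-p) ≤ (t / 2) ^ (-p) :=
            Real.rpow_le_rpow_of_nonpos (by positivity) h2 (by linarith)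
        _ = 2 ^ p * t ^ (-p) := by
            rw [Real.div_rpow (by positivity) (by norm_num), Real.rpow_neg (by norm_num : (0:ℝ) ≤ 2),
              div_inv_eq_mul, mul_comm]
    have h7 : D * ⟪ζ, w⟫ ^ (-p) * ‖cutTransform Ω φ ζ‖ ≤
        D * (2 ^ p * t ^ (-p)) * ‖cutTransform Ω φ ζ‖ := by gcongr
    have h8 := abs_nonneg (Complex.exp (2 * Real.pi * Complex.I * (⟪ζ, c⟫ : ℝ)) *
      cutTransform Ω φ ζ).re
    rw [mul_assoc D]
    linarith
  have h0 := hζ ξ hξ (by linarith) hz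
  have h1 := hζ (ξ + η) hξη (by simpa using (hseg 1 ⟨zero_le_one, le_rfl⟩).2) hz'
  obtain ⟨m, hm⟩ := exists_int_of_almost_imaginary (r := r) (β := β)
    (F := 2 * (⟪ξ + η, s (ξ + η)⟫ - ⟪ξ, s ξ⟫ - ⟪η, c⟫)) hr
    (mul_ne_zero (Complex.exp_ne_zero _) hTξ) (by
      have e1 : cutTransform Ω φ (ξ + η) = Complex.exp (-(2 * Real.pi * Complex.I *
          (⟪ξ + η, s (ξ + η)⟫ : ℝ))) * (r * Complex.exp (β * Complex.I) *
          (Complex.exp (2 * Real.pi * Complex.I * (⟪ξ, s ξ⟫ : ℝ)) * cutTransform Ω φ ξ)) := by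
        rw [← hE, ← mul_assoc, ← Complex.exp_add]
        simp
      rw [e1]
      have e2 : ∀ a b c d e f g r X : ℂ, a + (-b + (c + d)) = e + f → Complex.exp a *
          (Complex.exp (-b) * (r * Complex.exp c * (Complex.exp d * X))) =
          r * Complex.exp e * (Complex.exp f * X) := by
        intro a b c d e f g r X hh
        have : Complex.exp a * (Complex.exp (-b) * (Complex.exp c * Complex.exp d)) =
            Complex.exp e * Complex.exp f := by
          rw [← Complex.exp_add, ← Complex.exp_add, ← Complex.exp_add, ← Complex.exp_add, hh]
        linear_combination r * X * this
      refine e2 _ _ _ _ _ _ 0 _ _ ?_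
      rw [inner_add_left (x := ξ) (y := η) (z := c)]
      push_cast
      ring) h0 h1
  refine ⟨m, hm.trans ?_⟩
  have h2 : |β| ≤ C * |c₂| * (2 * C₁) ^ 2 * t ^ (-p) := by
    refine hβ.trans ?_
    have e1 : C * ‖η‖ / (t / (2 * C₁)) ^ 2 = C * ‖η‖ * (2 * C₁) ^ 2 * t ^ (-2 : ℝ) := by
      rw [Real.rpow_neg (by linarith), Real.rpow_two]
      field_simp
    have e2 : t ^ (-2 : ℝ) ≤ t ^ (-p) := Real.rpow_le_rpow_of_exponent_le ht1 (by linarith)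
    rw [e1]
    gcongr
  linarith [h2]

/-- Contracting an inner ball of `Ω` towards `y` by a factor of order `1 / l` yields a ball in `Ω`
at distance `O(1 / l)` from `y`, on which the exponent is bounded. Its volume has order `l ^ (-n)`;
this crude rate is enough for the bootstrap. -/
theorem exists_le_laplaceIntegral {Ω : Set E} (hΩ : Convex ℝ Ω) (hcpt : IsCompact Ω)
    (hint : (interior Ω).Nonempty) {ν : E → E} (hν : Continuous ν) {φ : E → ℝ} (hφ : Continuous φ)
    (hφ0 : ∀ x, 0 ≤ φ x) {x₀ : E} {ε : ℝ} (hε : 0 < ε)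
    (hφ1 : ∀ x ∈ Metric.ball x₀ ε, φ x = 1) :
    ∃ c, 0 < c ∧ ∀ y ∈ Ω ∩ Metric.ball x₀ (ε / 2), ∀ l : ℝ, 1 ≤ l →
      c * (l ^ (Module.finrank ℝ E))⁻¹ ≤ laplaceIntegral Ω ν φ y l := by
  obtain ⟨a, ha⟩ := hint
  obtain ⟨r, hr, har⟩ := Metric.isOpen_iff.1 isOpen_interior a ha
  replace har := har.trans interior_subset
  obtain ⟨L, hL⟩ := (isCompact_closedBall x₀ (ε / 2)).exists_bound_of_continuousOn
    hν.continuousOn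
  obtain ⟨D, hD⟩ := hcpt.isBounded.exists_norm_le
  set D' := |D| + ‖a‖ + r with hD'
  have hD'0 : 0 < D' := by positivity
  -- Keeps the contracted ball within `ε / 2` of `y`, hence in the region where `φ = 1`.
  set t₀ := min 1 (ε / 2 / D') with ht₀
  have ht₀0 : 0 < t₀ := by positivity
  set n := Module.finrank ℝ E
  set v := volume.real (Metric.ball (0 : E) 1) with hv
  have hv0 : 0 < v := ENNReal.toReal_pos (Metric.measure_ball_pos _ _ one_pos).ne'
    measure_ball_lt_top.ne
  refine ⟨Real.exp (-(2 * Real.pi * |L| * (t₀ * D'))) * ((t₀ * r) ^ n * v), by positivity, ?_⟩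
  intro y hy l hl
  have hl0 : 0 < l := by linarith
  set t := t₀ / l with ht
  have ht0 : 0 < t := by positivity
  have htt₀ : t ≤ t₀ := div_le_self ht₀0.le hl
  have ht1 : t ≤ 1 := htt₀.trans (min_le_left _ _)
  have htD : t * D' ≤ ε / 2 := by
    calc t * D' ≤ (ε / 2 / D') * D' := by
          gcongr
          exact htt₀.trans (min_le_right _ _)
      _ = ε / 2 := by field_simp
  set b := y + t • (a - y) with hb
  have hdist : ∀ x ∈ Metric.ball b (t * r), ‖y - x‖ ≤ t * D' := by
    intro x hx
    rw [Metric.mem_ball, dist_eq_norm] at hx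
    have e1 : y - x = -(x - b) - t • (a - y) := by rw [hb]; module
    rw [e1]
    calc ‖-(x - b) - t • (a - y)‖ ≤ ‖-(x - b)‖ + ‖t • (a - y)‖ := norm_sub_le _ _
      _ ≤ t * r + t * (‖a‖ + |D|) := by
        rw [norm_neg, norm_smul, Real.norm_of_nonneg ht0.le]
        have := norm_sub_le a y
        have := (hD y hy.1).trans (le_abs_self D)
        gcongr
        linarith
      _ = t * D' := by rw [hD']; ring
  have hsubΩ : Metric.ball b (t * r) ⊆ Ω := by
    intro x hx
    have h1 : a + t⁻¹ • (x - b) ∈ Ω := by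
      refine har ?_
      rw [Metric.mem_ball, dist_eq_norm, add_sub_cancel_left, norm_smul, norm_inv,
        Real.norm_of_nonneg ht0.le, inv_mul_lt_iff₀ ht0]
      rwa [Metric.mem_ball, dist_eq_norm] at hx
    have h2 := hΩ hy.1 h1 (sub_nonneg.2 ht1) ht0.le (by ring)
    convert h2 using 1
    rw [smul_add, smul_smul, mul_inv_cancel₀ ht0.ne', hb]
    module
  have hlow : ∀ x ∈ Metric.ball b (t * r), Real.exp (-(2 * Real.pi * |L| * (t₀ * D'))) ≤
      φ x * Real.exp (-(2 * Real.pi * l * ⟪ν y, y - x⟫)) := by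
    intro x hx
    have h1 := hdist x hx
    have hyb := hy.2
    rw [Metric.mem_ball, dist_eq_norm] at hyb
    have h2 : x ∈ Metric.ball x₀ ε := by
      rw [Metric.mem_ball, dist_eq_norm]
      have : x - x₀ = -(y - x) + (y - x₀) := by abel
      rw [this]
      refine (norm_add_le _ _).trans_lt ?_
      rw [norm_neg]
      linarith
    rw [hφ1 x h2, one_mul]
    refine Real.exp_le_exp.2 (neg_le_neg ?_)
    have h3 : ⟪ν y, y - x⟫ ≤ |L| * (t * D') := by
      refine (real_inner_le_norm _ _).trans ?_
      have := (hL y (Metric.ball_subset_closedBall hy.2)).trans (le_abs_self L)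
      gcongr
    calc 2 * Real.pi * l * ⟪ν y, y - x⟫ ≤ 2 * Real.pi * l * (|L| * (t * D')) := by
          have := Real.pi_pos
          gcongr
      _ = 2 * Real.pi * |L| * (t₀ * D') := by
          rw [ht]
          field_simp
  have hcont : Continuous fun x => φ x * Real.exp (-(2 * Real.pi * l * ⟪ν y, y - x⟫)) := by
    have : Continuous fun x => ⟪ν y, y - x⟫ := continuous_const.inner (by fun_prop)
    exact hφ.mul (continuous_const.mul this).neg.rexp
  have hi := hcont.continuousOn.integrableOn_compact (μ := volume) hcpt
  calc _ = ∫ _ in Metric.ball b (t * r), Real.exp (-(2 * Real.pi * |L| * (t₀ * D'))) := by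
        rw [setIntegral_const, Measure.real, Measure.addHaar_ball_of_pos _ _ (by positivity : 0 < t * r),
          ENNReal.toReal_mul, ENNReal.toReal_ofReal (by positivity), smul_eq_mul]
        change _ = ((t * r) ^ n * v) * _
        rw [ht, div_mul_eq_mul_div, div_pow]
        field_simp
    _ ≤ ∫ x in Metric.ball b (t * r), φ x * Real.exp (-(2 * Real.pi * l * ⟪ν y, y - x⟫)) :=
        setIntegral_mono_on (integrableOn_const measure_ball_lt_top.ne) (hi.mono_set hsubΩ)
          measurableSet_ball hlow
    _ ≤ _ := setIntegral_mono_set hi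
        (Eventually.of_forall fun x => mul_nonneg (hφ0 x) (Real.exp_pos _).le)
        (Eventually.of_forall hsubΩ)

theorem IsStronglyConvexPatch.exists_hasStationaryGain {Ω : Set E} (hΩ : Convex ℝ Ω)
    (hcpt : IsCompact Ω) {ρ : E → ℝ} {x₀ : E} {r c : ℝ} (h : IsStronglyConvexPatch Ω ρ x₀ r c)
    {V : Set E} (hV : V ∈ 𝓝 x₀) :
    ∃ (φ : E → ℝ) (A B Y₀ Y : Set E) (ε : ℝ),
      HasStationaryGain Ω (gradient ρ) φ A B Y₀ Y ∧ tsupport φ ⊆ V ∧ 0 < ε ∧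
      (∀ x ∈ Metric.ball x₀ ε, φ x = 1) ∧ Y ⊆ Ω ∩ Metric.ball x₀ (ε / 2) ∧
      ∃ N ∈ 𝓝 x₀, ∀ y ∈ N, ρ y = 0 → y ∈ Y := by
  obtain ⟨ε₀, hε₀, hε₀r, hgain⟩ := h.exists_gain hcpt.measurableSet
  obtain ⟨c₁, hc₁, hsep⟩ := h.exists_separation hΩ hcpt
  obtain ⟨ε₁, hε₁, hball⟩ := Metric.mem_nhds_iff.1 hV
  set e := min ε₀ ε₁ with he
  have he0 : 0 < e := lt_min hε₀ hε₁
  have heε₀ : e ≤ ε₀ := min_le_left _ _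
  obtain ⟨φ, hφ, hφc, hφs, hφ1, hφ01⟩ := exists_contDiff_cutoff
    (isCompact_closedBall x₀ (e / 2)) Metric.isOpen_ball (Metric.closedBall_subset_ball
      (by linarith : e / 2 < e))
  have hYr : Metric.closedBall x₀ (e / 5) ⊆ Metric.ball x₀ (r / 2) :=
    Metric.closedBall_subset_ball (by linarith)
  -- Nested radii: `φ` is supported within `e` and equals 1 within `e / 2`, which is the `ε` of the
  -- statement; the parameters lie within `e / 5`, so that their closed ball fits into radius `ε / 2
  -- = e / 4`.
  refine ⟨φ, Metric.ball x₀ (e / 2), Metric.ball x₀ e, Metric.closedBall x₀ (e / 5),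
    Metric.closedBall x₀ (e / 5) ∩ {y | ρ y = 0}, e / 2, ?_, ?_, by linarith,
    fun x hx => hφ1 x (Metric.ball_subset_closedBall hx), ?_, Metric.closedBall x₀ (e / 5),
    Metric.closedBall_mem_nhds _ (by linarith), fun y hy h0 => ⟨hy, h0⟩⟩
  · refine ⟨hcpt, contDiff_gradient h.contDiff, Metric.isOpen_ball, hφ, hφc, hφs,
      fun x hx => hφ1 x (Metric.ball_subset_closedBall hx), fun x => (hφ01 x).1,
      isCompact_closedBall _ _,
      Metric.closedBall_subset_ball (by linarith), inter_subset_left, ?_, ?_⟩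
    · intro y hy x hx
      exact (by positivity : (0 : ℝ) ≤ c₁ * ‖x - y‖ ^ 2).trans (hsep y (hYr hy.1) hy.2 x hx)
    · intro a ha hdiag
      obtain ⟨a', ha', H⟩ := hgain _ _ Metric.isOpen_ball Metric.isOpen_ball
        (Metric.ball_subset_ball (by linarith)) (Metric.ball_subset_ball heε₀) a ha hdiag
      exact ⟨a', ha', fun y hy => H y hy.2⟩
  · exact hφs.trans ((Metric.ball_subset_ball (min_le_right _ _)).trans hball)
  · intro y hy
    refine ⟨(h.mem_iff y (Metric.ball_subset_ball (by linarith [h.r_pos]) (hYr hy.1))).2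
      (le_of_eq hy.2), Metric.closedBall_subset_ball (by linarith) hy.1⟩

end Assembly

/-! ### Decay of the remainder for smooth boundaries. -/

section Decay

variable {E : Type} [NormedAddCommGroup E] [InnerProductSpace ℝ E] [FiniteDimensional ℝ E]
  [MeasurableSpace E] [BorelSpace E]

/-- The oscillatory integrals with amplitude supported in `U` are `O(l ^ (-k))`, uniformly for `y`
in `Y` near `x₀`. -/
def HasDecay (Ω : Set E) (ν : E → E) (Y : Set E) (x₀ : E) (k : ℕ) (U : Set E) : Prop :=
  ∃ N ∈ 𝓝 x₀, ∀ f : E → ℝ, ContDiff ℝ ∞ f → HasCompactSupport f → tsupport f ⊆ U →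
    ∃ C, 0 ≤ C ∧ ∀ y ∈ N ∩ Y, ∀ l : ℝ, 1 ≤ l →
      ‖oscIntegral Ω ν (fun p => f p.2) y l‖ ≤ C * (l ^ k)⁻¹

/-- The gain is iterated `k` times from the trivial bound. A cutoff in `y` makes a function of `x`
alone into an amplitude, at the cost of restricting `y` to a neighbourhood of `x₀`. -/
theorem hasDecay_of_gain {Ω : Set E} (hcpt : IsCompact Ω) {ν : E → E} {Y : Set E}
    (hY : ∀ y ∈ Y, ∀ x ∈ Ω, 0 ≤ ⟪ν y, y - x⟫) {x₀ : E} {A B : Set E} (hA : A ∈ 𝓝 x₀)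
    (hgain : ∀ a, IsAmplitude (interior A) B a → ∃ a', IsAmplitude (interior A) B a' ∧ ∀ y τ,
      τ * oscIntegral Ω ν a y τ = Complex.I * oscIntegral Ω ν a' y τ) (k : ℕ) :
    HasDecay Ω ν Y x₀ k B := by
  obtain ⟨ε, hε, hεA⟩ := Metric.mem_nhds_iff.1 (interior_mem_nhds.2 hA)
  have hiter : ∀ k : ℕ, ∀ a, IsAmplitude (interior A) B a → ∃ C, 0 ≤ C ∧ ∀ y ∈ Y, ∀ l : ℝ, 1 ≤ l →
      ‖oscIntegral Ω ν a y l‖ ≤ C * (l ^ k)⁻¹ := by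
    intro k
    induction k with
    | zero =>
      intro a ha
      obtain ⟨C, hC0, hC⟩ := HasStationaryGain.bounded_amplitude ha
      refine ⟨C * volume.real Ω, by positivity, fun y hy l hl => ?_⟩
      simpa using norm_oscIntegral_le hcpt (hY y hy) (fun x => hC (y, x)) (τ := (l : ℂ))
        (by simp)
    | succ k ih =>
      intro a ha
      obtain ⟨a', ha', H⟩ := hgain a ha
      obtain ⟨C, hC0, hC⟩ := ih a' ha'
      refine ⟨C, hC0, fun y hy l hl => ?_⟩
      have hl0 : 0 < l := by linarith
      have h1 := congrArg norm (H y l)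
      rw [norm_mul, norm_mul, Complex.norm_I, one_mul, Complex.norm_real,
        Real.norm_of_nonneg hl0.le] at h1
      have h2 := hC y hy l hl
      rw [← h1] at h2
      calc _ = l⁻¹ * (l * ‖oscIntegral Ω ν a y l‖) := by field_simp
        _ ≤ l⁻¹ * (C * (l ^ k)⁻¹) := by gcongr
        _ = C * (l ^ (k + 1))⁻¹ := by rw [pow_succ]; field_simp
  obtain ⟨χ, hχ, hχc, hχs, hχ1, -⟩ := exists_contDiff_cutoff (isCompact_closedBall x₀ (ε / 2))
    Metric.isOpen_ball (Metric.closedBall_subset_ball (by linarith : ε / 2 < ε))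
  refine ⟨Metric.closedBall x₀ (ε / 2), Metric.closedBall_mem_nhds _ (by linarith), ?_⟩
  intro f hf hfc hfs
  have ha : IsAmplitude (interior A) B fun p => χ p.1 * f p.2 := by
    refine ⟨(hχ.comp contDiff_fst).mul (hf.comp contDiff_snd), ?_, ?_⟩
    · refine HasCompactSupport.intro (hχc.isCompact.prod hfc.isCompact) fun p hp => ?_
      by_cases h1 : p.1 ∈ tsupport χ
      · rw [image_eq_zero_of_notMem_tsupport (f := f) fun h2 => hp ⟨h1, h2⟩, mul_zero]
      · rw [image_eq_zero_of_notMem_tsupport h1, zero_mul]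
    · have : tsupport (fun p : E × E => χ p.1 * f p.2) ⊆ tsupport χ ×ˢ tsupport f := by
        refine closure_minimal (fun p hp => ?_)
          ((isClosed_tsupport χ).prod (isClosed_tsupport f))
        exact ⟨subset_tsupport _ (left_ne_zero_of_mul hp),
          subset_tsupport _ (right_ne_zero_of_mul hp)⟩
      exact this.trans (prod_mono (hχs.trans hεA) hfs)
  obtain ⟨C, hC0, hC⟩ := hiter k _ ha
  refine ⟨C, hC0, fun y hy l hl => ?_⟩
  have h1 := hC y hy.2 l hl
  rwa [oscIntegral_const_mul Ω ν χ (fun p => f p.2), hχ1 y hy.1, Complex.ofReal_one,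
    one_mul] at h1

/-- A cutoff equal to 1 near the compact set `tsupport f \ V` and supported in `U` splits `f` into a
part living in `U` and a part living in `V`. -/
theorem HasDecay.union {Ω : Set E} (hcpt : IsCompact Ω) {ν : E → E} {Y : Set E} {x₀ : E} {k : ℕ}
    {U V : Set E} (hU : IsOpen U) (hV : IsOpen V) (h₁ : HasDecay Ω ν Y x₀ k U)
    (h₂ : HasDecay Ω ν Y x₀ k V) : HasDecay Ω ν Y x₀ k (U ∪ V) := by
  obtain ⟨N₁, hN₁, H₁⟩ := h₁
  obtain ⟨N₂, hN₂, H₂⟩ := h₂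
  refine ⟨N₁ ∩ N₂, inter_mem hN₁ hN₂, fun f hf hfc hfs => ?_⟩
  have hK : IsCompact (tsupport f \ V) := hfc.isCompact.diff hV
  have hKU : tsupport f \ V ⊆ U := fun x hx => (hfs hx.1).resolve_right hx.2
  obtain ⟨K', hK', hKK', hK'U⟩ := exists_compact_between hK hU hKU
  obtain ⟨θ, hθ, hθc, hθs, hθ1, -⟩ := exists_contDiff_cutoff hK' hU hK'U
  have hs₂ : tsupport (fun x => (1 - θ x) * f x) ⊆ V := by
    intro x hx
    by_contra hxV
    have hxf : x ∈ tsupport f := tsupport_mul_subset_right hx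
    have h1 : interior K' ∈ 𝓝 x := isOpen_interior.mem_nhds (hKK' ⟨hxf, hxV⟩)
    refine (notMem_tsupport_iff_eventuallyEq.2 ?_) hx
    filter_upwards [h1] with z hz
    simp [hθ1 z (interior_subset hz)]
  obtain ⟨C₁, hC₁, B₁⟩ := H₁ (fun x => θ x * f x) (hθ.mul hf) hfc.mul_left
    (tsupport_mul_subset_left.trans hθs)
  obtain ⟨C₂, hC₂, B₂⟩ := H₂ (fun x => (1 - θ x) * f x) ((contDiff_const.sub hθ).mul hf)
    hfc.mul_left hs₂
  refine ⟨C₁ + C₂, by positivity, fun y hy l hl => ?_⟩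
  have e : oscIntegral Ω ν (fun p => θ p.2 * f p.2) y l =
      oscIntegral Ω ν (fun p => f p.2) y l -
        oscIntegral Ω ν (fun p => (1 - θ p.2) * f p.2) y l := by
    rw [← oscIntegral_sub hcpt (a := fun p => f p.2) (b := fun p => (1 - θ p.2) * f p.2)
      hf.continuous ((continuous_const.sub hθ.continuous).mul hf.continuous)]
    congr 1
    funext p
    ring
  have b₁ := B₁ y ⟨hy.1.1, hy.2⟩ l hl
  have b₂ := B₂ y ⟨hy.1.2, hy.2⟩ l hl
  rw [e] at b₁
  rw [add_mul]
  have := norm_le_norm_sub_add (oscIntegral Ω ν (fun p => f p.2) y l)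
    (oscIntegral Ω ν (fun p => (1 - θ p.2) * f p.2) y l)
  linarith

theorem HasDecay.mono {Ω : Set E} {ν : E → E} {Y : Set E} {x₀ : E} {k : ℕ} {U V : Set E}
    (h : HasDecay Ω ν Y x₀ k U) (hVU : V ⊆ U) : HasDecay Ω ν Y x₀ k V := by
  obtain ⟨N, hN, H⟩ := h
  exact ⟨N, hN, fun f hf hfc hfs => H f hf hfc (hfs.trans hVU)⟩

theorem hasDecay_of_isCompact {Ω : Set E} (hcpt : IsCompact Ω) {ν : E → E} {Y : Set E} {x₀ : E}
    {k : ℕ} {K : Set E} (hK : IsCompact K)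
    (h : ∀ b ∈ K, ∃ U, IsOpen U ∧ b ∈ U ∧ HasDecay Ω ν Y x₀ k U) : HasDecay Ω ν Y x₀ k K := by
  have : ∃ U, IsOpen U ∧ K ⊆ U ∧ HasDecay Ω ν Y x₀ k U := by
    refine hK.induction_on (p := fun S => ∃ U, IsOpen U ∧ S ⊆ U ∧ HasDecay Ω ν Y x₀ k U)
      ?_ ?_ ?_ ?_
    · refine ⟨∅, isOpen_empty, Subset.rfl, univ, univ_mem, fun f _ _ hfs => ⟨0, le_rfl, ?_⟩⟩
      intro y _ l _
      have : f = 0 := by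
        rw [← tsupport_eq_empty_iff]
        exact subset_empty_iff.1 hfs
      simp [oscIntegral, this]
    · rintro S S' hSS' ⟨U, hU, hS'U, hd⟩
      exact ⟨U, hU, hSS'.trans hS'U, hd⟩
    · rintro S S' ⟨U, hU, hSU, hd⟩ ⟨U', hU', hSU', hd'⟩
      exact ⟨U ∪ U', hU.union hU', union_subset_union hSU hSU', hd.union hcpt hU hU' hd'⟩
    · intro b hb
      obtain ⟨U, hU, hbU, hd⟩ := h b hb
      exact ⟨U, mem_nhdsWithin_of_mem_nhds (hU.mem_nhds hbU), U, hU, Subset.rfl, hd⟩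
  obtain ⟨U, -, hKU, hd⟩ := this
  exact hd.mono hKU

/-- The integral is nonstationary at every point of `Ω` except `x₀` and its reflection: in the
interior any direction is admissible, and at another boundary point the normal is not parallel to
that at `x₀`, so the normal at `x₀` has a nonzero tangential part there. -/
theorem IsStronglyConvexPatch.exists_hasDecay {Ω : Set E} (hΩ : Convex ℝ Ω) (hcpt : IsCompact Ω)
    {c : E} (hsym : ∀ y ∈ Ω, (2 : ℝ) • c - y ∈ Ω)
    (hsm : ∀ b ∈ frontier Ω, ∃ ρ : E → ℝ, ContDiff ℝ ∞ ρ ∧ gradient ρ b ≠ 0 ∧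
      ∀ᶠ y in 𝓝 b, (y ∈ Ω ↔ ρ y ≤ 0))
    {ρ : E → ℝ} {x₀ : E} {r c₀ : ℝ} (h : IsStronglyConvexPatch Ω ρ x₀ r c₀) {Y : Set E}
    (hY : ∀ y ∈ Y, ∀ x ∈ Ω, 0 ≤ ⟪gradient ρ y, y - x⟫) (k : ℕ) {b : E} (hb : b ≠ x₀)
    (hb' : b ≠ (2 : ℝ) • c - x₀) :
    ∃ U, IsOpen U ∧ b ∈ U ∧ HasDecay Ω (gradient ρ) Y x₀ k U := by
  have hν := contDiff_gradient h.contDiff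
  have hx₀ : x₀ ∈ Metric.ball x₀ r := Metric.mem_ball_self h.r_pos
  have hν0 := h.gradient_ne_zero x₀ hx₀
  have hx₀Ω : x₀ ∈ Ω := (h.mem_iff x₀ hx₀).2 h.eq_zero.le
  by_cases hbΩ : b ∈ Ω
  swap
  · refine ⟨Ωᶜ, hcpt.isClosed.isOpen_compl, hbΩ, univ, univ_mem, fun f _ _ hfs =>
      ⟨0, le_rfl, fun y _ l _ => ?_⟩⟩
    have : oscIntegral Ω (gradient ρ) (fun p => f p.2) y l = ∫ x in Ω, (0 : ℂ) := by
      refine setIntegral_congr_fun hcpt.measurableSet fun x hx => ?_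
      have : f x = 0 := image_eq_zero_of_notMem_tsupport fun h => hfs h hx
      simp [this]
    simp [this]
  by_cases hbi : b ∈ interior Ω
  · refine ⟨interior Ω, isOpen_interior, hbi, hasDecay_of_gain hcpt hY
      (A := {y | gradient ρ y ≠ 0}) ?_ ?_ k⟩
    · exact hν.continuous.continuousAt.eventually_ne hν0
    · intro a ha
      -- In the interior a negative constant serves as defining function, and every field is tangent
      -- to its level sets.
      exact exists_amplitude_of_nonstationary hcpt.measurableSet hν (ρ := fun _ => -1)
        contDiff_const (V := fun p => gradient ρ p.1) (hν.comp contDiff_fst)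
        (fun x hx => by simpa using interior_subset hx) (fun y x => by simp)
        (fun y hy x _ => (real_inner_self_pos.2 (interior_subset hy)).ne') ha
  have hbf : b ∈ frontier Ω := ⟨subset_closure hbΩ, hbi⟩
  obtain ⟨q, hq, hqb, hqm⟩ := hsm b hbf
  have hqg := contDiff_gradient hq
  have hq0 := eq_zero_of_mem_frontier hcpt.isClosed hq.continuous.continuousAt hqm hbf
  obtain ⟨c₁, hc₁, hsep⟩ := h.exists_separation hΩ hcpt
  have hsep₀ := hsep x₀ (Metric.mem_ball_self (by linarith [h.r_pos])) h.eq_zero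
  have hqx : ∀ x ∈ Ω, ⟪gradient q b, x - b⟫ ≤ 0 := fun x hx =>
    inner_gradient_nonpos hΩ (hq.differentiable (by simp)).differentiableAt hqm hq0 hx
  -- For `m > 0` the point `b` would share its supporting hyperplane with `x₀`, and for `m < 0` the
  -- reflection of `b` would do so; strict separation at `x₀` excludes both.
  have hnp : ∀ m : ℝ, gradient q b ≠ m • gradient ρ x₀ := by
    intro m hm
    rcases lt_trichotomy m 0 with hm0 | hm0 | hm0
    · have h1 := hqx _ (hsym x₀ hx₀Ω)
      have h2 := hsep₀ _ (hsym b hbΩ)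
      rw [hm, real_inner_smul_left] at h1
      have h3 : ⟪gradient ρ x₀, x₀ - ((2 : ℝ) • c - b)⟫ ≤ 0 := by
        have : x₀ - ((2 : ℝ) • c - b) = -((2 : ℝ) • c - x₀ - b) := by abel
        rw [this, inner_neg_right]
        nlinarith
      have h4 : ‖(2 : ℝ) • c - b - x₀‖ ^ 2 ≤ 0 := by nlinarith [sq_nonneg ‖(2 : ℝ) • c - b - x₀‖]
      have h5 : (2 : ℝ) • c - b - x₀ = 0 := by simpa using h4
      apply hb'
      rw [sub_sub, add_comm, ← sub_sub] at h5
      exact (sub_eq_zero.1 h5).symm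
    · rw [hm0, zero_smul] at hm
      exact hqb hm
    · have h1 := hqx _ hx₀Ω
      have h2 := hsep₀ _ hbΩ
      rw [hm, real_inner_smul_left] at h1
      have h3 : ⟪gradient ρ x₀, x₀ - b⟫ ≤ 0 := by nlinarith
      have h4 : ‖b - x₀‖ ^ 2 ≤ 0 := by nlinarith [sq_nonneg ‖b - x₀‖]
      have h5 : b - x₀ = 0 := by simpa using h4
      exact hb (sub_eq_zero.1 h5)
  -- Up to a factor, the projection of `∇ρ p.1` to the tangent space of the level set of `q`; its
  -- pairing with `∇ρ p.1` vanishes only if it is itself zero, that is, if the normals are parallel.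
  let V : E × E → E := fun p => ⟪gradient q p.2, gradient q p.2⟫ • gradient ρ p.1 -
    ⟪gradient q p.2, gradient ρ p.1⟫ • gradient q p.2
  have h1 : ContDiff ℝ ∞ fun p : E × E => gradient ρ p.1 := hν.comp contDiff_fst
  have h2 : ContDiff ℝ ∞ fun p : E × E => gradient q p.2 := hqg.comp contDiff_snd
  have hV : ContDiff ℝ ∞ V := ((h2.inner ℝ h2).smul h1).sub ((h2.inner ℝ h1).smul h2)
  have hVν : ⟪gradient ρ x₀, V (x₀, b)⟫ ≠ 0 := by
    intro h0
    set g := gradient q b with hg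
    set v := gradient ρ x₀ with hv
    have hg0 : 0 < ⟪g, g⟫ := real_inner_self_pos.2 hqb
    have e1 : ⟪v, V (x₀, b)⟫ * ⟪g, g⟫ = ⟪V (x₀, b), V (x₀, b)⟫ := by
      simp only [V, ← hg, ← hv, inner_sub_right, inner_sub_left, inner_smul_right,
        real_inner_smul_left, real_inner_comm g v]
      ring
    rw [h0, zero_mul] at e1
    have e2 : V (x₀, b) = 0 := inner_self_eq_zero.1 e1.symm
    simp only [V, ← hg, ← hv] at e2
    have e3 := sub_eq_zero.1 e2
    by_cases h4 : ⟪g, v⟫ = 0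
    · rw [h4, zero_smul] at e3
      exact (smul_ne_zero hg0.ne' hν0) e3
    · refine hnp (⟪g, v⟫⁻¹ * ⟪g, g⟫) ?_
      rw [mul_smul, e3, smul_smul, inv_mul_cancel₀ h4, one_smul]
  have hne : ∀ᶠ p in 𝓝 (x₀, b), ⟪gradient ρ p.1, V p⟫ ≠ 0 :=
    (h1.inner ℝ hV).continuous.continuousAt.eventually_ne hVν
  obtain ⟨A, hA, B, hB, hAB⟩ := mem_nhds_prod_iff.1 hne
  have hBn := inter_mem hB hqm
  refine ⟨interior (B ∩ {y | y ∈ Ω ↔ q y ≤ 0}), isOpen_interior, mem_interior_iff_mem_nhds.2 hBn,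
    hasDecay_of_gain hcpt hY hA ?_ k⟩
  intro a ha
  have hsub : interior (B ∩ {y | y ∈ Ω ↔ q y ≤ 0}) ⊆ B ∩ {y | y ∈ Ω ↔ q y ≤ 0} :=
    interior_subset
  refine exists_amplitude_of_nonstationary hcpt.measurableSet hν hq hV
    (fun x hx => (hsub hx).2) (fun y x => ?_)
    (fun y (hy : y ∈ interior A) x hx =>
      hAB (mk_mem_prod (interior_subset hy) (hsub hx).1)) ha
  rw [← inner_gradient_eq_fderiv]
  simp only [V, inner_sub_right, inner_smul_right]
  ring

/-- Were `x₀` the centre, the separation inequalities at `x` and at its reflection would have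
opposite right hand sides, forcing `Ω ⊆ {x₀}`. -/
theorem IsStronglyConvexPatch.ne_reflection {Ω : Set E} (hΩ : Convex ℝ Ω) (hcpt : IsCompact Ω)
    (hint : (interior Ω).Nonempty) {c : E} (hsym : ∀ y ∈ Ω, (2 : ℝ) • c - y ∈ Ω) {ρ : E → ℝ}
    {x₀ : E} {r c₀ : ℝ} (h : IsStronglyConvexPatch Ω ρ x₀ r c₀) : x₀ ≠ (2 : ℝ) • c - x₀ := by
  intro he
  obtain ⟨c₁, hc₁, hsep⟩ := h.exists_separation hΩ hcpt
  have hsep₀ := hsep x₀ (Metric.mem_ball_self (by linarith [h.r_pos])) h.eq_zero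
  have hsub : Ω ⊆ {x₀} := by
    intro x hx
    have h1 := hsep₀ x hx
    have h2 := hsep₀ _ (hsym x hx)
    have h3 : x₀ - ((2 : ℝ) • c - x) = -(x₀ - x) := by
      rw [eq_sub_iff_add_eq] at he
      rw [← he]
      abel
    rw [h3, inner_neg_right] at h2
    have h4 : ‖x - x₀‖ ^ 2 ≤ 0 := by
      nlinarith [mul_nonneg hc₁.le (sq_nonneg ‖(2 : ℝ) • c - x - x₀‖)]
    have h5 : x - x₀ = 0 := by simpa using h4
    exact sub_eq_zero.1 h5
  have : Nontrivial E := nontrivial_of_ne _ _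
    (h.gradient_ne_zero x₀ (Metric.mem_ball_self h.r_pos))
  have h1 := hint.mono (interior_mono hsub)
  have : NeBot (𝓝[≠] x₀) := Module.punctured_nhds_neBot ℝ E x₀
  rw [interior_singleton] at h1
  exact Set.not_nonempty_empty h1

/-- The remainder is `O(l ^ (-(p + q)))` and the main piece at least of order `l ^ (-q)`, so their
quotient has the required rate `p`. This isolates the two estimates that differ between the smooth
and the planar case. -/
theorem IsStronglyConvexPatch.exists_hasPhaseBound_of_decay {Ω : Set E} (hΩ : Convex ℝ Ω)
    (hcpt : IsCompact Ω) (hint : (interior Ω).Nonempty) {c : E}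
    (hsym : ∀ y ∈ Ω, (2 : ℝ) • c - y ∈ Ω) {ρ : E → ℝ} {x₀ : E} {r c₀ p q : ℝ}
    (h : IsStronglyConvexPatch Ω ρ x₀ r c₀) (hp0 : 0 ≤ p) (hp2 : p ≤ 2)
    (hlap : ∀ (φ : E → ℝ) (ε : ℝ), Continuous φ → (∀ x, 0 ≤ φ x) → 0 < ε →
      (∀ x ∈ Metric.ball x₀ ε, φ x = 1) → ∃ a, 0 < a ∧ ∃ N ∈ 𝓝 x₀, ∀ y ∈ N, ρ y = 0 →
        ∀ l : ℝ, 1 ≤ l → a * l ^ (-q) ≤ laplaceIntegral Ω (gradient ρ) φ y l)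
    (hdec : ∀ f : E → ℝ, ContDiff ℝ ∞ f → f =ᶠ[𝓝 x₀] 0 → f =ᶠ[𝓝 ((2 : ℝ) • c - x₀)] 0 →
      ∃ C, 0 ≤ C ∧ ∃ N ∈ 𝓝 x₀, ∀ y ∈ N, ρ y = 0 → ∀ l : ℝ, 1 ≤ l →
        ‖oscIntegral Ω (gradient ρ) (fun p => f p.2) y l‖ ≤ C * l ^ (-(p + q)))
    {U : Set E} (hU : U ∈ 𝓝 x₀) :
    ∃ s w δ c' C, IsGaussCone Ω (gradient ρ) s w δ c' C ∧
      (∀ ξ ∈ directionCone w δ, s ξ ∈ frontier Ω ∩ U) ∧ HasPhaseBound Ω s w δ c p := by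
  have hν := contDiff_gradient h.contDiff
  set x₁ := (2 : ℝ) • c - x₀ with hx₁
  set D := ‖x₁ - x₀‖ with hD
  have hD0 : 0 < D := norm_pos_iff.2 (sub_ne_zero.2 (h.ne_reflection hΩ hcpt hint hsym).symm)
  -- `φ` is supported within half the distance from `x₀` to its reflection, so the two cutoffs do
  -- not interfere and the remainder vanishes near both points.
  obtain ⟨φ, A, B, Y₀, Y, ε, hst, hφV, hε, hφ1, hYΩ, N, hN, hNY⟩ :=
    h.exists_hasStationaryGain hΩ hcpt (Metric.ball_mem_nhds x₀ (half_pos hD0))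
  have hφc := hst.contDiff_cutoff.continuous
  -- The general bound with exponent the dimension serves the bootstrap; the rate `q` is needed only
  -- in the final quotient.
  obtain ⟨cl, hcl, hlap₀⟩ := exists_le_laplaceIntegral hΩ hcpt hint hν.continuous hφc
    hst.cutoff_nonneg hε hφ1
  obtain ⟨l₀, hl₀, hJ, hcomp⟩ := hst.exists_comparison hcl fun y hy => hlap₀ y (hYΩ hy)
  obtain ⟨a, ha, N₁, hN₁, hlap₁⟩ := hlap φ ε hφc hst.cutoff_nonneg hε hφ1
  set f : E → ℝ := fun x => 1 - φ x - φ ((2 : ℝ) • c - x) with hf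
  have hfs : ContDiff ℝ ∞ f := (contDiff_const.sub hst.contDiff_cutoff).sub
    (hst.contDiff_cutoff.comp (contDiff_const.sub contDiff_id))
  have hf₀ : f =ᶠ[𝓝 x₀] 0 := by
    filter_upwards [Metric.ball_mem_nhds x₀ hε, Metric.ball_mem_nhds x₀ (half_pos hD0)]
      with x hx hxD
    have h1 : (2 : ℝ) • c - x ∉ tsupport φ := by
      intro h2
      have h3 := hφV h2
      rw [Metric.mem_ball, dist_eq_norm] at h3 hxD
      have h4 : x₁ - x₀ = ((2 : ℝ) • c - x - x₀) + (x - x₀) := by rw [hx₁]; abel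
      have h5 := norm_add_le ((2 : ℝ) • c - x - x₀) (x - x₀)
      rw [← h4] at h5
      linarith
    simp [hf, hφ1 x hx, image_eq_zero_of_notMem_tsupport h1]
  have hf₁ : f =ᶠ[𝓝 x₁] 0 := by
    have h1 : Tendsto (fun x : E => (2 : ℝ) • c - x) (𝓝 x₁) (𝓝 x₀) := by
      have : ContinuousAt (fun x : E => (2 : ℝ) • c - x) x₁ := by fun_prop
      simpa [ContinuousAt, hx₁] using this
    filter_upwards [h1.eventually hf₀] with x hx
    simp only [hf, Pi.zero_apply, sub_sub_cancel] at hx ⊢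
    linarith
  obtain ⟨C, hC, N₂, hN₂, hdec₁⟩ := hdec f hfs hf₀ hf₁
  obtain ⟨s, hs⟩ := exists_isSupportSelection hcpt (hint.mono interior_subset)
  obtain ⟨δ, c', C₁, hg, hcone⟩ := h.exists_isGaussCone hΩ hcpt
    (inter_mem hU (inter_mem hN (inter_mem hN₁ hN₂))) hs
  have hC₁ := hg.C_pos
  refine ⟨s, _, δ, c', C₁, hg, fun ξ hξ => ⟨(hcone ξ hξ).2.2, (hcone ξ hξ).1.1⟩, ?_⟩
  have hl₀0 : 0 < l₀ := by linarith
  have hJ' : ∀ y ∈ Y, ∀ l : ℝ, l₀ ≤ l → oscIntegral Ω (gradient ρ) (fun p => φ p.2) y l ≠ 0 := by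
    intro y hy l hl
    have h1 := hJ y hy l hl
    have h2 := hlap₀ y (hYΩ hy) l (hl₀.trans hl)
    have h3 : 0 < l := hl₀0.trans_le hl
    have : 0 < cl * (l ^ Module.finrank ℝ E)⁻¹ := by positivity
    rw [← norm_pos_iff]
    linarith
  refine hst.hasPhaseBound hl₀ hJ' hcomp hsym hg (fun ξ hξ => hNY _ (hcone ξ hξ).1.2.1
    (hcone ξ hξ).2.1) hp0 hp2 (D := C * C₁ ^ p * (2 / a)) (T := C₁ * l₀) (by positivity) ?_
  intro ξ hξ hT
  obtain ⟨hsV, hs0, -⟩ := hcone ξ hξ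
  obtain ⟨l, hl, he, hle, -⟩ := hg.multiplier ξ hξ
  have hlt : C₁ * l₀ ≤ C₁ * l := hT.trans hle
  have hll₀ : l₀ ≤ l := le_of_mul_le_mul_left hlt hC₁
  have hl1 : 1 ≤ l := hl₀.trans hll₀
  have e1 := norm_cutTransform_smul_eq Ω (gradient ρ) f (k := fun _ => 1) (y := s ξ) rfl l
  have e2 := norm_cutTransform_smul_eq Ω (gradient ρ) φ (k := fun _ => 1) (y := s ξ) rfl l
  simp only [one_mul] at e1 e2
  rw [← he] at e1 e2
  have b1 := hdec₁ _ hsV.2.2.2 hs0 l hl1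
  have b2 := hlap₁ _ hsV.2.2.1 hs0 l hl1
  have b3 := hJ _ (hNY _ hsV.2.1 hs0) l hll₀
  set t := ⟪ξ, (‖gradient ρ x₀‖⁻¹ • gradient ρ x₀)⟫ with ht
  have ht0 : 0 < t := lt_of_lt_of_le (by positivity) hT
  rw [e1, e2]
  have b4 : l ^ (-p) ≤ C₁ ^ p * t ^ (-p) := by
    calc l ^ (-p) ≤ (t / C₁) ^ (-p) := Real.rpow_le_rpow_of_nonpos (by positivity)
          (by rw [div_le_iff₀ hC₁]; linarith) (by linarith)
      _ = C₁ ^ p * t ^ (-p) := by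
          rw [Real.div_rpow ht0.le hC₁.le, Real.rpow_neg hC₁.le, div_inv_eq_mul, mul_comm]
  have b5 : l ^ (-q) ≤ 2 / a * ‖oscIntegral Ω (gradient ρ) (fun p => φ p.2) (s ξ) l‖ := by
    rw [div_mul_eq_mul_div, le_div_iff₀ ha]
    linarith
  calc _ ≤ C * l ^ (-(p + q)) := b1
    _ = C * (l ^ (-p) * l ^ (-q)) := by rw [← Real.rpow_add hl]; ring_nf
    _ ≤ C * ((C₁ ^ p * t ^ (-p)) *
        (2 / a * ‖oscIntegral Ω (gradient ρ) (fun p => φ p.2) (s ξ) l‖)) := by gcongr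
    _ = _ := by ring

/-- Here `q` is the dimension, from the crude Laplace bound, and decay of order `q + 2` is
available. The limit `p = 2` comes from the drift of the argument, not from the remainder. -/
theorem IsStronglyConvexPatch.exists_hasPhaseBound_of_smooth {Ω : Set E} (hΩ : Convex ℝ Ω)
    (hcpt : IsCompact Ω) (hint : (interior Ω).Nonempty) {c : E}
    (hsym : ∀ y ∈ Ω, (2 : ℝ) • c - y ∈ Ω)
    (hsm : ∀ b ∈ frontier Ω, ∃ ρ : E → ℝ, ContDiff ℝ ∞ ρ ∧ gradient ρ b ≠ 0 ∧
      ∀ᶠ y in 𝓝 b, (y ∈ Ω ↔ ρ y ≤ 0))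
    {ρ : E → ℝ} {x₀ : E} {r c₀ : ℝ} (h : IsStronglyConvexPatch Ω ρ x₀ r c₀) {U : Set E}
    (hU : U ∈ 𝓝 x₀) :
    ∃ s w δ c' C, IsGaussCone Ω (gradient ρ) s w δ c' C ∧
      (∀ ξ ∈ directionCone w δ, s ξ ∈ frontier Ω ∩ U) ∧ HasPhaseBound Ω s w δ c 2 := by
  have hν := contDiff_gradient h.contDiff
  have hr := h.r_pos
  obtain ⟨c₁, hc₁, hsep⟩ := h.exists_separation hΩ hcpt
  refine h.exists_hasPhaseBound_of_decay hΩ hcpt hint hsym zero_le_two le_rfl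
    (q := Module.finrank ℝ E) ?_ ?_ hU
  · intro φ ε hφ hφ0 hε hφ1
    obtain ⟨a, ha, hlap⟩ := exists_le_laplaceIntegral hΩ hcpt hint hν.continuous hφ hφ0 hε hφ1
    refine ⟨a, ha, Metric.ball x₀ (min r (ε / 2)), Metric.ball_mem_nhds _ (by positivity), ?_⟩
    intro y hy h0 l hl
    rw [Real.rpow_neg (by linarith), Real.rpow_natCast]
    exact hlap y ⟨(h.mem_iff y (Metric.ball_subset_ball (min_le_left _ _) hy)).2 h0.le,
      Metric.ball_subset_ball (min_le_right _ _) hy⟩ l hl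
  · intro f hf hf₀ hf₁
    obtain ⟨θ, hθ, hθc, -, hθ1, -⟩ := exists_contDiff_cutoff hcpt isOpen_univ (subset_univ Ω)
    let Y := Metric.ball x₀ (r / 2) ∩ {y | ρ y = 0}
    have hY : ∀ y ∈ Y, ∀ x ∈ Ω, 0 ≤ ⟪gradient ρ y, y - x⟫ := fun y hy x hx =>
      (by positivity : (0 : ℝ) ≤ c₁ * ‖x - y‖ ^ 2).trans (hsep y hy.1 hy.2 x hx)
    have hsupp : HasCompactSupport fun x => θ x * f x := hθc.mul_right
    have hdec := hasDecay_of_isCompact hcpt (ν := gradient ρ) (Y := Y) (x₀ := x₀)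
      (k := Module.finrank ℝ E + 2) hsupp.isCompact fun b hb =>
        h.exists_hasDecay hΩ hcpt hsym hsm hY _ (by
          rintro rfl
          refine notMem_tsupport_iff_eventuallyEq.2 ?_ hb
          filter_upwards [hf₀] with x hx
          simp [hx]) (by
          rintro rfl
          refine notMem_tsupport_iff_eventuallyEq.2 ?_ hb
          filter_upwards [hf₁] with x hx
          simp [hx])
    obtain ⟨N, hN, H⟩ := hdec
    obtain ⟨C, hC, B⟩ := H _ (hθ.mul hf) hsupp Subset.rfl
    refine ⟨C, hC, N ∩ Metric.ball x₀ (r / 2),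
      inter_mem hN (Metric.ball_mem_nhds _ (by linarith)), fun y hy h0 l hl => ?_⟩
    have h1 := B y ⟨hy.1, hy.2, h0⟩ l hl
    have h2 : oscIntegral Ω (gradient ρ) (fun p => θ p.2 * f p.2) y l =
        oscIntegral Ω (gradient ρ) (fun p => f p.2) y l :=
      setIntegral_congr_fun hcpt.measurableSet fun x hx => by simp [hθ1 x hx]
    rw [h2] at h1
    rw [Real.rpow_neg (by linarith)]
    have h3 : l ^ (2 + (Module.finrank ℝ E : ℝ)) = l ^ (Module.finrank ℝ E + 2) := by
      rw [← Real.rpow_natCast]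
      congr 1
      push_cast
      ring
    rw [h3]
    exact h1

end Decay

/-! ### Volume packing. -/

section Packing

variable {E : Type} [NormedAddCommGroup E] [InnerProductSpace ℝ E] [FiniteDimensional ℝ E]

/-- The balls of radius `κ / 2` around the points are disjoint and contained in one of radius `r + κ
/ 2`. -/
theorem card_mul_pow_le_of_separated {S : Finset E} {z : E} {r κ : ℝ}
    (hr : 0 ≤ r) (hκ : 0 < κ) (hS : ∀ x ∈ S, x ∈ Metric.closedBall z r)
    (hsep : ∀ x ∈ S, ∀ y ∈ S, x ≠ y → κ ≤ dist x y) :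
    (S.card : ℝ) * (κ / 2) ^ Module.finrank ℝ E ≤ (r + κ / 2) ^ Module.finrank ℝ E := by
  borelize E
  set n := Module.finrank ℝ E
  have hκ2 : 0 < κ / 2 := half_pos hκ
  have hdisj : (S : Set E).PairwiseDisjoint fun x => Metric.ball x (κ / 2) := by
    intro x hx y hy hxy
    exact Metric.ball_disjoint_ball (by linarith [hsep x hx y hy hxy])
  have hsub : (⋃ x ∈ S, Metric.ball x (κ / 2)) ⊆ Metric.ball z (r + κ / 2) := by
    refine iUnion₂_subset fun x hx => Metric.ball_subset_ball' ?_
    linarith [Metric.mem_closedBall.1 (hS x hx)]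
  have h1 := measureReal_mono (μ := volume) hsub measure_ball_lt_top.ne
  rw [measureReal_biUnion_finset hdisj fun x _ => measurableSet_ball] at h1
  have hb : ∀ (x : E) (t : ℝ), 0 < t → volume.real (Metric.ball x t) =
      t ^ n * volume.real (Metric.ball (0 : E) 1) := by
    intro x t ht
    rw [Measure.real, Measure.addHaar_ball_of_pos _ _ ht, ENNReal.toReal_mul,
      ENNReal.toReal_ofReal (by positivity)]
    rfl
  have hv0 : 0 < volume.real (Metric.ball (0 : E) 1) :=
    ENNReal.toReal_pos (Metric.measure_ball_pos _ _ one_pos).ne' measure_ball_lt_top.ne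
  rw [Finset.sum_congr rfl fun x _ => hb x _ hκ2, hb z _ (by linarith), Finset.sum_const,
    nsmul_eq_mul, ← mul_assoc] at h1
  exact le_of_mul_le_mul_right h1 hv0

end Packing

/-! ### Pushing points along the change of direction. -/

section Push

variable {E : Type} [NormedAddCommGroup E] [InnerProductSpace ℝ E]

open Classical in
/-- The direction of `q`, with the default value `e₀` for `q = 0`. -/
def unitDir (e₀ q : E) : E := if q = 0 then e₀ else ‖q‖⁻¹ • q

theorem norm_unitDir {e₀ : E} (h : ‖e₀‖ = 1) (q : E) : ‖unitDir e₀ q‖ = 1 := by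
  unfold unitDir
  split_ifs with hq
  · exact h
  · rw [norm_smul, norm_inv, norm_norm, inv_mul_cancel₀ (norm_ne_zero_iff.2 hq)]

theorem norm_smul_unitDir (e₀ q : E) : ‖q‖ • unitDir e₀ q = q := by
  unfold unitDir
  split_ifs with hq
  · simp [hq]
  · rw [smul_smul, mul_inv_cancel₀ (norm_ne_zero_iff.2 hq), one_smul]

theorem unitDir_smul_unitDir {e₀ : E} (h : ‖e₀‖ = 1) (q : E) {r : ℝ} (hr : ‖q‖ ≤ r) :
    unitDir e₀ (r • unitDir e₀ q) = unitDir e₀ q := by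
  have hn := norm_unitDir h q
  have hr0 : 0 ≤ r := (norm_nonneg q).trans hr
  have hne : unitDir e₀ q ≠ 0 := by
    intro h0
    rw [h0, norm_zero] at hn
    exact zero_ne_one hn
  by_cases h0 : r = 0
  · have hq : q = 0 := norm_le_zero_iff.1 (hr.trans h0.le)
    simp [h0, hq, unitDir]
  · have hdef : ∀ u, u ≠ 0 → unitDir e₀ u = ‖u‖⁻¹ • u := fun u hu => if_neg hu
    rw [hdef _ (smul_ne_zero h0 hne), norm_smul, hn, Real.norm_of_nonneg hr0, mul_one, smul_smul,
      inv_mul_cancel₀ h0, one_smul]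

/-- Monotonicity of `q ↦ q / ‖q‖`, a subgradient of the norm: the inner product equals `(‖q‖ + ‖q'‖)
* (1 - ⟪e, e'⟫)`. -/
theorem inner_unitDir_sub_nonneg {e₀ : E} (h : ‖e₀‖ = 1) (q q' : E) :
    0 ≤ ⟪q - q', unitDir e₀ q - unitDir e₀ q'⟫ := by
  set e := unitDir e₀ q with he
  set e' := unitDir e₀ q' with he'
  have hn : ‖e‖ = 1 := norm_unitDir h q
  have hn' : ‖e'‖ = 1 := norm_unitDir h q'
  have h1 : q = ‖q‖ • e := (norm_smul_unitDir e₀ q).symm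
  have h2 : q' = ‖q'‖ • e' := (norm_smul_unitDir e₀ q').symm
  have h3 : ⟪q - q', e - e'⟫ = (‖q‖ + ‖q'‖) * (1 - ⟪e, e'⟫) := by
    rw [h1, h2]
    simp only [inner_sub_left, inner_sub_right, real_inner_smul_left, norm_smul, hn, hn',
      real_inner_self_eq_norm_sq, real_inner_comm e e', norm_norm]
    ring
  rw [h3]
  have h4 := real_inner_le_norm e e'
  rw [hn, hn', one_mul] at h4
  exact mul_nonneg (by positivity) (by linarith)

theorem norm_unitDir_sub_mul_le {e₀ : E} (h : ‖e₀‖ = 1) (q q' : E) :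
    ‖unitDir e₀ q - unitDir e₀ q'‖ * ‖q‖ ≤ 2 * ‖q - q'‖ := by
  have hn' : ‖unitDir e₀ q'‖ = 1 := norm_unitDir h q'
  have h1 : ‖q‖ • (unitDir e₀ q - unitDir e₀ q') =
      (q - q') + (‖q'‖ - ‖q‖) • unitDir e₀ q' := by
    rw [smul_sub, norm_smul_unitDir, sub_smul, norm_smul_unitDir]
    abel
  have h2 := congrArg norm h1
  rw [norm_smul, norm_norm] at h2
  have h3 := norm_add_le (q - q') ((‖q'‖ - ‖q‖) • unitDir e₀ q')
  rw [norm_smul, hn', mul_one, Real.norm_eq_abs, abs_sub_comm] at h3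
  have h4 := abs_norm_sub_norm_le q q'
  rw [mul_comm]
  linarith

/-- A vector orthogonal to `w`, positively proportional to the change of the projective coordinate
`ξ / ⟪ξ, w⟫` under translation by `η`. -/
def crossVec (w η ξ : E) : E := ⟪ξ, w⟫ • η - ⟪η, w⟫ • ξ

theorem inner_crossVec (w η ξ : E) : ⟪crossVec w η ξ, w⟫ = 0 := by
  simp only [crossVec, inner_sub_left, real_inner_smul_left]
  ring

theorem crossVec_sub (w η ξ ξ' : E) :
    crossVec w η ξ - crossVec w η ξ' = crossVec w η (ξ - ξ') := by
  simp only [crossVec, inner_sub_left]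
  module

theorem norm_crossVec_le {w η : E} (hw : ‖w‖ = 1) (ξ : E) :
    ‖crossVec w η ξ‖ ≤ 2 * ‖η‖ * ‖ξ‖ := by
  have h1 := abs_real_inner_le_norm ξ w
  have h2 := abs_real_inner_le_norm η w
  rw [hw, mul_one] at h1 h2
  calc ‖crossVec w η ξ‖ ≤ ‖⟪ξ, w⟫ • η‖ + ‖⟪η, w⟫ • ξ‖ := norm_sub_le _ _
    _ = |⟪ξ, w⟫| * ‖η‖ + |⟪η, w⟫| * ‖ξ‖ := by
      rw [norm_smul, norm_smul, Real.norm_eq_abs, Real.norm_eq_abs]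
    _ ≤ ‖ξ‖ * ‖η‖ + ‖η‖ * ‖ξ‖ := by gcongr
    _ = _ := by ring

/-- `⟪ξ, w⟫ • η` is the sum of the cross vector and a multiple of `ξ`. So if the cross vector is
small, that is, `η` is almost parallel to `ξ`, then `⟪η, w⟫` must be comparable to `‖η‖`. -/
theorem le_norm_crossVec_add {w η ξ : E} (hσ : 0 ≤ ⟪η, w⟫) (hτ : 0 ≤ ⟪ξ, w⟫)
    (hξ : ‖ξ‖ ≤ 3 * ⟪ξ, w⟫) : ⟪ξ, w⟫ * ‖η‖ ≤ ‖crossVec w η ξ‖ + 3 * ⟪η, w⟫ * ⟪ξ, w⟫ := by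
  have h1 : ⟪ξ, w⟫ • η = crossVec w η ξ + ⟪η, w⟫ • ξ := by simp [crossVec]
  have h2 := congrArg norm h1
  rw [norm_smul, Real.norm_of_nonneg hτ] at h2
  rw [h2]
  refine (norm_add_le _ _).trans ?_
  rw [norm_smul, Real.norm_of_nonneg hσ]
  have := mul_le_mul_of_nonneg_left hξ hσ
  linarith

/-- Translation by `-t` in the direction of `crossVec w η ξ`. -/
def push (w η e₀ : E) (t : ℝ) (ξ : E) : E := ξ - t • unitDir e₀ (crossVec w η ξ)

theorem inner_unitDir_crossVec {w e₀ : E} (he : ⟪e₀, w⟫ = 0) (η ξ : E) :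
    ⟪unitDir e₀ (crossVec w η ξ), w⟫ = 0 := by
  unfold unitDir
  split_ifs
  · exact he
  · rw [real_inner_smul_left, inner_crossVec, mul_zero]

theorem inner_push {w e₀ : E} (he : ⟪e₀, w⟫ = 0) (η : E) (t : ℝ) (ξ : E) :
    ⟪push w η e₀ t ξ, w⟫ = ⟪ξ, w⟫ := by
  rw [push, inner_sub_left, real_inner_smul_left, inner_unitDir_crossVec he, mul_zero, sub_zero]

theorem norm_push_sub {e₀ : E} (h : ‖e₀‖ = 1) (w η : E) {t : ℝ} (ht : 0 ≤ t) (ξ : E) :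
    ‖push w η e₀ t ξ - ξ‖ = t := by
  rw [push, sub_sub_cancel_left, norm_neg, norm_smul, norm_unitDir h, mul_one,
    Real.norm_of_nonneg ht]

/-- The push preserves the `w`-component and moves the cross vector along its own direction. For `0
≤ ⟪η, w⟫` and forward pushes it only gets longer, so pushes compose additively and the motion stays
straight. -/
theorem crossVec_push {w e₀ : E} (he : ⟪e₀, w⟫ = 0) (η : E) (t : ℝ) (ξ : E) :
    crossVec w η (push w η e₀ t ξ) =
      (‖crossVec w η ξ‖ + ⟪η, w⟫ * t) • unitDir e₀ (crossVec w η ξ) := by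
  have h1 : ∀ e : E, ⟪e, w⟫ = 0 →
      crossVec w η (ξ - t • e) = crossVec w η ξ + (⟪η, w⟫ * t) • e := fun e he => by
    rw [crossVec, crossVec, inner_sub_left, real_inner_smul_left, he]
    module
  rw [push, h1 _ (inner_unitDir_crossVec he η ξ), add_smul, norm_smul_unitDir]

theorem unitDir_crossVec_push {w e₀ η : E} (h : ‖e₀‖ = 1) (he : ⟪e₀, w⟫ = 0) (hσ : 0 ≤ ⟪η, w⟫)
    {t : ℝ} (ht : 0 ≤ t) (ξ : E) : unitDir e₀ (crossVec w η (push w η e₀ t ξ)) =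
      unitDir e₀ (crossVec w η ξ) := by
  rw [crossVec_push he]
  exact unitDir_smul_unitDir h _ (le_add_of_nonneg_right (mul_nonneg hσ ht))

theorem push_push {w e₀ η : E} (h : ‖e₀‖ = 1) (he : ⟪e₀, w⟫ = 0) (hσ : 0 ≤ ⟪η, w⟫)
    {t : ℝ} (ht : 0 ≤ t) (t' : ℝ) (ξ : E) :
    push w η e₀ t' (push w η e₀ t ξ) = push w η e₀ (t' + t) ξ := by
  rw [push, unitDir_crossVec_push h he hσ ht, push, push]
  module

/-- Pushing does not bring points together by more than a constant factor. If `⟪η, w⟫` is comparable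
to `‖η‖`, monotonicity of `unitDir` shows that differences of cross vectors do not shrink, and `ξ -
ξ'` is recovered from them. Otherwise the cross vector at `ξ` is long, its direction varies slowly,
and the two displacements differ by at most half of `‖ξ - ξ'‖`. -/
theorem norm_sub_le_norm_push_sub {w e₀ η : E} (hw : ‖w‖ = 1) (h : ‖e₀‖ = 1) (he : ⟪e₀, w⟫ = 0)
    (hσ : 0 ≤ ⟪η, w⟫) (hη : η ≠ 0) {t : ℝ} (ht : 0 ≤ t) {ξ ξ' : E} (hξ : ‖ξ‖ ≤ 3 * ⟪ξ, w⟫)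
    (hτ : 0 < ⟪ξ, w⟫) (htτ : 16 * t ≤ ⟪ξ, w⟫) :
    ‖ξ - ξ'‖ ≤ 13 * ‖push w η e₀ t ξ - push w η e₀ t ξ'‖ := by
  set q := crossVec w η ξ with hq
  set q' := crossVec w η ξ' with hq'
  set e := unitDir e₀ q with hee
  set e' := unitDir e₀ q' with hee'
  set D := push w η e₀ t ξ - push w η e₀ t ξ' with hD
  have hDe : D = (ξ - ξ') - t • (e - e') := by
    simp only [hD, push, ← hq, ← hq', ← hee, ← hee']
    module
  have hη0 : 0 < ‖η‖ := norm_pos_iff.2 hη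
  rcases le_or_gt ‖η‖ (6 * ⟪η, w⟫) with hcase | hcase
  · have hσ0 : 0 < ⟪η, w⟫ := by linarith
    have hDw : ⟪D, w⟫ = ⟪ξ - ξ', w⟫ := by
      rw [hD, inner_sub_left, inner_push he, inner_push he, inner_sub_left]
    have h1 : crossVec w η D = (q - q') + (⟪η, w⟫ * t) • (e - e') := by
      rw [hq, hq', crossVec_sub, crossVec, crossVec, hDw, hDe]
      module
    have h2 : ‖q - q'‖ ≤ ‖crossVec w η D‖ := by
      rw [h1]
      refine le_of_sq_le_sq ?_ (norm_nonneg _)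
      rw [norm_add_sq_real, inner_smul_right]
      have := mul_nonneg (mul_nonneg hσ ht) (inner_unitDir_sub_nonneg h q q')
      nlinarith [sq_nonneg ‖(⟪η, w⟫ * t) • (e - e')‖]
    have h3 : ⟪η, w⟫ • (ξ - ξ') = ⟪D, w⟫ • η - (q - q') := by
      rw [hq, hq', crossVec_sub, crossVec, hDw]
      abel
    have h4 : ‖crossVec w η D‖ ≤ ‖η‖ * ‖D‖ + ⟪η, w⟫ * ‖D‖ := by
      refine (norm_sub_le _ _).trans ?_
      have h5 := abs_real_inner_le_norm D w
      rw [hw, mul_one] at h5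
      rw [norm_smul, norm_smul, Real.norm_of_nonneg hσ, Real.norm_eq_abs]
      nlinarith
    have h6 : ⟪η, w⟫ * ‖ξ - ξ'‖ ≤ ‖D‖ * ‖η‖ + (‖η‖ * ‖D‖ + ⟪η, w⟫ * ‖D‖) := by
      have := congrArg norm h3
      rw [norm_smul, Real.norm_of_nonneg hσ] at this
      rw [this]
      refine (norm_sub_le _ _).trans (add_le_add ?_ (h2.trans h4))
      have h5 := abs_real_inner_le_norm D w
      rw [hw, mul_one] at h5
      rw [norm_smul, Real.norm_eq_abs]
      gcongr
    have h7 : ⟪η, w⟫ * ‖ξ - ξ'‖ ≤ ⟪η, w⟫ * (13 * ‖D‖) := by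
      nlinarith [mul_le_mul_of_nonneg_right hcase (norm_nonneg D)]
    exact le_of_mul_le_mul_left h7 hσ0
  · have h1 := le_norm_crossVec_add hσ hτ.le hξ
    rw [← hq] at h1
    have h2 : ⟪ξ, w⟫ * ‖η‖ ≤ 2 * ‖q‖ := by nlinarith
    have h3 := norm_unitDir_sub_mul_le h q q'
    rw [← hee, ← hee'] at h3
    have h4 : ‖q - q'‖ ≤ 2 * ‖η‖ * ‖ξ - ξ'‖ := by
      rw [hq, hq', crossVec_sub]
      exact norm_crossVec_le hw _
    have h5 : ‖e - e'‖ * ⟪ξ, w⟫ * ‖η‖ ≤ 8 * ‖ξ - ξ'‖ * ‖η‖ := by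
      nlinarith [mul_le_mul_of_nonneg_left h2 (norm_nonneg (e - e'))]
    have h6 : ‖e - e'‖ * ⟪ξ, w⟫ ≤ 8 * ‖ξ - ξ'‖ := le_of_mul_le_mul_right h5 hη0
    have h7 : t * ‖e - e'‖ ≤ ‖ξ - ξ'‖ / 2 := by
      nlinarith [mul_le_mul_of_nonneg_right htτ (norm_nonneg (e - e'))]
    have h8 : ‖ξ - ξ'‖ ≤ ‖D‖ + t * ‖e - e'‖ := by
      have : ξ - ξ' = D + t • (e - e') := by rw [hDe]; abel
      calc ‖ξ - ξ'‖ = ‖D + t • (e - e')‖ := by rw [← this]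
        _ ≤ _ := by
          refine (norm_add_le _ _).trans ?_
          rw [norm_smul, Real.norm_of_nonneg ht]
    linarith [norm_nonneg D]

end Push

/-! ### Counting points with phase increment near one integer. -/

section Counting

variable {E : Type} [NormedAddCommGroup E] [InnerProductSpace ℝ E] [FiniteDimensional ℝ E]
  [MeasurableSpace E] [BorelSpace E]

/-- Twice the increment under translation by `η` of the support function with respect to `a`. -/
def phaseIncrement (s : E → E) (a η ξ : E) : ℝ :=
  2 * (⟪ξ + η, s (ξ + η)⟫ - ⟪ξ, s ξ⟫ - ⟪η, a⟫)

theorem inv_smul_sub_inv_smul_eq {w η ξ : E} (h₁ : 0 < ⟪ξ, w⟫) (h₂ : 0 < ⟪ξ + η, w⟫) :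
    ⟪ξ + η, w⟫⁻¹ • (ξ + η) - ⟪ξ, w⟫⁻¹ • ξ = (⟪ξ, w⟫ * ⟪ξ + η, w⟫)⁻¹ • crossVec w η ξ := by
  have h3 : ⟪ξ, w⟫ • (ξ + η) - ⟪ξ + η, w⟫ • ξ = crossVec w η ξ := by
    rw [crossVec, inner_add_left]
    module
  rw [← h3, smul_sub, smul_smul, smul_smul]
  congr 2 <;> field_simp

variable {Ω : Set E} {ν s : E → E} {w a : E} {δ c C : ℝ}

theorem IsGaussCone.hasFDerivAt_phaseIncrement (hg : IsGaussCone Ω ν s w δ c C) {ξ η : E}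
    (h₁ : ξ ∈ directionCone w δ) (h₂ : ξ + η ∈ directionCone w δ) :
    HasFDerivAt (phaseIncrement s a η) (innerSL ℝ ((2 : ℝ) • (s (ξ + η) - s ξ))) ξ := by
  have e1 := hg.selection.hasFDerivAt (hg.continuousAt _ h₁)
  have e2 := (hg.selection.hasFDerivAt (hg.continuousAt _ h₂)).comp ξ
    ((hasFDerivAt_id ξ).add_const η)
  refine (((e2.sub e1).sub_const ⟪η, a⟫).const_mul 2).congr_fderiv ?_
  ext v
  simp

theorem IsGaussCone.norm_support_sub_le (hg : IsGaussCone Ω ν s w δ c C) {ξ η : E} {R : ℝ}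
    (hR : 0 < R) (h₁ : ξ ∈ directionCone w δ) (h₂ : ξ + η ∈ directionCone w δ)
    (hτ₁ : R ≤ ⟪ξ, w⟫) (hτ₂ : R ≤ ⟪ξ + η, w⟫) :
    ‖s (ξ + η) - s ξ‖ ≤ C / R ^ 2 * ‖crossVec w η ξ‖ := by
  have hC := hg.C_pos
  refine (hg.lipschitz ξ h₁ _ h₂).trans ?_
  rw [inv_smul_sub_inv_smul_eq (hR.trans_le hτ₁) (hR.trans_le hτ₂), norm_smul, norm_inv,
    Real.norm_of_nonneg (mul_nonneg (hR.le.trans hτ₁) (hR.le.trans hτ₂)), div_eq_mul_inv,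
    mul_assoc]
  gcongr
  rw [pow_two]
  gcongr
  exact hR.le.trans hτ₁

/-- The normalised directions of `ξ` and `ξ + η` differ by a positive multiple of the cross vector.
Strong monotonicity of the support points therefore bounds from below the slope of the phase
increment along the push. -/
theorem IsGaussCone.le_inner_unitDir (hg : IsGaussCone Ω ν s w δ c C) {ξ η e₀ : E} {R : ℝ}
    (hR : 0 < R) (h₁ : ξ ∈ directionCone w δ) (h₂ : ξ + η ∈ directionCone w δ)
    (hτ₁ : 0 < ⟪ξ, w⟫) (hτ₂ : 0 < ⟪ξ + η, w⟫) (hτ₁' : ⟪ξ, w⟫ ≤ R) (hτ₂' : ⟪ξ + η, w⟫ ≤ R) :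
    c / R ^ 2 * ‖crossVec w η ξ‖ ≤ ⟪unitDir e₀ (crossVec w η ξ), s (ξ + η) - s ξ⟫ := by
  have hc := hg.c_pos
  set q := crossVec w η ξ with hq
  set k := ⟪ξ, w⟫ * ⟪ξ + η, w⟫ with hk
  have hk0 : 0 < k := mul_pos hτ₁ hτ₂
  have hkR : k ≤ R ^ 2 := by rw [pow_two]; exact mul_le_mul hτ₁' hτ₂' hτ₂.le hR.le
  by_cases hq0 : q = 0
  · have h3 := hg.lipschitz ξ h₁ _ h₂
    rw [inv_smul_sub_inv_smul_eq hτ₁ hτ₂, ← hq, hq0, smul_zero, norm_zero, mul_zero] at h3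
    rw [norm_le_zero_iff.1 h3, hq0, norm_zero, mul_zero, inner_zero_right]
  have hqn : 0 < ‖q‖ := norm_pos_iff.2 hq0
  have h3 := hg.monotone ξ h₁ _ h₂
  rw [inv_smul_sub_inv_smul_eq hτ₁ hτ₂, ← hq, norm_smul, norm_inv, ← hk,
    Real.norm_of_nonneg hk0.le, real_inner_smul_left] at h3
  have h4 : unitDir e₀ q = ‖q‖⁻¹ • q := if_neg hq0
  rw [h4, real_inner_smul_left]
  have h5 : c * (k⁻¹ * ‖q‖) ^ 2 * k = (c / k * ‖q‖) * ‖q‖ := by field_simp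
  have h6 : c / k * ‖q‖ ≤ ‖q‖⁻¹ * ⟪q, s (ξ + η) - s ξ⟫ := by
    rw [le_inv_mul_iff₀ hqn]
    calc ‖q‖ * (c / k * ‖q‖) = c * (k⁻¹ * ‖q‖) ^ 2 * k := by rw [h5]; ring
      _ ≤ (k⁻¹ * ⟪q, s (ξ + η) - s ξ⟫) * k := mul_le_mul_of_nonneg_right h3 hk0.le
      _ = _ := by field_simp
  refine le_trans ?_ h6
  gcongr

/-- Integrates the slope along the straight push, where the cross vector has length `‖q‖ + ⟪η, w⟫ *
t`. The quadratic term still gives a decrease when the cross vector vanishes at the start, provided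
`⟪η, w⟫ > 0`. -/
theorem IsGaussCone.phaseIncrement_push_add_le (hg : IsGaussCone Ω ν s w δ c C) {ξ η e₀ : E}
    (h : ‖e₀‖ = 1) (he : ⟪e₀, w⟫ = 0) (hσ : 0 ≤ ⟪η, w⟫) {R T : ℝ} (hR : 0 < R) (hT : 0 ≤ T)
    (hτ₁ : 0 < ⟪ξ, w⟫) (hτ₂ : ⟪ξ + η, w⟫ ≤ R)
    (hcone : ∀ t ∈ Icc 0 T, push w η e₀ t ξ ∈ directionCone w δ ∧
      push w η e₀ t ξ + η ∈ directionCone w δ) :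
    phaseIncrement s a η (push w η e₀ T ξ) +
      c / R ^ 2 * (2 * ‖crossVec w η ξ‖ * T + ⟪η, w⟫ * T ^ 2) ≤ phaseIncrement s a η ξ := by
  set q := crossVec w η ξ with hq
  set e := unitDir e₀ q with hee
  let G : ℝ → ℝ := fun t => phaseIncrement s a η (push w η e₀ t ξ) +
    c / R ^ 2 * (2 * ‖q‖ * t + ⟪η, w⟫ * t ^ 2)
  have hd : ∀ t ∈ Icc 0 T, HasDerivAt G (⟪(2 : ℝ) • (s (push w η e₀ t ξ + η) -
      s (push w η e₀ t ξ)), -e⟫ + c / R ^ 2 * (2 * ‖q‖ + 2 * ⟪η, w⟫ * t)) t := by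
    intro t ht
    have h1 : HasDerivAt (fun t => push w η e₀ t ξ) (-e) t := by
      have := ((hasDerivAt_id t).smul_const e).const_sub ξ
      simpa using! this
    have h2 := (hg.hasFDerivAt_phaseIncrement (a := a) (hcone t ht).1
      (hcone t ht).2).comp_hasDerivAt t h1
    have h3 : HasDerivAt (fun t : ℝ => c / R ^ 2 * (2 * ‖q‖ * t + ⟪η, w⟫ * t ^ 2))
        (c / R ^ 2 * (2 * ‖q‖ + 2 * ⟪η, w⟫ * t)) t := by
      refine ((((hasDerivAt_id t).const_mul (2 * ‖q‖)).add
        ((hasDerivAt_pow 2 t).const_mul ⟪η, w⟫)).const_mul (c / R ^ 2)).congr_deriv ?_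
      simp only [Nat.cast_ofNat, Nat.add_one_sub_one, pow_one, mul_one]
      ring
    exact h2.add h3
  have hanti : AntitoneOn G (Icc 0 T) := by
    refine antitoneOn_of_deriv_nonpos (convex_Icc 0 T)
      (fun t ht => (hd t ht).continuousAt.continuousWithinAt)
      (fun t ht => (hd t (interior_subset ht)).differentiableAt.differentiableWithinAt) ?_
    intro t ht
    have ht' := interior_subset ht
    rw [(hd t ht').deriv]
    have e1 : ⟪push w η e₀ t ξ + η, w⟫ = ⟪ξ + η, w⟫ := by
      rw [inner_add_left, inner_push he, ← inner_add_left]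
    have e2 : ⟪ξ, w⟫ ≤ ⟪ξ + η, w⟫ := by rw [inner_add_left]; linarith
    have h4 := hg.le_inner_unitDir (e₀ := e₀) hR (hcone t ht').1 (hcone t ht').2
      (by rw [inner_push he]; exact hτ₁) (by rw [e1]; linarith)
      (by rw [inner_push he]; linarith) (by rw [e1]; linarith)
    rw [unitDir_crossVec_push h he hσ ht'.1, crossVec_push he, norm_smul,
      norm_unitDir h, mul_one, ← hq, ← hee,
      Real.norm_of_nonneg (add_nonneg (norm_nonneg _) (mul_nonneg hσ ht'.1))] at h4
    rw [inner_neg_right, real_inner_smul_left, real_inner_comm]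
    linarith
  have h5 := hanti (left_mem_Icc.2 hT) (right_mem_Icc.2 hT) hT
  have h6 : push w η e₀ 0 ξ = ξ := by simp [push]
  simp only [G, h6] at h5
  linarith

theorem IsGaussCone.abs_phaseIncrement_sub_le (hg : IsGaussCone Ω ν s w δ c C) {ξ ζ η : E}
    {R : ℝ} (hR : 0 < R) {W : Set E} (hW : Convex ℝ W)
    (hWc : ∀ x ∈ W, x ∈ directionCone w δ ∧ x + η ∈ directionCone w δ ∧ R ≤ ⟪x, w⟫ ∧
      R ≤ ⟪x + η, w⟫) (hξ : ξ ∈ W) (hζ : ζ ∈ W) :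
    |phaseIncrement s a η ξ - phaseIncrement s a η ζ| ≤
      2 * C / R ^ 2 * (‖crossVec w η ζ‖ + 2 * ‖η‖ * ‖ξ - ζ‖) * ‖ξ - ζ‖ := by
  have hC := hg.C_pos
  have hseg : segment ℝ ζ ξ ⊆ W := hW.segment_subset hζ hξ
  refine (convex_segment ζ ξ).norm_image_sub_le_of_norm_hasFDerivWithin_le
    (f := phaseIncrement s a η) (fun x hx => (hg.hasFDerivAt_phaseIncrement (hWc x (hseg hx)).1
      (hWc x (hseg hx)).2.1).hasFDerivWithinAt) (fun x hx => ?_)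
    (left_mem_segment ℝ ζ ξ) (right_mem_segment ℝ ζ ξ)
  obtain ⟨h1, h2, h3, h4⟩ := hWc x (hseg hx)
  rw [innerSL_apply_norm, norm_smul, Real.norm_two]
  have h5 := hg.norm_support_sub_le hR h1 h2 h3 h4
  have h6 : ‖crossVec w η x‖ ≤ ‖crossVec w η ζ‖ + 2 * ‖η‖ * ‖ξ - ζ‖ := by
    have e1 : crossVec w η x = crossVec w η ζ + crossVec w η (x - ζ) := by
      rw [← crossVec_sub]; abel
    rw [e1]
    refine (norm_add_le _ _).trans (add_le_add le_rfl ?_)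
    refine (norm_crossVec_le hg.norm_eq _).trans ?_
    have : ‖x - ζ‖ ≤ ‖ξ - ζ‖ := by
      rw [segment_eq_image'] at hx
      obtain ⟨θ, hθ, rfl⟩ := hx
      rw [add_sub_cancel_left, norm_smul, Real.norm_of_nonneg hθ.1]
      exact mul_le_of_le_one_left (norm_nonneg _) hθ.2
    gcongr
  calc 2 * ‖s (x + η) - s x‖ ≤ 2 * (C / R ^ 2 * ‖crossVec w η x‖) := by gcongr
    _ ≤ 2 * (C / R ^ 2 * (‖crossVec w η ζ‖ + 2 * ‖η‖ * ‖ξ - ζ‖)) := by gcongr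
    _ = _ := by ring

/-- A push of length at least `l` lowers the phase increment by more than the window `2 * ε` plus
its variation on a ball of radius `1 / 2`, so no pushed point returns near `S`. Pushing `S` by all
multiples of `l` up to `R` thus produces about `R / l` copies that are separated from each other,
all within a ball of radius `2 * R`. -/
theorem IsGaussCone.card_mul_le (hg : IsGaussCone Ω ν s w δ c C) {η e₀ z : E} (h : ‖e₀‖ = 1)
    (he : ⟪e₀, w⟫ = 0) (hσ : 0 ≤ ⟪η, w⟫) {c₁ c₂ R B ε l m : ℝ} (hc₁ : 0 < c₁) (hη₁ : c₁ ≤ ‖η‖)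
    (hη₂ : ‖η‖ ≤ c₂) (hR : 1 ≤ R) (hB : 0 < B) (hl0 : 0 < l)
    (hW : ∀ x ∈ Metric.closedBall z (2 * R), x ∈ directionCone w δ ∧ x + η ∈ directionCone w δ ∧
      16 * R ≤ ⟪x, w⟫ ∧ ⟪x + η, w⟫ ≤ B * R)
    (hl₁ : 2 * B ^ 2 * C ≤ c * l) (hl₂ : 6 * B ^ 2 * (2 * ε * R ^ 2 + C * c₂) < c * c₁ * l ^ 2)
    {S : Finset E} (hS : ∀ x ∈ S, x ∈ Metric.closedBall z R)
    (hsep : ∀ x ∈ S, ∀ y ∈ S, x ≠ y → 1 ≤ dist x y)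
    (hm : ∀ x ∈ S, |phaseIncrement s a η x - m| ≤ ε) :
    (S.card : ℝ) * (R / l) ≤ (156 * R) ^ Module.finrank ℝ E := by
  classical
  have hR0 : 0 < R := by linarith
  have hC := hg.C_pos
  have hc := hg.c_pos
  have hη0 : η ≠ 0 := norm_pos_iff.1 (hc₁.trans_le hη₁)
  have hc₂ : 0 ≤ c₂ := (norm_nonneg _).trans hη₂
  have hsub : Metric.closedBall z R ⊆ Metric.closedBall z (2 * R) :=
    Metric.closedBall_subset_closedBall (by linarith)
  have hpushW : ∀ x ∈ S, ∀ t, 0 ≤ t → t ≤ R →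
      push w η e₀ t x ∈ Metric.closedBall z (2 * R) := by
    intro x hx t ht htR
    have h1 := hS x hx
    rw [Metric.mem_closedBall, dist_eq_norm] at h1 ⊢
    have h2 : push w η e₀ t x - z = (push w η e₀ t x - x) + (x - z) := by abel
    rw [h2]
    refine (norm_add_le _ _).trans ?_
    rw [norm_push_sub h w η ht]
    linarith
  have hexp : ∀ x ∈ Metric.closedBall z (2 * R), ∀ y, ∀ t, 0 ≤ t → t ≤ R →
      ‖x - y‖ ≤ 13 * ‖push w η e₀ t x - push w η e₀ t y‖ := by
    intro x hx y t ht htR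
    obtain ⟨h1, -, h2, -⟩ := hW x hx
    have h3 := directionCone_bounds hg.norm_eq hg.δ_le h1
    exact norm_sub_le_norm_push_sub hg.norm_eq h he hσ hη0 ht h3.2.1 h3.1 (by linarith)
  have hnear : ∀ x ∈ S, ∀ y ∈ S, ∀ t, l ≤ t → t ≤ R →
      1 / 2 < ‖x - push w η e₀ t y‖ := by
    intro x hx y hy t hlt htR
    have ht : 0 < t := hl0.trans_le hlt
    by_contra hcon
    push Not at hcon
    set ζ := push w η e₀ t y with hζ
    obtain ⟨hy1, hy2, hy3, hy4⟩ := hW y (hsub (hS y hy))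
    have hgap := hg.phaseIncrement_push_add_le (a := a) (ξ := y) (η := η) h he hσ
      (R := B * R) (by positivity) ht.le (by linarith) hy4 (fun r hr => by
        have := hW _ (hpushW y hy r hr.1 (hr.2.trans htR))
        exact ⟨this.1, this.2.1⟩)
    have hlip := hg.abs_phaseIncrement_sub_le (a := a) (η := η) hR0
      (convex_closedBall z (2 * R)) (fun u hu => by
        obtain ⟨h1, h2, h3, h4⟩ := hW u hu
        refine ⟨h1, h2, by linarith, ?_⟩
        rw [inner_add_left]
        linarith) (hsub (hS x hx)) (hpushW y hy t ht.le htR)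
    rw [← hζ] at hgap hlip
    set Q := ‖crossVec w η ζ‖ with hQ
    have hQe : Q = ‖crossVec w η y‖ + ⟪η, w⟫ * t := by
      rw [hQ, hζ, crossVec_push he, norm_smul, norm_unitDir h, mul_one,
        Real.norm_of_nonneg (add_nonneg (norm_nonneg _) (mul_nonneg hσ ht.le))]
    have hQ0 : 0 ≤ Q := norm_nonneg _
    have hqy := norm_nonneg (crossVec w η y)
    have hyb := directionCone_bounds hg.norm_eq hg.δ_le hy1
    -- Either the initial cross vector is long, or `⟪η, w⟫` is bounded below and the push itself has
    -- lengthened it.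
    have hQt : c₁ * t ≤ 3 * Q := by
      have h1 := le_norm_crossVec_add hσ hyb.1.le hyb.2.1
      have h2 : ⟪y, w⟫ * c₁ ≤ ⟪y, w⟫ * ‖η‖ := mul_le_mul_of_nonneg_left hη₁ hyb.1.le
      have h3 : t ≤ ⟪y, w⟫ := by linarith
      have h4 : ⟪y, w⟫ * (c₁ * t) ≤ ⟪y, w⟫ * (3 * Q) := by
        rw [hQe]
        nlinarith [mul_le_mul_of_nonneg_right (h2.trans h1) ht.le,
          mul_le_mul_of_nonneg_right h3 hqy]
      exact le_of_mul_le_mul_left h4 hyb.1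
    have hgap' : c / (B * R) ^ 2 * (Q * t) ≤
        phaseIncrement s a η y - phaseIncrement s a η ζ := by
      have h1 : Q * t ≤ 2 * ‖crossVec w η y‖ * t + ⟪η, w⟫ * t ^ 2 := by
        rw [hQe]
        nlinarith [mul_nonneg hqy ht.le]
      have h2 := mul_le_mul_of_nonneg_left h1 (by positivity : 0 ≤ c / (B * R) ^ 2)
      linarith
    have hlip' : |phaseIncrement s a η x - phaseIncrement s a η ζ| ≤ C / R ^ 2 * (Q + c₂) := by
      refine hlip.trans ?_
      have h1 : (Q + 2 * ‖η‖ * ‖x - ζ‖) * ‖x - ζ‖ ≤ (Q + c₂) * (1 / 2) := by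
        have : 2 * ‖η‖ * ‖x - ζ‖ ≤ c₂ := by
          nlinarith [norm_nonneg η, norm_nonneg (x - ζ)]
        exact mul_le_mul (by linarith) hcon (norm_nonneg _) (by positivity)
      calc _ = 2 * C / R ^ 2 * ((Q + 2 * ‖η‖ * ‖x - ζ‖) * ‖x - ζ‖) := by ring
        _ ≤ 2 * C / R ^ 2 * ((Q + c₂) * (1 / 2)) := by gcongr
        _ = _ := by ring
    have hx' := abs_le.1 (hm x hx)
    have hy' := abs_le.1 (hm y hy)
    have hl' := abs_le.1 hlip'
    have htot : c / (B * R) ^ 2 * (Q * t) ≤ 2 * ε + C / R ^ 2 * (Q + c₂) := by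
      linarith [hl'.1, hl'.2, hx'.1, hx'.2, hy'.1, hy'.2]
    have htot' : c * (Q * t) ≤ B ^ 2 * (2 * ε * R ^ 2 + C * (Q + c₂)) := by
      have h1 := mul_le_mul_of_nonneg_left htot (by positivity : 0 ≤ (B * R) ^ 2)
      have e1 : (B * R) ^ 2 * (c / (B * R) ^ 2 * (Q * t)) = c * (Q * t) := by field_simp
      have e2 : (B * R) ^ 2 * (2 * ε + C / R ^ 2 * (Q + c₂)) =
          B ^ 2 * (2 * ε * R ^ 2 + C * (Q + c₂)) := by field_simp
      rwa [e1, e2] at h1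
    -- `hl₁` absorbs the variation proportional to `Q` into half of the decrease; what remains
    -- contradicts `hl₂` through the lower bound for `Q * t`.
    have h3 : 2 * B ^ 2 * C * Q ≤ c * (Q * t) := by
      have := mul_le_mul_of_nonneg_right (hl₁.trans (mul_le_mul_of_nonneg_left hlt hc.le)) hQ0
      linarith
    have h4 : c * c₁ * l ^ 2 ≤ 3 * (c * (Q * t)) := by
      have h5 : l ^ 2 ≤ t ^ 2 := by gcongr
      calc c * c₁ * l ^ 2 ≤ c * c₁ * t ^ 2 := by gcongr
        _ = c * t * (c₁ * t) := by ring
        _ ≤ c * t * (3 * Q) := by gcongr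
        _ = _ := by ring
    linarith
  set K := ⌊R / l⌋₊ with hK
  have hkR : ∀ k : ℕ, k < K + 1 → (k : ℝ) * l ≤ R := by
    intro k hk
    have h1 : (k : ℝ) ≤ R / l :=
      (Nat.le_floor_iff (by positivity)).1 (Nat.lt_succ_iff.1 hk)
    rwa [le_div_iff₀ hl0] at h1
  let f : E × ℕ → E := fun p => push w η e₀ (p.2 * l) p.1
  -- The common push by `k * l` is removed at the cost of the factor 13. What is left is a distance
  -- of at least `1 / 2`, by `hnear` if `j > 0` and by separation of `S` if `j = 0`; hence `1 / 26`.
  have hlt : ∀ x ∈ S, ∀ y ∈ S, ∀ k j : ℕ, k + j < K + 1 → (x, k) ≠ (y, k + j) →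
      (1 / 26 : ℝ) ≤ dist (f (x, k)) (f (y, k + j)) := by
    intro x hx y hy k j hkj hne
    have hk0 : 0 ≤ (k : ℝ) * l := by positivity
    have h1 : f (y, k + j) = push w η e₀ (k * l) (push w η e₀ (j * l) y) := by
      rw [push_push h he hσ (by positivity)]
      simp only [f]
      push_cast
      ring_nf
    have h2 := hexp x (hsub (hS x hx)) (push w η e₀ (j * l) y) (k * l) hk0
      (hkR k (by omega))
    rw [dist_eq_norm, h1]
    change _ ≤ ‖push w η e₀ (k * l) x - _‖
    have h3 : 1 / 2 ≤ ‖x - push w η e₀ (j * l) y‖ := by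
      rcases Nat.eq_zero_or_pos j with hj | hj
      · subst hj
        have hxy : x ≠ y := by
          rintro rfl
          exact hne rfl
        have := hsep x hx y hy hxy
        rw [dist_eq_norm] at this
        simp only [Nat.cast_zero, zero_mul, push, zero_smul, sub_zero]
        linarith
      · refine (hnear x hx y hy _ ?_ (hkR j (by omega))).le
        exact le_mul_of_one_le_left hl0.le (by exact_mod_cast hj)
    linarith
  have hfsep : ∀ p ∈ S ×ˢ Finset.range (K + 1), ∀ p' ∈ S ×ˢ Finset.range (K + 1), p ≠ p' →
      (1 / 26 : ℝ) ≤ dist (f p) (f p') := by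
    rintro ⟨x, k⟩ hp ⟨y, k'⟩ hp' hne
    rw [Finset.mem_product, Finset.mem_range] at hp hp'
    rcases le_total k k' with hkk | hkk
    · obtain ⟨j, rfl⟩ := Nat.exists_eq_add_of_le hkk
      exact hlt x hp.1 y hp'.1 k j hp'.2 hne
    · obtain ⟨j, rfl⟩ := Nat.exists_eq_add_of_le hkk
      rw [dist_comm]
      exact hlt y hp'.1 x hp.1 k' j hp.2 hne.symm
  have hinj : Set.InjOn f (S ×ˢ Finset.range (K + 1) : Finset (E × ℕ)) := by
    intro p hp p' hp' heq
    by_contra hne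
    have := hfsep p hp p' hp' hne
    rw [heq, dist_self] at this
    norm_num at this
  have hcard := card_mul_pow_le_of_separated (S := (S ×ˢ Finset.range (K + 1)).image f) (z := z)
    (r := 2 * R) (κ := 1 / 26) (by positivity) (by norm_num) (by
      intro u hu
      obtain ⟨p, hp, rfl⟩ := Finset.mem_image.1 hu
      rw [Finset.mem_product, Finset.mem_range] at hp
      exact hpushW p.1 hp.1 _ (by positivity) (hkR p.2 hp.2)) (by
      intro u hu v hv huv
      obtain ⟨p, hp, rfl⟩ := Finset.mem_image.1 hu
      obtain ⟨p', hp', rfl⟩ := Finset.mem_image.1 hv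
      exact hfsep p hp p' hp' fun hpp => huv (by rw [hpp]))
  rw [Finset.card_image_of_injOn hinj, Finset.card_product, Finset.card_range] at hcard
  have hKR : R / l ≤ K + 1 := (Nat.lt_floor_add_one _).le
  push_cast at hcard
  set n := Module.finrank ℝ E
  -- `156 = 3 * 52`: disjoint balls of radius `1 / 52` inside one of radius at most `3 * R`.
  have h1 : (S.card : ℝ) * (K + 1) ≤ (156 * R) ^ n := by
    have h2 : (2 * R + 1 / 26 / 2) ^ n ≤ (3 * R) ^ n := by
      gcongr
      linarith
    have h3 : (156 * R) ^ n * (1 / 26 / 2) ^ n = (3 * R) ^ n := by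
      rw [← mul_pow]
      congr 1
      ring
    have h4 : (0 : ℝ) < (1 / 26 / 2) ^ n := by positivity
    refine le_of_mul_le_mul_right ?_ h4
    rw [h3]
    exact hcard.trans h2
  exact (mul_le_mul_of_nonneg_left hKR (Nat.cast_nonneg _)).trans h1

end Counting

/-! ### Cardinality of separated sets of zero pairs. -/

section Entropy

variable {E : Type} [NormedAddCommGroup E] [InnerProductSpace ℝ E] [FiniteDimensional ℝ E]
  [MeasurableSpace E] [BorelSpace E]

theorem mem_directionCone_of_dist_le {w ξ : E} {δ A R : ℝ} (hAR : 0 < A * R)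
    (h : ‖ξ - (A * R) • w‖ ≤ δ * (A * R)) : ξ ∈ directionCone w δ := ⟨A * R, hAR, h⟩

variable {Ω : Set E} {ν s : E → E} {w a : E} {δ c C p : ℝ}

theorem IsSupportSelection.abs_phaseIncrement_le (hs : IsSupportSelection Ω s) {D : ℝ}
    (hD : ∀ x ∈ Ω, ‖x‖ ≤ D) (a η ξ : E) :
    |phaseIncrement s a η ξ| ≤ 2 * ‖η‖ * (D + ‖a‖) := by
  have h1 := (hs ξ).2 _ (hs (ξ + η)).1
  have h2 := (hs (ξ + η)).2 _ (hs ξ).1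
  rw [inner_add_left] at h2
  have hb : ∀ x ∈ Ω, |⟪η, x⟫| ≤ ‖η‖ * D := fun x hx =>
    (abs_real_inner_le_norm _ _).trans (mul_le_mul_of_nonneg_left (hD x hx) (norm_nonneg _))
  have h3 := abs_le.1 (hb _ (hs ξ).1)
  have h4 := abs_le.1 (hb _ (hs (ξ + η)).1)
  have h5 := abs_le.1 (abs_real_inner_le_norm η a)
  have h6 : ⟪ξ + η, s (ξ + η)⟫ = ⟪ξ, s (ξ + η)⟫ + ⟪η, s (ξ + η)⟫ := inner_add_left _ _ _
  rw [phaseIncrement, abs_le]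
  constructor <;> nlinarith

/-- A finite set of `1`-separated points `ξ` of the ball such that `ξ` and `ξ + η` are zeros. -/
structure IsZeroConfiguration (Ω : Set E) (B : Set E) (η : E) (S : Finset E) : Prop where
  mem : ∀ ξ ∈ S, ξ ∈ B
  add_mem : ∀ ξ ∈ S, ξ + η ∈ B
  zero : ∀ ξ ∈ S, cutTransform Ω (fun _ => 1) ξ = 0
  add_zero : ∀ ξ ∈ S, cutTransform Ω (fun _ => 1) (ξ + η) = 0
  separated : ∀ ξ ∈ S, ∀ ζ ∈ S, ξ ≠ ζ → 1 ≤ dist ξ ζ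

/-- The phase increment is bounded, so boundedly many integers are approached. For each of them the
push length `l` of order `R ^ (1 - p / 2)` is admissible and leaves at most a constant times `R ^ (n
- 1) * l` points. -/
theorem IsGaussCone.exists_card_le_of_inner_nonneg (hg : IsGaussCone Ω ν s w δ c C)
    (hcpt : IsCompact Ω) (hdim : 2 ≤ Module.finrank ℝ E) (hp0 : 0 ≤ p) (hp2 : p ≤ 2)
    (hph : HasPhaseBound Ω s w δ a p) {c₁ c₂ : ℝ} (hc₁ : 0 < c₁) (hc : c₁ ≤ c₂) :
    ∃ K : ℝ, 0 < K ∧ ∀ R : ℝ, 1 ≤ R → ∀ η : E, c₁ ≤ ‖η‖ → ‖η‖ ≤ c₂ → 0 ≤ ⟪η, w⟫ →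
      ∀ S : Finset E, IsZeroConfiguration Ω (Metric.closedBall ((20 / δ * R) • w) R) η S →
        (S.card : ℝ) ≤ K * R ^ ((Module.finrank ℝ E : ℝ) - p / 2) := by
  have hw := hg.norm_eq
  have hC := hg.C_pos
  have hc0 := hg.c_pos
  have hδ := hg.δ_pos
  have hδ2 := hg.δ_le
  have hc₂ : 0 < c₂ := hc₁.trans_le hc
  set n := Module.finrank ℝ E with hn
  have hn2 : (2 : ℝ) ≤ n := by exact_mod_cast hdim
  -- The default push direction for a vanishing cross vector; a unit vector orthogonal to `w` exists
  -- since the dimension is at least 2.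
  obtain ⟨e₀, he₀, he₀n⟩ : ∃ e₀ : E, ⟪e₀, w⟫ = 0 ∧ ‖e₀‖ = 1 := by
    have h1 : (ℝ ∙ w)ᗮ ≠ ⊥ := by
      intro h
      have h2 := (Submodule.orthogonal_eq_bot_iff (K := ℝ ∙ w)).1 h
      have h3 := finrank_span_singleton (K := ℝ) (v := w) (by
        rintro rfl
        simp at hw)
      rw [h2, finrank_top] at h3
      omega
    obtain ⟨v, hv, hv0⟩ := Submodule.exists_mem_ne_zero_of_ne_bot h1
    refine ⟨‖v‖⁻¹ • v, ?_, ?_⟩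
    · rw [real_inner_smul_left, Submodule.mem_orthogonal_singleton_iff_inner_left.1 hv, mul_zero]
    · rw [norm_smul, norm_inv, norm_norm, inv_mul_cancel₀ (norm_ne_zero_iff.2 hv0)]
  obtain ⟨Cp, T, hCp, hphase⟩ := hph c₂
  obtain ⟨D, hD⟩ := hcpt.isBounded.exists_norm_le
  -- At height `A * R` the cone has room for the ball of radius `2 * R` of pushed points and a
  -- further translation by `‖η‖ ≤ R`, and all these points have `w`-component at least `16 * R`.
  set A := 20 / δ with hA
  have hAδ : δ * A = 20 := by rw [hA]; field_simp
  have hA40 : 40 ≤ A := by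
    rw [hA, le_div_iff₀ hδ]
    linarith
  set B := A + 3 with hB
  set X := 6 * B ^ 2 * (2 * Cp + C * c₂) with hX
  have hX0 : 0 ≤ X := by positivity
  -- The second summand serves `hl₁`, the third `hl₂`, and the first makes the latter strict and `M
  -- ≤ M ^ 2`.
  set M := 1 + 2 * B ^ 2 * C / c + X / (c * c₁) with hM
  have hM1 : 1 ≤ M := by
    have h1 : 0 ≤ 2 * B ^ 2 * C / c := by positivity
    have h2 : 0 ≤ X / (c * c₁) := by positivity
    linarith
  set N := ⌈2 * c₂ * (|D| + ‖a‖) + Cp⌉₊ with hN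
  -- Radii below `R₁` are covered by plain packing, which is the first summand of the constant.
  set R₁ := max 1 (max c₂ T) with hR₁
  have hR₁1 : 1 ≤ R₁ := le_max_left _ _
  refine ⟨(4 * R₁) ^ n + (2 * N + 1) * (156 ^ n * M), by positivity, ?_⟩
  intro R hR η hη₁ hη₂ hσ S hS
  have hR0 : 0 < R := by linarith
  have hpow0 : 0 < R ^ ((n : ℝ) - p / 2) := Real.rpow_pos_of_pos hR0 _
  rcases lt_or_ge R R₁ with hRR | hRR
  · have h1 := card_mul_pow_le_of_separated hR0.le one_pos hS.mem hS.separated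
    have h2 : (S.card : ℝ) ≤ (4 * R₁) ^ n := by
      have h3 : (0 : ℝ) < (1 / 2) ^ n := by positivity
      refine le_of_mul_le_mul_right (h1.trans ?_) h3
      rw [← mul_pow]
      gcongr
      linarith
    have h3 : 1 ≤ R ^ ((n : ℝ) - p / 2) := Real.one_le_rpow hR (by linarith)
    have h4 : 0 ≤ (2 * N + 1) * (156 ^ n * M) := by positivity
    calc (S.card : ℝ) ≤ (4 * R₁) ^ n * 1 := by rw [mul_one]; exact h2
      _ ≤ _ := by
        gcongr
        linarith
  · have hRc₂ : c₂ ≤ R := ((le_max_left _ _).trans (le_max_right _ _)).trans hRR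
    have hRT : T ≤ R := ((le_max_right _ _).trans (le_max_right _ _)).trans hRR
    set z := (A * R) • w with hz
    have hAR : 0 < A * R := by positivity
    have hcone : ∀ x : E, ‖x - z‖ ≤ 3 * R → x ∈ directionCone w δ := fun x hx => by
      refine mem_directionCone_of_dist_le hAR (hx.trans ?_)
      rw [← mul_assoc, hAδ]
      linarith
    have hinner : ∀ x : E, ∀ k : ℝ, ‖x - z‖ ≤ k → A * R - k ≤ ⟪x, w⟫ ∧ ⟪x, w⟫ ≤ A * R + k := by
      intro x k hx
      have h1 := abs_real_inner_le_norm (x - z) w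
      rw [hw, mul_one] at h1
      have h2 : ⟪x - z, w⟫ = ⟪x, w⟫ - A * R := by
        rw [hz, inner_sub_left, real_inner_smul_left, real_inner_self_eq_norm_sq, hw]
        ring
      rw [h2] at h1
      have h3 := abs_le.1 (h1.trans hx)
      constructor <;> linarith [h3.1, h3.2]
    have h40 : 40 * R ≤ A * R := by gcongr
    have hW : ∀ x ∈ Metric.closedBall z (2 * R), x ∈ directionCone w δ ∧
        x + η ∈ directionCone w δ ∧ 16 * R ≤ ⟪x, w⟫ ∧ ⟪x + η, w⟫ ≤ B * R := by
      intro x hx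
      rw [Metric.mem_closedBall, dist_eq_norm] at hx
      have h1 : ‖x + η - z‖ ≤ 3 * R := by
        rw [add_sub_right_comm]
        refine (norm_add_le _ _).trans ?_
        linarith
      refine ⟨hcone x (by linarith), hcone _ h1, ?_, ?_⟩
      · linarith [(hinner x _ hx).1]
      · rw [hB, add_mul]
        exact (hinner _ _ h1).2
    have hbR : ∀ x ∈ S, x ∈ Metric.closedBall z (2 * R) := fun x hx =>
      Metric.closedBall_subset_closedBall (by linarith) (hS.mem x hx)
    have hchoice : ∀ x ∈ S, ∃ m : ℤ, |phaseIncrement s a η x - m| ≤ Cp * R ^ (-p) := by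
      intro x hx
      obtain ⟨h1, h2, h3, -⟩ := hW x (hbR x hx)
      obtain ⟨m, hm⟩ := hphase x η hη₂ (by linarith) h1 h2 (hS.zero x hx) (hS.add_zero x hx)
      refine ⟨m, hm.trans ?_⟩
      have := Real.rpow_le_rpow_of_nonpos hR0 (by linarith : R ≤ ⟪x, w⟫) (by linarith : -p ≤ 0)
      gcongr
    choose! m hm using hchoice
    have hRp : R ^ (-p) ≤ 1 := Real.rpow_le_one_of_one_le_of_nonpos hR (by linarith)
    have hmN : ∀ x ∈ S, m x ∈ Finset.Icc (-(N : ℤ)) N := by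
      intro x hx
      have h1 := hg.selection.abs_phaseIncrement_le (D := |D|)
        (fun y hy => (hD y hy).trans (le_abs_self D)) a η x
      have h2 : |(m x : ℝ)| ≤ 2 * c₂ * (|D| + ‖a‖) + Cp := by
        have h3 : (m x : ℝ) = phaseIncrement s a η x - (phaseIncrement s a η x - m x) := by ring
        rw [h3]
        refine (abs_sub _ _).trans (add_le_add (h1.trans (by gcongr)) ((hm x hx).trans ?_))
        exact mul_le_of_le_one_right hCp hRp
      have h4 : |(m x : ℝ)| ≤ N := h2.trans (Nat.le_ceil _)
      rw [Finset.mem_Icc]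
      have h5 := abs_le.1 h4
      exact ⟨by exact_mod_cast h5.1, by exact_mod_cast h5.2⟩
    -- Chosen so that `l ^ 2 / R ^ 2`, the decrease under a push, is a large multiple of the window
    -- `R ^ (-p)`.
    set l := M * R ^ (1 - p / 2) with hl
    have hRl : 1 ≤ R ^ (1 - p / 2) := Real.one_le_rpow hR (by linarith)
    have hl0 : 0 < l := by positivity
    have hl₁ : 2 * B ^ 2 * C ≤ c * l := by
      have h1 : 2 * B ^ 2 * C / c ≤ M := by
        have : 0 ≤ X / (c * c₁) := by positivity
        linarith
      rw [div_le_iff₀ hc0] at h1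
      have h2 : M ≤ l := le_mul_of_one_le_right (by positivity) hRl
      calc _ ≤ M * c := h1
        _ ≤ l * c := by gcongr
        _ = _ := mul_comm _ _
    have hl₂ : 6 * B ^ 2 * (2 * (Cp * R ^ (-p)) * R ^ 2 + C * c₂) < c * c₁ * l ^ 2 := by
      have e1 : R ^ (-p) * R ^ 2 = R ^ (2 - p) := by
        rw [← Real.rpow_two, ← Real.rpow_add hR0]
        ring_nf
      have e2 : (R ^ (1 - p / 2)) ^ 2 = R ^ (2 - p) := by
        rw [← Real.rpow_natCast, ← Real.rpow_mul hR0.le]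
        congr 1
        push_cast
        ring
      have h1 : 1 ≤ R ^ (2 - p) := Real.one_le_rpow hR (by linarith)
      have h2 : X < c * c₁ * M ^ 2 := by
        have h3 : X / (c * c₁) < M := by
          have : 0 ≤ 2 * B ^ 2 * C / c := by positivity
          linarith
        rw [div_lt_iff₀ (by positivity)] at h3
        have h4 : M ≤ M ^ 2 := by nlinarith
        calc X < M * (c * c₁) := h3
          _ ≤ M ^ 2 * (c * c₁) := by gcongr
          _ = _ := mul_comm _ _
      calc _ = 6 * B ^ 2 * (2 * Cp * R ^ (2 - p) + C * c₂ * 1) := by rw [← e1]; ring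
        _ ≤ 6 * B ^ 2 * (2 * Cp * R ^ (2 - p) + C * c₂ * R ^ (2 - p)) := by gcongr
        _ = X * R ^ (2 - p) := by rw [hX]; ring
        _ < c * c₁ * M ^ 2 * R ^ (2 - p) := by gcongr
        _ = _ := by rw [hl, mul_pow, e2]; ring
    have hfib : ∀ k ∈ Finset.Icc (-(N : ℤ)) N, ((S.filter fun x => m x = k).card : ℝ) ≤
        156 ^ n * M * R ^ ((n : ℝ) - p / 2) := by
      intro k _
      have h1 := hg.card_mul_le (a := a) (z := z) he₀n he₀ hσ (m := k) hc₁ hη₁ hη₂ hR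
        (by positivity) hl0 hW hl₁ hl₂ (S := S.filter fun x => m x = k)
        (fun x hx => hS.mem x (Finset.mem_filter.1 hx).1)
        (fun x hx y hy => hS.separated x (Finset.mem_filter.1 hx).1 y (Finset.mem_filter.1 hy).1)
        (fun x hx => by
          have := hm x (Finset.mem_filter.1 hx).1
          rwa [(Finset.mem_filter.1 hx).2] at this)
      rw [← hn, ← mul_div_assoc, div_le_iff₀ hl0] at h1
      refine le_of_mul_le_mul_right (h1.trans (le_of_eq ?_)) hR0
      have e3 : R ^ n * R ^ (1 - p / 2) = R ^ ((n : ℝ) - p / 2) * R := by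
        rw [← Real.rpow_natCast, ← Real.rpow_add hR0, ← Real.rpow_add_one hR0.ne']
        congr 1
        ring
      rw [hl, mul_pow]
      linear_combination 156 ^ n * M * e3
    have hcard := Finset.card_eq_sum_card_fiberwise hmN
    have h1 : (S.card : ℝ) ≤ (2 * N + 1) * (156 ^ n * M * R ^ ((n : ℝ) - p / 2)) := by
      rw [hcard]
      push_cast
      refine (Finset.sum_le_card_nsmul _ _ _ hfib).trans (le_of_eq ?_)
      rw [Int.card_Icc, nsmul_eq_mul]
      congr 1
      have : ((N : ℤ) + 1 - -(N : ℤ)).toNat = 2 * N + 1 := by omega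
      rw [this]
      push_cast
      ring
    refine h1.trans ?_
    have h2 : 0 ≤ (4 * R₁) ^ n * R ^ ((n : ℝ) - p / 2) := by positivity
    rw [add_mul ((4 * R₁) ^ n), mul_assoc (2 * (N : ℝ) + 1)]
    exact le_add_of_nonneg_left h2

/-- Exchanging the roles of `ξ` and `ξ + η` changes the sign of `η`, so `0 ≤ ⟪η, w⟫` may be assumed.
-/
theorem IsZeroConfiguration.image_add {B : Set E} {η : E} {S : Finset E} [DecidableEq E]
    (h : IsZeroConfiguration Ω B η S) : IsZeroConfiguration Ω B (-η) (S.image (· + η)) := by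
  refine ⟨?_, ?_, ?_, ?_, ?_⟩
  · exact Finset.forall_mem_image.2 fun ξ hξ => by simpa using h.add_mem ξ hξ
  · exact Finset.forall_mem_image.2 fun ξ hξ => by simpa using h.mem ξ hξ
  · exact Finset.forall_mem_image.2 fun ξ hξ => by simpa using h.add_zero ξ hξ
  · exact Finset.forall_mem_image.2 fun ξ hξ => by simpa using h.zero ξ hξ
  · intro x hx y hy hxy
    obtain ⟨ξ, hξ, rfl⟩ := Finset.mem_image.1 hx
    obtain ⟨ζ, hζ, rfl⟩ := Finset.mem_image.1 hy
    rw [dist_add_right]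
    exact h.separated ξ hξ ζ hζ fun he => hxy (by rw [he])

theorem IsGaussCone.exists_card_le (hg : IsGaussCone Ω ν s w δ c C)
    (hcpt : IsCompact Ω) (hdim : 2 ≤ Module.finrank ℝ E) (hp0 : 0 ≤ p) (hp2 : p ≤ 2)
    (hph : HasPhaseBound Ω s w δ a p) {c₁ c₂ : ℝ} (hc₁ : 0 < c₁) (hc : c₁ ≤ c₂) :
    ∃ K : ℝ, 0 < K ∧ ∀ R : ℝ, 1 ≤ R → ∀ η : E, c₁ ≤ ‖η‖ → ‖η‖ ≤ c₂ →
      ∀ S : Finset E, IsZeroConfiguration Ω (Metric.closedBall ((20 / δ * R) • w) R) η S →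
        (S.card : ℝ) ≤ K * R ^ ((Module.finrank ℝ E : ℝ) - p / 2) := by
  classical
  obtain ⟨K, hK, H⟩ := hg.exists_card_le_of_inner_nonneg hcpt hdim hp0 hp2 hph hc₁ hc
  refine ⟨K, hK, fun R hR η hη₁ hη₂ S hS => ?_⟩
  rcases le_total 0 ⟪η, w⟫ with h | h
  · exact H R hR η hη₁ hη₂ h S hS
  · have := H R hR (-η) (by rwa [norm_neg]) (by rwa [norm_neg])
      (by rw [inner_neg_left]; linarith) _ hS.image_add
    rwa [Finset.card_image_of_injective _ (add_left_injective η)] at this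

end Entropy

/-! ### Translation to entropy; the smooth case. -/

section Euclidean

variable {d : ℕ}

theorem entropy_le_of_card_le {X : Set (EuclideanSpace ℝ (Fin d))} {b : ℝ} (hb : 0 ≤ b)
    (h : ∀ S : Finset (EuclideanSpace ℝ (Fin d)), (∀ x ∈ S, x ∈ X) →
      (∀ x ∈ S, ∀ y ∈ S, x ≠ y → 1 ≤ dist x y) → (S.card : ℝ) ≤ b) :
    (entropy X : ℝ≥0∞) ≤ ENNReal.ofReal b := by
  have h1 : entropy X ≤ (⌊b⌋₊ : ℕ∞) := by
    refine iSup_le fun S => iSup_le fun hSX => iSup_le fun hS => ?_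
    by_contra hcon
    push Not at hcon
    -- `S` might be infinite; a finite subset with one point too many already gives the
    -- contradiction.
    have h2 : ((⌊b⌋₊ + 1 : ℕ) : ℕ∞) ≤ S.encard := by
      push_cast
      exact Order.add_one_le_of_lt hcon
    obtain ⟨t, htS, ht⟩ := Set.exists_subset_encard_eq h2
    have hfin : t.Finite := Set.finite_of_encard_eq_coe ht
    have h3 := h hfin.toFinset (fun x hx => hSX (htS (hfin.mem_toFinset.1 hx)))
      (fun x hx y hy => hS (htS (hfin.mem_toFinset.1 hx)) (htS (hfin.mem_toFinset.1 hy)))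
    rw [hfin.encard_eq_coe_toFinset_card] at ht
    have h4 : hfin.toFinset.card = ⌊b⌋₊ + 1 := by exact_mod_cast ht
    rw [h4] at h3
    push_cast at h3
    linarith [Nat.lt_floor_add_one b]
  calc (entropy X : ℝ≥0∞) ≤ ((⌊b⌋₊ : ℕ∞) : ℝ≥0∞) := by exact_mod_cast h1
    _ = ENNReal.ofReal (⌊b⌋₊ : ℝ) := by rw [ENNReal.ofReal_natCast]; rfl
    _ ≤ _ := ENNReal.ofReal_le_ofReal (Nat.floor_le hb)

theorem hasLowEntropyBalls_of_hasPhaseBound {Ω : Set (EuclideanSpace ℝ (Fin d))} (hd : 2 ≤ d)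
    (hcpt : IsCompact Ω) {x₀ a : EuclideanSpace ℝ (Fin d)} {p : ℝ} (hp0 : 0 ≤ p) (hp2 : p ≤ 2)
    (h : ∀ U ∈ 𝓝 x₀, ∃ ν s w δ c C, IsGaussCone Ω ν s w δ c C ∧
      (∀ ξ ∈ directionCone w δ, s ξ ∈ frontier Ω ∩ U) ∧ HasPhaseBound Ω s w δ a p) :
    HasLowEntropyBalls Ω x₀ (p / 2) := by
  intro U hU
  obtain ⟨ν, s, w, δ, c, C, hg, hsU, hph⟩ := h U hU
  have hδ := hg.δ_pos
  have hfin : Module.finrank ℝ (EuclideanSpace ℝ (Fin d)) = d := by simp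
  refine ⟨1, one_pos, fun R => (20 / δ * R) • w, fun R hR ξ hξ => ?_, fun c₁ c₂ hc₁ hc => ?_⟩
  · have hR0 : 0 < R := by linarith
    have h1 : ξ ∈ directionCone w δ := by
      refine mem_directionCone_of_dist_le (by positivity : 0 < 20 / δ * R) ?_
      rw [Metric.mem_closedBall, dist_eq_norm] at hξ
      refine hξ.trans ?_
      have : δ * (20 / δ * R) = 20 * R := by field_simp
      rw [this]
      linarith
    have h2 := directionCone_bounds hg.norm_eq hg.δ_le h1
    refine ⟨?_, s ξ, hsU ξ h1, fun y hy => ?_⟩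
    · rintro rfl
      simp at h2
    · rw [inner_sub_right]
      linarith [(hg.selection ξ).2 y hy]
  · obtain ⟨K, hK, H⟩ := hg.exists_card_le hcpt (by rw [hfin]; exact hd) hp0 hp2 hph hc₁ hc
    refine ⟨K, hK, fun R hR η hη₁ hη₂ => ?_⟩
    have hR0 : 0 < R := by linarith
    refine entropy_le_of_card_le (by positivity) fun S hSX hS => ?_
    rw [hfin] at H
    have hz : ∀ ξ, ξ ∈ zeroSet Ω → cutTransform Ω (fun _ => 1) ξ = 0 := fun ξ hξ => by
      rw [← fourier_indicator_eq_cutTransform hcpt.measurableSet]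
      exact hξ
    exact H R hR η hη₁ hη₂ S ⟨fun ξ hξ => (hSX ξ hξ).2.1, fun ξ hξ => (hSX ξ hξ).2.2.2,
      fun ξ hξ => hz ξ (hSX ξ hξ).1, fun ξ hξ => hz _ (hSX ξ hξ).2.2.1, hS⟩

theorem HasSmoothBoundary.exists_contDiff {Ω : Set (EuclideanSpace ℝ (Fin d))}
    (h : HasSmoothBoundary Ω) : ∀ b ∈ frontier Ω, ∃ ρ : EuclideanSpace ℝ (Fin d) → ℝ,
      ContDiff ℝ ∞ ρ ∧ gradient ρ b ≠ 0 ∧ ∀ᶠ y in 𝓝 b, (y ∈ Ω ↔ ρ y ≤ 0) := by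
  intro b hb
  obtain ⟨ρ, hρ⟩ := h b hb
  obtain ⟨ρ', hs, he⟩ := exists_contDiff_eventuallyEq hρ.smooth
  refine ⟨ρ', hs, ?_, ?_⟩
  · have : gradient ρ' b = gradient ρ b := by
      simp only [gradient, he.fderiv_eq]
    rw [this]
    exact hρ.gradient_ne_zero
  · filter_upwards [hρ.mem_iff, he] with y h1 h2
    rw [h1, h2]

theorem IsCurvaturePoint.hasLowEntropyBalls_of_smooth {Ω : Set (EuclideanSpace ℝ (Fin d))}
    (hd : 2 ≤ d) (hΩ : Convex ℝ Ω) (hcpt : IsCompact Ω) (hint : (interior Ω).Nonempty)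
    (hsym : IsSymmetric Ω) (hsm : HasSmoothBoundary Ω) {x₀ : EuclideanSpace ℝ (Fin d)}
    (hx₀ : IsCurvaturePoint Ω x₀) : HasLowEntropyBalls Ω x₀ 1 := by
  obtain ⟨a, ha⟩ := hsym
  obtain ⟨ρ, r, c, hpatch⟩ := hx₀.exists_patch hΩ hcpt.isClosed
  have := hasLowEntropyBalls_of_hasPhaseBound hd hcpt (a := a) (x₀ := x₀) zero_le_two le_rfl
    fun U hU => ⟨gradient ρ, hpatch.exists_hasPhaseBound_of_smooth hΩ hcpt hint ha
      hsm.exists_contDiff hU⟩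
  norm_num at this
  exact this

end Euclidean

/-! ### Second differences and one-dimensional Fourier transforms. -/

section SecondDifference

/-- A shift by half a period changes the sign of the exponential, so the transform of the second
difference is `-4` times the transform of `G`. -/
theorem four_mul_norm_integral_le {G : ℝ → ℂ} (hG : Integrable G) {l : ℝ} (hl : l ≠ 0) :
    4 * ‖∫ v, G v * Complex.exp (-(2 * Real.pi * Complex.I * (l * v : ℝ)))‖ ≤
      ∫ v, ‖G (v + (2 * l)⁻¹) + G (v - (2 * l)⁻¹) - 2 * G v‖ := by
  set h := (2 * l)⁻¹ with hh
  let e : ℝ → ℂ := fun v => Complex.exp (-(2 * Real.pi * Complex.I * (l * v : ℝ)))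
  have he1 : ∀ v, ‖e v‖ = 1 := fun v => by
    simp only [e]
    rw [Complex.norm_exp]
    simp
  have hec : Continuous e := by fun_prop
  have hlh : (l : ℂ) * h = 1 / 2 := by
    rw [hh]
    have : (l : ℂ) ≠ 0 := by exact_mod_cast hl
    push_cast
    field_simp
  have heh : ∀ v, e (v + h) = -e v := fun v => by
    simp only [e]
    rw [← Complex.exp_sub_pi_mul_I]
    congr 1
    push_cast
    linear_combination (-2 * Real.pi * Complex.I) * hlh
  have hint : ∀ k : ℝ, Integrable fun v => G (v + k) * e v := fun k =>
    (hG.comp_add_right k).mul_bdd hec.aestronglyMeasurable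
      (Eventually.of_forall fun v => (he1 v).le)
  have h1 : ∫ v, G (v + h) * e v = -∫ v, G v * e v := by
    rw [← integral_neg, ← integral_add_right_eq_self (fun v => -(G v * e v)) h]
    refine integral_congr_ae (Eventually.of_forall fun v => ?_)
    simp only [heh]
    ring
  have h2 : ∫ v, G (v - h) * e v = -∫ v, G v * e v := by
    rw [← integral_add_right_eq_self (fun v => G (v - h) * e v) h, ← integral_neg]
    refine integral_congr_ae (Eventually.of_forall fun v => ?_)
    simp only [heh, add_sub_cancel_right]
    ring
  have h3 : ∫ v, (G (v + h) + G (v - h) - 2 * G v) * e v = -4 * ∫ v, G v * e v := by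
    have e1 : ∀ v, (G (v + h) + G (v - h) - 2 * G v) * e v =
        (G (v + h) * e v + G (v - h) * e v) - 2 * (G v * e v) := fun v => by ring
    have i0 : Integrable fun v => G v * e v := by simpa using hint 0
    have i1 : Integrable fun v => G (v - h) * e v := by simpa [sub_eq_add_neg] using hint (-h)
    have i2 : Integrable fun v => G (v + h) * e v + G (v - h) * e v := (hint h).add i1
    simp only [e1]
    rw [integral_sub i2 (i0.const_mul 2), integral_add (hint h) i1, h1, h2,
      integral_const_mul]
    ring
  calc 4 * ‖∫ v, G v * e v‖ = ‖∫ v, (G (v + h) + G (v - h) - 2 * G v) * e v‖ := by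
        rw [h3, norm_mul]
        norm_num
    _ ≤ ∫ v, ‖(G (v + h) + G (v - h) - 2 * G v) * e v‖ := norm_integral_le_integral_norm _
    _ = _ := by
        refine integral_congr_ae (Eventually.of_forall fun v => ?_)
        simp only [norm_mul, he1, mul_one]

theorem ConcaveOn.abs_sub_le_of_abs_le {b : ℝ → ℝ} {m r D ε : ℝ}
    (hb : ConcaveOn ℝ (Metric.ball m r) b) (hε : 0 < ε) (hD : ∀ v ∈ Metric.ball m r, |b v| ≤ D)
    {x y : ℝ} (hx : x ∈ Metric.ball m (r - ε)) (hy : y ∈ Metric.ball m (r - ε)) :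
    |b x - b y| ≤ 2 * D / ε * |x - y| := by
  have h1 := hb.lipschitzOnWith_of_abs_le (M := D) hε hD
  have h2 := h1.dist_le_mul x hx y hy
  have h3 : m ∈ Metric.ball m r := by
    rw [Metric.mem_ball] at hx
    rw [Metric.mem_ball, dist_self]
    linarith [dist_nonneg (x := x) (y := m)]
  have h4 : 0 ≤ D := (abs_nonneg _).trans (hD m h3)
  rw [Real.dist_eq, Real.dist_eq, Real.coe_toNNReal _ (by positivity)] at h2
  exact h2

/-- By concavity the second difference has a constant sign, so the integral of its absolute value
telescopes to integrals of first differences over two end intervals of length `h`. There the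
Lipschitz bound of a bounded concave function gives `O(h ^ 2)`. -/
theorem integral_abs_second_difference_le {b : ℝ → ℝ} {m r D ε h : ℝ}
    (hb : ConcaveOn ℝ (Metric.ball m r) b) (hε : 0 < ε)
    (hD : ∀ v ∈ Metric.ball m r, |b v| ≤ D) (hh : 0 < h) (hhε : h ≤ ε) (hr : 3 * ε ≤ r) :
    ContinuousOn (fun v => |b (v + h) + b (v - h) - 2 * b v|)
      (Icc (m - (r - 3 * ε)) (m + (r - 3 * ε))) ∧
    ∫ v in (m - (r - 3 * ε))..(m + (r - 3 * ε)), |b (v + h) + b (v - h) - 2 * b v| ≤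
      4 * D / ε * h ^ 2 := by
  set α := m - (r - 3 * ε) with hα
  set β := m + (r - 3 * ε) with hβ
  have hαβ : α ≤ β := by linarith
  have hball : ∀ v, α - h ≤ v → v ≤ β + h → v ∈ Metric.ball m (r - ε) := by
    intro v h1 h2
    rw [Metric.mem_ball, Real.dist_eq, abs_lt]
    constructor <;> linarith
  have hlip : ∀ x y, α - h ≤ x → x ≤ β + h → α - h ≤ y → y ≤ β + h →
      |b x - b y| ≤ 2 * D / ε * |x - y| := fun x y h1 h2 h3 h4 =>
    ConcaveOn.abs_sub_le_of_abs_le hb hε hD (hball x h1 h2) (hball y h3 h4)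
  have hcont : ContinuousOn b (Icc (α - h) (β + h)) := by
    exact (hb.lipschitzOnWith_of_abs_le (M := D) hε hD).continuousOn.mono fun v hv =>
      hball v hv.1 hv.2
  have hshift : ∀ k, |k| ≤ h → ContinuousOn (fun v => b (v + k)) (Icc α β) := by
    intro k hk
    have hk' := abs_le.1 hk
    exact hcont.comp (by fun_prop) fun v hv => ⟨by linarith [hv.1, hk'.1], by
      linarith [hv.2, hk'.2]⟩
  have c1 := hshift h (abs_of_pos hh).le
  have c2 := hshift (-h) (by rw [abs_neg, abs_of_pos hh])
  have c0 := hshift 0 (by simpa using hh.le)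
  simp only [← sub_eq_add_neg, add_zero] at c2 c0
  have c3 : ContinuousOn (fun v => b (v + h) + b (v - h) - 2 * b v) (Icc α β) :=
    (c1.add c2).sub (continuousOn_const.mul c0)
  refine ⟨c3.abs, ?_⟩
  have hnonpos : ∀ v ∈ Icc α β, b (v + h) + b (v - h) - 2 * b v ≤ 0 := by
    intro v hv
    have hsub : Metric.ball m (r - ε) ⊆ Metric.ball m r := Metric.ball_subset_ball (by linarith)
    have h1 := hb.2 (hsub (hball (v + h) (by linarith [hv.1]) (by linarith [hv.2])))
      (hsub (hball (v - h) (by linarith [hv.1]) (by linarith [hv.2])))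
      (by norm_num : (0 : ℝ) ≤ 1 / 2) (by norm_num : (0 : ℝ) ≤ 1 / 2) (by norm_num)
    have h2 : (1 / 2 : ℝ) • (v + h) + (1 / 2 : ℝ) • (v - h) = v := by
      simp only [smul_eq_mul]
      ring
    rw [h2] at h1
    simp only [smul_eq_mul] at h1
    linarith
  have hu : uIcc α β = Icc α β := uIcc_of_le hαβ
  have i1 : IntervalIntegrable (fun v => b (v + h) - b v) volume α β :=
    (hu ▸ (c1.sub c0)).intervalIntegrable
  have i2 : IntervalIntegrable (fun v => b v - b (v - h)) volume α β :=
    (hu ▸ (c0.sub c2)).intervalIntegrable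
  have e1 : ∫ v in α..β, |b (v + h) + b (v - h) - 2 * b v| =
      (∫ v in α..β, (b v - b (v - h))) - ∫ v in α..β, (b (v + h) - b v) := by
    rw [← intervalIntegral.integral_sub i2 i1]
    refine intervalIntegral.integral_congr fun v hv => ?_
    rw [hu] at hv
    rw [abs_of_nonpos (hnonpos v hv)]
    ring
  have e2 : ∫ v in α..β, (b v - b (v - h)) = ∫ v in (α - h)..(β - h), (b (v + h) - b v) := by
    rw [← intervalIntegral.integral_comp_sub_right (fun v => b (v + h) - b v) h]
    simp
  have hcg : ∀ x y, α - h ≤ x → x ≤ β → α - h ≤ y → y ≤ β →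
      IntervalIntegrable (fun v => b (v + h) - b v) volume x y := by
    intro x y h1 h2 h3 h4
    refine ContinuousOn.intervalIntegrable ?_
    have hsub : uIcc x y ⊆ Icc (α - h) β := uIcc_subset_Icc ⟨h1, h2⟩ ⟨h3, h4⟩
    refine (ContinuousOn.sub (hcont.comp (by fun_prop) fun v hv => ?_)
      (hcont.mono (Icc_subset_Icc_right (by linarith)))).mono hsub
    exact ⟨by linarith [hv.1], by linarith [hv.2]⟩
  have e3 : (∫ v in (α - h)..(β - h), (b (v + h) - b v)) - ∫ v in α..β, (b (v + h) - b v) =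
      (∫ v in (α - h)..α, (b (v + h) - b v)) - ∫ v in (β - h)..β, (b (v + h) - b v) := by
    rcases le_total α (β - h) with hc | hc
    · have j1 := hcg (α - h) α le_rfl (by linarith) (by linarith) (by linarith)
      have j2 := hcg α (β - h) (by linarith) (by linarith) (by linarith) (by linarith)
      have j3 := hcg (β - h) β (by linarith) (by linarith) (by linarith) (by linarith)
      rw [← intervalIntegral.integral_add_adjacent_intervals j1 j2,
        ← intervalIntegral.integral_add_adjacent_intervals j2 j3]
      ring
    · have j1 := hcg (α - h) (β - h) le_rfl (by linarith) (by linarith) (by linarith)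
      have j2 := hcg (β - h) α (by linarith) (by linarith) (by linarith) (by linarith)
      have j3 := hcg α β (by linarith) (by linarith) (by linarith) (by linarith)
      rw [← intervalIntegral.integral_add_adjacent_intervals j1 j2,
        ← intervalIntegral.integral_add_adjacent_intervals j2 j3]
      ring
  have hbd : ∀ x, α - h ≤ x → x ≤ β - h → |∫ v in x..(x + h), (b (v + h) - b v)| ≤
      2 * D / ε * h ^ 2 := by
    intro x h1 h2
    have := intervalIntegral.norm_integral_le_of_norm_le_const (a := x) (b := x + h)
      (f := fun v => b (v + h) - b v) (C := 2 * D / ε * h) (fun v hv => by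
        rw [uIoc_of_le (by linarith)] at hv
        have := hlip (v + h) v (by linarith [hv.1]) (by linarith [hv.2]) (by linarith [hv.1])
          (by linarith [hv.2])
        rwa [add_sub_cancel_left, abs_of_pos hh] at this)
    rw [add_sub_cancel_left, abs_of_pos hh] at this
    calc _ ≤ 2 * D / ε * h * h := this
      _ = _ := by ring
  have b1 := abs_le.1 (hbd (α - h) le_rfl (by linarith))
  have b2 := abs_le.1 (hbd (β - h) (by linarith) le_rfl)
  rw [sub_add_cancel] at b1 b2
  rw [e1, e2, e3]
  have : 4 * D / ε * h ^ 2 = 2 * D / ε * h ^ 2 + 2 * D / ε * h ^ 2 := by ring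
  linarith [b1.2, b2.1]

/-- With the end point frozen at `b v`, only the second difference of `f` in `v` appears. The
remaining strips contribute `f (b v) v * (b (v ± h) - b v)` up to `O(h ^ 2)`, and these add up to a
multiple of the second difference of `b`. -/
theorem abs_second_difference_integral_le {f : ℝ → ℝ → ℝ} (hf : ∀ v, Continuous fun u => f u v)
    {b : ℝ → ℝ} {v h D L M₀ M₁ M₂ : ℝ} (hh : 0 ≤ h) (hL : 0 ≤ L) (hM₁ : 0 ≤ M₁)
    (h₀ : ∀ u v, |f u v| ≤ M₀)
    (h₁ : ∀ u u' v v', |f u v - f u' v'| ≤ M₁ * (|u - u'| + |v - v'|))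
    (h₂ : ∀ u, |f u (v + h) + f u (v - h) - 2 * f u v| ≤ M₂ * h ^ 2)
    (hD : |b v| ≤ D) (hb₁ : |b (v + h) - b v| ≤ L * h) (hb₂ : |b (v - h) - b v| ≤ L * h) :
    |(∫ u in (0 : ℝ)..b (v + h), f u (v + h)) + (∫ u in (0 : ℝ)..b (v - h), f u (v - h)) -
        2 * ∫ u in (0 : ℝ)..b v, f u v| ≤
      M₀ * |b (v + h) + b (v - h) - 2 * b v| + (M₂ * D + 2 * (M₁ * (L + 1) * L)) * h ^ 2 := by
  have hi : ∀ x y v, IntervalIntegrable (fun u => f u v) volume x y := fun x y v =>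
    (hf v).intervalIntegrable x y
  have hpiece : ∀ v', |v' - v| ≤ h → |b v' - b v| ≤ L * h →
      |(∫ u in b v..b v', f u v') - f (b v) v * (b v' - b v)| ≤ M₁ * (L + 1) * L * h ^ 2 := by
    intro v' hv' hbv'
    have e1 : (∫ u in b v..b v', f u v') - f (b v) v * (b v' - b v) =
        ∫ u in b v..b v', (f u v' - f (b v) v) := by
      rw [intervalIntegral.integral_sub (hi _ _ _) intervalIntegrable_const,
        intervalIntegral.integral_const, smul_eq_mul, mul_comm]
    rw [e1]
    have := intervalIntegral.norm_integral_le_of_norm_le_const (a := b v) (b := b v')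
      (f := fun u => f u v' - f (b v) v) (C := M₁ * (L * h + h)) (fun u hu => by
        refine (h₁ u (b v) v' v).trans ?_
        have h3 : |u - b v| ≤ |b v' - b v| :=
          abs_sub_left_of_mem_uIcc (uIoc_subset_uIcc hu)
        gcongr
        linarith)
    refine this.trans ?_
    calc M₁ * (L * h + h) * |b v' - b v| ≤ M₁ * (L * h + h) * (L * h) := by gcongr
      _ = _ := by ring
  have p1 := hpiece (v + h) (by rw [add_sub_cancel_left, abs_of_nonneg hh]) hb₁
  have p2 := hpiece (v - h) (by rw [sub_sub_cancel_left, abs_neg, abs_of_nonneg hh]) hb₂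
  have p3 : |∫ u in (0 : ℝ)..b v, (f u (v + h) + f u (v - h) - 2 * f u v)| ≤ M₂ * D * h ^ 2 := by
    have := intervalIntegral.norm_integral_le_of_norm_le_const (a := 0) (b := b v)
      (f := fun u => f u (v + h) + f u (v - h) - 2 * f u v) (C := M₂ * h ^ 2) fun u _ => h₂ u
    rw [sub_zero] at this
    have h4 : 0 ≤ M₂ * h ^ 2 := (abs_nonneg _).trans (h₂ 0)
    calc _ ≤ M₂ * h ^ 2 * |b v| := this
      _ ≤ M₂ * h ^ 2 * D := by gcongr
      _ = _ := by ring
  rw [intervalIntegral.integral_sub ((hi _ _ _).add (hi _ _ _)) ((hi _ _ _).const_mul 2),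
    intervalIntegral.integral_add (hi _ _ _) (hi _ _ _),
    intervalIntegral.integral_const_mul] at p3
  rw [← intervalIntegral.integral_add_adjacent_intervals (hi 0 (b v) (v + h))
    (hi (b v) (b (v + h)) (v + h)), ← intervalIntegral.integral_add_adjacent_intervals
    (hi 0 (b v) (v - h)) (hi (b v) (b (v - h)) (v - h))]
  have p4 : |f (b v) v * (b (v + h) + b (v - h) - 2 * b v)| ≤
      M₀ * |b (v + h) + b (v - h) - 2 * b v| := by
    rw [abs_mul]
    gcongr
    exact h₀ _ _
  have q1 := abs_le.1 p1
  have q2 := abs_le.1 p2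
  have q3 := abs_le.1 p3
  have q4 := abs_le.1 p4
  rw [abs_le]
  constructor <;> linarith [q1.1, q1.2, q2.1, q2.2, q3.1, q3.2, q4.1, q4.2]

end SecondDifference

/-! ### Slices of planar convex sets. -/

section Planar

variable {E : Type} [NormedAddCommGroup E] [InnerProductSpace ℝ E] [FiniteDimensional ℝ E]
  [MeasurableSpace E] [BorelSpace E]

/-- The point with coordinates `u, v` in the orthonormal basis `b`. -/
def planePoint (b : OrthonormalBasis (Fin 2) ℝ E) (u v : ℝ) : E := u • b 0 + v • b 1

theorem inner_planePoint_zero (b : OrthonormalBasis (Fin 2) ℝ E) (u v : ℝ) :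
    ⟪b 0, planePoint b u v⟫ = u := by
  simp [planePoint, inner_add_right, inner_smul_right, b.inner_eq_ite]

theorem inner_planePoint_one (b : OrthonormalBasis (Fin 2) ℝ E) (u v : ℝ) :
    ⟪b 1, planePoint b u v⟫ = v := by
  simp [planePoint, inner_add_right, inner_smul_right, b.inner_eq_ite]

theorem planePoint_inner (b : OrthonormalBasis (Fin 2) ℝ E) (x : E) :
    planePoint b ⟪b 0, x⟫ ⟪b 1, x⟫ = x := by
  have := b.sum_repr' x
  simpa [planePoint, Fin.sum_univ_two] using this

theorem continuous_planePoint (b : OrthonormalBasis (Fin 2) ℝ E) :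
    Continuous fun p : ℝ × ℝ => planePoint b p.1 p.2 := by
  unfold planePoint
  fun_prop

theorem norm_planePoint_sub_le (b : OrthonormalBasis (Fin 2) ℝ E) (u u' v v' : ℝ) :
    ‖planePoint b u v - planePoint b u' v'‖ ≤ |u - u'| + |v - v'| := by
  have h : planePoint b u v - planePoint b u' v' = (u - u') • b 0 + (v - v') • b 1 := by
    simp only [planePoint]
    module
  rw [h]
  refine (norm_add_le _ _).trans (le_of_eq ?_)
  simp [norm_smul]

theorem measurePreserving_planePoint (b : OrthonormalBasis (Fin 2) ℝ E) :
    MeasurePreserving (fun p : ℝ × ℝ => planePoint b p.1 p.2) := by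
  have h1 := (volume_preserving_finTwoArrow ℝ).symm
  have h2 := PiLp.volume_preserving_toLp (Fin 2)
  have h3 := b.measurePreserving_repr_symm
  have h := h3.comp (h2.comp h1)
  have e : (fun p : ℝ × ℝ => planePoint b p.1 p.2) =
      b.repr.symm ∘ WithLp.toLp 2 ∘ MeasurableEquiv.finTwoArrow.symm := by
    funext p
    simp [planePoint, ← b.sum_repr_symm, Fin.sum_univ_two, MeasurableEquiv.finTwoArrow]
  rw [e]
  exact h

theorem measurableEmbedding_planePoint (b : OrthonormalBasis (Fin 2) ℝ E) :
    MeasurableEmbedding fun p : ℝ × ℝ => planePoint b p.1 p.2 := by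
  refine (continuous_planePoint b).measurableEmbedding fun p q h => ?_
  have h0 := congrArg (fun x => ⟪b 0, x⟫) h
  have h1 := congrArg (fun x => ⟪b 1, x⟫) h
  simp only [inner_planePoint_zero, inner_planePoint_one] at h0 h1
  exact Prod.ext h0 h1

theorem integrable_planar {F : Type} [NormedAddCommGroup F] [NormedSpace ℝ F]
    (b : OrthonormalBasis (Fin 2) ℝ E) {g : E → F}
    (hg : Integrable g) : Integrable fun p : ℝ × ℝ => g (planePoint b p.1 p.2) :=
  (measurePreserving_planePoint b).integrable_comp_emb (measurableEmbedding_planePoint b) |>.2 hg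

theorem integral_planar {F : Type} [NormedAddCommGroup F] [NormedSpace ℝ F]
    (b : OrthonormalBasis (Fin 2) ℝ E) {g : E → F} (hg : Integrable g) :
    ∫ x, g x = ∫ v, ∫ u, g (planePoint b u v) := by
  rw [← (measurePreserving_planePoint b).integral_comp (measurableEmbedding_planePoint b)]
  exact integral_prod_symm _ (integrable_planar b hg)

/-- The slice at height `v` of the planar set `Ω`. -/
def planeSlice (b : OrthonormalBasis (Fin 2) ℝ E) (Ω : Set E) (v : ℝ) : Set ℝ :=
  {u | planePoint b u v ∈ Ω}

variable {Ω : Set E} {b : OrthonormalBasis (Fin 2) ℝ E}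

theorem isCompact_planeSlice (hcpt : IsCompact Ω) (v : ℝ) : IsCompact (planeSlice b Ω v) := by
  have h1 : planeSlice b Ω v ⊆ (fun x => ⟪b 0, x⟫) '' Ω := fun u hu =>
    ⟨_, hu, inner_planePoint_zero b u v⟩
  refine (hcpt.image (by fun_prop)).of_isClosed_subset ?_ h1
  exact hcpt.isClosed.preimage ((continuous_planePoint b).comp (by fun_prop : Continuous fun u : ℝ =>
    (u, v)))

theorem convex_combination_mem_planeSlice (hΩ : Convex ℝ Ω) {u u' v v' k k' : ℝ}
    (hu : u ∈ planeSlice b Ω v) (hu' : u' ∈ planeSlice b Ω v') (hk : 0 ≤ k) (hk' : 0 ≤ k')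
    (hkk : k + k' = 1) : k * u + k' * u' ∈ planeSlice b Ω (k * v + k' * v') := by
  have := hΩ hu hu' hk hk' hkk
  have e : planePoint b (k * u + k' * u') (k * v + k' * v') =
      k • planePoint b u v + k' • planePoint b u' v' := by
    simp only [planePoint]
    module
  rw [planeSlice, mem_ofPred_eq, e]
  exact this

/-- The right end point of the slice at height `v`. -/
def sliceTop (b : OrthonormalBasis (Fin 2) ℝ E) (Ω : Set E) (v : ℝ) : ℝ := sSup (planeSlice b Ω v)

/-- The left end point of the slice at height `v`. -/
def sliceBot (b : OrthonormalBasis (Fin 2) ℝ E) (Ω : Set E) (v : ℝ) : ℝ := sInf (planeSlice b Ω v)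

theorem planeSlice_eq_Icc (hΩ : Convex ℝ Ω) (hcpt : IsCompact Ω) {v : ℝ}
    (hv : (planeSlice b Ω v).Nonempty) :
    planeSlice b Ω v = Icc (sliceBot b Ω v) (sliceTop b Ω v) ∧
      sliceBot b Ω v ≤ sliceTop b Ω v := by
  have hc := isCompact_planeSlice (b := b) hcpt v
  have hconv : Convex ℝ (planeSlice b Ω v) := by
    intro u hu u' hu' k k' hk hk' hkk
    have := convex_combination_mem_planeSlice hΩ hu hu' hk hk' hkk
    rwa [← add_mul, hkk, one_mul] at this
  have hle : sliceBot b Ω v ≤ sliceTop b Ω v :=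
    csInf_le_csSup hv hc.bddBelow hc.bddAbove
  refine ⟨subset_antisymm (fun u hu => ⟨csInf_le hc.bddBelow hu, le_csSup hc.bddAbove hu⟩) ?_,
    hle⟩
  exact hconv.ordConnected.out (hc.sInf_mem hv) (hc.sSup_mem hv)

theorem concaveOn_sliceTop (hΩ : Convex ℝ Ω) (hcpt : IsCompact Ω) {I : Set ℝ} (hI : Convex ℝ I)
    (hne : ∀ v ∈ I, (planeSlice b Ω v).Nonempty) : ConcaveOn ℝ I (sliceTop b Ω) := by
  refine ⟨hI, fun v hv v' hv' k k' hk hk' hkk => ?_⟩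
  exact le_csSup (isCompact_planeSlice hcpt _).bddAbove (convex_combination_mem_planeSlice hΩ
    ((isCompact_planeSlice hcpt v).sSup_mem (hne v hv))
    ((isCompact_planeSlice hcpt v').sSup_mem (hne v' hv')) hk hk' hkk)

theorem concaveOn_neg_sliceBot (hΩ : Convex ℝ Ω) (hcpt : IsCompact Ω) {I : Set ℝ}
    (hI : Convex ℝ I) (hne : ∀ v ∈ I, (planeSlice b Ω v).Nonempty) :
    ConcaveOn ℝ I fun v => -sliceBot b Ω v := by
  refine ⟨hI, fun v hv v' hv' k k' hk hk' hkk => ?_⟩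
  have := csInf_le (isCompact_planeSlice hcpt _).bddBelow (convex_combination_mem_planeSlice hΩ
    ((isCompact_planeSlice (b := b) hcpt v).sInf_mem (hne v hv))
    ((isCompact_planeSlice hcpt v').sInf_mem (hne v' hv')) hk hk' hkk)
  simp only [smul_eq_mul, sliceBot] at this ⊢
  linarith

theorem abs_le_of_mem_planeSlice {D : ℝ} (hD : ∀ x ∈ Ω, ‖x‖ ≤ D) {u v : ℝ}
    (hu : u ∈ planeSlice b Ω v) : |u| ≤ D := by
  have h1 := abs_real_inner_le_norm (b 0) (planePoint b u v)
  rw [inner_planePoint_zero, b.norm_eq_one, one_mul] at h1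
  exact h1.trans (hD _ hu)

/-- The integral of `f` over the slice of `Ω` at height `v`. -/
def sliceIntegral (b : OrthonormalBasis (Fin 2) ℝ E) (Ω : Set E) (f : E → ℝ) (v : ℝ) : ℝ :=
  ∫ u, Ω.indicator f (planePoint b u v)

theorem sliceIntegral_eq (hΩ : Convex ℝ Ω) (hcpt : IsCompact Ω) {f : E → ℝ} (hf : Continuous f)
    {v : ℝ} (hv : (planeSlice b Ω v).Nonempty) : sliceIntegral b Ω f v =
      (∫ u in (0 : ℝ)..sliceTop b Ω v, f (planePoint b u v)) -
        ∫ u in (0 : ℝ)..sliceBot b Ω v, f (planePoint b u v) := by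
  obtain ⟨h1, h2⟩ := planeSlice_eq_Icc hΩ hcpt hv
  have hc : Continuous fun u => f (planePoint b u v) :=
    hf.comp ((continuous_planePoint b).comp (by fun_prop : Continuous fun u : ℝ => (u, v)))
  rw [intervalIntegral.integral_interval_sub_left (hc.intervalIntegrable _ _)
    (hc.intervalIntegrable _ _), intervalIntegral.integral_of_le h2,
    ← integral_Icc_eq_integral_Ioc, ← h1, ← integral_indicator
      (isCompact_planeSlice hcpt v).measurableSet]
  rfl

theorem sliceIntegral_eq_zero {f : E → ℝ} {v : ℝ}
    (h : ∀ x ∈ Ω, ⟪b 1, x⟫ = v → f x = 0) : sliceIntegral b Ω f v = 0 := by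
  have : ∀ u, Ω.indicator f (planePoint b u v) = 0 := fun u => by
    rw [indicator_apply_eq_zero]
    exact fun hu => h _ hu (inner_planePoint_one b u v)
  simp [sliceIntegral, this]

theorem cutTransform_smul_basis (hcpt : IsCompact Ω) {f : E → ℝ} (hf : Continuous f) (l : ℝ) :
    cutTransform Ω f (l • b 1) = ∫ v, (sliceIntegral b Ω f v : ℂ) *
      Complex.exp (-(2 * Real.pi * Complex.I * (l * v : ℝ))) := by
  have hi := (integrableOn_cutIntegrand hcpt hf (l • b 1)).integrable_indicator
    hcpt.measurableSet
  rw [cutTransform, ← integral_indicator hcpt.measurableSet, integral_planar b hi]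
  refine integral_congr_ae (Eventually.of_forall fun v => ?_)
  simp only [sliceIntegral]
  rw [← integral_complex_ofReal, ← integral_mul_const]
  refine integral_congr_ae (Eventually.of_forall fun u => ?_)
  by_cases hx : planePoint b u v ∈ Ω
  · simp only [indicator_of_mem hx, real_inner_smul_left, inner_planePoint_one]
  · simp only [indicator_of_notMem hx, Complex.ofReal_zero, zero_mul]

theorem integrable_sliceIntegral (hcpt : IsCompact Ω) {f : E → ℝ} (hf : Continuous f) :
    Integrable (sliceIntegral b Ω f) :=
  (integrable_planar b ((hf.continuousOn.integrableOn_compact hcpt).integrable_indicator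
    hcpt.measurableSet)).integral_prod_right

/-- In the direction `b 1` the transform is the one-dimensional transform of the slice integrals.
Their second differences are controlled by those of the slice end points, one concave and one convex
in the height, whose total is `O(l ^ (-2))` at step `(2 * l)⁻¹`. Only convexity of the boundary
matters; near the extreme slices, where the end points are not Lipschitz, `f` vanishes. -/
theorem norm_cutTransform_planar_le (hΩ : Convex ℝ Ω) (hcpt : IsCompact Ω) {f : E → ℝ}
    (hf : Continuous f) {M₀ M₁ M₂ D m r ε l : ℝ} (hM₁ : 0 ≤ M₁) (h₀ : ∀ x, |f x| ≤ M₀)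
    (h₁ : ∀ x y, |f x - f y| ≤ M₁ * ‖x - y‖)
    (h₂ : ∀ x k, |f (x + k) + f (x - k) - 2 * f x| ≤ M₂ * ‖k‖ ^ 2)
    (hD0 : 0 ≤ D) (hD : ∀ x ∈ Ω, ‖x‖ ≤ D)
    (hε : 0 < ε) (hproj : ∀ v ∈ Metric.ball m r, ∃ x ∈ Ω, ⟪b 1, x⟫ = v)
    (hzero : ∀ x ∈ Ω, r - 4 * ε < |⟪b 1, x⟫ - m| → f x = 0) (hl : 0 < l)
    (hlε : (2 * l)⁻¹ ≤ ε) :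
    ‖cutTransform Ω f (l • b 1)‖ ≤
      (M₀ * (8 * D / ε) + 4 * D * (M₂ * D + 2 * (M₁ * (2 * D / ε + 1) * (2 * D / ε)))) *
        (l ^ 2)⁻¹ := by
  have hM₀ : 0 ≤ M₀ := (abs_nonneg _).trans (h₀ 0)
  have hne : ∀ v ∈ Metric.ball m r, (planeSlice b Ω v).Nonempty := by
    intro v hv
    obtain ⟨x, hx, hxv⟩ := hproj v hv
    refine ⟨⟪b 0, x⟫, ?_⟩
    rw [planeSlice, mem_ofPred_eq, ← hxv, planePoint_inner]
    exact hx
  set G := sliceIntegral b Ω f with hG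
  have hGi : Integrable G := integrable_sliceIntegral hcpt hf
  set h := (2 * l)⁻¹ with hh
  have hh0 : 0 < h := by positivity
  have hG0 : ∀ v, r - 4 * ε < |v - m| → G v = 0 := fun v hv =>
    sliceIntegral_eq_zero fun x hx hxv => hzero x hx (by rwa [hxv])
  have hM₂ : 0 ≤ M₂ := by
    have h3 := (abs_nonneg _).trans (h₂ 0 (b 0))
    rwa [b.norm_eq_one, one_pow, mul_one] at h3
  have hmain := four_mul_norm_integral_le (G := fun v => (G v : ℂ)) hGi.ofReal hl.ne'
  rw [← cutTransform_smul_basis hcpt hf] at hmain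
  have hnorm : ∀ v, ‖(G (v + h) : ℂ) + (G (v - h) : ℂ) - 2 * (G v : ℂ)‖ =
      |G (v + h) + G (v - h) - 2 * G v| := fun v => by
    rw [← Real.norm_eq_abs, ← Complex.norm_real]
    push_cast
    rfl
  simp only [← hh, hnorm] at hmain
  -- If `r < 3 * ε`, the vanishing condition holds on every slice and the transform is zero.
  rcases lt_or_ge r (3 * ε) with hr | hr
  · have hGz : ∀ v, G v = 0 := fun v => hG0 v (by linarith [abs_nonneg (v - m)])
    simp only [hGz, add_zero, sub_zero, mul_zero, abs_zero, integral_zero] at hmain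
    have hn := norm_nonneg (cutTransform Ω f (l • b 1))
    have : ‖cutTransform Ω f (l • b 1)‖ = 0 := by linarith
    rw [this]
    positivity
  have hrD : r ≤ D := by
    by_contra hcon
    push Not at hcon
    have hin : ∀ k : ℝ, |k| < r → |m + k| ≤ D := by
      intro k hk
      obtain ⟨x, hx, hxv⟩ := hproj (m + k) (by
        rwa [Metric.mem_ball, Real.dist_eq, add_sub_cancel_left])
      have h1 := abs_real_inner_le_norm (b 1) x
      rw [hxv, b.norm_eq_one, one_mul] at h1
      exact h1.trans (hD x hx)
    have hk0 : 0 < (r + D) / 2 := by linarith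
    have a1 := abs_le.1 (hin ((r + D) / 2) (by rw [abs_of_pos hk0]; linarith))
    have a2 := abs_le.1 (hin (-((r + D) / 2)) (by rw [abs_neg, abs_of_pos hk0]; linarith))
    linarith [a1.2, a2.1]
  set K := M₂ * D + 2 * (M₁ * (2 * D / ε + 1) * (2 * D / ε)) with hK
  have hK0 : 0 ≤ K := by positivity
  -- `G` lives within `r - 4 * ε` of `m` and the step is at most `ε`, so the second difference lives
  -- on `J`; the shifts of points of `J` stay where the slice end points are Lipschitz.
  set J := Icc (m - (r - 3 * ε)) (m + (r - 3 * ε)) with hJ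
  have hJz : ∀ v, v ∉ J → |G (v + h) + G (v - h) - 2 * G v| = 0 := by
    intro v hv
    have h3 : r - 3 * ε < |v - m| := by
      by_contra hcon
      push Not at hcon
      have := abs_le.1 hcon
      exact hv ⟨by linarith, by linarith⟩
    have h4 : ∀ k, |k| ≤ h → G (v + k) = 0 := fun k hk => hG0 _ (by
      have h5 : |v - m| ≤ |v + k - m| + |k| := by
        have : v - m = (v + k - m) - k := by ring
        rw [this]
        exact abs_sub _ _
      linarith)
    have e1 := h4 h (abs_of_pos hh0).le
    have e2 := h4 (-h) (by rw [abs_neg, abs_of_pos hh0])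
    have e3 := h4 0 (by simpa using hh0.le)
    rw [← sub_eq_add_neg] at e2
    rw [add_zero] at e3
    simp [e1, e2, e3]
  have hDt : ∀ v ∈ Metric.ball m r, |sliceTop b Ω v| ≤ D := fun v hv =>
    abs_le_of_mem_planeSlice hD ((isCompact_planeSlice hcpt v).sSup_mem (hne v hv))
  have hDb : ∀ v ∈ Metric.ball m r, |sliceBot b Ω v| ≤ D := fun v hv =>
    abs_le_of_mem_planeSlice hD ((isCompact_planeSlice hcpt v).sInf_mem (hne v hv))
  have hct := concaveOn_sliceTop (b := b) hΩ hcpt (convex_ball m r) hne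
  have hcb := concaveOn_neg_sliceBot (b := b) hΩ hcpt (convex_ball m r) hne
  obtain ⟨t1, t2⟩ := integral_abs_second_difference_le hct hε hDt hh0 hlε hr
  obtain ⟨s1, s2⟩ := integral_abs_second_difference_le hcb hε
    (fun v hv => by rw [abs_neg]; exact hDb v hv) hh0 hlε hr
  have hbneg : ∀ v, |(-sliceBot b Ω (v + h)) + (-sliceBot b Ω (v - h)) - 2 * (-sliceBot b Ω v)| =
      |sliceBot b Ω (v + h) + sliceBot b Ω (v - h) - 2 * sliceBot b Ω v| := fun v => by
    rw [← abs_neg]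
    congr 1
    ring
  simp only [hbneg] at s1 s2
  have hpt : ∀ v ∈ J, |G (v + h) + G (v - h) - 2 * G v| ≤
      M₀ * |sliceTop b Ω (v + h) + sliceTop b Ω (v - h) - 2 * sliceTop b Ω v| +
      M₀ * |sliceBot b Ω (v + h) + sliceBot b Ω (v - h) - 2 * sliceBot b Ω v| +
      2 * (K * h ^ 2) := by
    intro v hv
    have hin : ∀ k, |k| ≤ h → v + k ∈ Metric.ball m (r - ε) := by
      intro k hk
      have := abs_le.1 hk
      rw [Metric.mem_ball, Real.dist_eq, abs_lt]
      constructor <;> linarith [hv.1, hv.2]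
    have hsub : Metric.ball m (r - ε) ⊆ Metric.ball m r := Metric.ball_subset_ball (by linarith)
    have i1 := hin h (abs_of_pos hh0).le
    have i2 := hin (-h) (by rw [abs_neg, abs_of_pos hh0])
    have i3 := hin 0 (by simpa using hh0.le)
    rw [← sub_eq_add_neg] at i2
    rw [add_zero] at i3
    have hfc : ∀ v, Continuous fun u => f (planePoint b u v) := fun v =>
      hf.comp ((continuous_planePoint b).comp (by fun_prop : Continuous fun u : ℝ => (u, v)))
    have hf1 : ∀ u u' v v', |f (planePoint b u v) - f (planePoint b u' v')| ≤
        M₁ * (|u - u'| + |v - v'|) := fun u u' v v' => (h₁ _ _).trans (by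
      gcongr
      exact norm_planePoint_sub_le b u u' v v')
    have hf2 : ∀ u, |f (planePoint b u (v + h)) + f (planePoint b u (v - h)) -
        2 * f (planePoint b u v)| ≤ M₂ * h ^ 2 := fun u => by
      have e1 : planePoint b u (v + h) = planePoint b u v + h • b 1 := by
        simp only [planePoint]; module
      have e2 : planePoint b u (v - h) = planePoint b u v - h • b 1 := by
        simp only [planePoint]; module
      have := h₂ (planePoint b u v) (h • b 1)
      rwa [← e1, ← e2, norm_smul, b.norm_eq_one, mul_one, Real.norm_of_nonneg hh0.le] at this
    have hlt : ∀ g : ℝ → ℝ, ConcaveOn ℝ (Metric.ball m r) g → (∀ v ∈ Metric.ball m r, |g v| ≤ D) →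
        |g (v + h) - g v| ≤ 2 * D / ε * h ∧ |g (v - h) - g v| ≤ 2 * D / ε * h := by
      intro g hg hgD
      have j1 := ConcaveOn.abs_sub_le_of_abs_le hg hε hgD i1 i3
      have j2 := ConcaveOn.abs_sub_le_of_abs_le hg hε hgD i2 i3
      rw [add_sub_cancel_left, abs_of_pos hh0] at j1
      rw [sub_sub_cancel_left, abs_neg, abs_of_pos hh0] at j2
      exact ⟨j1, j2⟩
    have jt := hlt _ hct hDt
    have jb := hlt _ hcb fun v hv => by rw [abs_neg]; exact hDb v hv
    simp only [neg_sub_neg] at jb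
    rw [abs_sub_comm, abs_sub_comm (sliceBot b Ω v)] at jb
    have L0 : 0 ≤ 2 * D / ε := by positivity
    have k1 := abs_second_difference_integral_le hfc (b := sliceTop b Ω) (v := v) (D := D)
      (M₀ := M₀) hh0.le L0 hM₁ (fun u v => h₀ _) hf1 hf2 (hDt v (hsub i3)) jt.1 jt.2
    have k2 := abs_second_difference_integral_le hfc (b := sliceBot b Ω) (v := v) (D := D)
      (M₀ := M₀) hh0.le L0 hM₁ (fun u v => h₀ _) hf1 hf2 (hDb v (hsub i3)) jb.1 jb.2
    rw [← hK] at k1 k2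
    simp only [hG, sliceIntegral_eq hΩ hcpt hf (hne _ (hsub i1)),
      sliceIntegral_eq hΩ hcpt hf (hne _ (hsub i2)), sliceIntegral_eq hΩ hcpt hf (hne _ (hsub i3))]
    have k1' := abs_le.1 k1
    have k2' := abs_le.1 k2
    rw [abs_le]
    constructor <;> linarith [k1'.1, k1'.2, k2'.1, k2'.2]
  have hbound : ∫ v, |G (v + h) + G (v - h) - 2 * G v| ≤
      M₀ * (4 * D / ε * h ^ 2) + M₀ * (4 * D / ε * h ^ 2) + 2 * (K * h ^ 2) * (2 * D) := by
    have i1 : Integrable fun v => |G (v + h) + G (v - h) - 2 * G v| := by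
      have a1 := hGi.comp_add_right h
      have a2 := hGi.comp_sub_right h
      have a3 : Integrable fun v => G (v + h) + G (v - h) - 2 * G v :=
        (a1.add a2).sub (hGi.const_mul 2)
      exact a3.abs
    have hle : m - (r - 3 * ε) ≤ m + (r - 3 * ε) := by linarith
    rw [← setIntegral_eq_integral_of_forall_compl_eq_zero hJz]
    have ci : ContinuousOn (fun v =>
      M₀ * |sliceTop b Ω (v + h) + sliceTop b Ω (v - h) - 2 * sliceTop b Ω v| +
      M₀ * |sliceBot b Ω (v + h) + sliceBot b Ω (v - h) - 2 * sliceBot b Ω v| +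
      2 * (K * h ^ 2)) J :=
      ((continuousOn_const.mul t1).add (continuousOn_const.mul s1)).add continuousOn_const
    refine (setIntegral_mono_on i1.integrableOn (ci.integrableOn_compact isCompact_Icc)
      measurableSet_Icc hpt).trans ?_
    rw [integral_Icc_eq_integral_Ioc, ← intervalIntegral.integral_of_le hle]
    rw [← uIcc_of_le hle] at t1 s1
    have u1 := (t1.intervalIntegrable (μ := volume)).const_mul M₀
    have u2 := (s1.intervalIntegrable (μ := volume)).const_mul M₀
    rw [intervalIntegral.integral_add (u1.add u2) intervalIntegrable_const,
      intervalIntegral.integral_add u1 u2, intervalIntegral.integral_const_mul,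
      intervalIntegral.integral_const_mul, intervalIntegral.integral_const, smul_eq_mul]
    have hlen : m + (r - 3 * ε) - (m - (r - 3 * ε)) ≤ 2 * D := by linarith
    have e1 : 0 ≤ 2 * (K * h ^ 2) := by positivity
    have := mul_le_mul_of_nonneg_right hlen e1
    have := mul_le_mul_of_nonneg_left t2 hM₀
    have := mul_le_mul_of_nonneg_left s2 hM₀
    linarith
  have hfin := hmain.trans hbound
  have e1 : h ^ 2 ≤ (l ^ 2)⁻¹ := by
    rw [hh, mul_inv, mul_pow, inv_pow, inv_pow]
    have : 0 ≤ (l ^ 2)⁻¹ := by positivity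
    linarith
  set c := M₀ * (8 * D / ε) + 4 * D * K with hc
  have hc0 : 0 ≤ c := by positivity
  have e2 : M₀ * (4 * D / ε * h ^ 2) + M₀ * (4 * D / ε * h ^ 2) + 2 * (K * h ^ 2) * (2 * D) =
      c * h ^ 2 := by rw [hc]; ring
  rw [e2] at hfin
  have e3 := mul_le_mul_of_nonneg_left e1 hc0
  linarith [norm_nonneg (cutTransform Ω f (l • b 1))]

end Planar

/-! ### Decay, cap estimate and conclusion in the plane. -/

section PlanarBounds

variable {E : Type} [NormedAddCommGroup E] [InnerProductSpace ℝ E] [FiniteDimensional ℝ E]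
  [MeasurableSpace E] [BorelSpace E]

theorem exists_orthonormalBasis_one_eq (hdim : Module.finrank ℝ E = 2) {n : E} (hn : ‖n‖ = 1) :
    ∃ b : OrthonormalBasis (Fin 2) ℝ E, b 1 = n := by
  have h : Orthonormal ℝ (({1} : Set (Fin 2)).domRestrict fun _ => n) := by
    refine ⟨fun i => hn, fun i j hij => ?_⟩
    exact absurd (Subsingleton.elim i j) hij
  obtain ⟨b, hb⟩ := h.exists_orthonormalBasis_extension_of_card_eq (by simpa using hdim)
  exact ⟨b, hb 1 rfl⟩

theorem exists_second_difference_le {g : E → ℝ} (hg : ContDiff ℝ ∞ g) (hgc : HasCompactSupport g) :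
    ∃ M, 0 ≤ M ∧ ∀ x k, |g (x + k) + g (x - k) - 2 * g x| ≤ M * ‖k‖ ^ 2 := by
  have hd : ContDiff ℝ 1 (fderiv ℝ g) := hg.fderiv_right (m := 1) (by norm_cast)
  obtain ⟨L, hL⟩ := ContDiff.lipschitzWith_of_hasCompactSupport (hgc.fderiv ℝ) hd one_ne_zero
  refine ⟨2 * L, by positivity, fun x k => ?_⟩
  have hdiff : Differentiable ℝ g := hg.differentiable (by simp)
  have h1 : ∀ t : ℝ, HasDerivAt (fun t : ℝ => g (x + t • k) + g (x - t • k))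
      (fderiv ℝ g (x + t • k) k - fderiv ℝ g (x - t • k) k) t := by
    intro t
    have e1 : HasDerivAt (fun t : ℝ => x + t • k) k t := by
      simpa using ((hasDerivAt_id t).smul_const k).const_add x
    have e2 : HasDerivAt (fun t : ℝ => x - t • k) (-k) t := by
      exact (((hasDerivAt_id t).smul_const k).const_sub x).congr_deriv (by simp)
    have := ((hdiff _).hasFDerivAt.comp_hasDerivAt t e1).add
      ((hdiff _).hasFDerivAt.comp_hasDerivAt t e2)
    refine this.congr_deriv ?_
    rw [map_neg]
    exact (sub_eq_add_neg _ _).symm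
  have h2 := norm_image_sub_le_of_norm_deriv_le_segment_01' (C := 2 * L * ‖k‖ ^ 2)
    (fun t _ => (h1 t).hasDerivWithinAt) (fun t ht => by
      rw [← sub_apply]
      refine (ContinuousLinearMap.le_opNorm _ _).trans ?_
      have h3 := hL.dist_le_mul (x + t • k) (x - t • k)
      rw [dist_eq_norm, dist_eq_norm] at h3
      have h4 : x + t • k - (x - t • k) = (2 * t) • k := by module
      rw [h4, norm_smul, Real.norm_of_nonneg (by linarith [ht.1] : 0 ≤ 2 * t)] at h3
      have h5 : (L : ℝ) * (2 * t * ‖k‖) ≤ L * (2 * 1 * ‖k‖) := by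
        have := ht.2.le
        gcongr
      calc _ ≤ (L * (2 * 1 * ‖k‖)) * ‖k‖ := by gcongr; exact h3.trans h5
        _ = _ := by ring)
  simp only [one_smul, zero_smul, add_zero, sub_zero, Real.norm_eq_abs] at h2
  rwa [← two_mul] at h2

/-- Slices are taken perpendicular to the normal at `y`. By the separation inequality, points of `Ω`
on slices close to the extreme ones lie near `y` or its reflection, hence near `x₀` or its
reflection, where `f` vanishes; so the slice estimate applies. -/
theorem IsStronglyConvexPatch.exists_planar_decay {Ω : Set E} (hdim : Module.finrank ℝ E = 2)
    (hΩ : Convex ℝ Ω) (hcpt : IsCompact Ω) {c : E} (hsym : ∀ y ∈ Ω, (2 : ℝ) • c - y ∈ Ω)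
    {ρ : E → ℝ} {x₀ : E} {r c₀ : ℝ} (h : IsStronglyConvexPatch Ω ρ x₀ r c₀) {f : E → ℝ}
    (hf : ContDiff ℝ ∞ f) (hf₀ : f =ᶠ[𝓝 x₀] 0) (hf₁ : f =ᶠ[𝓝 ((2 : ℝ) • c - x₀)] 0) :
    ∃ C, 0 ≤ C ∧ ∃ N ∈ 𝓝 x₀, ∀ y ∈ N, ρ y = 0 → ∀ l : ℝ, 1 ≤ l →
      ‖oscIntegral Ω (gradient ρ) (fun p => f p.2) y l‖ ≤ C * (l ^ 2)⁻¹ := by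
  have hr := h.r_pos
  have hνc := (contDiff_gradient h.contDiff).continuous
  obtain ⟨c₁, hc₁, hsep⟩ := h.exists_separation hΩ hcpt
  obtain ⟨θ, hθ, hθc, -, hθ1, -⟩ := exists_contDiff_cutoff hcpt isOpen_univ (subset_univ Ω)
  set g : E → ℝ := fun x => θ x * f x with hg
  have hgs : ContDiff ℝ ∞ g := hθ.mul hf
  have hgc : HasCompactSupport g := hθc.mul_right
  have hgf : ∀ x, f x = 0 → g x = 0 := fun x hx => by simp [hg, hx]
  obtain ⟨M₀, hM₀⟩ := hgc.exists_bound_of_continuous hgs.continuous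
  have hgs₁ : ContDiff ℝ 1 g := hgs.of_le (by norm_cast)
  obtain ⟨M₁, hM₁⟩ := ContDiff.lipschitzWith_of_hasCompactSupport hgc hgs₁ one_ne_zero
  obtain ⟨M₂, hM₂0, hM₂⟩ := exists_second_difference_le hgs hgc
  obtain ⟨D', hD'⟩ := hcpt.isBounded.exists_norm_le
  set D := |D'|
  have hD : ∀ x ∈ Ω, ‖x‖ ≤ D := fun x hx => (hD' x hx).trans (le_abs_self _)
  have hD0 : 0 ≤ D := abs_nonneg _
  obtain ⟨r₁, hr₁, hb₁⟩ : ∃ r₁ > 0, ∀ x, ‖x - x₀‖ < 2 * r₁ → f x = 0 ∧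
      f ((2 : ℝ) • c - x) = 0 := by
    have h1 : Tendsto (fun x : E => (2 : ℝ) • c - x) (𝓝 x₀) (𝓝 ((2 : ℝ) • c - x₀)) := by
      have : ContinuousAt (fun x : E => (2 : ℝ) • c - x) x₀ := by fun_prop
      exact this
    obtain ⟨e, he, H⟩ := Metric.eventually_nhds_iff.1 (hf₀.and (h1.eventually hf₁))
    refine ⟨e / 2, by positivity, fun x hx => ?_⟩
    exact H (by rw [dist_eq_norm]; linarith)
  have hν0 : 0 < ‖gradient ρ x₀‖ := norm_pos_iff.2 (h.gradient_ne_zero x₀ (Metric.mem_ball_self hr))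
  set g₀ := ‖gradient ρ x₀‖ / 2 with hg₀
  set G₀ := 2 * ‖gradient ρ x₀‖ with hG₀
  have hg₀0 : 0 < g₀ := by positivity
  have hG₀0 : 0 < G₀ := by positivity
  have hN : ∀ᶠ y in 𝓝 x₀, ‖y - x₀‖ < r₁ ∧ y ∈ Metric.ball x₀ (r / 2) ∧
      g₀ < ‖gradient ρ y‖ ∧ ‖gradient ρ y‖ < G₀ := by
    have h1 := hνc.norm.continuousAt (x := x₀)
    filter_upwards [Metric.ball_mem_nhds x₀ hr₁, Metric.ball_mem_nhds x₀ (half_pos hr),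
      h1.eventually (lt_mem_nhds (by linarith : g₀ < ‖gradient ρ x₀‖)),
      h1.eventually (gt_mem_nhds (by linarith : ‖gradient ρ x₀‖ < G₀))] with y a1 a2 a3 a4
    exact ⟨by rwa [Metric.mem_ball, dist_eq_norm] at a1, a2, a3, a4⟩
  -- Points of `Ω` within height `4 * ε` of the supporting line at `y` are within `r₁` of `y`, by
  -- separation and `‖∇ρ y‖ < G₀`.
  set ε := c₁ * r₁ ^ 2 / (4 * G₀) with hε
  have hε0 : 0 < ε := by positivity
  set C₁ := M₀ * (8 * D / ε) + 4 * D * (M₂ * D + 2 * (M₁ * (2 * D / ε + 1) * (2 * D / ε)))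
    with hC₁
  have hM₀0 : 0 ≤ M₀ := (norm_nonneg _).trans (hM₀ 0)
  have hC₁0 : 0 ≤ C₁ := by positivity
  -- The first summand covers frequencies whose half period is at most `ε`. For the others `l` is
  -- bounded, and the second comes from the trivial bound.
  refine ⟨C₁ * (g₀ ^ 2)⁻¹ + M₀ * volume.real Ω * ((2 * g₀ * ε) ^ 2)⁻¹, by positivity, _, hN, ?_⟩
  intro y ⟨hy₁, hyr, hyg, hyG⟩ hρy l hl
  have hl0 : 0 < l := by linarith
  have hyΩ : y ∈ Ω := (h.mem_iff y (Metric.ball_subset_ball (by linarith) hyr)).2 hρy.le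
  have hsepy := hsep y hyr hρy
  have hosc : oscIntegral Ω (gradient ρ) (fun p => f p.2) y l =
      oscIntegral Ω (gradient ρ) (fun p => g p.2) y l :=
    setIntegral_congr_fun hcpt.measurableSet fun x hx => by simp [hg, hθ1 x hx]
  have hnorm := norm_cutTransform_smul_eq Ω (gradient ρ) g (k := fun _ => 1) (y := y) rfl l
  simp only [one_mul] at hnorm
  rw [hosc]
  set v := gradient ρ y with hv
  have hv0 : 0 < ‖v‖ := hg₀0.trans hyg
  by_cases hlarge : (2 * (l * ‖v‖))⁻¹ ≤ ε
  · obtain ⟨n, hn1, hvn⟩ : ∃ n : E, ‖n‖ = 1 ∧ v = ‖v‖ • n :=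
      ⟨‖v‖⁻¹ • v, by rw [norm_smul, norm_inv, norm_norm, inv_mul_cancel₀ hv0.ne'],
        by rw [smul_smul, mul_inv_cancel₀ hv0.ne', one_smul]⟩
    obtain ⟨b, hb⟩ := exists_orthonormalBasis_one_eq hdim hn1
    set R := ⟪n, y - c⟫ with hR
    have hclose : ∀ x ∈ Ω, R - 4 * ε < ⟪n, x⟫ - ⟪n, c⟫ → ‖x - x₀‖ < 2 * r₁ := by
      intro x hx hxR
      have h1 : ⟪n, y - x⟫ < 4 * ε := by
        rw [hR, inner_sub_right] at hxR
        rw [inner_sub_right]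
        linarith
      have h2 := hsepy x hx
      rw [hvn, real_inner_smul_left] at h2
      have h3 : c₁ * ‖x - y‖ ^ 2 < c₁ * r₁ ^ 2 := by
        calc c₁ * ‖x - y‖ ^ 2 ≤ ‖v‖ * ⟪n, y - x⟫ := h2
          _ < ‖v‖ * (4 * ε) := by gcongr
          _ ≤ G₀ * (4 * ε) := by gcongr
          _ = c₁ * r₁ ^ 2 := by rw [hε]; field_simp
      have h4 : ‖x - y‖ < r₁ := lt_of_pow_lt_pow_left₀ 2 hr₁.le (lt_of_mul_lt_mul_left h3 hc₁.le)
      have h5 := norm_add_le (x - y) (y - x₀)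
      rw [sub_add_sub_cancel] at h5
      linarith
    have key := norm_cutTransform_planar_le (b := b) (f := g) (M₀ := M₀) (M₁ := M₁) (M₂ := M₂)
      (m := ⟪n, c⟫) (r := R) (ε := ε) (l := l * ‖v‖) hΩ hcpt hgs.continuous M₁.2 hM₀
      (fun x y => by simpa [dist_eq_norm] using hM₁.dist_le_mul x y) hM₂ hD0 hD hε0 (by
        -- All heights between the two extreme ones are attained on the segment from `y` to its
        -- reflection.
        intro t ht
        rw [Metric.mem_ball, Real.dist_eq] at ht
        have hR0 : 0 < R := (abs_nonneg _).trans_lt ht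
        set q := (t - ⟪n, c⟫) / R with hq
        have hq1 : |q| < 1 := by
          rw [hq, abs_div, abs_of_pos hR0, div_lt_one hR0]
          exact ht
        have hq2 := abs_lt.1 hq1
        refine ⟨c + q • (y - c), ?_, ?_⟩
        · have := hΩ hyΩ (hsym y hyΩ) (by linarith : 0 ≤ (1 + q) / 2)
            (by linarith : 0 ≤ (1 - q) / 2) (by ring)
          convert this using 1
          module
        · rw [hb, inner_add_right, inner_smul_right, ← hR, hq]
          field_simp
          ring) (by
        intro x hx hxR
        rw [hb] at hxR
        rcases lt_abs.1 hxR with hx1 | hx1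
        · exact hgf _ (hb₁ x (hclose x hx hx1)).1
        · refine hgf _ ?_
          have h1 := (hb₁ _ (hclose _ (hsym x hx) (by
            rw [inner_sub_right, inner_smul_right]
            linarith))).2
          rwa [sub_sub_cancel] at h1) (by positivity) hlarge
    rw [hb, mul_smul, ← hvn, hnorm, ← hC₁] at key
    refine key.trans ?_
    have e1 : ((l * ‖v‖) ^ 2)⁻¹ ≤ (g₀ ^ 2)⁻¹ * (l ^ 2)⁻¹ := by
      rw [mul_comm l, ← mul_inv, ← mul_pow]
      gcongr
    calc C₁ * ((l * ‖v‖) ^ 2)⁻¹ ≤ C₁ * ((g₀ ^ 2)⁻¹ * (l ^ 2)⁻¹) := by gcongr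
      _ ≤ C₁ * ((g₀ ^ 2)⁻¹ * (l ^ 2)⁻¹) +
          M₀ * volume.real Ω * ((2 * g₀ * ε) ^ 2)⁻¹ * (l ^ 2)⁻¹ :=
        le_add_of_nonneg_right (by positivity)
      _ = _ := by ring
  · push Not at hlarge
    have h1 : 2 * g₀ * ε * l ≤ 1 := by
      have h2 : ε * (2 * (l * ‖v‖)) < 1 := by
        rwa [lt_inv_comm₀ hε0 (by positivity), ← one_div, lt_div_iff₀ hε0, mul_comm] at hlarge
      have h3 : ε * (2 * (l * g₀)) ≤ ε * (2 * (l * ‖v‖)) := by gcongr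
      linarith
    have h2 : 1 ≤ ((2 * g₀ * ε) ^ 2)⁻¹ * (l ^ 2)⁻¹ := by
      rw [← mul_inv, ← mul_pow]
      refine (one_le_inv₀ (by positivity)).2 (pow_le_one₀ (by positivity) h1)
    have h3 := norm_oscIntegral_le hcpt (ν := gradient ρ) (a := fun p => g p.2) (y := y)
      (fun x hx => (by positivity : (0 : ℝ) ≤ c₁ * ‖x - y‖ ^ 2).trans (hsepy x hx)) hM₀
      (τ := (l : ℂ)) (by simp)
    have h4 : 0 ≤ M₀ * volume.real Ω := by positivity
    have h5 : 0 ≤ C₁ * (g₀ ^ 2)⁻¹ * (l ^ 2)⁻¹ := by positivity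
    calc _ ≤ M₀ * volume.real Ω * 1 := by rw [mul_one]; exact h3
      _ ≤ M₀ * volume.real Ω * (((2 * g₀ * ε) ^ 2)⁻¹ * (l ^ 2)⁻¹) := by gcongr
      _ ≤ _ := by rw [add_mul]; linarith

theorem IsStronglyConvexPatch.exists_le_add_sq {Ω : Set E} {ρ : E → ℝ} {x₀ : E} {r c : ℝ}
    (h : IsStronglyConvexPatch Ω ρ x₀ r c) (s : ℝ) :
    ∃ H, 0 ≤ H ∧ ∀ x ∈ Metric.closedBall x₀ s, ∀ y ∈ Metric.closedBall x₀ s,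
      ρ x ≤ ρ y + ⟪gradient ρ y, x - y⟫ + H * ‖x - y‖ ^ 2 := by
  have hg := contDiff_gradient h.contDiff
  have hgd : Differentiable ℝ (gradient ρ) := hg.differentiable (by simp)
  have hρd : Differentiable ℝ ρ := h.contDiff.differentiable (by simp)
  obtain ⟨H, hH⟩ := (isCompact_closedBall x₀ s).exists_bound_of_continuousOn
    (hg.continuous_fderiv (by simp)).continuousOn
  refine ⟨|H|, abs_nonneg _, fun x hx y hy => ?_⟩
  have hconv := convex_closedBall x₀ s
  have hseg : segment ℝ y x ⊆ Metric.closedBall x₀ s := hconv.segment_subset hy hx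
  have h1 : ∀ z ∈ segment ℝ y x, HasFDerivWithinAt (fun z => ρ z - ⟪gradient ρ y, z⟫)
      (fderiv ℝ ρ z - innerSL ℝ (gradient ρ y)) (segment ℝ y x) z := fun z _ =>
    ((hρd z).hasFDerivAt.sub (innerSL ℝ (gradient ρ y)).hasFDerivAt).hasFDerivWithinAt
  have h2 := (convex_segment y x).norm_image_sub_le_of_norm_hasFDerivWithin_le
    (C := |H| * ‖x - y‖) h1 (fun z hz => by
      have e1 : fderiv ℝ ρ z - innerSL ℝ (gradient ρ y) =
          innerSL ℝ (gradient ρ z - gradient ρ y) := by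
        ext w
        simp
      rw [e1, innerSL_apply_norm]
      have h3 := hconv.norm_image_sub_le_of_norm_fderiv_le (𝕜 := ℝ) (fun w _ => hgd w)
        (fun w hw => (hH w hw).trans (le_abs_self H)) hy (hseg hz)
      refine h3.trans ?_
      have : ‖z - y‖ ≤ ‖x - y‖ := by
        rw [segment_eq_image'] at hz
        obtain ⟨θ, hθ, rfl⟩ := hz
        rw [add_sub_cancel_left, norm_smul, Real.norm_of_nonneg hθ.1]
        exact mul_le_of_le_one_left (norm_nonneg _) hθ.2
      gcongr) (left_mem_segment ℝ y x) (right_mem_segment ℝ y x)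
  rw [Real.norm_eq_abs] at h2
  have h4 := (abs_le.1 h2).2
  rw [inner_sub_right]
  nlinarith

-- Since the boundary curves at most quadratically, a cap of height about `1 / l` at `y` has width
-- about `l ^ (-1/2)`. It is filled by about `√l` disjoint discs of radius of order `1 / l`, of
-- total area of order `l ^ (-3/2)`, on which the exponent is bounded.
set_option maxHeartbeats 400000 in
theorem IsStronglyConvexPatch.exists_le_laplaceIntegral_planar {Ω : Set E}
    (hdim : Module.finrank ℝ E = 2) (hcpt : IsCompact Ω)
    {ρ : E → ℝ} {x₀ : E} {r c₀ : ℝ} (h : IsStronglyConvexPatch Ω ρ x₀ r c₀) {φ : E → ℝ} {ε : ℝ}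
    (hφ : Continuous φ) (hφ0 : ∀ x, 0 ≤ φ x) (hε : 0 < ε)
    (hφ1 : ∀ x ∈ Metric.ball x₀ ε, φ x = 1) :
    ∃ a, 0 < a ∧ ∃ N ∈ 𝓝 x₀, ∀ y ∈ N, ρ y = 0 → ∀ l : ℝ, 1 ≤ l →
      a * l ^ (-(3 / 2) : ℝ) ≤ laplaceIntegral Ω (gradient ρ) φ y l := by
  have hr := h.r_pos
  have hνc := (contDiff_gradient h.contDiff).continuous
  set s := min r ε / 2 with hs
  have hs0 : 0 < s := by positivity
  have hsr : s < r := by have := min_le_left r ε; linarith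
  have hsε : s < ε := by have := min_le_right r ε; linarith
  obtain ⟨H, hH0, hH⟩ := h.exists_le_add_sq s
  have hν0 : 0 < ‖gradient ρ x₀‖ := norm_pos_iff.2 (h.gradient_ne_zero x₀ (Metric.mem_ball_self hr))
  set g₀ := ‖gradient ρ x₀‖ / 2 with hg₀
  set G₀ := 2 * ‖gradient ρ x₀‖ with hG₀
  have hg₀0 : 0 < g₀ := by positivity
  have hG₀0 : 0 < G₀ := by positivity
  have hN : ∀ᶠ y in 𝓝 x₀, ‖y - x₀‖ < s / 2 ∧ g₀ < ‖gradient ρ y‖ ∧ ‖gradient ρ y‖ < G₀ := by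
    have h1 := hνc.norm.continuousAt (x := x₀)
    filter_upwards [Metric.ball_mem_nhds x₀ (half_pos hs0),
      h1.eventually (lt_mem_nhds (by linarith : g₀ < ‖gradient ρ x₀‖)),
      h1.eventually (gt_mem_nhds (by linarith : ‖gradient ρ x₀‖ < G₀))] with y a1 a2 a3
    exact ⟨by rwa [Metric.mem_ball, dist_eq_norm] at a1, a2, a3⟩
  -- The bound by `s / 5` keeps the discs in the patch; the last one makes the quadratic Taylor term
  -- smaller than the linear descent of `ρ` below the tangent line.
  set k := min 1 (min (s / 5) (g₀ / (14 * (H + 1)))) with hk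
  have hk0 : 0 < k := by positivity
  have hk1 : k ≤ 1 := min_le_left _ _
  have hks : 5 * k ≤ s := by
    have : k ≤ s / 5 := (min_le_right _ _).trans (min_le_left _ _)
    linarith
  have hkH : 14 * H * k ≤ g₀ := by
    have h1 : k ≤ g₀ / (14 * (H + 1)) := (min_le_right _ _).trans (min_le_right _ _)
    rw [le_div_iff₀ (by positivity)] at h1
    nlinarith
  clear_value k g₀ G₀ s
  set v₀ := volume.real (Metric.ball (0 : E) 1) with hv₀
  have hv₀0 : 0 < v₀ := ENNReal.toReal_pos (Metric.measure_ball_pos _ _ one_pos).ne'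
    measure_ball_lt_top.ne
  set E₀ := Real.exp (-(2 * Real.pi * (3 / 2 * G₀ * k ^ 2))) with hE₀
  have hE₀0 : 0 < E₀ := Real.exp_pos _
  refine ⟨(k ^ 2 / 2) ^ 2 * v₀ * E₀, by positivity, _, hN, ?_⟩
  intro y ⟨hys, hyg, hyG⟩ hρy l hl
  have hl0 : 0 < l := by linarith
  set v := gradient ρ y with hv
  have hvp : 0 < ‖v‖ := hg₀0.trans hyg
  obtain ⟨n, hn1, hvn⟩ : ∃ n : E, ‖n‖ = 1 ∧ v = ‖v‖ • n :=
    ⟨‖v‖⁻¹ • v, by rw [norm_smul, norm_inv, norm_norm, inv_mul_cancel₀ hvp.ne'],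
      by rw [smul_smul, mul_inv_cancel₀ hvp.ne', one_smul]⟩
  obtain ⟨b, hb⟩ := exists_orthonormalBasis_one_eq hdim hn1
  set e := b 0 with he
  have hne : ⟪n, e⟫ = 0 := by
    rw [← hb, he, b.inner_eq_ite]
    simp
  have he1 : ‖e‖ = 1 := b.norm_eq_one 0
  set t := k ^ 2 / l with ht
  have ht0 : 0 < t := by positivity
  have htk : t ≤ k ^ 2 := div_le_self (by positivity) hl
  clear_value t
  set J := ⌊Real.sqrt l⌋₊ with hJ
  have hsl0 : 0 < Real.sqrt l := Real.sqrt_pos.2 hl0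
  have hsl : Real.sqrt l ^ 2 = l := Real.sq_sqrt hl0.le
  have hsl1 : 1 ≤ Real.sqrt l := Real.one_le_sqrt.2 hl
  have hj : ∀ j ∈ Finset.range (J + 1), (j : ℝ) ≤ Real.sqrt l := fun j hj =>
    (Nat.le_floor_iff hsl0.le).1 (Nat.lt_succ_iff.1 (Finset.mem_range.1 hj))
  -- Centres at depth `t = k ^ 2 / l`, spaced by `t` along the tangent. For `j ≤ √l` the squared
  -- offset `(j * t) ^ 2` is at most `k ^ 2 * t`, so it does not exceed the order of the depth.
  let z : ℕ → E := fun j => y - t • n + ((j : ℝ) * t) • e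
  have hz : ∀ j ∈ Finset.range (J + 1), ∀ x ∈ Metric.ball (z j) (t / 2),
      ‖x - y‖ ≤ 3 / 2 * t + j * t ∧ -(3 / 2 * t) ≤ ⟪n, x - y⟫ ∧ ⟪n, x - y⟫ ≤ -(t / 2) := by
    intro j _ x hx
    rw [Metric.mem_ball, dist_eq_norm] at hx
    have e1 : x - y = (x - z j) - t • n + ((j : ℝ) * t) • e := by
      simp only [z]
      module
    have e2 : ⟪n, x - y⟫ = ⟪n, x - z j⟫ - t := by
      rw [e1, inner_add_right, inner_sub_right, real_inner_smul_right, real_inner_smul_right, hne,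
        real_inner_self_eq_norm_sq, hn1]
      ring
    have e3 := abs_le.1 (abs_real_inner_le_norm n (x - z j))
    rw [hn1, one_mul] at e3
    refine ⟨?_, by rw [e2]; linarith [e3.1], by rw [e2]; linarith [e3.2]⟩
    rw [e1]
    refine (norm_add_le _ _).trans (add_le_add ((norm_sub_le _ _).trans ?_) ?_)
    · rw [norm_smul, hn1, mul_one, Real.norm_of_nonneg ht0.le]
      linarith
    · rw [norm_smul, he1, mul_one, Real.norm_of_nonneg (by positivity)]
  have hjt : ∀ j ∈ Finset.range (J + 1), ((j : ℝ) * t) ^ 2 ≤ k ^ 2 * t ∧ (j : ℝ) * t ≤ k ^ 2 := by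
    intro j hjJ
    have h1 := hj j hjJ
    constructor
    · calc ((j : ℝ) * t) ^ 2 ≤ (Real.sqrt l * t) ^ 2 := by gcongr
        _ = k ^ 2 * t := by rw [mul_pow, hsl, ht]; field_simp
    · have h2 : Real.sqrt l ≤ l := by nlinarith
      calc (j : ℝ) * t ≤ l * t := by gcongr; linarith
        _ = k ^ 2 := by rw [ht]; field_simp
  have hk2 : k ^ 2 ≤ k := by nlinarith
  have hsub : ∀ j ∈ Finset.range (J + 1), ∀ x ∈ Metric.ball (z j) (t / 2),
      x ∈ Metric.closedBall x₀ s ∧ x ∈ Ω := by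
    intro j hjJ x hx
    obtain ⟨h1, h2, h3⟩ := hz j hjJ x hx
    obtain ⟨h4, h5⟩ := hjt j hjJ
    have hxs : x ∈ Metric.closedBall x₀ s := by
      rw [Metric.mem_closedBall, dist_eq_norm]
      have := norm_add_le (x - y) (y - x₀)
      rw [sub_add_sub_cancel] at this
      linarith
    refine ⟨hxs, (h.mem_iff x (Metric.closedBall_subset_ball hsr hxs)).2 ?_⟩
    have hyb : y ∈ Metric.closedBall x₀ s := by
      rw [Metric.mem_closedBall, dist_eq_norm]
      linarith
    have h6 := hH x hxs y hyb
    rw [hρy, zero_add, ← hv, hvn, real_inner_smul_left] at h6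
    have h7 : ‖v‖ * ⟪n, x - y⟫ ≤ -(g₀ * (t / 2)) := by
      calc ‖v‖ * ⟪n, x - y⟫ ≤ ‖v‖ * -(t / 2) := by gcongr
        _ = -(‖v‖ * (t / 2)) := mul_neg _ _
        _ ≤ _ := by gcongr
    have h8 : ‖x - y‖ ^ 2 ≤ 7 * k ^ 2 * t := by
      have h9 : ‖x - y‖ ^ 2 ≤ (3 / 2 * t + j * t) ^ 2 := by gcongr
      have h10 : t ^ 2 ≤ k ^ 2 * t := by
        rw [sq]
        exact mul_le_mul_of_nonneg_right htk ht0.le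
      have h11 := add_sq_le (a := 3 / 2 * t) (b := j * t)
      have h12 : (3 / 2 * t) ^ 2 = 9 / 4 * t ^ 2 := by ring
      have h13 : 0 ≤ k ^ 2 * t := by positivity
      linarith
    have h9 : H * ‖x - y‖ ^ 2 ≤ g₀ * (t / 2) := by
      calc H * ‖x - y‖ ^ 2 ≤ H * (7 * k ^ 2 * t) := by gcongr
        _ ≤ H * (7 * k * t) := by gcongr
        _ = (14 * H * k) * (t / 2) := by ring
        _ ≤ g₀ * (t / 2) := by gcongr
    linarith
  have hdisj : ((Finset.range (J + 1) : Finset ℕ) : Set ℕ).PairwiseDisjoint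
      fun j => Metric.ball (z j) (t / 2) := by
    intro i _ j _ hij
    refine Metric.ball_disjoint_ball ?_
    have e1 : z i - z j = (((i : ℝ) - j) * t) • e := by
      simp only [z]
      module
    rw [dist_eq_norm, e1, norm_smul, he1, mul_one, Real.norm_eq_abs, abs_mul, abs_of_pos ht0]
    have h1 : (1 : ℝ) ≤ |(i : ℝ) - j| := by
      have : (1 : ℤ) ≤ |(i : ℤ) - j| := Int.one_le_abs (sub_ne_zero.2 (by exact_mod_cast hij))
      exact_mod_cast this
    nlinarith
  set U := ⋃ j ∈ Finset.range (J + 1), Metric.ball (z j) (t / 2) with hU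
  have hUΩ : U ⊆ Ω := iUnion₂_subset fun j hj x hx => (hsub j hj x hx).2
  have hUm : MeasurableSet U :=
    Finset.measurableSet_biUnion _ fun j _ => measurableSet_ball
  have hvol : volume.real U = (J + 1) * ((t / 2) ^ 2 * v₀) := by
    rw [hU, measureReal_biUnion_finset hdisj fun j _ => measurableSet_ball]
    have hb : ∀ j, volume.real (Metric.ball (z j) (t / 2)) = (t / 2) ^ 2 * v₀ := by
      intro j
      rw [Measure.real, Measure.addHaar_ball_of_pos _ _ (half_pos ht0), ENNReal.toReal_mul,
        ENNReal.toReal_ofReal (by positivity), hdim]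
      rfl
    rw [Finset.sum_congr rfl fun j _ => hb j, Finset.sum_const, Finset.card_range, nsmul_eq_mul]
    push_cast
    ring
  have hlow : ∀ x ∈ U, E₀ ≤ φ x * Real.exp (-(2 * Real.pi * l * ⟪gradient ρ y, y - x⟫)) := by
    intro x hx
    obtain ⟨j, hjJ, hxj⟩ := mem_iUnion₂.1 hx
    have h1 := (hsub j hjJ x hxj).1
    obtain ⟨-, h2, -⟩ := hz j hjJ x hxj
    rw [hφ1 x (Metric.closedBall_subset_ball hsε h1), one_mul]
    refine Real.exp_le_exp.2 (neg_le_neg ?_)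
    have h3 : ⟪gradient ρ y, y - x⟫ ≤ G₀ * (3 / 2 * t) := by
      have h5 : ⟪n, y - x⟫ ≤ 3 / 2 * t := by
        have : y - x = -(x - y) := by abel
        rw [this, inner_neg_right]
        linarith
      rw [← hv, hvn, real_inner_smul_left]
      calc ‖v‖ * ⟪n, y - x⟫ ≤ ‖v‖ * (3 / 2 * t) := by gcongr
        _ ≤ _ := by gcongr
    have hpi := Real.pi_pos
    calc 2 * Real.pi * l * ⟪gradient ρ y, y - x⟫ ≤ 2 * Real.pi * l * (G₀ * (3 / 2 * t)) := by
          gcongr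
      _ = _ := by rw [ht]; field_simp
  have hcont : Continuous fun x => φ x * Real.exp (-(2 * Real.pi * l * ⟪gradient ρ y, y - x⟫)) := by
    have : Continuous fun x => ⟪gradient ρ y, y - x⟫ := continuous_const.inner (by fun_prop)
    exact hφ.mul (continuous_const.mul this).neg.rexp
  have hi := hcont.continuousOn.integrableOn_compact (μ := volume) hcpt
  have hUfin : volume U ≠ ⊤ := ((measure_mono hUΩ).trans_lt hcpt.measure_lt_top).ne
  have hpow : l ^ (-(3 / 2) : ℝ) = Real.sqrt l * (l ^ 2)⁻¹ := by
    rw [Real.sqrt_eq_rpow, ← Real.rpow_natCast, ← Real.rpow_neg hl0.le, ← Real.rpow_add hl0]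
    norm_num
  calc _ = Real.sqrt l * ((t / 2) ^ 2 * v₀) * E₀ := by
        rw [hpow, ht]
        field_simp
    _ ≤ (J + 1) * ((t / 2) ^ 2 * v₀) * E₀ := by
        have := (Nat.lt_floor_add_one (Real.sqrt l)).le
        gcongr
    _ = ∫ _ in U, E₀ := by rw [setIntegral_const, hvol, smul_eq_mul]
    _ ≤ ∫ x in U, φ x * Real.exp (-(2 * Real.pi * l * ⟪gradient ρ y, y - x⟫)) :=
        setIntegral_mono_on (integrableOn_const hUfin enorm_ne_top) (hi.mono_set hUΩ) hUm hlow
    _ ≤ _ := setIntegral_mono_set hi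
        (Eventually.of_forall fun x => mul_nonneg (hφ0 x) (Real.exp_pos _).le)
        (Eventually.of_forall hUΩ)

/-- Remainder `O(l ^ (-2))` against a main piece of order at least `l ^ (-3/2)`: here `p = 1/2`, and
the count gains `p / 2 = 1/4`. -/
theorem IsCurvaturePoint.hasLowEntropyBalls_planar {Ω : Set (EuclideanSpace ℝ (Fin 2))}
    (hΩ : Convex ℝ Ω) (hcpt : IsCompact Ω) (hint : (interior Ω).Nonempty)
    (hsym : IsSymmetric Ω) {x₀ : EuclideanSpace ℝ (Fin 2)}
    (hx₀ : IsCurvaturePoint Ω x₀) : HasLowEntropyBalls Ω x₀ (1 / 4) := by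
  obtain ⟨a, ha⟩ := hsym
  have hdim : Module.finrank ℝ (EuclideanSpace ℝ (Fin 2)) = 2 := by simp
  obtain ⟨ρ, r, c, hpatch⟩ := hx₀.exists_patch hΩ hcpt.isClosed
  have := hasLowEntropyBalls_of_hasPhaseBound (p := 1 / 2) le_rfl hcpt (a := a) (x₀ := x₀)
    (by norm_num) (by norm_num)
    fun U hU => ⟨gradient ρ, hpatch.exists_hasPhaseBound_of_decay hΩ hcpt hint ha
      (p := 1 / 2) (q := 3 / 2) (by norm_num) (by norm_num)
      (fun φ ε hφ hφ0 hε hφ1 =>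
        hpatch.exists_le_laplaceIntegral_planar hdim hcpt hφ hφ0 hε hφ1)
      (fun f hf hf₀ hf₁ => by
        obtain ⟨C, hC, N, hN, H⟩ := hpatch.exists_planar_decay hdim hΩ hcpt ha hf hf₀ hf₁
        refine ⟨C, hC, N, hN, fun y hy h0 l hl => ?_⟩
        have e : l ^ (-(1 / 2 + 3 / 2) : ℝ) = (l ^ 2)⁻¹ := by
          rw [Real.rpow_neg (by linarith)]
          norm_num
        rw [e]
        exact H y hy h0 l hl) hU⟩
  norm_num at this ⊢
  exact this

end PlanarBounds

end ConvexFourier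

end

theorem proposition0p3 :
    (∀ (d : ℕ), 2 ≤ d → ∀ (Ω : Set (EuclideanSpace ℝ (Fin d))),
      Convex ℝ Ω → IsCompact Ω → (interior Ω).Nonempty →
      ConvexFourier.IsSymmetric Ω → ConvexFourier.HasSmoothBoundary Ω →
      (∃ x₀, ConvexFourier.IsCurvaturePoint Ω x₀) ∧
      ∀ x₀, ConvexFourier.IsCurvaturePoint Ω x₀ → ConvexFourier.HasLowEntropyBalls Ω x₀ 1) ∧
    (∀ (Ω : Set (EuclideanSpace ℝ (Fin 2))),
      Convex ℝ Ω → IsCompact Ω → (interior Ω).Nonempty →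
      ConvexFourier.IsSymmetric Ω → ConvexFourier.HasPiecewiseSmoothBoundary Ω →
      ∀ x₀, ConvexFourier.IsCurvaturePoint Ω x₀ →
        ConvexFourier.HasLowEntropyBalls Ω x₀ (1 / 4)) := by
  refine ⟨fun d hd Ω hΩ hcpt hint hsym hsm =>
    ⟨ConvexFourier.exists_isCurvaturePoint hd hcpt hint hsm, fun x₀ hx₀ =>
      hx₀.hasLowEntropyBalls_of_smooth hd hΩ hcpt hint hsym hsm⟩, ?_⟩
  exact fun Ω hΩ hcpt hint hsym _ x₀ hx₀ => hx₀.hasLowEntropyBalls_planar hΩ hcpt hint hsym
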